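/- Let $n\ge 2$ and let $\mathbb R^{n+1}_1=\mathbb R^n\times\mathbb R$ carry the Minkowski form $\langle x,y\rangle=x_1y_1+\dots+x_ny_n-x_{n+1}y_{n+1}$. Let $S:S^{n-1}\to B_1(0)\subset\mathbb R^n$ be a smooth embedding of the unit sphere into the open unit ball whose image is convex (it is the boundary of its convex hull), let $\Sigma=\{\,l\,(S(x),1): l>0,\ x\in S^{n-1}\}$ be the corresponding timelike cone, and let $\mu$ be its outward unit normal. Let $M$ be a compact smooth $n$-manifold with boundary and $\mathbf F_0:M\to\mathbb R^{n+1}_1$ a smooth spacelike embedding whose image $M_0$ lies in the closed region $\{\,l\,(y,1):l>0,\ y\in\operatorname{conv}S(S^{n-1})\}$ bounded by $\Sigma$, with $\mathbf F_0(\partial M)\subset\Sigma$ and $\langle\nu,\mu\rangle=0$ along $\partial M$, where $\nu$ is the (future directed) unit normal, $\langle\nu,\nu\rangle=-1$. A solution on $[0,T]$ of mean curvature flow with Neumann free boundary condition $\Sigma$ starting from $\mathbf F_0$ is a map $\mathbf F:M\times[0,T]\to\mathbb R^{n+1}_1$, smooth away from $\partial M\times\{0\}$, continuous with continuous spatial derivatives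 of order at most two on all of $M\times[0,T]$, such that every $\mathbf F(\cdot,t)$ is a spacelike immersion and $$\frac{d\mathbf F}{dt}=H\nu \ \text{ on } M\times[0,T],\qquad \mathbf F(\cdot,0)=\mathbf F_0,\qquad \mathbf F(\partial M,t)\subset\Sigma,\quad \langle\nu,\mu\rangle=0\ \text{ on }\partial M\times[0,T].$$ Here $A=(h_{ij})$, $h_{ij}=-\langle\partial_i\partial_j\mathbf F,\nu\rangle$, is the second fundamental form, $H=g^{ij}h_{ij}$, $\nabla$ is the Levi-Civita connection of the induced metric $g_{ij}=\langle\partial_i\mathbf F,\partial_j\mathbf F\rangle$, and $|\cdot|$ is the norm induced by $g$ on tensors. Write $M_t=\mathbf F(M,t)$ and $F^2=-\langle\mathbf F,\mathbf F\rangle$. Let $Y_1=\{x:\langle x,x\rangle=-1,\ x_{n+1}>0\}$ be the hyperbolic plane, with hyperbolic distance $\operatorname{arcosh}(-\langle x,y\rangle)$. Let $L\subset\mathbb R^{n+1}_1$ satisfy $\lambda x\in L$ for all $x\in L$, $\lambda\in\mathbb R$, and suppose that $Y_1\cap L$ is compact and that every point of $Y_1\cap L$ has hyperbolic distance at least $d>0$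 from every point of $Y_1\cap\Sigma$. Then for every $m\ge1$ there is a constant $C_{A,m}$, depending only on $m$, $n$, $L$, $d$, the cone $\Sigma$ and the initial embedding $\mathbf F_0$ (in particular neither on $T$ nor on the solution), such that for every $T>0$ and every such solution $\mathbf F$ on $[0,T]$ $$|\nabla^mA|^2\le\frac{C_{A,m}}{F^2}\qquad\text{on } M_t\cap L,\ \text{ for all } t\in[0,T].$$ -/

import Mathlib

open scoped Manifold ContDiff InnerProductSpace

noncomputable section

namespace MinkMCF

/-- The coordinate space `ℝⁿ` with its Euclidean inner product. -/
abbrev Euc (n : ℕ) : Type := EuclideanSpace ℝ (Fin n)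

/-- The underlying vector space `ℝⁿ × ℝ` of Minkowski space `ℝ^{n+1}_1`; the second component is the
coordinate `x_{n+1}`. -/
abbrev Mink (n : ℕ) : Type := Euc n × ℝ

/-- The Minkowski metric `x₁y₁ + … + xₙyₙ - x_{n+1}y_{n+1}`. -/
def ip {n : ℕ} (x y : Mink n) : ℝ := ⟪x.1, y.1⟫_ℝ - x.2 * y.2

/-! ### Local geometry of a spacelike parametrised hypersurface

`X : ℝⁿ → ℝ^{n+1}_1` is a parametrisation, `s` the part of `ℝⁿ` on which it is considered (the half
space that models a manifold with boundary), and all derivatives are taken within `s`. -/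

section Local

variable {n : ℕ} (s : Set (Euc n)) (X : Euc n → Mink n)

/-- The partial derivative `∂f/∂xⁱ` at `x`, within `s`. -/
def pd {W : Type*} [NormedAddCommGroup W] [NormedSpace ℝ W]
    (f : Euc n → W) (i : Fin n) (x : Euc n) : W :=
  fderivWithin ℝ f s x (EuclideanSpace.single i 1)

/-- The induced metric `g_{ij} = ⟨∂ᵢX, ∂ⱼX⟩`. -/
def metric (x : Euc n) : Matrix (Fin n) (Fin n) ℝ :=
  Matrix.of fun i j => ip (pd s X i x) (pd s X j x)

/-- The Christoffel symbols `Γᵏᵢⱼ` of the induced metric (`k` is the first argument). -/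
def christoffel (x : Euc n) (k i j : Fin n) : ℝ :=
  (1 / 2) * ∑ l, (metric s X x)⁻¹ k l *
    (pd s (fun y => metric s X y j l) i x + pd s (fun y => metric s X y i l) j x
      - pd s (fun y => metric s X y i j) l x)

/-- The component of `e_{n+1}` that is normal to the hypersurface,
`e_{n+1} - g^{ij} ⟨e_{n+1}, ∂ⱼX⟩ ∂ᵢX`. -/
def normalPart (x : Euc n) : Mink n :=
  ((0, 1) : Mink n) -
    ∑ i, ∑ j, ((metric s X x)⁻¹ i j * ip ((0, 1) : Mink n) (pd s X j x)) • pd s X i x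

/-- The future directed unit normal `ν`, with `⟨ν, ν⟩ = -1`. -/
def unitNormal (x : Euc n) : Mink n :=
  (Real.sqrt (-ip (normalPart s X x) (normalPart s X x)))⁻¹ • normalPart s X x

/-- The second fundamental form `A = (h_{ij})`, determined by `∇ᵢ∇ⱼX = h_{ij} ν`, that is,
`h_{ij} = -⟨∂ᵢ∂ⱼX, ν⟩` (recall `⟨ν, ν⟩ = -1`). -/
def secondForm (x : Euc n) (i j : Fin n) : ℝ :=
  -ip (pd s (pd s X j) i x) (unitNormal s X x)

/-- The mean curvature `H = g^{ij} h_{ij}`. -/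
def meanCurv (x : Euc n) : ℝ :=
  ∑ i, ∑ j, (metric s X x)⁻¹ i j * secondForm s X x i j

/-- The Levi-Civita covariant derivative of a covariant `r`-tensor field with components
`T x (i₁, …, i_r)`. The new index comes first:
`∇ₖ T_{i₁…i_r} = ∂ₖ T_{i₁…i_r} - ∑ₐ Γˡ_{k iₐ} T_{i₁…l…i_r}`. -/
def covDeriv {r : ℕ} (T : Euc n → (Fin r → Fin n) → ℝ) (x : Euc n)
    (I : Fin (r + 1) → Fin n) : ℝ :=
  pd s (fun y => T y (Fin.tail I)) (I 0) x
    - ∑ a : Fin r, ∑ l : Fin n,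
        christoffel s X x l (I 0) (Fin.tail I a) * T x (Function.update (Fin.tail I) a l)

/-- The components of the `m`-th covariant derivative `∇ᵐA` of the second fundamental form. -/
def nablaA : (m : ℕ) → Euc n → (Fin (m + 2) → Fin n) → ℝ
  | 0 => fun x I => secondForm s X x (I 0) (I 1)
  | m + 1 => covDeriv s X (nablaA m)

/-- The squared norm `g^{i₁j₁}⋯g^{i_rj_r} T_{i₁…i_r} T_{j₁…j_r}` of the value `T` at `x` of a
covariant tensor field. -/
def tensorNormSq {r : ℕ} (x : Euc n) (T : (Fin r → Fin n) → ℝ) : ℝ :=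
  ∑ I : Fin r → Fin n, ∑ J : Fin r → Fin n, (∏ a, (metric s X x)⁻¹ (I a) (J a)) * T I * T J

end Local

/-! ### Hypersurfaces given by maps from a manifold with boundary -/

section Manifold

variable {n : ℕ} [NeZero n] {M : Type*} [TopologicalSpace M]
  [ChartedSpace (EuclideanHalfSpace n) M]

/-- The map `f` in the preferred chart around `p`. -/
def localRep (f : M → Mink n) (p : M) : Euc n → Mink n :=
  f ∘ (extChartAt (𝓡∂ n) p).symm

/-- `f` is a spacelike immersion: the induced metric is positive definite at every point. -/
def IsSpacelike (f : M → Mink n) : Prop :=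
  ∀ p : M, (metric (Set.range (𝓡∂ n)) (localRep f p) (extChartAt (𝓡∂ n) p p)).PosDef

/-- The future directed unit normal of `f` at `p`. -/
def normalAt (f : M → Mink n) (p : M) : Mink n :=
  unitNormal (Set.range (𝓡∂ n)) (localRep f p) (extChartAt (𝓡∂ n) p p)

/-- The mean curvature of `f` at `p`. -/
def meanCurvAt (f : M → Mink n) (p : M) : ℝ :=
  meanCurv (Set.range (𝓡∂ n)) (localRep f p) (extChartAt (𝓡∂ n) p p)

/-- The squared norm `|∇ᵐA|²` of `f` at `p`. -/
def nablaASq (f : M → Mink n) (m : ℕ) (p : M) : ℝ :=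
  tensorNormSq (Set.range (𝓡∂ n)) (localRep f p) (extChartAt (𝓡∂ n) p p)
    (nablaA (Set.range (𝓡∂ n)) (localRep f p) m (extChartAt (𝓡∂ n) p p))

end Manifold

/-! ### The boundary cone -/

/-- `S`, restricted to the unit sphere `S^{n-1}`, is a smooth embedding into the open unit ball of
`ℝⁿ`. (Every smooth map on the sphere is the restriction of a smooth map on `ℝⁿ`; only the values on
the sphere matter below.) -/
structure IsSphereEmbedding {n : ℕ} (S : Euc n → Euc n) : Prop where
  smooth : ContDiff ℝ ∞ S
  injOn : Set.InjOn S (Metric.sphere 0 1)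
  immersion : ∀ x ∈ Metric.sphere (0 : Euc n) 1, ∀ v : Euc n,
    ⟪x, v⟫_ℝ = 0 → fderiv ℝ S x v = 0 → v = 0
  mem_ball : ∀ x ∈ Metric.sphere (0 : Euc n) 1, S x ∈ Metric.ball (0 : Euc n) 1

/-- The embedded sphere is convex: it is the boundary of a convex body, its convex hull. -/
def IsConvexSphere {n : ℕ} (S : Euc n → Euc n) : Prop :=
  frontier (convexHull ℝ (S '' Metric.sphere 0 1)) = S '' Metric.sphere 0 1

/-- The boundary cone `Σ = {l (S(x), 1) : l > 0, x ∈ S^{n-1}}`. -/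
def cone {n : ℕ} (S : Euc n → Euc n) : Set (Mink n) :=
  {q | ∃ l : ℝ, 0 < l ∧ ∃ x ∈ Metric.sphere (0 : Euc n) 1, q = l • ((S x, 1) : Mink n)}

/-- The closed solid cone bounded by `Σ`, without its apex (for a convex sphere `S`). -/
def solidCone {n : ℕ} (S : Euc n → Euc n) : Set (Mink n) :=
  {q | ∃ l : ℝ, 0 < l ∧ ∃ y ∈ convexHull ℝ (S '' Metric.sphere (0 : Euc n) 1),
    q = l • ((y, 1) : Mink n)}

/-- `μ` is the outward unit normal, with respect to the Minkowski metric, of `Σ` at `q ∈ Σ`: it is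
orthogonal to the ray through `q` and to the directions `(dS(v), 0)`, `v ∈ T_x S^{n-1}`, it has
`⟨μ, μ⟩ = 1`, and the (convex) sphere at height one lies on its negative side. -/
def IsOutwardUnitNormal {n : ℕ} (S : Euc n → Euc n) (q μ : Mink n) : Prop :=
  ∃ l : ℝ, 0 < l ∧ ∃ x ∈ Metric.sphere (0 : Euc n) 1, q = l • ((S x, 1) : Mink n) ∧
    ip μ (S x, 1) = 0 ∧ (∀ v : Euc n, ⟪x, v⟫_ℝ = 0 → ip μ (fderiv ℝ S x v, 0) = 0) ∧
    ip μ μ = 1 ∧ ∀ y ∈ Metric.sphere (0 : Euc n) 1, ip μ (S y - S x, 0) ≤ 0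

/-- The hyperbolic plane `Y₁` of radius one. -/
def hypPlane (n : ℕ) : Set (Mink n) := {x | ip x x = -1 ∧ 0 < x.2}

/-- The hyperbolic distance of two points of `Y₁`. -/
def hypDist {n : ℕ} (x y : Mink n) : ℝ := Real.arcosh (-ip x y)

/-! ### The flow -/

section Flow

variable {n : ℕ} [NeZero n] {M : Type*} [TopologicalSpace M]
  [ChartedSpace (EuclideanHalfSpace n) M]

/-- The boundary condition for a hypersurface `f`: the boundary of `M` is mapped to `Σ`, and there
`⟨ν, μ⟩ = 0`. -/
def MeetsConePerp (S : Euc n → Euc n) (f : M → Mink n) : Prop :=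
  ∀ p ∈ (𝓡∂ n).boundary M, f p ∈ cone S ∧
    ∀ μ : Mink n, IsOutwardUnitNormal S (f p) μ → ip (normalAt f p) μ = 0

/-- `F₀` is an admissible initial hypersurface: a smooth spacelike embedding of `M` (for compact `M`
an injective immersion is an embedding) into the region bounded by `Σ` that meets `Σ`
perpendicularly along the boundary. -/
structure IsInitialHypersurface (S : Euc n → Euc n) (F₀ : M → Mink n) : Prop where
  smooth : ContMDiff (𝓡∂ n) 𝓘(ℝ, Mink n) ∞ F₀
  injective : Function.Injective F₀
  spacelike : IsSpacelike F₀
  inside : ∀ p, F₀ p ∈ solidCone S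
  perp : MeetsConePerp S F₀

/-- `F : M × [0, T] → ℝ^{n+1}_1` moves by mean curvature flow with Neumann free boundary condition
`Σ` and initial hypersurface `F₀`. It is smooth away from the corner `∂M × {0}` (where smoothness
would need compatibility conditions of higher order on `F₀`), and its spatial derivatives of order at
most two are continuous on all of `M × [0, T]`. -/
structure IsNeumannMCF (S : Euc n → Euc n) (F₀ : M → Mink n) (T : ℝ) (F : M → ℝ → Mink n) :
    Prop where
  smooth : ContMDiffOn ((𝓡∂ n).prod 𝓘(ℝ, ℝ)) 𝓘(ℝ, Mink n) ∞ (fun z : M × ℝ => F z.1 z.2)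
    ((Set.univ ×ˢ Set.Icc 0 T) \ ((𝓡∂ n).boundary M ×ˢ {0}))
  continuousOn : ContinuousOn (fun z : M × ℝ => F z.1 z.2) (Set.univ ×ˢ Set.Icc 0 T)
  continuousOn_fst : ∀ (p : M) (i : Fin n), ContinuousOn
    (fun z : Euc n × ℝ => pd (Set.range (𝓡∂ n)) (localRep (fun q => F q z.2) p) i z.1)
    ((extChartAt (𝓡∂ n) p).target ×ˢ Set.Icc 0 T)
  continuousOn_snd : ∀ (p : M) (i j : Fin n), ContinuousOn
    (fun z : Euc n × ℝ => pd (Set.range (𝓡∂ n))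
      (pd (Set.range (𝓡∂ n)) (localRep (fun q => F q z.2) p) j) i z.1)
    ((extChartAt (𝓡∂ n) p).target ×ˢ Set.Icc 0 T)
  spacelike : ∀ t ∈ Set.Icc 0 T, IsSpacelike (fun q => F q t)
  initial : ∀ p, F p 0 = F₀ p
  evolution : ∀ p, ∀ t ∈ Set.Icc 0 T, HasDerivWithinAt (F p)
    (meanCurvAt (fun q => F q t) p • normalAt (fun q => F q t) p) (Set.Icc 0 T) t
  perp : ∀ t ∈ Set.Icc 0 T, MeetsConePerp S (fun q => F q t)

end Flow

end MinkMCF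

end

/-!
The estimates are interior estimates for graphs. Away from its boundary a solution is locally the
graph `x_{n+1} = u(x, t)` of a function with `|Du| < 1`, and in these coordinates a quantity `f`
attached to the moving graph satisfies an equation for the operator `box f = ∂ₜf - aⁱʲ∂ᵢ∂ⱼf` with
`aⁱʲ = gⁱʲ`, which is `(d/dt - Δ) f` for the motion in normal direction. At a space-time maximum over
the past `box f ≥ 0` (`box_nonneg_of_max`), so only evolution inequalities and a bound on the
parabolic boundary are needed.

*Global bounds* (`exists_global_bounds`). Since `box F² = 2n` and `box ⟨F, ν⟩² ≤ 4n + 4`, the functions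
`F² - 2nt` and `⟨F, ν⟩² - (4n + 4)t` obey a maximum principle. At the free boundary the conormal is
tangent to the hypersurface, `Σ` is a cone and hence `⟨F, μ⟩ = 0`, so the conormal derivatives of `F²`
vanish, and convexity of `Σ` gives the sign of the conormal derivative of the support function. The
maximum principle (`IsNeumannMCF.max_principle`) is strengthened to weak inequalities by adding a
multiple of `⟨F, e⟩` for a vector `e` pointing into the cone. With `θ = R + 2nt` the outcome is that
`F²` is comparable to `θ` and `⟨F, ν⟩²` is at most a multiple of `θ`.

*Localisation.* The function `φ = c²F² - ⟨F, e⟩²` has a bounded evolution, and its positivity set is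
the cone over the hyperbolic ball of radius `arcosh c` around `e`. For `e ∈ Y₁ ∩ L` and `c < cosh d`
this set stays away from `Σ`, and on it `ν` is uniformly timelike (`region_bounds`), so the graph
equations are uniformly parabolic. If a quantity `q` satisfies `θ box q ≤ K - δq²` on this set, the
maximum of `φ²q/θ²` is bounded in terms of the initial values (`exists_cutoff_bound`,
`SolutionBounds.exists_bound`), hence so is `q` on the set belonging to any smaller `c`.

*The quantities `q`.* For second derivatives `q = θ|A|²`: Simons' identity in graph coordinates gives
`box |A|² ≤ -2|A|⁴` (`FlowGraph.box_gA_le`, which rests on the algebraic inequality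
`simons_quadratic_nonneg`), the Lorentzian signature making the reaction term favourable. For
derivatives of order `k ≥ 3`, by induction, `q = θ^(k-1)|Dᵏu|² (Λ + θ^(k-2)|Dᵏ⁻¹u|²)` with a large
constant `Λ` (`exists_gQ_evolution`). The commutators of derivatives with the elliptic operator are
controlled by their polynomial structure (`JetFun`, `TopForm`).

*Conclusion.* On the cone over `Y₁ ∩ L` the derivatives `D^I u` are `O(θ^(-(|I|-1)/2))`
(`SolutionBounds.exists_jetBound`), and `|∇ᵐA|²` is a function of the derivatives of `u` of weight
`2(m + 1)` (`exists_nablaA_bound`), whence `|∇ᵐA|² ≤ C θ^(-(m+1)) ≤ C' / F²`. The geometric quantities of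
the chart representation are matched with those of the graph by their behaviour under
reparametrisation (`Reparam.nablaA_eq`). Since `θ ≥ R > 0` depends only on the initial hypersurface,
and all solutions agree at time zero, the constant is independent of the solution.
-/

open Filter Topology

noncomputable section

namespace MinkMCF

/-! ### Directional derivatives of functions that are smooth near a point -/

section Calculus

variable {V W : Type*} [NormedAddCommGroup V] [NormedSpace ℝ V]
  [NormedAddCommGroup W] [NormedSpace ℝ W]

/-- `f` is smooth on some neighbourhood of `z`. (For the exponent `∞`, `ContDiffAt ℝ ∞ f z` is the
weaker statement that for every finite order there is such a neighbourhood.) -/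
def SmoothNear (f : V → W) (z : V) : Prop := ∀ᶠ y in 𝓝 z, ContDiffAt ℝ ∞ f y

/-- The derivative of `f` in the direction `v`. -/
def dir (v : V) (f : V → W) (z : V) : W := fderiv ℝ f z v

theorem SmoothNear.contDiffAt {f : V → W} {z : V} (h : SmoothNear f z) : ContDiffAt ℝ ∞ f z :=
  h.self_of_nhds

theorem SmoothNear.eventually {f : V → W} {z : V} (h : SmoothNear f z) :
    ∀ᶠ y in 𝓝 z, SmoothNear f y := eventually_eventually_nhds.2 h

theorem SmoothNear.differentiableAt {f : V → W} {z : V} (h : SmoothNear f z) :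
    DifferentiableAt ℝ f z := h.contDiffAt.differentiableAt (by simp)

theorem SmoothNear.congr {f g : V → W} {z : V} (h : SmoothNear f z) (hg : g =ᶠ[𝓝 z] f) :
    SmoothNear g z := by
  filter_upwards [h, hg.eventuallyEq_nhds] with y hy hgy using hy.congr_of_eventuallyEq hgy

theorem ContDiff.smoothNear {f : V → W} (h : ContDiff ℝ ∞ f) (z : V) : SmoothNear f z :=
  Eventually.of_forall fun _ => h.contDiffAt

theorem smoothNear_const (c : W) (z : V) : SmoothNear (fun _ : V => c) z :=
  ContDiff.smoothNear contDiff_const z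

theorem SmoothNear.add {f g : V → W} {z : V} (hf : SmoothNear f z) (hg : SmoothNear g z) :
    SmoothNear (fun y => f y + g y) z := by
  filter_upwards [hf, hg] with y h1 h2 using h1.add h2

theorem SmoothNear.sub {f g : V → W} {z : V} (hf : SmoothNear f z) (hg : SmoothNear g z) :
    SmoothNear (fun y => f y - g y) z := by
  filter_upwards [hf, hg] with y h1 h2 using h1.sub h2

theorem SmoothNear.mul {f g : V → ℝ} {z : V} (hf : SmoothNear f z) (hg : SmoothNear g z) :
    SmoothNear (fun y => f y * g y) z := by
  filter_upwards [hf, hg] with y h1 h2 using h1.mul h2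

theorem SmoothNear.const_mul {f : V → ℝ} {z : V} (c : ℝ) (hf : SmoothNear f z) :
    SmoothNear (fun y => c * f y) z := (smoothNear_const c z).mul hf

theorem SmoothNear.pow {f : V → ℝ} {z : V} (hf : SmoothNear f z) (k : ℕ) :
    SmoothNear (fun y => f y ^ k) z := by
  filter_upwards [hf] with y h1 using h1.pow k

theorem SmoothNear.sum {ι : Type*} {s : Finset ι} {f : ι → V → W} {z : V}
    (hf : ∀ i ∈ s, SmoothNear (f i) z) : SmoothNear (fun y => ∑ i ∈ s, f i y) z := by
  have : ∀ᶠ y in 𝓝 z, ∀ i ∈ s, ContDiffAt ℝ ∞ (f i) y := by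
    rw [Filter.eventually_all_finset]; exact hf
  filter_upwards [this] with y hy using ContDiffAt.sum hy

theorem SmoothNear.dir {f : V → W} {z : V} (hf : SmoothNear f z) (v : V) :
    SmoothNear (dir v f) z := by
  filter_upwards [hf] with y hy
  exact (hy.fderiv_right (m := ∞) (by simp)).clm_apply contDiffAt_const

theorem SmoothNear.comp {U : Type*} [NormedAddCommGroup U] [NormedSpace ℝ U] {g : W → U}
    {f : V → W} {z : V} (hg : SmoothNear g (f z)) (hf : SmoothNear f z) :
    SmoothNear (fun y => g (f y)) z := by
  filter_upwards [hf, hf.contDiffAt.continuousAt.eventually hg] with y h1 h2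
  exact h2.comp y h1

theorem SmoothNear.continuousAt {f : V → W} {z : V} (h : SmoothNear f z) : ContinuousAt f z :=
  h.contDiffAt.continuousAt

theorem dir_congr {f g : V → W} {z : V} (h : f =ᶠ[𝓝 z] g) (v : V) :
    dir v f =ᶠ[𝓝 z] dir v g := by
  filter_upwards [h.eventuallyEq_nhds] with y hy
  simp only [dir, hy.fderiv_eq]

theorem dir_congr' {f g : V → W} {z : V} (h : f =ᶠ[𝓝 z] g) (v : V) : dir v f z = dir v g z :=
  (dir_congr h v).self_of_nhds

theorem dir_const (c : W) (v : V) (z : V) : dir v (fun _ => c) z = 0 := by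
  simp [dir]

theorem dir_add {f g : V → W} {z : V} (hf : SmoothNear f z) (hg : SmoothNear g z) (v : V) :
    dir v (fun y => f y + g y) z = dir v f z + dir v g z := by
  simp only [dir]; rw [fderiv_fun_add hf.differentiableAt hg.differentiableAt]; rfl

theorem dir_sub {f g : V → W} {z : V} (hf : SmoothNear f z) (hg : SmoothNear g z) (v : V) :
    dir v (fun y => f y - g y) z = dir v f z - dir v g z := by
  simp only [dir]; rw [fderiv_fun_sub hf.differentiableAt hg.differentiableAt]; rfl

theorem dir_mul {f g : V → ℝ} {z : V} (hf : SmoothNear f z) (hg : SmoothNear g z) (v : V) :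
    dir v (fun y => f y * g y) z = dir v f z * g z + f z * dir v g z := by
  simp only [dir]; rw [fderiv_fun_mul hf.differentiableAt hg.differentiableAt]
  simp; ring

theorem dir_const_mul {f : V → ℝ} {z : V} (c : ℝ) (hf : SmoothNear f z) (v : V) :
    dir v (fun y => c * f y) z = c * dir v f z := by
  rw [dir_mul (smoothNear_const c z) hf, dir_const]; ring

theorem dir_sum {ι : Type*} {s : Finset ι} {f : ι → V → W} {z : V}
    (hf : ∀ i ∈ s, SmoothNear (f i) z) (v : V) :
    dir v (fun y => ∑ i ∈ s, f i y) z = ∑ i ∈ s, dir v (f i) z := by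
  simp only [dir]
  rw [fderiv_fun_sum fun i hi => (hf i hi).differentiableAt]
  simp

theorem two_le_infty : (2 : WithTop ℕ∞) ≤ ∞ := WithTop.coe_le_coe.2 le_top

theorem dir_comm {f : V → W} {z : V} (hf : SmoothNear f z) (v w : V) :
    dir v (dir w f) z = dir w (dir v f) z := by
  have h2 : DifferentiableAt ℝ (fderiv ℝ f) z :=
    (hf.contDiffAt.fderiv_right (m := ∞) (by simp)).differentiableAt (by simp)
  have key : ∀ a b : V, dir a (dir b f) z = fderiv ℝ (fderiv ℝ f) z a b := by
    intro a b
    have : HasFDerivAt (fun y => fderiv ℝ f y b) ((fderiv ℝ (fderiv ℝ f) z).flip b) z :=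
      h2.hasFDerivAt.clm_apply (hasFDerivAt_const b z) |>.congr_fderiv (by ext; simp)
    change fderiv ℝ (fun y => fderiv ℝ f y b) z a = _
    rw [this.fderiv]; rfl
  rw [key, key]
  exact (hf.contDiffAt.isSymmSndFDerivAt (by simpa using two_le_infty)) v w

theorem dir_hasDerivAt {f : V → W} {z v : V} {τ : ℝ} (hf : SmoothNear f (z + τ • v)) :
    HasDerivAt (fun τ : ℝ => f (z + τ • v)) (dir v f (z + τ • v)) τ := by
  have h1 : HasDerivAt (fun τ : ℝ => z + τ • v) v τ := by
    simpa using ((hasDerivAt_id τ).smul_const v).const_add z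
  exact hf.differentiableAt.hasFDerivAt.comp_hasDerivAt τ h1

/-- The first and second order conditions along a line through a local maximum. -/
theorem dir_eq_zero_of_isLocalMax_line {f : V → ℝ} {z v : V} (hf : SmoothNear f z)
    (hmax : ∀ᶠ τ : ℝ in 𝓝 0, f (z + τ • v) ≤ f z) :
    dir v f z = 0 ∧ dir v (dir v f) z ≤ 0 := by
  have hcont : Tendsto (fun τ : ℝ => z + τ • v) (𝓝 0) (𝓝 z) := by
    have : Continuous fun τ : ℝ => z + τ • v := by fun_prop
    simpa using this.tendsto 0
  have hz : z + (0 : ℝ) • v = z := by simp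
  have hmax' : IsLocalMax (fun τ : ℝ => f (z + τ • v)) 0 := by
    filter_upwards [hmax] with τ hτ
    simpa using hτ
  have hd : ∀ᶠ τ in 𝓝 (0 : ℝ), HasDerivAt (fun τ : ℝ => f (z + τ • v)) (dir v f (z + τ • v)) τ := by
    filter_upwards [hcont.eventually hf.eventually] with τ hτ using dir_hasDerivAt hτ
  have h0 : dir v f z = 0 := by
    have := hmax'.hasDerivAt_eq_zero hd.self_of_nhds
    simpa using this
  refine ⟨h0, ?_⟩
  by_contra! hpos
  have hdd : deriv (fun τ : ℝ => f (z + τ • v)) =ᶠ[𝓝 0] fun τ => dir v f (z + τ • v) := by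
    filter_upwards [hd] with τ hτ using hτ.deriv
  have h2 : HasDerivAt (fun τ : ℝ => dir v f (z + τ • v)) (dir v (dir v f) z) 0 := by
    have := dir_hasDerivAt (z := z) (v := v) (τ := 0) (f := dir v f) (by rw [hz]; exact hf.dir v)
    rwa [hz] at this
  have h3 : deriv (deriv (fun τ : ℝ => f (z + τ • v))) 0 = dir v (dir v f) z := by
    rw [hdd.deriv_eq, h2.deriv]
  have hmin : IsLocalMin (fun τ : ℝ => f (z + τ • v)) 0 := by
    apply isLocalMin_of_deriv_deriv_pos
    · rw [h3]; exact hpos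
    · rw [hd.self_of_nhds.deriv, hz, h0]
    · exact hd.self_of_nhds.continuousAt
  have hconst : (fun τ : ℝ => f (z + τ • v)) =ᶠ[𝓝 0] fun _ => f z := by
    filter_upwards [hmin, hmax] with τ h1 h2
    simp only [zero_smul, add_zero] at h1
    exact le_antisymm h2 h1
  have h4 : deriv (deriv (fun τ : ℝ => f (z + τ • v))) 0 = 0 := by
    have : deriv (fun τ : ℝ => f (z + τ • v)) =ᶠ[𝓝 0] fun _ => 0 := by
      filter_upwards [hconst.eventuallyEq_nhds] with τ hτ
      rw [hτ.deriv_eq]; simp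
    rw [this.deriv_eq]; simp
  rw [h3] at h4; linarith

end Calculus

/-! ### The heat operator of a spacelike graph -/

section Box

variable {n : ℕ}

/-- Space-time `ℝⁿ × ℝ`, on which the graph function `u(x, t)` lives. -/
abbrev ST (n : ℕ) : Type := Euc n × ℝ

/-- The spatial coordinate directions. -/
def eb (i : Fin n) : ST n := (EuclideanSpace.single i 1, 0)

/-- The time direction. -/
def et : ST n := (0, 1)

/-- The partial derivative `∂ᵢ` of a function on space-time. -/
abbrev sd (i : Fin n) (f : ST n → ℝ) : ST n → ℝ := dir (eb i) f

/-- The operator `∂ₜ - aⁱʲ∂ᵢ∂ⱼ` with `aⁱʲ = δᵢⱼ + NᵢNⱼ`. When `N` is the spatial part of the unit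
normal of a graph moving by mean curvature, this is `∂ₜ - Δ` on the moving hypersurface. -/
def box (N : Fin n → ℝ) (f : ST n → ℝ) (z : ST n) : ℝ :=
  dir et f z - ∑ i, sd i (sd i f) z - ∑ i, ∑ j, N i * N j * sd i (sd j f) z

/-- The inner product `aⁱʲ ∂ᵢf ∂ⱼg` of the gradients, with `aⁱʲ = δᵢⱼ + NᵢNⱼ`. -/
def gam (N : Fin n → ℝ) (f g : ST n → ℝ) (z : ST n) : ℝ :=
  ∑ i, sd i f z * sd i g z + (∑ i, N i * sd i f z) * ∑ i, N i * sd i g z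

variable {N : Fin n → ℝ} {f g : ST n → ℝ} {z : ST n}

theorem sd_sd_mul (hf : SmoothNear f z) (hg : SmoothNear g z) (v w : ST n) :
    dir v (dir w (fun y => f y * g y)) z = dir v (dir w f) z * g z + dir w f z * dir v g z
      + (dir v f z * dir w g z + f z * dir v (dir w g) z) := by
  have : dir w (fun y => f y * g y) =ᶠ[𝓝 z] fun y => dir w f y * g y + f y * dir w g y := by
    filter_upwards [hf.eventually, hg.eventually] with y h1 h2 using dir_mul h1 h2 w
  rw [dir_congr' this, dir_add ((hf.dir w).mul hg) (hf.mul (hg.dir w)), dir_mul (hf.dir w) hg,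
    dir_mul hf (hg.dir w)]

theorem box_congr (h : f =ᶠ[𝓝 z] g) : box N f z = box N g z := by
  unfold box
  simp only [dir_congr' h, dir_congr' (dir_congr h _)]

/-- The product rule. The symbol of the operator enters through the carré du champ `gam`. -/
theorem box_mul (hf : SmoothNear f z) (hg : SmoothNear g z) :
    box N (fun y => f y * g y) z = f z * box N g z + g z * box N f z - 2 * gam N f g z := by
  unfold box gam
  simp only [sd_sd_mul hf hg, dir_mul hf hg]
  have e1 : ∀ F G : Fin n → ℝ, (∑ i, N i * F i) * (∑ i, N i * G i)
      = ∑ i, ∑ j, N i * N j * (F i * G j) := by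
    intro F G
    rw [Finset.sum_mul_sum]
    exact Finset.sum_congr rfl fun i _ => Finset.sum_congr rfl fun j _ => by ring
  have e2 : (∑ i, N i * sd i f z) * (∑ i, N i * sd i g z)
      = ∑ i, ∑ j, N i * N j * (sd j f z * sd i g z) := by
    rw [mul_comm, e1]
    exact Finset.sum_congr rfl fun i _ => Finset.sum_congr rfl fun j _ => by ring
  have e3 : 2 * ((∑ i, sd i f z * sd i g z) + (∑ i, N i * sd i f z) * ∑ i, N i * sd i g z)
      = 2 * (∑ i, sd i f z * sd i g z) + ∑ i, ∑ j, N i * N j * (sd i f z * sd j g z)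
        + ∑ i, ∑ j, N i * N j * (sd j f z * sd i g z) := by
    rw [← e1, ← e2]; ring
  rw [e3]
  simp only [mul_add, Finset.sum_add_distrib, mul_sub, Finset.mul_sum]
  have c1 : ∑ i, ∑ j, N i * N j * (sd i (sd j f) z * g z)
      = ∑ i, ∑ j, g z * (N i * N j * sd i (sd j f) z) :=
    Finset.sum_congr rfl fun i _ => Finset.sum_congr rfl fun j _ => by ring
  have c2 : ∑ i, ∑ j, N i * N j * (f z * sd i (sd j g) z)
      = ∑ i, ∑ j, f z * (N i * N j * sd i (sd j g) z) :=
    Finset.sum_congr rfl fun i _ => Finset.sum_congr rfl fun j _ => by ring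
  have c3 : ∑ i, sd i (sd i f) z * g z = ∑ i, g z * sd i (sd i f) z :=
    Finset.sum_congr rfl fun i _ => by ring
  have c4 : ∑ i, 2 * (sd i f z * sd i g z)
      = ∑ i, sd i f z * sd i g z + ∑ i, sd i f z * sd i g z := by
    rw [← Finset.sum_add_distrib]; exact Finset.sum_congr rfl fun i _ => by ring
  rw [c1, c2, c3, c4]
  ring

theorem box_add (hf : SmoothNear f z) (hg : SmoothNear g z) :
    box N (fun y => f y + g y) z = box N f z + box N g z := by
  have h2 : ∀ v w : ST n, dir v (dir w (fun y => f y + g y)) z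
      = dir v (dir w f) z + dir v (dir w g) z := by
    intro v w
    have : dir w (fun y => f y + g y) =ᶠ[𝓝 z] fun y => dir w f y + dir w g y := by
      filter_upwards [hf.eventually, hg.eventually] with y h1 h2 using dir_add h1 h2 w
    rw [dir_congr' this, dir_add (hf.dir w) (hg.dir w)]
  unfold box
  simp only [h2, dir_add hf hg, mul_add, Finset.sum_add_distrib]
  ring

theorem box_const (c : ℝ) : box N (fun _ => c) z = 0 := by
  have : ∀ v : ST n, dir v (fun _ : ST n => c) = fun _ => 0 := fun v => funext fun y =>
    dir_const c v y
  simp [box, this, dir_const]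

theorem gam_const_left (c : ℝ) : gam N (fun _ => c) g z = 0 := by
  simp [gam, dir_const]

theorem box_const_mul (c : ℝ) (hf : SmoothNear f z) :
    box N (fun y => c * f y) z = c * box N f z := by
  rw [box_mul (smoothNear_const c z) hf, box_const, gam_const_left]; ring

theorem box_sub (hf : SmoothNear f z) (hg : SmoothNear g z) :
    box N (fun y => f y - g y) z = box N f z - box N g z := by
  have : (fun y => f y - g y) = fun y => f y + (-1) * g y := by funext y; ring
  rw [this, box_add hf (hg.const_mul _), box_const_mul _ hg]; ring

theorem box_sum {ι : Type*} {s : Finset ι} {F : ι → ST n → ℝ}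
    (hF : ∀ i ∈ s, SmoothNear (F i) z) :
    box N (fun y => ∑ i ∈ s, F i y) z = ∑ i ∈ s, box N (F i) z := by
  classical
  induction s using Finset.induction_on with
  | empty => simpa using box_const (N := N) (z := z) 0
  | insert a s ha ih =>
    simp only [Finset.sum_insert ha]
    rw [box_add (hF a (by simp)) (SmoothNear.sum fun i hi => hF i (by simp [hi])),
      ih fun i hi => hF i (by simp [hi])]

theorem gam_comm : gam N f g z = gam N g f z := by
  unfold gam; rw [mul_comm (∑ i, N i * sd i f z)]
  congr 1; exact Finset.sum_congr rfl fun i _ => mul_comm _ _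

theorem gam_mul_left {h : ST n → ℝ} (hf : SmoothNear f z) (hg : SmoothNear g z) :
    gam N (fun y => f y * g y) h z = f z * gam N g h z + g z * gam N f h z := by
  unfold gam
  simp only [dir_mul hf hg, mul_add, add_mul, Finset.sum_add_distrib, Finset.mul_sum]
  have c1 : ∑ i, N i * (sd i f z * g z) = g z * ∑ i, N i * sd i f z := by
    rw [Finset.mul_sum]; exact Finset.sum_congr rfl fun i _ => by ring
  have c2 : ∑ i, N i * (f z * sd i g z) = f z * ∑ i, N i * sd i g z := by
    rw [Finset.mul_sum]; exact Finset.sum_congr rfl fun i _ => by ring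
  have c3 : ∑ i, sd i f z * g z * sd i h z = ∑ i, g z * (sd i f z * sd i h z) :=
    Finset.sum_congr rfl fun i _ => by ring
  have c4 : ∑ i, f z * sd i g z * sd i h z = ∑ i, f z * (sd i g z * sd i h z) :=
    Finset.sum_congr rfl fun i _ => by ring
  simp only [← Finset.mul_sum] at *
  rw [c1, c2, c3, c4]; ring

theorem gam_add_left {h : ST n → ℝ} (hf : SmoothNear f z) (hg : SmoothNear g z) :
    gam N (fun y => f y + g y) h z = gam N f h z + gam N g h z := by
  unfold gam
  simp only [dir_add hf hg, mul_add, add_mul, Finset.sum_add_distrib]; ring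

theorem gam_self_nonneg : 0 ≤ gam N f f z := by
  unfold gam
  exact add_nonneg (Finset.sum_nonneg fun i _ => mul_self_nonneg _) (mul_self_nonneg _)

/-- `gam` is a positive definite form, bounded below by the Euclidean one. -/
theorem sum_sq_le_gam : ∑ i, sd i f z ^ 2 ≤ gam N f f z := by
  unfold gam
  have : ∑ i, sd i f z ^ 2 = ∑ i, sd i f z * sd i f z :=
    Finset.sum_congr rfl fun i _ => by ring
  rw [this]; nlinarith [mul_self_nonneg (∑ i, N i * sd i f z)]

theorem gam_le : gam N f f z ≤ (1 + ∑ i, N i ^ 2) * ∑ i, sd i f z ^ 2 := by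
  unfold gam
  have h1 := Finset.sum_mul_sq_le_sq_mul_sq Finset.univ N (fun i => sd i f z)
  have : ∑ i, sd i f z ^ 2 = ∑ i, sd i f z * sd i f z :=
    Finset.sum_congr rfl fun i _ => by ring
  rw [← this]; nlinarith

theorem abs_gam_le : gam N f g z ^ 2 ≤ gam N f f z * gam N g g z := by
  -- the discriminant of the nonnegative quadratic form `gam` on the span of `f` and `g`
  have key : ∀ a b : ℝ, 0 ≤ a ^ 2 * gam N f f z + 2 * a * b * gam N f g z + b ^ 2 * gam N g g z := by
    intro a b
    have : a ^ 2 * gam N f f z + 2 * a * b * gam N f g z + b ^ 2 * gam N g g z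
        = ∑ i, (a * sd i f z + b * sd i g z) ^ 2
          + (a * (∑ i, N i * sd i f z) + b * ∑ i, N i * sd i g z) ^ 2 := by
      unfold gam
      have e : ∑ i, (a * sd i f z + b * sd i g z) ^ 2 = a ^ 2 * ∑ i, sd i f z * sd i f z
          + 2 * a * b * ∑ i, sd i f z * sd i g z + b ^ 2 * ∑ i, sd i g z * sd i g z := by
        simp only [Finset.mul_sum, ← Finset.sum_add_distrib]
        exact Finset.sum_congr rfl fun i _ => by ring
      rw [e]; ring
    rw [this]
    exact add_nonneg (Finset.sum_nonneg fun i _ => sq_nonneg _) (sq_nonneg _)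
  have hf := gam_self_nonneg (N := N) (f := f) (z := z)
  have hg := gam_self_nonneg (N := N) (f := g) (z := z)
  have h1 := key (gam N g g z) (-gam N f g z)
  have h2 := key 1 (-gam N f g z)
  rcases eq_or_lt_of_le hg with h0 | h0
  · rw [← h0] at h1 h2 ⊢
    by_contra! hlt
    have hne : gam N f g z ≠ 0 := by
      rintro h; rw [h] at hlt; simp at hlt
    have h3 := key 1 (-(gam N f f z + 1) / gam N f g z)
    rw [← h0] at h3
    have h4 : 2 * 1 * (-(gam N f f z + 1) / gam N f g z) * gam N f g z
        = -2 * (gam N f f z + 1) := by field_simp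
    rw [h4] at h3
    linarith
  · have : 0 ≤ gam N g g z * (gam N f f z * gam N g g z - gam N f g z ^ 2) := by nlinarith
    have := nonneg_of_mul_nonneg_right this h0
    linarith

/-- At a maximum over the past, the spatial gradient vanishes and `∂ₜ - aⁱʲ∂ᵢ∂ⱼ` is nonnegative. -/
theorem box_nonneg_of_max (hf : SmoothNear f z) (hmax : ∀ᶠ y in 𝓝 z, y.2 ≤ z.2 → f y ≤ f z) :
    (∀ i, sd i f z = 0) ∧ 0 ≤ box N f z := by
  have hline : ∀ v : ST n, v.2 = 0 → dir v f z = 0 ∧ dir v (dir v f) z ≤ 0 := by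
    intro v hv
    apply dir_eq_zero_of_isLocalMax_line hf
    have hcont : Tendsto (fun τ : ℝ => z + τ • v) (𝓝 0) (𝓝 z) := by
      have : Continuous fun τ : ℝ => z + τ • v := by fun_prop
      simpa using this.tendsto 0
    filter_upwards [hcont.eventually hmax] with τ hτ
    exact hτ (by simp [hv])
  have ht : 0 ≤ dir et f z := by
    have hcont : Tendsto (fun τ : ℝ => z + τ • (et : ST n)) (𝓝 0) (𝓝 z) := by
      have : Continuous fun τ : ℝ => z + τ • (et : ST n) := by fun_prop
      simpa using this.tendsto 0
    have hd := dir_hasDerivAt (z := z) (v := et) (τ := 0) (f := f) (by simpa using hf)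
    simp only [zero_smul, add_zero] at hd
    have hs := (hasDerivAt_iff_tendsto_slope.1 hd).mono_left
      (nhdsWithin_mono (0 : ℝ) (show Set.Iio (0 : ℝ) ⊆ {0}ᶜ from fun x hx => ne_of_lt hx))
    refine ge_of_tendsto hs ?_
    filter_upwards [nhdsWithin_le_nhds (hcont.eventually hmax), self_mem_nhdsWithin] with τ h1 h2
    have h2' : τ < 0 := h2
    have h3 : f (z + τ • et) ≤ f z := h1 (by simp [et]; exact h2'.le)
    rw [slope_def_field]
    apply div_nonneg_of_nonpos
    · simpa using h3
    · linarith
  refine ⟨fun i => (hline (eb i) rfl).1, ?_⟩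
  have hN := (hline (∑ i, N i • eb i) (by simp [Prod.snd_sum, eb])).2
  have hdir : ∀ (h : ST n → ℝ) (y : ST n), dir (∑ i, N i • eb i) h y = ∑ i, N i * sd i h y := by
    intro h y; simp [dir, map_sum]
  have hfun : dir (∑ i, N i • eb i) f = fun y => ∑ j, N j * sd j f y := funext fun y => hdir f y
  have hN' : ∑ i, ∑ j, N i * N j * sd i (sd j f) z ≤ 0 := by
    rw [hdir, hfun] at hN
    refine le_of_eq_of_le (Finset.sum_congr rfl fun i _ => ?_) hN
    have : sd i (fun y => ∑ j, N j * sd j f y) z = ∑ j, sd i (fun y => N j * sd j f y) z :=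
      dir_sum (fun j _ => (hf.dir _).const_mul _) _
    rw [this, Finset.mul_sum]
    refine Finset.sum_congr rfl fun j _ => ?_
    have h2 : sd i (fun y => N j * sd j f y) z = N j * sd i (sd j f) z :=
      dir_const_mul _ (hf.dir _) _
    rw [h2]; ring
  have hi : ∑ i, sd i (sd i f) z ≤ 0 := Finset.sum_nonpos fun i _ => (hline (eb i) rfl).2
  unfold box; linarith

end Box


/-! ### Polynomials in the derivatives of a function -/

section Jets

variable {n : ℕ} {V : Type*} [NormedAddCommGroup V] [NormedSpace ℝ V] (b : Fin n → V)

/-- The iterated derivative of `f` along the word `I` in the directions `b`. -/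
def iter : List (Fin n) → (V → ℝ) → V → ℝ
  | [], f => f
  | i :: I, f => dir (b i) (iter I f)

variable {b}

theorem SmoothNear.iter {f : V → ℝ} {z : V} (hf : SmoothNear f z) (I : List (Fin n)) :
    SmoothNear (iter b I f) z := by
  induction I with
  | nil => exact hf
  | cons i I ih => exact ih.dir _

theorem iter_congr {f g : V → ℝ} {z : V} (h : f =ᶠ[𝓝 z] g) (I : List (Fin n)) :
    MinkMCF.iter b I f =ᶠ[𝓝 z] MinkMCF.iter b I g := by
  induction I with
  | nil => exact h
  | cons i I ih => exact dir_congr ih _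

theorem dir_iter {f : V → ℝ} {z : V} (hf : SmoothNear f z) (v : V) (I : List (Fin n)) :
    dir v (iter b I f) z = iter b I (dir v f) z := by
  induction I generalizing z with
  | nil => rfl
  | cons i I ih =>
    have : dir v (MinkMCF.iter b I f) =ᶠ[𝓝 z] MinkMCF.iter b I (dir v f) := by
      filter_upwards [hf.eventually] with y hy using ih hy
    change dir v (dir (b i) (MinkMCF.iter b I f)) z = dir (b i) (MinkMCF.iter b I (dir v f)) z
    rw [dir_comm (hf.iter I), dir_congr' this]

variable (b)

/-- The gradient of `u` with respect to the directions `b`. -/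
def grad (u : V → ℝ) (z : V) : Euc n := WithLp.toLp 2 fun i => dir (b i) u z

@[simp] theorem grad_apply (u : V → ℝ) (z : V) (i : Fin n) : grad b u z i = dir (b i) u z := rfl

variable {b}

theorem SmoothNear.grad {u : V → ℝ} {z : V} (hu : SmoothNear u z) :
    SmoothNear (grad b u) z := by
  have : ∀ᶠ y in 𝓝 z, ∀ i, SmoothNear (MinkMCF.dir (b i) u) y :=
    Filter.eventually_all.2 fun i => (hu.dir (b i)).eventually
  filter_upwards [this] with y hy
  rw [contDiffAt_piLp]
  exact fun i => (hy i).contDiffAt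

variable (b)

/-- `u` is smooth near `z` with gradient of length less than one: its graph is spacelike. -/
def Adm (u : V → ℝ) (z : V) : Prop := SmoothNear u z ∧ ‖grad b u z‖ < 1

variable {b}

theorem Adm.eventually {u : V → ℝ} {z : V} (h : Adm b u z) : ∀ᶠ y in 𝓝 z, Adm b u y :=
  h.1.eventually.and <|
    (h.1.grad (b := b)).continuousAt.norm.eventually (gt_mem_nhds h.2)

theorem smoothNear_coef {c : Euc n → ℝ} (hc : ContDiffOn ℝ ∞ c (Metric.ball 0 1)) {p : Euc n}
    (hp : ‖p‖ < 1) : SmoothNear c p := by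
  filter_upwards [Metric.isOpen_ball.mem_nhds (show p ∈ Metric.ball (0 : Euc n) 1 by simpa using hp)]
    with q hq using hc.contDiffAt (Metric.isOpen_ball.mem_nhds hq)

theorem Adm.coef {u : V → ℝ} {z : V} (h : Adm b u z) {c : Euc n → ℝ}
    (hc : ContDiffOn ℝ ∞ c (Metric.ball 0 1)) : SmoothNear (fun y => c (grad b u y)) z :=
  (smoothNear_coef hc h.2).comp h.1.grad

theorem contDiffOn_partial {c : Euc n → ℝ} (hc : ContDiffOn ℝ ∞ c (Metric.ball 0 1)) (i : Fin n) :
    ContDiffOn ℝ ∞ (dir (EuclideanSpace.single i 1) c) (Metric.ball 0 1) := by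
  intro p hp
  exact ((smoothNear_coef hc (by simpa using hp)).dir _).contDiffAt.contDiffWithinAt

theorem Adm.dir_coef {u : V → ℝ} {z : V} (h : Adm b u z) {c : Euc n → ℝ}
    (hc : ContDiffOn ℝ ∞ c (Metric.ball 0 1)) (m : Fin n) :
    dir (b m) (fun y => c (grad b u y)) z
      = ∑ i, dir (EuclideanSpace.single i 1) c (grad b u z) * iter b [m, i] u z := by
  have h1 := (smoothNear_coef hc h.2).differentiableAt.hasFDerivAt.comp z
    (h.1.grad (b := b)).differentiableAt.hasFDerivAt
  have h2 : fderiv ℝ (grad b u) z (b m) = ∑ i, iter b [m, i] u z • EuclideanSpace.single i (1 : ℝ) := by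
    ext j
    have hj : HasFDerivAt (fun y => grad b u y j)
        ((EuclideanSpace.proj j : Euc n →L[ℝ] ℝ).comp (fderiv ℝ (grad b u) z)) z :=
      (EuclideanSpace.proj j : Euc n →L[ℝ] ℝ).hasFDerivAt.comp z
        (h.1.grad (b := b)).differentiableAt.hasFDerivAt
    have : fderiv ℝ (grad b u) z (b m) j = iter b [m, j] u z := by
      change _ = fderiv ℝ (fun y => grad b u y j) z (b m)
      rw [hj.fderiv]; rfl
    rw [this]
    simp [Finset.sum_apply, Pi.single_apply]
  change fderiv ℝ (c ∘ grad b u) z (b m) = _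
  rw [h1.fderiv]
  simp only [ContinuousLinearMap.comp_apply, h2, map_sum, map_smul, smul_eq_mul, dir]
  exact Finset.sum_congr rfl fun i _ => mul_comm _ _

variable (b)

/-- `JetFun b k w Θ`: the operator `u ↦ Θ u` is a polynomial in the derivatives `∂_I u`,
`2 ≤ |I| ≤ k`, whose coefficients are smooth functions of the gradient on the open unit ball, and it
is homogeneous of weight `w` when `∂_I u` has weight `|I| - 1`. Operators are identified when they
agree on functions with spacelike graph. -/
inductive JetFun (k : ℕ) : ℕ → ((V → ℝ) → V → ℝ) → Prop
  | coef (c : Euc n → ℝ) (hc : ContDiffOn ℝ ∞ c (Metric.ball 0 1)) :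
      JetFun k 0 fun u z => c (grad b u z)
  | jet (I : List (Fin n)) (h2 : 2 ≤ I.length) (hk : I.length ≤ k) :
      JetFun k (I.length - 1) fun u => iter b I u
  | zero (w : ℕ) : JetFun k w fun _ _ => 0
  | add {w : ℕ} {Θ Ψ : (V → ℝ) → V → ℝ} : JetFun k w Θ → JetFun k w Ψ →
      JetFun k w fun u z => Θ u z + Ψ u z
  | mul {v w : ℕ} {Θ Ψ : (V → ℝ) → V → ℝ} : JetFun k v Θ → JetFun k w Ψ →
      JetFun k (v + w) fun u z => Θ u z * Ψ u z
  | congr {w : ℕ} {Θ Ψ : (V → ℝ) → V → ℝ} : JetFun k w Θ →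
      (∀ u z, Adm b u z → Ψ u z = Θ u z) → JetFun k w Ψ

variable {b} {k v w : ℕ} {Θ Ψ : (V → ℝ) → V → ℝ}

theorem JetFun.mono (h : JetFun b k w Θ) {k' : ℕ} (hk : k ≤ k') : JetFun b k' w Θ := by
  induction h with
  | coef c hc => exact .coef c hc
  | jet I h2 h => exact .jet I h2 (h.trans hk)
  | zero w => exact .zero _
  | add _ _ h1 h2 => exact .add h1 h2
  | mul _ _ h1 h2 => exact .mul h1 h2
  | congr _ h h1 => exact .congr h1 h

theorem JetFun.const (k : ℕ) (c : ℝ) : JetFun b k 0 fun _ _ => c :=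
  .coef (fun _ => c) contDiffOn_const

theorem JetFun.sum {ι : Type*} (s : Finset ι) {F : ι → (V → ℝ) → V → ℝ}
    (h : ∀ i ∈ s, JetFun b k w (F i)) : JetFun b k w fun u z => ∑ i ∈ s, F i u z := by
  classical
  induction s using Finset.induction_on with
  | empty => simpa using JetFun.zero w
  | insert a s ha ih =>
    simp only [Finset.sum_insert ha]
    exact .add (h a (by simp)) (ih fun i hi => h i (by simp [hi]))

theorem JetFun.cast (h : JetFun b k v Θ) (hvw : v = w) : JetFun b k w Θ := hvw ▸ h

theorem JetFun.const_mul (c : ℝ) (h : JetFun b k w Θ) : JetFun b k w fun u z => c * Θ u z :=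
  ((JetFun.const k c).mul h).cast (zero_add w)

theorem JetFun.neg (h : JetFun b k w Θ) : JetFun b k w fun u z => -Θ u z :=
  (h.const_mul (-1)).congr fun _ _ _ => by ring

theorem JetFun.sub (h : JetFun b k w Θ) (h' : JetFun b k w Ψ) :
    JetFun b k w fun u z => Θ u z - Ψ u z :=
  (h.add h'.neg).congr fun _ _ _ => by ring

theorem JetFun.prod {ι : Type*} (s : Finset ι) {F : ι → (V → ℝ) → V → ℝ}
    (h : ∀ i ∈ s, JetFun b k 0 (F i)) : JetFun b k 0 fun u z => ∏ i ∈ s, F i u z := by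
  classical
  induction s using Finset.induction_on with
  | empty => simpa using JetFun.const k 1
  | insert a s ha ih =>
    simp only [Finset.prod_insert ha]
    exact .mul (h a (by simp)) (ih fun i hi => h i (by simp [hi]))

theorem JetFun.smoothNear (h : JetFun b k w Θ) {u : V → ℝ} {z : V} (hu : Adm b u z) :
    SmoothNear (Θ u) z := by
  induction h with
  | coef c hc => exact hu.coef hc
  | jet I h2 h => exact hu.1.iter I
  | zero w => exact smoothNear_const 0 z
  | add _ _ h1 h2 => exact h1.add h2
  | mul _ _ h1 h2 => exact h1.mul h2
  | congr _ h h1 =>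
    exact h1.congr (by filter_upwards [hu.eventually] with y hy using h u y hy)

theorem jetFun_dir_coef (hk : 2 ≤ k) {c : Euc n → ℝ}
    (hc : ContDiffOn ℝ ∞ c (Metric.ball 0 1)) (m : Fin n) :
    JetFun b k 1 fun u => dir (b m) fun y => c (grad b u y) := by
  have : JetFun b k 1 fun u z =>
      ∑ i, dir (EuclideanSpace.single i 1) c (grad b u z) * iter b [m, i] u z :=
    JetFun.sum _ fun i _ =>
      ((JetFun.coef _ (contDiffOn_partial hc i)).mul (.jet [m, i] (by simp) (by simpa))).cast
        (by simp)
  exact this.congr fun u z hu => hu.dir_coef hc m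

/-- Differentiation raises order and weight by one. -/
theorem JetFun.dir (h : JetFun b k w Θ) (hk : 1 ≤ k) (m : Fin n) :
    JetFun b (k + 1) (w + 1) fun u => dir (b m) (Θ u) := by
  induction h with
  | coef c hc => exact jetFun_dir_coef (by omega) hc m
  | jet I h2 h =>
    exact (JetFun.jet (k := k + 1) (m :: I) (by simp; omega) (by simpa)).cast (by simp; omega)
  | zero w => exact (JetFun.zero (w + 1)).congr fun u z _ => dir_const 0 _ _
  | add h1 h2 ih1 ih2 =>
    exact (ih1.add ih2).congr fun u z hu =>
      dir_add (h1.smoothNear hu) (h2.smoothNear hu) _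
  | @mul v w Θ Ψ h1 h2 ih1 ih2 =>
    have e1 := (ih1.mul (h2.mono (Nat.le_succ k))).cast
      (show v + 1 + w = v + w + 1 by omega)
    have e2 := ((h1.mono (Nat.le_succ k)).mul ih2).cast
      (show v + (w + 1) = v + w + 1 by omega)
    exact (e1.add e2).congr fun u z hu => dir_mul (h1.smoothNear hu) (h2.smoothNear hu) _
  | congr h1 h ih =>
    exact ih.congr fun u z hu => dir_congr'
      (by filter_upwards [hu.eventually] with y hy using h u y hy) _

/-- A bound on the derivatives compatible with the weights bounds the whole polynomial. -/
theorem JetFun.bound (h : JetFun b k w Θ) (K κ : ℝ) (hκ : κ < 1) :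
    ∃ C : ℝ, 0 ≤ C ∧ ∀ (u : V → ℝ) (z : V) (l : ℝ), 0 ≤ l → Adm b u z → ‖grad b u z‖ ≤ κ →
      (∀ I : List (Fin n), 2 ≤ I.length → I.length ≤ k → |iter b I u z| ≤ K * l ^ (I.length - 1)) →
      |Θ u z| ≤ C * l ^ w := by
  induction h with
  | coef c hc =>
    obtain ⟨C, hC⟩ := (isCompact_closedBall (0 : Euc n) κ).exists_bound_of_continuousOn
      (hc.continuousOn.mono (Metric.closedBall_subset_ball hκ))
    refine ⟨max C 0, le_max_right _ _, fun u z l hl hu hg hI => ?_⟩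
    have := hC (grad b u z) (by simpa using hg)
    simpa using Or.inl this
  | jet I h2 h =>
    refine ⟨|K|, abs_nonneg _, fun u z l hl hu hg hI => (hI I h2 h).trans ?_⟩
    exact mul_le_mul_of_nonneg_right (le_abs_self K) (pow_nonneg hl _)
  | zero w => exact ⟨0, le_rfl, fun u z l hl hu hg hI => by simp⟩
  | add _ _ h1 h2 =>
    obtain ⟨C, hC0, hC⟩ := h1
    obtain ⟨D, hD0, hD⟩ := h2
    refine ⟨C + D, add_nonneg hC0 hD0, fun u z l hl hu hg hI => ?_⟩
    rw [add_mul]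
    exact (abs_add_le _ _).trans (add_le_add (hC u z l hl hu hg hI) (hD u z l hl hu hg hI))
  | mul _ _ h1 h2 =>
    obtain ⟨C, hC0, hC⟩ := h1
    obtain ⟨D, hD0, hD⟩ := h2
    refine ⟨C * D, mul_nonneg hC0 hD0, fun u z l hl hu hg hI => ?_⟩
    rw [abs_mul, pow_add, mul_mul_mul_comm]
    exact mul_le_mul (hC u z l hl hu hg hI) (hD u z l hl hu hg hI) (abs_nonneg _)
      (mul_nonneg hC0 (pow_nonneg hl _))
  | congr _ h h1 =>
    obtain ⟨C, hC0, hC⟩ := h1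
    exact ⟨C, hC0, fun u z l hl hu hg hI => by rw [h u z hu]; exact hC u z l hl hu hg hI⟩

variable (b)

/-- The shape of the terms of order at most `k + 1` that arise when a quasilinear operator
`aⁱʲ(∇u)∂ᵢ∂ⱼu` is differentiated `k` times: polynomials of order `k` and weight `k + 1`, and products
of one second derivative with one derivative of order `k + 1`. -/
inductive TopForm (k : ℕ) : ((V → ℝ) → V → ℝ) → Prop
  | low {Θ : (V → ℝ) → V → ℝ} : JetFun b k (k + 1) Θ → TopForm k Θ
  | top (c : Euc n → ℝ) (hc : ContDiffOn ℝ ∞ c (Metric.ball 0 1)) (J' J : List (Fin n))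
      (hJ' : J'.length = 2) (hJ : J.length = k + 1) :
      TopForm k fun u z => c (grad b u z) * (iter b J' u z * iter b J u z)
  | add {Θ Ψ : (V → ℝ) → V → ℝ} : TopForm k Θ → TopForm k Ψ →
      TopForm k fun u z => Θ u z + Ψ u z
  | congr {Θ Ψ : (V → ℝ) → V → ℝ} : TopForm k Θ →
      (∀ u z, Adm b u z → Ψ u z = Θ u z) → TopForm k Ψ

variable {b}

theorem TopForm.sum {ι : Type*} (s : Finset ι) {F : ι → (V → ℝ) → V → ℝ}
    (h : ∀ i ∈ s, TopForm b k (F i)) : TopForm b k fun u z => ∑ i ∈ s, F i u z := by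
  classical
  induction s using Finset.induction_on with
  | empty => simpa using TopForm.low (JetFun.zero (k + 1))
  | insert a s ha ih =>
    simp only [Finset.sum_insert ha]
    exact .add (h a (by simp)) (ih fun i hi => h i (by simp [hi]))

theorem TopForm.smoothNear (h : TopForm b k Θ) {u : V → ℝ} {z : V} (hu : Adm b u z) :
    SmoothNear (Θ u) z := by
  induction h with
  | low h => exact h.smoothNear hu
  | top c hc J' J hJ' hJ => exact (hu.coef hc).mul ((hu.1.iter J').mul (hu.1.iter J))
  | add _ _ h1 h2 => exact h1.add h2
  | congr _ h h1 =>
    exact h1.congr (by filter_upwards [hu.eventually] with y hy using h u y hy)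

theorem TopForm.dir (h : TopForm b k Θ) (hk : 1 ≤ k) (m : Fin n) :
    TopForm b (k + 1) fun u => dir (b m) (Θ u) := by
  induction h with
  | low h => exact .low (h.dir hk m)
  | @top c hc J' J hJ' hJ =>
    have t1 : TopForm b (k + 1) fun u z => MinkMCF.dir (b m) (fun y => c (grad b u y)) z
        * (iter b J' u z * iter b J u z) := by
      refine .low (((jetFun_dir_coef (by omega) hc m).mul
        ((JetFun.jet (k := k + 1) J' (by omega) (by omega)).mul
          (JetFun.jet (k := k + 1) J (by omega) (by omega)))).cast (by omega))
    have t2 : TopForm b (k + 1) fun u z => c (grad b u z)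
        * (iter b (m :: J') u z * iter b J u z) := by
      rcases eq_or_lt_of_le hk with h1 | h1
      · exact (TopForm.top c hc J (m :: J') (by omega) (by simp; omega)).congr
          fun u z _ => by ring
      · refine .low (((JetFun.coef (k := k + 1) c hc).mul
          ((JetFun.jet (k := k + 1) (m :: J') (by simp; omega) (by simp; omega)).mul
            (JetFun.jet (k := k + 1) J (by omega) (by omega)))).cast (by simp; omega))
    have t3 : TopForm b (k + 1) fun u z => c (grad b u z)
        * (iter b J' u z * iter b (m :: J) u z) := .top c hc J' (m :: J) hJ' (by simp; omega)
    refine ((t1.add t2).add t3).congr fun u z hu => ?_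
    rw [dir_mul (hu.coef hc) ((hu.1.iter J').mul (hu.1.iter J)),
      dir_mul (hu.1.iter J') (hu.1.iter J)]
    change _ = _ + c (grad b u z) * (MinkMCF.dir (b m) (iter b J' u) z * _) + c (grad b u z) *
      (_ * MinkMCF.dir (b m) (iter b J u) z)
    ring
  | add h1 h2 ih1 ih2 =>
    exact (ih1.add ih2).congr fun u z hu =>
      dir_add (h1.smoothNear hu) (h2.smoothNear hu) _
  | congr h1 h ih =>
    exact ih.congr fun u z hu => dir_congr'
      (by filter_upwards [hu.eventually] with y hy using h u y hy) _

/-- The estimate that the structure of a `TopForm` encodes: terms of lower order scale like `l^(k+1)`, and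
the top order enters only multiplied by a second derivative. -/
theorem TopForm.bound (h : TopForm b k Θ) (K κ : ℝ) (hκ : κ < 1) :
    ∃ C : ℝ, 0 ≤ C ∧ ∀ (u : V → ℝ) (z : V) (l μ B : ℝ), 0 ≤ l → 0 ≤ μ → 0 ≤ B → Adm b u z →
      ‖grad b u z‖ ≤ κ →
      (∀ I : List (Fin n), 2 ≤ I.length → I.length ≤ k → |iter b I u z| ≤ K * l ^ (I.length - 1)) →
      (∀ I : List (Fin n), I.length = 2 → |iter b I u z| ≤ μ) →
      (∀ I : List (Fin n), I.length = k + 1 → |iter b I u z| ≤ B) →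
      |Θ u z| ≤ C * (l ^ (k + 1) + μ * B) := by
  induction h with
  | low h =>
    obtain ⟨C, hC0, hC⟩ := h.bound K κ hκ
    refine ⟨C, hC0, fun u z l μ B hl hμ hB hu hg hI h2 hB' => (hC u z l hl hu hg hI).trans ?_⟩
    exact mul_le_mul_of_nonneg_left (le_add_of_nonneg_right (mul_nonneg hμ hB)) hC0
  | @top c hc J' J hJ' hJ =>
    obtain ⟨C, hC0, hC⟩ := (JetFun.coef (b := b) (k := 0) c hc).bound 0 κ hκ
    refine ⟨C, hC0, fun u z l μ B hl hμ hB hu hg hI h2 hB' => ?_⟩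
    have h0 := hC u z 0 le_rfl hu hg (fun I h1 h2 => by omega)
    simp only [pow_zero, mul_one] at h0
    rw [abs_mul, abs_mul]
    refine mul_le_mul h0 ?_ (by positivity) hC0
    have := mul_le_mul (h2 J' hJ') (hB' J hJ) (abs_nonneg _) hμ
    have := pow_nonneg hl (k + 1)
    linarith
  | add _ _ h1 h2 =>
    obtain ⟨C, hC0, hC⟩ := h1
    obtain ⟨D, hD0, hD⟩ := h2
    refine ⟨C + D, add_nonneg hC0 hD0, fun u z l μ B hl hμ hB hu hg hI h2 hB' => ?_⟩
    rw [add_mul]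
    exact (abs_add_le _ _).trans (add_le_add (hC u z l μ B hl hμ hB hu hg hI h2 hB')
      (hD u z l μ B hl hμ hB hu hg hI h2 hB'))
  | congr _ h h1 =>
    obtain ⟨C, hC0, hC⟩ := h1
    exact ⟨C, hC0, fun u z l μ B hl hμ hB hu hg hI h2 hB' => by
      rw [h u z hu]; exact hC u z l μ B hl hμ hB hu hg hI h2 hB'⟩

/-- The vertical component `(1 - |p|²)^{-1/2}` of the unit normal of a graph with gradient `p`. -/
def wgt (p : Euc n) : ℝ := (Real.sqrt (1 - ‖p‖ ^ 2))⁻¹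

/-- The horizontal components of the unit normal of a graph with gradient `p`. -/
def nrm (p : Euc n) (i : Fin n) : ℝ := wgt p * p i

theorem one_sub_norm_sq_pos {p : Euc n} (hp : ‖p‖ < 1) : 0 < 1 - ‖p‖ ^ 2 := by
  nlinarith [norm_nonneg p]

theorem contDiffOn_wgt : ContDiffOn ℝ ∞ (wgt : Euc n → ℝ) (Metric.ball 0 1) := by
  intro p hp
  have hp' := one_sub_norm_sq_pos (show ‖p‖ < 1 by simpa using hp)
  apply ContDiffAt.contDiffWithinAt
  have h1 : ContDiffAt ℝ ∞ (fun p : Euc n => 1 - ‖p‖ ^ 2) p :=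
    contDiffAt_const.sub (contDiff_norm_sq ℝ).contDiffAt
  exact (h1.sqrt hp'.ne').inv (Real.sqrt_pos.2 hp').ne'

theorem contDiffOn_nrm (i : Fin n) :
    ContDiffOn ℝ ∞ (fun p : Euc n => nrm p i) (Metric.ball 0 1) :=
  contDiffOn_wgt.mul (EuclideanSpace.proj i : Euc n →L[ℝ] ℝ).contDiff.contDiffOn

variable (b)

/-- The second order operator `aⁱʲ(∇u) ∂ᵢ∂ⱼ`, `aⁱʲ = δᵢⱼ + νᵢνⱼ`, of a graph. -/
def lop (u f : V → ℝ) (z : V) : ℝ :=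
  ∑ i, dir (b i) (dir (b i) f) z
    + ∑ i, ∑ j, nrm (grad b u z) i * nrm (grad b u z) j * dir (b i) (dir (b j) f) z

variable {b}

theorem Adm.lop {u f : V → ℝ} {z : V} (h : Adm b u z) (hf : SmoothNear f z) :
    SmoothNear (lop b u f) z :=
  (SmoothNear.sum fun i _ => (hf.dir _).dir _).add <| SmoothNear.sum fun i _ =>
    SmoothNear.sum fun j _ => ((h.coef (contDiffOn_nrm i)).mul (h.coef (contDiffOn_nrm j))).mul
      ((hf.dir _).dir _)

theorem dir_lop {u f : V → ℝ} {z : V} (h : Adm b u z) (hf : SmoothNear f z) (m : Fin n) :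
    dir (b m) (lop b u f) z = lop b u (dir (b m) f) z
      + ∑ i, ∑ j, dir (b m) (fun y => nrm (grad b u y) i * nrm (grad b u y) j) z
        * dir (b i) (dir (b j) f) z := by
  have hc : ∀ i j, SmoothNear (fun y => nrm (grad b u y) i * nrm (grad b u y) j) z := fun i j =>
    (h.coef (contDiffOn_nrm i)).mul (h.coef (contDiffOn_nrm j))
  have hcomm : ∀ i j, dir (b m) (dir (b i) (dir (b j) f)) z
      = dir (b i) (dir (b j) (dir (b m) f)) z := by
    intro i j
    rw [dir_comm (hf.dir _)]
    exact dir_congr' (by filter_upwards [hf.eventually] with y hy using dir_comm hy _ _) _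
  unfold MinkMCF.lop
  rw [dir_add (SmoothNear.sum fun i _ => (hf.dir _).dir _) (SmoothNear.sum fun i _ =>
    SmoothNear.sum fun j _ => (hc i j).mul ((hf.dir _).dir _)),
    dir_sum fun i _ => (hf.dir _).dir _,
    dir_sum fun i _ => SmoothNear.sum fun j _ => (hc i j).mul ((hf.dir _).dir _), add_assoc]
  congr 1
  · exact Finset.sum_congr rfl fun i _ => hcomm i i
  · rw [← Finset.sum_add_distrib]
    refine Finset.sum_congr rfl fun i _ => ?_
    rw [dir_sum fun j _ => (hc i j).mul ((hf.dir _).dir _), ← Finset.sum_add_distrib]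
    refine Finset.sum_congr rfl fun j _ => ?_
    rw [dir_mul (hc i j) ((hf.dir _).dir _), hcomm]; ring

variable (b)

/-- The commutator of `∂_I` with the quasilinear operator, evaluated on `u` itself. -/
def commutator (I : List (Fin n)) (u : V → ℝ) (z : V) : ℝ :=
  iter b I (lop b u u) z - lop b u (iter b I u) z

variable {b}

theorem topForm_commutator_cons (m : Fin n) (I : List (Fin n))
    (h : TopForm b (I.length + 1) fun u => dir (b m) (commutator b I u)) :
    TopForm b (I.length + 1) (commutator b (m :: I)) := by
  have t : TopForm b (I.length + 1) fun u z =>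
      ∑ i, ∑ j, dir (b m) (fun y => nrm (grad b u y) i * nrm (grad b u y) j) z
        * dir (b i) (dir (b j) (iter b I u)) z := by
    refine TopForm.sum _ fun i _ => TopForm.sum _ fun j _ => ?_
    have hcc := (contDiffOn_nrm i).mul (contDiffOn_nrm (n := n) j)
    have := TopForm.sum (b := b) (k := I.length + 1) Finset.univ (F := fun l u z =>
      dir (EuclideanSpace.single l 1) (fun p : Euc n => nrm p i * nrm p j) (grad b u z)
        * (iter b [m, l] u z * iter b (i :: j :: I) u z)) fun l _ =>
        .top _ (contDiffOn_partial hcc l) _ _ (by simp) (by simp)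
    refine this.congr fun u z hu => ?_
    rw [hu.dir_coef hcc, Finset.sum_mul]
    exact Finset.sum_congr rfl fun l _ => by rw [mul_assoc]; rfl
  refine (h.add t).congr fun u z hu => ?_
  have e : iter b I (lop b u u) =ᶠ[𝓝 z] fun y => commutator b I u y + lop b u (iter b I u) y := by
    filter_upwards with y; simp [commutator]
  have hs : SmoothNear (commutator b I u) z :=
    ((hu.lop hu.1).iter I).sub (hu.lop (hu.1.iter I))
  have : commutator b (m :: I) u z
      = dir (b m) (iter b I (lop b u u)) z - lop b u (dir (b m) (iter b I u)) z := rfl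
  rw [this, dir_congr' e, dir_add hs (hu.lop (hu.1.iter I)), dir_lop hu (hu.1.iter I)]
  ring

/-- The commutator of `D^I` with `lop` is linear in the derivatives of order `|I| + 1`, with second
derivatives as coefficients, up to terms of lower order. -/
theorem topForm_commutator (I : List (Fin n)) (hI : 1 ≤ I.length) :
    TopForm b I.length (commutator b I) := by
  induction I with
  | nil => simp at hI
  | cons m I ih =>
    apply topForm_commutator_cons
    rcases Nat.eq_zero_or_pos I.length with h0 | h0
    · have hI : I = [] := List.eq_nil_of_length_eq_zero h0
      subst hI
      refine (TopForm.low (JetFun.zero _)).congr fun u z hu => ?_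
      have : commutator b [] u = fun _ => 0 := by
        funext y; simp [commutator, iter]
      rw [this]; exact dir_const 0 _ _
    · exact (ih h0).dir h0 m

end Jets


/-! ### The algebra of Simons' inequality -/

section SimonsAlgebra

open Matrix

variable {n : ℕ}

theorem sum_mul_comm_rankOne (s : Matrix (Fin n) (Fin n) ℝ) (hs : s.IsSymm)
    (ν X c h : Fin n → ℝ) :
    ∑ i, ∑ j, (s i j + ν i * X j - c i * h j) * (s j i + ν j * X i - c j * h i)
      = (∑ i, ∑ j, s i j ^ 2) + 2 * (X ⬝ᵥ s *ᵥ ν) - 2 * (h ⬝ᵥ s *ᵥ c) + (X ⬝ᵥ ν) ^ 2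
        - 2 * (h ⬝ᵥ ν) * (X ⬝ᵥ c) + (h ⬝ᵥ c) ^ 2 := by
  have hs' : ∀ i j, s j i = s i j := fun i j => hs.apply i j
  have e1 : ∀ a b : Fin n → ℝ, ∑ i, ∑ j, s i j * (a j * b i) = b ⬝ᵥ s *ᵥ a := by
    intro a b
    simp only [dotProduct, mulVec, Finset.mul_sum]
    exact Finset.sum_congr rfl fun i _ => Finset.sum_congr rfl fun j _ => by ring
  have e2 : ∀ a b : Fin n → ℝ, ∑ i, ∑ j, s i j * (a i * b j) = b ⬝ᵥ s *ᵥ a := by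
    intro a b
    rw [← e1 a b, Finset.sum_comm]
    exact Finset.sum_congr rfl fun i _ => Finset.sum_congr rfl fun j _ => by rw [hs']
  have e3 : ∀ a b d e : Fin n → ℝ, ∑ i, ∑ j, (a i * b i) * (d j * e j) = (a ⬝ᵥ b) * (d ⬝ᵥ e) := by
    intro a b d e
    simp only [dotProduct, Finset.sum_mul_sum]
  have : ∀ i j, (s i j + ν i * X j - c i * h j) * (s j i + ν j * X i - c j * h i)
      = s i j ^ 2 + s i j * (ν j * X i) + s i j * (ν i * X j) - s i j * (c j * h i)
        - s i j * (c i * h j) + (X i * ν i) * (X j * ν j) - (h i * ν i) * (X j * c j)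
        - (X i * c i) * (h j * ν j) + (h i * c i) * (h j * c j) := by
    intro i j; rw [hs']; ring
  simp only [this, Finset.sum_add_distrib, Finset.sum_sub_distrib, e1, e2, e3]
  ring

theorem sum_mul_rankOne (M s : Matrix (Fin n) (Fin n) ℝ) (ν X c h : Fin n → ℝ) :
    ∑ i, ∑ j, M j i * (s i j + ν i * X j - c i * h j)
      = (∑ i, ∑ j, M j i * s i j) + X ⬝ᵥ M *ᵥ ν - h ⬝ᵥ M *ᵥ c := by
  have e1 : ∀ a b : Fin n → ℝ, ∑ i, ∑ j, M j i * (a i * b j) = b ⬝ᵥ M *ᵥ a := by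
    intro a b
    rw [Finset.sum_comm]
    simp only [dotProduct, mulVec, Finset.mul_sum]
    exact Finset.sum_congr rfl fun i _ => Finset.sum_congr rfl fun j _ => by ring
  simp only [mul_add, mul_sub, Finset.sum_add_distrib, Finset.sum_sub_distrib, e1]

/-- The quadratic expression that appears in the evolution of `tr B²`, where `B = a h` is the
Weingarten map of a spacelike graph, `a = 1 + ν ⊗ ν`, and `C k` is the derivative of `B` in the
direction `k`. It is the squared norm, in the metric with inverse `a`, of the totally symmetric
tensor `S`, the covariant derivative of the second fundamental form. -/
theorem simons_quadratic_nonneg (ν c : Fin n → ℝ) (h : Matrix (Fin n) (Fin n) ℝ) (hh : h.IsSymm)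
    (S : Fin n → Matrix (Fin n) (Fin n) ℝ) (hS : ∀ k i j, S k i j = S i k j ∧ S k i j = S k j i)
    (σ X B : Matrix (Fin n) (Fin n) ℝ) (γ : ℝ) (hc : c = h *ᵥ ν) (hγ : γ = c ⬝ᵥ ν)
    (hσ : ∀ k j, σ k j = (S k *ᵥ ν) j)
    (hX : X = σ + h * h + vecMulVec c c - γ • h)
    (hB : B = h + vecMulVec ν c)
    (C : Fin n → Matrix (Fin n) (Fin n) ℝ)
    (hC : ∀ k i j, C k i j = S k i j + ν i * X k j - c i * h k j) :
    0 ≤ (∑ k, ∑ i, ∑ j, C k i j * C k j i)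
      + (∑ i, ∑ j, (∑ k, ν k * C k i j) * (∑ k, ν k * C k j i))
      - 2 * (∑ i, ∑ j, (B * B) j i * ∑ k, ν k * C k i j)
      + 2 * ∑ k, (B *ᵥ ν) k * ∑ i, ∑ j, B j i * C k i j := by
  have hSs : ∀ k, (S k).IsSymm := fun k => by
    ext i j; exact (hS k j i).2
  have hσs : σ.IsSymm := by
    ext i j
    simp only [transpose_apply, hσ, mulVec, dotProduct]
    exact Finset.sum_congr rfl fun l _ => by
      rw [(hS j i l).1]
  have hσ' : ∀ k, S k *ᵥ ν = σ k := fun k => funext fun j => (hσ k j).symm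
  have hσn : ∀ i j, ∑ k, ν k * S k i j = σ i j := by
    intro i j
    rw [hσ]; simp only [mulVec, dotProduct]
    exact Finset.sum_congr rfl fun k _ => by
      rw [(hS k i j).1, (hS i k j).2, mul_comm]
  set x : Fin n → ℝ := X *ᵥ ν with hx
  set y : Fin n → ℝ := h *ᵥ c with hy
  set s : Fin n → ℝ := σ *ᵥ ν with hs
  have hsymm : ∀ (M : Matrix (Fin n) (Fin n) ℝ), M.IsSymm → ∀ a b : Fin n → ℝ,
      a ⬝ᵥ M *ᵥ b = b ⬝ᵥ M *ᵥ a := by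
    intro M hM a b
    rw [dotProduct_mulVec, dotProduct_comm, ← mulVec_transpose, hM.eq]
  have hqn : (h * h) *ᵥ ν = y := by rw [← mulVec_mulVec, ← hc]
  have hccn : ∀ a b d : Fin n → ℝ, vecMulVec a b *ᵥ d = (b ⬝ᵥ d) • a := by
    intro a b d
    ext i; simp [vecMulVec, mulVec, dotProduct, Finset.sum_mul]
    exact Finset.sum_congr rfl fun _ _ => by ring
  have hxe : x = s + y := by
    rw [hx, hX, sub_mulVec, add_mulVec, add_mulVec, hqn, hccn, ← hγ, smul_mulVec, ← hc]
    simp [← hs]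
  -- the sum of the squares of the matrices `C k`
  have T1 : (∑ k, ∑ i, ∑ j, C k i j * C k j i) = (∑ k, ∑ i, ∑ j, S k i j ^ 2)
      + 2 * (∑ k, X k ⬝ᵥ σ k) - 2 * (∑ k, h k ⬝ᵥ S k *ᵥ c) + x ⬝ᵥ x - 2 * (c ⬝ᵥ X *ᵥ c) + y ⬝ᵥ y := by
    have : ∀ k, ∑ i, ∑ j, C k i j * C k j i = (∑ i, ∑ j, S k i j ^ 2) + 2 * (X k ⬝ᵥ σ k)
        - 2 * (h k ⬝ᵥ S k *ᵥ c) + (x k) * (x k) - 2 * (c k * (X *ᵥ c) k) + y k * y k := by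
      intro k
      simp only [hC]
      rw [sum_mul_comm_rankOne (S k) (hSs k) ν (X k) c (h k), hσ']
      have a1 : X k ⬝ᵥ ν = x k := rfl
      have a2 : h k ⬝ᵥ ν = c k := by rw [hc]; rfl
      have a3 : X k ⬝ᵥ c = (X *ᵥ c) k := rfl
      have a4 : h k ⬝ᵥ c = y k := rfl
      rw [a1, a2, a3, a4]; ring
    simp only [this, Finset.sum_add_distrib, Finset.sum_sub_distrib, ← Finset.mul_sum]
    rfl
  have hCn : ∀ i j, ∑ k, ν k * C k i j = σ i j + ν i * x j - c i * c j := by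
    intro i j
    have hXs : X.IsSymm := by
      rw [hX]; ext i j
      have hq : (h * h) j i = (h * h) i j := by
        have : (h * h).IsSymm := by
          unfold Matrix.IsSymm; rw [transpose_mul, hh.eq]
        exact this.apply i j
      simp only [transpose_apply, Matrix.add_apply, Matrix.sub_apply, Matrix.smul_apply, vecMulVec_apply, hσs.apply i j,
        hh.apply i j, hq, smul_eq_mul]
      ring
    have a1 : x j = ∑ k, ν k * X k j := by
      simp only [hx, mulVec, dotProduct]
      exact Finset.sum_congr rfl fun k _ => by rw [hXs.apply k j, mul_comm]
    have a2 : c j = ∑ k, ν k * h k j := by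
      rw [hc]; simp only [mulVec, dotProduct]
      exact Finset.sum_congr rfl fun k _ => by rw [hh.apply k j, mul_comm]
    rw [a1, ← hσn, a2, Finset.mul_sum, Finset.mul_sum, ← Finset.sum_add_distrib,
      ← Finset.sum_sub_distrib]
    exact Finset.sum_congr rfl fun k _ => by rw [hC]; ring
  have T2 : (∑ i, ∑ j, (∑ k, ν k * C k i j) * (∑ k, ν k * C k j i))
      = (∑ i, ∑ j, σ i j ^ 2) + 2 * (x ⬝ᵥ s) - 2 * (c ⬝ᵥ σ *ᵥ c) + (x ⬝ᵥ ν) ^ 2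
        - 2 * γ * (x ⬝ᵥ c) + (c ⬝ᵥ c) ^ 2 := by
    simp only [hCn]
    rw [sum_mul_comm_rankOne σ hσs ν x c c, ← hγ]
  have hBB : B * B = h * h + vecMulVec c c + vecMulVec ν y + γ • vecMulVec ν c := by
    rw [hB, add_mul, mul_add, mul_add, mul_vecMulVec, ← hc, vecMulVec_mul, ← mulVec_transpose,
      hh.eq, ← hy, vecMulVec_mul_vecMulVec, ← hγ]
    simp only [vecMulVec_smul]
    abel
  have hyn : y ⬝ᵥ ν = c ⬝ᵥ c := by
    rw [hy, dotProduct_comm, hsymm h hh, ← hc]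
  have hin : ∀ (M : Matrix (Fin n) (Fin n) ℝ), ∀ a b : Fin n → ℝ,
      ∑ i, ∑ j, vecMulVec a b j i * M i j = b ⬝ᵥ M *ᵥ a := by
    intro M a b
    simp only [dotProduct, mulVec, Finset.mul_sum, vecMulVec_apply]
    exact Finset.sum_congr rfl fun i _ => Finset.sum_congr rfl fun j _ => by ring
  have T3 : (∑ i, ∑ j, (B * B) j i * ∑ k, ν k * C k i j)
      = (∑ i, ∑ j, (h * h) j i * σ i j) + c ⬝ᵥ σ *ᵥ c + y ⬝ᵥ s + γ * (c ⬝ᵥ s)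
        + (x ⬝ᵥ y + γ * (x ⬝ᵥ c) + (c ⬝ᵥ c) * (x ⬝ᵥ ν) + γ * (γ * (x ⬝ᵥ ν)))
        - (y ⬝ᵥ y + (c ⬝ᵥ c) * (c ⬝ᵥ c) + (y ⬝ᵥ c) * γ + γ * ((c ⬝ᵥ c) * γ)) := by
    simp only [hCn]
    rw [sum_mul_rankOne]
    have b1 : ∑ i, ∑ j, (B * B) j i * σ i j = (∑ i, ∑ j, (h * h) j i * σ i j) + c ⬝ᵥ σ *ᵥ c
        + y ⬝ᵥ s + γ * (c ⬝ᵥ s) := by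
      rw [hs, ← hin, ← hin, ← hin, hBB]
      simp only [Matrix.add_apply, Matrix.smul_apply, smul_eq_mul, add_mul, Finset.sum_add_distrib,
        Finset.mul_sum, mul_assoc]
    have b2 : (B * B) *ᵥ ν = y + γ • c + (c ⬝ᵥ c) • ν + (γ * γ) • ν := by
      rw [hBB, add_mulVec, add_mulVec, add_mulVec, hqn, smul_mulVec, hccn, hccn, hccn, ← hγ, hyn,
        smul_smul]
    have b3 : (B * B) *ᵥ c = h *ᵥ y + (c ⬝ᵥ c) • c + (y ⬝ᵥ c) • ν + (γ * (c ⬝ᵥ c)) • ν := by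
      rw [hBB, add_mulVec, add_mulVec, add_mulVec, ← mulVec_mulVec, ← hy, smul_mulVec, hccn, hccn,
        hccn, smul_smul]
    have b4 : c ⬝ᵥ h *ᵥ y = y ⬝ᵥ y := by rw [hsymm h hh, ← hy]
    rw [b1, b2, b3]
    simp only [dotProduct_add, dotProduct_smul, smul_eq_mul, b4, ← hγ]
    ring
  have hBn : B *ᵥ ν = c + γ • ν := by rw [hB, add_mulVec, hccn, ← hc, ← hγ]
  have hBc : B *ᵥ c = y + (c ⬝ᵥ c) • ν := by rw [hB, add_mulVec, hccn]
  have T4 : (∑ k, (B *ᵥ ν) k * ∑ i, ∑ j, B j i * C k i j)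
      = (∑ k, h k ⬝ᵥ S k *ᵥ c) + γ * (∑ i, ∑ j, h j i * σ i j) + c ⬝ᵥ σ *ᵥ c + γ * (c ⬝ᵥ s)
        + (c ⬝ᵥ X *ᵥ c + 2 * γ * (x ⬝ᵥ c) + γ * γ * (x ⬝ᵥ ν))
        - (y ⬝ᵥ y + γ * (y ⬝ᵥ c) + (c ⬝ᵥ c) * (c ⬝ᵥ c) + γ * γ * (c ⬝ᵥ c)) := by
    have c1 : ∀ k, ∑ i, ∑ j, B j i * C k i j
        = (∑ i, ∑ j, h j i * S k i j) + (σ *ᵥ c) k + (X *ᵥ (c + γ • ν)) k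
          - (h *ᵥ (y + (c ⬝ᵥ c) • ν)) k := by
      intro k
      simp only [hC]
      rw [sum_mul_rankOne, hBn, hBc]
      have : ∑ i, ∑ j, B j i * S k i j = (∑ i, ∑ j, h j i * S k i j) + (σ *ᵥ c) k := by
        have : (σ *ᵥ c) k = c ⬝ᵥ S k *ᵥ ν := by
          rw [hσ', dotProduct_comm]; rfl
        rw [this, ← hin, hB]
        simp only [Matrix.add_apply, add_mul, Finset.sum_add_distrib]
      rw [this]; rfl
    have c2 : ∀ a : Fin n → ℝ, ∑ k, a k * ((∑ i, ∑ j, h j i * S k i j) + (σ *ᵥ c) k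
        + (X *ᵥ (c + γ • ν)) k - (h *ᵥ (y + (c ⬝ᵥ c) • ν)) k)
        = (∑ k, a k * ∑ i, ∑ j, h j i * S k i j) + a ⬝ᵥ σ *ᵥ c + a ⬝ᵥ X *ᵥ (c + γ • ν)
          - a ⬝ᵥ h *ᵥ (y + (c ⬝ᵥ c) • ν) := by
      intro a
      simp only [mul_add, mul_sub, Finset.sum_add_distrib, Finset.sum_sub_distrib]
      rfl
    have c3 : ∑ k, c k * ∑ i, ∑ j, h j i * S k i j = ∑ k, h k ⬝ᵥ S k *ᵥ c := by
      simp only [dotProduct, mulVec, Finset.mul_sum]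
      have l1 : ∑ k, ∑ i, ∑ j, c k * (h j i * S k i j) = ∑ i, ∑ j, ∑ k, c k * (h j i * S k i j) := by
        rw [Finset.sum_comm]
        exact Finset.sum_congr rfl fun i _ => Finset.sum_comm
      rw [l1]
      refine Finset.sum_congr rfl fun i _ => Finset.sum_congr rfl fun j _ =>
        Finset.sum_congr rfl fun k _ => ?_
      rw [(hS k i j).1, (hS i k j).2, hh.apply i j]; ring
    have c4 : ∑ k, ν k * ∑ i, ∑ j, h j i * S k i j = ∑ i, ∑ j, h j i * σ i j := by
      simp only [← hσn, Finset.mul_sum]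
      rw [Finset.sum_comm]
      refine Finset.sum_congr rfl fun i _ => ?_
      rw [Finset.sum_comm]
      exact Finset.sum_congr rfl fun j _ => Finset.sum_congr rfl fun k _ => by ring
    simp only [c1]
    rw [c2, hBn]
    have c5 : ∑ k, (c + γ • ν) k * ∑ i, ∑ j, h j i * S k i j
        = (∑ k, h k ⬝ᵥ S k *ᵥ c) + γ * ∑ i, ∑ j, h j i * σ i j := by
      rw [← c3, ← c4, Finset.mul_sum, ← Finset.sum_add_distrib]
      exact Finset.sum_congr rfl fun k _ => by simp; ring
    have hXs : ν ⬝ᵥ X *ᵥ c = x ⬝ᵥ c := by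
      rw [hX]
      have : x = s + y := hxe
      rw [this, sub_mulVec, add_mulVec, add_mulVec, smul_mulVec, ← hy, hccn, ← mulVec_mulVec, ← hy]
      simp only [dotProduct_sub, dotProduct_add, dotProduct_smul, add_dotProduct, smul_eq_mul]
      rw [hsymm σ hσs ν c, ← hs, dotProduct_comm ν c, ← hγ, dotProduct_comm ν y, hyn,
        hsymm h hh ν y, ← hc, dotProduct_comm c s]
      ring
    rw [c5]
    simp only [add_dotProduct, smul_dotProduct, mulVec_add, mulVec_smul, dotProduct_add,
      dotProduct_smul, smul_eq_mul, hXs, ← hx, ← hc]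
    rw [hsymm σ hσs ν c, ← hs, hsymm h hh c y, ← hy, hsymm h hh ν y, ← hc, dotProduct_comm ν x,
      dotProduct_comm c x, dotProduct_comm ν c, ← hγ]
    ring
  have eX : (∑ k, X k ⬝ᵥ σ k) = (∑ i, ∑ j, σ i j ^ 2) + (∑ i, ∑ j, (h * h) j i * σ i j)
      + c ⬝ᵥ σ *ᵥ c - γ * ∑ i, ∑ j, h j i * σ i j := by
    have hq : ∀ i j, (h * h) j i = (h * h) i j := by
      have : (h * h).IsSymm := by
        unfold Matrix.IsSymm; rw [transpose_mul, hh.eq]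
      exact fun i j => this.apply i j
    rw [← hin]
    simp only [Finset.mul_sum, ← Finset.sum_add_distrib, ← Finset.sum_sub_distrib, dotProduct]
    refine Finset.sum_congr rfl fun i _ => Finset.sum_congr rfl fun j _ => ?_
    rw [hX, hq, hh.apply i j]
    simp only [Matrix.add_apply, Matrix.sub_apply, Matrix.smul_apply, vecMulVec_apply, smul_eq_mul]
    ring
  rw [T1, T2, T3, T4, eX, hxe]
  have n1 : 0 ≤ ∑ k, ∑ i, ∑ j, S k i j ^ 2 := by positivity
  have n2 : 0 ≤ ∑ i, ∑ j, σ i j ^ 2 := by positivity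
  have n3 : 0 ≤ s ⬝ᵥ s := by
    simp only [dotProduct]; exact Finset.sum_nonneg fun i _ => mul_self_nonneg _
  have hsy : y ⬝ᵥ s = s ⬝ᵥ y := dotProduct_comm _ _
  simp only [add_dotProduct, dotProduct_add, hyn, hsy]
  nlinarith [sq_nonneg (s ⬝ᵥ ν)]

end SimonsAlgebra


/-! ### Evolution equations on a spacelike graph moving by mean curvature -/

section Graph

variable {n : ℕ} {u : ST n → ℝ} {z : ST n}

theorem wgt_pos {p : Euc n} (hp : ‖p‖ < 1) : 0 < wgt p :=
  inv_pos.2 (Real.sqrt_pos.2 (one_sub_norm_sq_pos hp))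

theorem wgt_sq_mul {p : Euc n} (hp : ‖p‖ < 1) : wgt p * wgt p * (1 - ‖p‖ ^ 2) = 1 := by
  have h := one_sub_norm_sq_pos hp
  unfold wgt
  rw [← mul_inv, Real.mul_self_sqrt h.le, inv_mul_cancel₀ h.ne']

theorem norm_sq_eq_sum (p : Euc n) : ‖p‖ ^ 2 = ∑ i, p i * p i := by
  rw [EuclideanSpace.real_norm_sq_eq]; exact Finset.sum_congr rfl fun i _ => sq _

/-- The vertical component of the unit normal of the graph of `u`. -/
def gw (u : ST n → ℝ) (y : ST n) : ℝ := wgt (grad eb u y)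

/-- The horizontal components of the unit normal of the graph of `u`. -/
def gn (u : ST n → ℝ) (i : Fin n) (y : ST n) : ℝ := nrm (grad eb u y) i

/-- The Weingarten map `Bⁱⱼ = ∂ⱼνⁱ` of the graph of `u`. -/
def gB (u : ST n → ℝ) (i j : Fin n) (y : ST n) : ℝ := sd j (gn u i) y

/-- The squared norm `|A|² = tr B²` of the second fundamental form of the graph of `u`. -/
def gA (u : ST n → ℝ) (y : ST n) : ℝ := ∑ i, ∑ j, gB u i j y * gB u j i y

/-- Near `z` the function `u` is smooth, its graph is spacelike, and it moves by mean curvature. -/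
def FlowGraph (u : ST n → ℝ) (z : ST n) : Prop :=
  Adm eb u z ∧ ∀ᶠ y in 𝓝 z, dir et u y = lop eb u u y

theorem FlowGraph.eventually (h : FlowGraph u z) : ∀ᶠ y in 𝓝 z, FlowGraph u y := by
  filter_upwards [h.1.eventually, h.2.eventually_nhds] with y h1 h2 using ⟨h1, h2⟩

theorem box_eq_lop (f : ST n → ℝ) :
    box (fun i => gn u i z) f z = dir et f z - lop eb u f z := by
  unfold box lop gn; ring

theorem Adm.gw (h : Adm eb u z) : SmoothNear (gw u) z := h.coef contDiffOn_wgt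

theorem Adm.gn (h : Adm eb u z) (i : Fin n) : SmoothNear (gn u i) z := h.coef (contDiffOn_nrm i)

theorem Adm.gB (h : Adm eb u z) (i j : Fin n) : SmoothNear (gB u i j) z := (h.gn i).dir _

theorem Adm.gA (h : Adm eb u z) : SmoothNear (gA u) z :=
  SmoothNear.sum fun i _ => SmoothNear.sum fun j _ => (h.gB i j).mul (h.gB j i)

theorem Adm.gw_pos (h : Adm eb u z) : 0 < MinkMCF.gw u z := wgt_pos h.2

theorem Adm.gw_sq_mul (h : Adm eb u z) :
    MinkMCF.gw u z * MinkMCF.gw u z * (1 - ∑ i, sd i u z * sd i u z) = 1 := by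
  have := wgt_sq_mul h.2
  rw [norm_sq_eq_sum] at this
  exact this

theorem gn_eq (i : Fin n) (y : ST n) : gn u i y = gw u y * sd i u y := rfl

/-- On solutions the heat operator of `∂_I u` is the commutator. -/
theorem FlowGraph.box_iter (h : FlowGraph u z) (I : List (Fin n)) :
    box (fun i => MinkMCF.gn u i z) (iter eb I u) z = commutator eb I u z := by
  rw [box_eq_lop, dir_iter h.1.1, (iter_congr h.2 I).self_of_nhds]; rfl

/-- The height function of a hypersurface moving by mean curvature satisfies the heat equation. -/
theorem FlowGraph.box_self (h : FlowGraph u z) : box (fun i => MinkMCF.gn u i z) u z = 0 := by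
  have := h.box_iter []
  simpa [commutator, iter] using this

/-- The contraction `yₖ = pᵢ uₖᵢ` of the Hessian with the gradient. -/
def gy (u : ST n → ℝ) (k : Fin n) (y : ST n) : ℝ := ∑ i, sd i u y * sd k (sd i u) y

theorem hess_symm (h : SmoothNear u z) (i j : Fin n) : sd i (sd j u) z = sd j (sd i u) z :=
  dir_comm h _ _

theorem Adm.sd_one_sub (h : Adm eb u z) (k : Fin n) :
    sd k (fun y => 1 - ∑ i, sd i u y * sd i u y) z = -2 * gy u k z := by
  have hs : ∀ i ∈ Finset.univ, SmoothNear (fun y => sd i u y * sd i u y) z :=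
    fun i _ => (h.1.dir _).mul (h.1.dir _)
  have : sd k (fun y => 1 - ∑ i, sd i u y * sd i u y) z
      = 0 - ∑ i, (sd k (sd i u) z * sd i u z + sd i u z * sd k (sd i u) z) := by
    rw [← dir_const (1 : ℝ) (eb k) z]
    rw [← Finset.sum_congr rfl fun i _ => dir_mul (h.1.dir (eb i)) (h.1.dir (eb i)) (eb k)]
    rw [← dir_sum hs]
    exact dir_sub (smoothNear_const 1 z) (SmoothNear.sum hs) _
  rw [this, gy, zero_sub, Finset.mul_sum, ← Finset.sum_neg_distrib]
  exact Finset.sum_congr rfl fun i _ => by ring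

theorem Adm.sd_gw (h : Adm eb u z) (k : Fin n) :
    sd k (MinkMCF.gw u) z = MinkMCF.gw u z ^ 3 * gy u k z := by
  set f : ST n → ℝ := fun y => 1 - ∑ i, sd i u y * sd i u y with hf
  have hfs : SmoothNear f z := (smoothNear_const 1 z).sub
    (SmoothNear.sum fun i _ => (h.1.dir _).mul (h.1.dir _))
  have e : (fun y => MinkMCF.gw u y * MinkMCF.gw u y * f y) =ᶠ[𝓝 z] fun _ => 1 := by
    filter_upwards [h.eventually] with y hy using hy.gw_sq_mul
  have h1 := dir_congr' e (eb k)
  rw [dir_const, dir_mul (h.gw.mul h.gw) hfs, dir_mul h.gw h.gw] at h1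
  have h2 : dir (eb k) f z = -2 * gy u k z := h.sd_one_sub k
  rw [h2] at h1
  have h3 : MinkMCF.gw u z * MinkMCF.gw u z * f z = 1 := h.gw_sq_mul
  have hw := h.gw_pos
  have h4 : (sd k (MinkMCF.gw u) z - MinkMCF.gw u z ^ 3 * gy u k z) * (MinkMCF.gw u z * f z) = 0 := by
    linear_combination h1 / 2 - (MinkMCF.gw u z ^ 2 * gy u k z) * h3
  have h5 : MinkMCF.gw u z * f z ≠ 0 := by
    intro h0
    rw [mul_assoc, h0] at h3; simp at h3
  have := (mul_eq_zero.1 h4).resolve_right h5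
  linarith

theorem Adm.gB_eq (h : Adm eb u z) (i k : Fin n) : MinkMCF.gB u i k z
    = MinkMCF.gw u z ^ 3 * gy u k z * sd i u z + MinkMCF.gw u z * sd k (sd i u) z := by
  have : MinkMCF.gB u i k z = sd k (fun y => MinkMCF.gw u y * sd i u y) z := rfl
  rw [this, ← h.sd_gw]
  exact dir_mul h.gw (h.1.dir _) _

/-- The squared length of the contraction `y`. -/
def gyy (u : ST n → ℝ) (z : ST n) : ℝ := ∑ k, gy u k z * gy u k z

/-- The second derivative of `u` in the direction of its gradient. -/
def gpy (u : ST n → ℝ) (z : ST n) : ℝ := ∑ k, sd k u z * gy u k z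

/-- The squared Euclidean length of the Hessian. -/
def ghh (u : ST n → ℝ) (z : ST n) : ℝ := ∑ i, ∑ k, sd i (sd k u) z * sd i (sd k u) z

theorem Adm.gA_eq (h : Adm eb u z) : MinkMCF.gA u z = MinkMCF.gw u z ^ 2 * ghh u z
    + 2 * MinkMCF.gw u z ^ 4 * gyy u z + MinkMCF.gw u z ^ 6 * gpy u z ^ 2 := by
  have e1 : gpy u z ^ 2 = ∑ i, ∑ k, (sd i u z * gy u i z) * (sd k u z * gy u k z) := by
    rw [sq, gpy, Finset.sum_mul_sum]
  have e2 : gyy u z = ∑ i, ∑ k, gy u i z * (sd k u z * sd i (sd k u) z) := by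
    simp only [gyy, ← Finset.mul_sum]; rfl
  have e3 : gyy u z = ∑ i, ∑ k, gy u k z * (sd i u z * sd k (sd i u) z) := by
    rw [e2, Finset.sum_comm]
  have : 2 * MinkMCF.gw u z ^ 4 * gyy u z = MinkMCF.gw u z ^ 4 * gyy u z
    + MinkMCF.gw u z ^ 4 * gyy u z := by ring
  rw [this]
  nth_rewrite 1 [e2]
  rw [e3, e1, ghh, MinkMCF.gA]
  simp only [Finset.mul_sum, ← Finset.sum_add_distrib]
  refine Finset.sum_congr rfl fun i _ => Finset.sum_congr rfl fun k _ => ?_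
  rw [h.gB_eq, h.gB_eq, hess_symm h.1 k i]; ring

theorem FlowGraph.box_sd (h : FlowGraph u z) (k : Fin n) :
    box (fun i => MinkMCF.gn u i z) (sd k u) z
      = 2 * MinkMCF.gw u z ^ 2 * (∑ i, gy u i z * sd i (sd k u) z)
        + 2 * MinkMCF.gw u z ^ 4 * gpy u z * gy u k z := by
  have h1 := h.box_iter [k]
  have h2 : commutator eb [k] u z = dir (eb k) (lop eb u u) z - lop eb u (sd k u) z := rfl
  change box _ (sd k u) z = _ at h1
  rw [h1, h2, dir_lop h.1 h.1.1, add_sub_cancel_left]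
  have h3 : ∀ i j, dir (eb k) (fun y => nrm (grad eb u y) i * nrm (grad eb u y) j) z
      = MinkMCF.gB u i k z * MinkMCF.gn u j z + MinkMCF.gn u i z * MinkMCF.gB u j k z :=
    fun i j => dir_mul (h.1.gn i) (h.1.gn j) _
  simp only [h3]
  have h4 : ∑ i, ∑ j, (MinkMCF.gB u i k z * MinkMCF.gn u j z + MinkMCF.gn u i z * MinkMCF.gB u j k z)
      * sd i (sd j u) z = 2 * ∑ i, ∑ j, MinkMCF.gB u i k z * MinkMCF.gn u j z * sd i (sd j u) z := by
    simp only [add_mul, Finset.sum_add_distrib, two_mul]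
    congr 1
    rw [Finset.sum_comm]
    refine Finset.sum_congr rfl fun i _ => Finset.sum_congr rfl fun j _ => ?_
    rw [hess_symm h.1.1 j i]; ring
  rw [h4]
  have h5 : ∀ i, ∑ j, MinkMCF.gB u i k z * MinkMCF.gn u j z * sd i (sd j u) z
      = MinkMCF.gw u z ^ 2 * (gy u i z * sd i (sd k u) z)
        + MinkMCF.gw u z ^ 4 * gy u k z * (sd i u z * gy u i z) := by
    intro i
    have : ∑ j, MinkMCF.gB u i k z * MinkMCF.gn u j z * sd i (sd j u) z
        = MinkMCF.gB u i k z * MinkMCF.gw u z * gy u i z := by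
      rw [gy, Finset.mul_sum]
      exact Finset.sum_congr rfl fun j _ => by rw [gn_eq]; ring
    rw [this, h.1.gB_eq, hess_symm h.1.1 k i]; ring
  simp only [h5, Finset.sum_add_distrib, ← Finset.mul_sum]
  rw [← gpy]; ring

theorem Adm.gam_formula (h : Adm eb u z) (f g : ST n → ℝ) :
    gam (fun i => MinkMCF.gn u i z) f g z = ∑ i, sd i f z * sd i g z
      + MinkMCF.gw u z ^ 2 * (∑ i, sd i u z * sd i f z) * ∑ i, sd i u z * sd i g z := by
  have : ∀ f : ST n → ℝ, ∑ i, MinkMCF.gn u i z * sd i f z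
      = MinkMCF.gw u z * ∑ i, sd i u z * sd i f z := by
    intro f
    rw [Finset.mul_sum]; exact Finset.sum_congr rfl fun i _ => by rw [gn_eq]; ring
  rw [gam, this, this]; ring

theorem Adm.sum_gam_sd (h : Adm eb u z) :
    ∑ k, gam (fun i => MinkMCF.gn u i z) (sd k u) (sd k u) z
      = ghh u z + MinkMCF.gw u z ^ 2 * gyy u z := by
  have e : ∀ k, ∑ i, sd i u z * sd i (sd k u) z = gy u k z := by
    intro k
    exact Finset.sum_congr rfl fun i _ => by rw [hess_symm h.1 i k]
  simp only [h.gam_formula, e, Finset.sum_add_distrib]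
  congr 1
  · rw [ghh, Finset.sum_comm]
  · rw [gyy, Finset.mul_sum]; exact Finset.sum_congr rfl fun k _ => by ring

/-- The evolution of the tilt `w = -⟨ν, e_{n+1}⟩`. -/
theorem FlowGraph.box_gw (h : FlowGraph u z) :
    box (fun i => MinkMCF.gn u i z) (MinkMCF.gw u) z = -MinkMCF.gA u z * MinkMCF.gw u z := by
  set N : Fin n → ℝ := fun i => MinkMCF.gn u i z with hN
  set w := MinkMCF.gw u z with hw
  have hA := h.1
  set f : ST n → ℝ := fun y => 1 - ∑ i, sd i u y * sd i u y with hf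
  have hss : ∀ i ∈ Finset.univ, SmoothNear (fun y => sd i u y * sd i u y) z :=
    fun i _ => (hA.1.dir _).mul (hA.1.dir _)
  have hfs : SmoothNear f z := (smoothNear_const 1 z).sub (SmoothNear.sum hss)
  have e : (fun y => MinkMCF.gw u y * MinkMCF.gw u y * f y) =ᶠ[𝓝 z] fun _ => 1 := by
    filter_upwards [h.1.eventually] with y hy using hy.gw_sq_mul
  have h3 : w * w * f z = 1 := hA.gw_sq_mul
  have h1 := box_congr (N := N) e
  rw [box_const, box_mul (hA.gw.mul hA.gw) hfs, box_mul hA.gw hA.gw, gam_mul_left hA.gw hA.gw] at h1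
  have hy : ∀ k, dir (eb k) f z = -2 * gy u k z := fun k => hA.sd_one_sub k
  have g1 : gam N (MinkMCF.gw u) (MinkMCF.gw u) z
      = w ^ 6 * (gyy u z + w ^ 2 * gpy u z ^ 2) := by
    rw [hA.gam_formula]
    simp only [hA.sd_gw, ← hw]
    have a1 : ∑ i, w ^ 3 * gy u i z * (w ^ 3 * gy u i z) = w ^ 6 * gyy u z := by
      rw [gyy, Finset.mul_sum]; exact Finset.sum_congr rfl fun i _ => by ring
    have a2 : ∑ i, sd i u z * (w ^ 3 * gy u i z) = w ^ 3 * gpy u z := by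
      rw [gpy, Finset.mul_sum]; exact Finset.sum_congr rfl fun i _ => by ring
    rw [a1, a2]; ring
  have g2 : gam N (MinkMCF.gw u) f z = -2 * w ^ 3 * (gyy u z + w ^ 2 * gpy u z ^ 2) := by
    rw [hA.gam_formula]
    simp only [hA.sd_gw, hy, ← hw]
    have a1 : ∑ i, w ^ 3 * gy u i z * (-2 * gy u i z) = -2 * w ^ 3 * gyy u z := by
      rw [gyy, Finset.mul_sum]; exact Finset.sum_congr rfl fun i _ => by ring
    have a2 : ∑ i, sd i u z * (w ^ 3 * gy u i z) = w ^ 3 * gpy u z := by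
      rw [gpy, Finset.mul_sum]; exact Finset.sum_congr rfl fun i _ => by ring
    have a3 : ∑ i, sd i u z * (-2 * gy u i z) = -2 * gpy u z := by
      rw [gpy, Finset.mul_sum]; exact Finset.sum_congr rfl fun i _ => by ring
    rw [a1, a2, a3]; ring
  have g3 : box N f z = 2 * ghh u z - 2 * w ^ 2 * gyy u z - 4 * w ^ 4 * gpy u z ^ 2 := by
    have b1 : box N f z = 0 - ∑ k, (sd k u z * box N (sd k u) z + sd k u z * box N (sd k u) z
        - 2 * gam N (sd k u) (sd k u) z) := by
      rw [← box_const (N := N) (z := z) 1]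
      rw [← Finset.sum_congr rfl fun k _ =>
        box_mul (N := N) (hA.1.dir (eb k)) (hA.1.dir (eb k))]
      rw [← box_sum hss]
      exact box_sub (smoothNear_const 1 z) (SmoothNear.sum hss)
    have b2 : ∑ k, sd k u z * box N (sd k u) z
        = 2 * w ^ 2 * gyy u z + 2 * w ^ 4 * gpy u z * gpy u z := by
      have c1 : ∑ k, sd k u z * ∑ i, gy u i z * sd i (sd k u) z = gyy u z := by
        simp only [Finset.mul_sum]
        rw [Finset.sum_comm, gyy]
        refine Finset.sum_congr rfl fun i _ => ?_
        nth_rewrite 3 [gy]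
        rw [Finset.mul_sum]
        exact Finset.sum_congr rfl fun k _ => by ring
      have c2 : ∀ k, sd k u z * box N (sd k u) z
          = 2 * w ^ 2 * (sd k u z * ∑ i, gy u i z * sd i (sd k u) z)
            + 2 * w ^ 4 * gpy u z * (sd k u z * gy u k z) := by
        intro k; rw [h.box_sd]; ring
      simp only [c2, Finset.sum_add_distrib, ← Finset.mul_sum, c1]
      rw [← gpy]
    simp only [b1, Finset.sum_sub_distrib, Finset.sum_add_distrib, ← Finset.mul_sum, b2]
    rw [hA.sum_gam_sd]; ring
  rw [g1, g2, g3] at h1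
  have hwp : 0 < w := hA.gw_pos
  have hfz : f z ≠ 0 := by intro h0; rw [h0] at h3; simp at h3
  rw [hA.gA_eq, ← hw]
  have hz : (box N (MinkMCF.gw u) z + (w ^ 2 * ghh u z + 2 * w ^ 4 * gyy u z + w ^ 6 * gpy u z ^ 2) * w)
      * (2 * w * f z) = 0 := by
    linear_combination h1 + (2 * w ^ 4 * (gyy u z + w ^ 2 * gpy u z ^ 2) + 2 * w ^ 2 * ghh u z
      + 4 * w ^ 4 * gyy u z + 2 * w ^ 6 * gpy u z ^ 2 ) * h3
  have := (mul_eq_zero.1 hz).resolve_right (by positivity)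
  linarith

end Graph


section Graph

variable {n : ℕ} {u : ST n → ℝ} {z : ST n}

/-- The evolution of the normal. Together with `FlowGraph.box_gw` it says `box ν = -|A|² ν`. -/
theorem FlowGraph.box_gn (h : FlowGraph u z) (k : Fin n) :
    box (fun i => MinkMCF.gn u i z) (MinkMCF.gn u k) z = -MinkMCF.gA u z * MinkMCF.gn u k z := by
  have hA := h.1
  have e : MinkMCF.gn u k = fun y => MinkMCF.gw u y * sd k u y := rfl
  have hg : gam (fun i => MinkMCF.gn u i z) (MinkMCF.gw u) (sd k u) z
      = MinkMCF.gw u z ^ 3 * (∑ i, gy u i z * sd i (sd k u) z)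
        + MinkMCF.gw u z ^ 5 * gpy u z * gy u k z := by
    rw [hA.gam_formula]
    simp only [hA.sd_gw]
    have a1 : ∑ i, MinkMCF.gw u z ^ 3 * gy u i z * sd i (sd k u) z
        = MinkMCF.gw u z ^ 3 * ∑ i, gy u i z * sd i (sd k u) z := by
      rw [Finset.mul_sum]; exact Finset.sum_congr rfl fun i _ => by ring
    have a2 : ∑ i, sd i u z * (MinkMCF.gw u z ^ 3 * gy u i z) = MinkMCF.gw u z ^ 3 * gpy u z := by
      rw [gpy, Finset.mul_sum]; exact Finset.sum_congr rfl fun i _ => by ring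
    have a3 : ∑ i, sd i u z * sd i (sd k u) z = gy u k z :=
      Finset.sum_congr rfl fun i _ => by rw [hess_symm hA.1 i k]
    rw [a1, a2, a3]; ring
  have hb : box (fun i => MinkMCF.gn u i z) (fun y => MinkMCF.gw u y * sd k u y) z
      = MinkMCF.gw u z * box (fun i => MinkMCF.gn u i z) (sd k u) z
        + sd k u z * box (fun i => MinkMCF.gn u i z) (MinkMCF.gw u) z
        - 2 * gam (fun i => MinkMCF.gn u i z) (MinkMCF.gw u) (sd k u) z :=
    box_mul hA.gw (hA.1.dir _)
  rw [e, hb, hg, h.box_gw, h.box_sd]; ring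

/-- The evolution of the Weingarten map, by differentiating that of the normal. -/
theorem FlowGraph.box_gB (h : FlowGraph u z) (i j : Fin n) :
    box (fun i => MinkMCF.gn u i z) (MinkMCF.gB u i j) z
      = 2 * (∑ a, MinkMCF.gB u a j z * ∑ k, MinkMCF.gn u k z * sd k (MinkMCF.gB u i a) z)
        - MinkMCF.gn u i z * sd j (MinkMCF.gA u) z
        - MinkMCF.gA u z * MinkMCF.gB u i j z := by
  have hA := h.1
  have e : dir et (MinkMCF.gn u i) =ᶠ[𝓝 z]
      fun y => lop eb u (MinkMCF.gn u i) y - MinkMCF.gA u y * MinkMCF.gn u i y := by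
    filter_upwards [h.eventually] with y hy
    have := hy.box_gn i
    rw [box_eq_lop] at this; linarith
  have h1 : dir et (MinkMCF.gB u i j) z = dir (eb j) (dir et (MinkMCF.gn u i)) z :=
    dir_comm (hA.gn i) _ _
  rw [box_eq_lop, h1, dir_congr' e, dir_sub (hA.lop (hA.gn i)) (hA.gA.mul (hA.gn i)),
    dir_lop hA (hA.gn i), dir_mul hA.gA (hA.gn i)]
  have h3 : ∀ a b, dir (eb j) (fun y => nrm (grad eb u y) a * nrm (grad eb u y) b) z
      = MinkMCF.gB u a j z * MinkMCF.gn u b z + MinkMCF.gn u a z * MinkMCF.gB u b j z :=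
    fun a b => dir_mul (hA.gn a) (hA.gn b) _
  simp only [h3]
  have hgB : ∀ i j, MinkMCF.gB u i j = dir (eb j) (MinkMCF.gn u i) := fun _ _ => rfl
  have h4 : ∑ a, ∑ b, (MinkMCF.gB u a j z * MinkMCF.gn u b z + MinkMCF.gn u a z * MinkMCF.gB u b j z)
      * dir (eb a) (dir (eb b) (MinkMCF.gn u i)) z
      = 2 * ∑ a, MinkMCF.gB u a j z * ∑ k, MinkMCF.gn u k z * sd k (MinkMCF.gB u i a) z := by
    simp only [add_mul, Finset.sum_add_distrib, two_mul]
    congr 1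
    · refine Finset.sum_congr rfl fun a _ => ?_
      rw [Finset.mul_sum]
      refine Finset.sum_congr rfl fun b _ => ?_
      rw [dir_comm (hA.gn i), hgB i a]; ring
    · rw [Finset.sum_comm]
      refine Finset.sum_congr rfl fun a _ => ?_
      rw [Finset.mul_sum]
      refine Finset.sum_congr rfl fun b _ => ?_
      rw [hgB i a]; ring
  rw [h4, hgB i j]
  simp only [MinkMCF.gB]; ring

/-- Simons' inequality `(∂ₜ - Δ)|A|² ≤ -2|A|⁴`. -/
theorem FlowGraph.box_gA_le (h : FlowGraph u z) :
    box (fun i => MinkMCF.gn u i z) (MinkMCF.gA u) z ≤ -2 * MinkMCF.gA u z ^ 2 := by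
  have hA := h.1
  set N : Fin n → ℝ := fun i => MinkMCF.gn u i z with hN
  set w := MinkMCF.gw u z with hw
  set p : Fin n → ℝ := fun i => sd i u z with hp
  set H : Matrix (Fin n) (Fin n) ℝ := fun i j => sd i (sd j u) z with hH
  set y : Fin n → ℝ := fun i => gy u i z with hy
  set U : Fin n → Fin n → Fin n → ℝ := fun k i j => sd k (sd i (sd j u)) z with hU
  set B : Matrix (Fin n) (Fin n) ℝ := fun i j => MinkMCF.gB u i j z with hB
  set C : Fin n → Matrix (Fin n) (Fin n) ℝ := fun k i j => sd k (MinkMCF.gB u i j) z with hC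
  have hHs : ∀ i j, H i j = H j i := fun i j => hess_symm hA.1 i j
  have hUs : ∀ k i j, U k i j = U i k j ∧ U k i j = U k j i := by
    intro k i j
    refine ⟨dir_comm (hA.1.dir _) _ _, dir_congr' ?_ _⟩
    filter_upwards [hA.1.eventually] with x hx using hess_symm hx i j
  have hyk : ∀ k, y k = ∑ l, p l * H k l := fun k => rfl
  have hNk : ∀ k, N k = w * p k := fun k => rfl
  have hBe : ∀ i j, B i j = w ^ 3 * y j * p i + w * H j i := fun i j => hA.gB_eq i j
  -- the derivative of the Weingarten map in terms of third derivatives of `u`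
  have hsy : ∀ j, SmoothNear (gy u j) z := fun j =>
    SmoothNear.sum fun l _ => (hA.1.dir _).mul ((hA.1.dir _).dir _)
  have hdy : ∀ k j, sd k (gy u j) z = ∑ l, (H k l * H j l + p l * U k j l) := by
    intro k j
    have : sd k (gy u j) z = ∑ l, sd k (fun x => sd l u x * sd j (sd l u) x) z :=
      dir_sum (fun l _ => (hA.1.dir _).mul ((hA.1.dir _).dir _)) _
    rw [this]
    exact Finset.sum_congr rfl fun l _ => dir_mul (hA.1.dir _) ((hA.1.dir _).dir _) _
  have hCe : ∀ k i j, C k i j = 3 * w ^ 5 * y k * y j * p i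
      + w ^ 3 * (∑ l, (H k l * H j l + p l * U k j l)) * p i
      + w ^ 3 * y j * H k i + w ^ 3 * y k * H j i + w * U k j i := by
    intro k i j
    have e : MinkMCF.gB u i j =ᶠ[𝓝 z] fun x => MinkMCF.gw u x * MinkMCF.gw u x * MinkMCF.gw u x
        * gy u j x * sd i u x + MinkMCF.gw u x * sd j (sd i u) x := by
      filter_upwards [hA.eventually] with x hx
      rw [hx.gB_eq]; ring
    have hdw : dir (eb k) (MinkMCF.gw u) z = w ^ 3 * y k := hA.sd_gw k
    have hdy' : dir (eb k) (gy u j) z = _ := hdy k j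
    have s2 := hA.gw.mul hA.gw
    have s3 := s2.mul hA.gw
    have s4 := s3.mul (hsy j)
    have : C k i j = _ := dir_congr' e (eb k)
    rw [this, dir_add (s4.mul (hA.1.dir _)) (hA.gw.mul ((hA.1.dir _).dir _)),
      dir_mul s4 (hA.1.dir _), dir_mul s3 (hsy j), dir_mul s2 hA.gw, dir_mul hA.gw hA.gw,
      dir_mul hA.gw ((hA.1.dir _).dir _), hdw, hdy']
    have c1 : dir (eb k) (dir (eb i) u) z = H k i := rfl
    have c2 : dir (eb k) (dir (eb j) (dir (eb i) u)) z = U k j i := rfl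
    have c3 : dir (eb j) (dir (eb i) u) z = H j i := rfl
    have c4 : gy u j z = y j := rfl
    have c5 : dir (eb i) u z = p i := rfl
    rw [c1, c2, c3, c4, c5, ← hw]
    ring
  -- the totally symmetric tensor `S = ∇A`
  set S : Fin n → Matrix (Fin n) (Fin n) ℝ := fun k i j =>
    w * U k i j + w ^ 3 * (y k * H i j + y i * H k j + y j * H k i) with hS
  set σ : Matrix (Fin n) (Fin n) ℝ := fun k j => (Matrix.mulVec (S k) N) j with hσ
  set hM : Matrix (Fin n) (Fin n) ℝ := w • H with hhM
  set c : Fin n → ℝ := Matrix.mulVec hM N with hc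
  set γ : ℝ := c ⬝ᵥ N with hγ
  set py : ℝ := gpy u z with hpy
  have hpye : py = ∑ k, p k * y k := rfl
  have hce : ∀ i, c i = w ^ 2 * y i := by
    intro i
    simp only [hc, Matrix.mulVec, dotProduct, hhM, Matrix.smul_apply, smul_eq_mul, hNk, hyk,
      Finset.mul_sum]
    exact Finset.sum_congr rfl fun l _ => by ring
  have hγe : γ = w ^ 3 * py := by
    simp only [hγ, dotProduct, hce, hNk, hpye, Finset.mul_sum]
    exact Finset.sum_congr rfl fun l _ => by ring
  have hσe : ∀ k j, σ k j = w ^ 2 * (∑ l, p l * U k j l)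
      + w ^ 4 * (2 * (y k * y j) + py * H k j) := by
    intro k j
    have a1 : y j = ∑ l, p l * H j l := hyk j
    have a2 : y k = ∑ l, p l * H k l := hyk k
    have : σ k j = w ^ 2 * (∑ l, p l * U k j l)
        + w ^ 4 * (y k * (∑ l, p l * H j l) + y j * (∑ l, p l * H k l) + (∑ l, p l * y l) * H k j) := by
      simp only [hσ, Matrix.mulVec, dotProduct, hS, hNk, Finset.mul_sum, Finset.sum_mul,
        ← Finset.sum_add_distrib]
      exact Finset.sum_congr rfl fun l _ => by ring
    rw [this, ← a1, ← a2, ← hpye]; ring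
  have hX : ∀ k j, (σ + hM * hM + Matrix.vecMulVec c c - γ • hM) k j
      = σ k j + w ^ 2 * (∑ l, H k l * H j l) + w ^ 4 * (y k * y j) - w ^ 4 * py * H k j := by
    intro k j
    have : (hM * hM) k j = w ^ 2 * ∑ l, H k l * H j l := by
      simp only [Matrix.mul_apply, hhM, Matrix.smul_apply, smul_eq_mul, Finset.mul_sum]
      exact Finset.sum_congr rfl fun l _ => by rw [hHs l j]; ring
    have hMkj : hM k j = w * H k j := rfl
    simp only [Matrix.add_apply, Matrix.sub_apply, Matrix.smul_apply, Matrix.vecMulVec_apply, this,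
      hce, hγe, smul_eq_mul, hMkj]
    ring
  have hBm : B = hM + Matrix.vecMulVec N c := by
    ext i j
    simp only [Matrix.add_apply, Matrix.vecMulVec_apply, hhM, Matrix.smul_apply, smul_eq_mul, hce,
      hNk]
    rw [hBe, hHs j i]; ring
  have hCm : ∀ k i j, C k i j
      = S k i j + N i * (σ + hM * hM + Matrix.vecMulVec c c - γ • hM) k j - c i * hM k j := by
    intro k i j
    rw [hX, hσe, hCe, hNk, hce]
    simp only [hS, hhM, Matrix.smul_apply, smul_eq_mul, Finset.sum_add_distrib]
    rw [(hUs k i j).2, hHs i j]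
    ring
  have key := simons_quadratic_nonneg N c hM (by
      ext i j; simp only [Matrix.transpose_apply, hhM, Matrix.smul_apply]; rw [hHs]) S (by
      intro k i j
      simp only [hS]
      rw [(hUs k i j).1, hHs k i, (hUs k i j).1.symm, (hUs k i j).2, hHs i j]
      refine ⟨?_, ?_⟩
      · rw [← (hUs k i j).2, (hUs k i j).1, hHs j i]; ring
      · ring) σ _ B γ rfl rfl (fun k j => rfl) rfl hBm C hCm
  -- assemble the evolution of `tr B²`
  have hsB := hA.gB
  have hbox : box N (MinkMCF.gA u) z = ∑ i, ∑ j, (B i j * box N (MinkMCF.gB u j i) z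
      + B j i * box N (MinkMCF.gB u i j) z - 2 * gam N (MinkMCF.gB u i j) (MinkMCF.gB u j i) z) := by
    have : box N (MinkMCF.gA u) z
        = ∑ i, ∑ j, box N (fun x => MinkMCF.gB u i j x * MinkMCF.gB u j i x) z := by
      have e1 := box_sum (N := N) (z := z) (s := Finset.univ)
        (F := fun i x => ∑ j, MinkMCF.gB u i j x * MinkMCF.gB u j i x)
        (fun i _ => SmoothNear.sum fun j _ => (hsB i j).mul (hsB j i))
      refine (show box N (MinkMCF.gA u) z = _ from e1).trans ?_
      exact Finset.sum_congr rfl fun i _ => box_sum fun j _ => (hsB i j).mul (hsB j i)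
    rw [this]
    exact Finset.sum_congr rfl fun i _ => Finset.sum_congr rfl fun j _ => box_mul (hsB i j) (hsB j i)
  have hbox2 : box N (MinkMCF.gA u) z = 2 * (∑ i, ∑ j, B j i * box N (MinkMCF.gB u i j) z)
      - 2 * ∑ i, ∑ j, gam N (MinkMCF.gB u i j) (MinkMCF.gB u j i) z := by
    rw [hbox]
    simp only [Finset.sum_sub_distrib, Finset.sum_add_distrib, ← Finset.mul_sum]
    rw [Finset.sum_comm (f := fun i j => B i j * box N (MinkMCF.gB u j i) z)]; ring
  have hgam : ∑ i, ∑ j, gam N (MinkMCF.gB u i j) (MinkMCF.gB u j i) z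
      = (∑ k, ∑ i, ∑ j, C k i j * C k j i)
        + ∑ i, ∑ j, (∑ k, N k * C k i j) * (∑ k, N k * C k j i) := by
    have : (∑ k, ∑ i, ∑ j, C k i j * C k j i) = ∑ i, ∑ j, ∑ k, C k i j * C k j i := by
      rw [Finset.sum_comm]
      exact Finset.sum_congr rfl fun i _ => Finset.sum_comm
    rw [this]
    simp only [← Finset.sum_add_distrib]
    rfl
  have hdA : ∀ j, sd j (MinkMCF.gA u) z = 2 * ∑ a, ∑ b, B b a * C j a b := by
    intro j
    have : sd j (MinkMCF.gA u) z = ∑ a, ∑ b, (C j a b * B b a + B a b * C j b a) := by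
      have e1 : sd j (MinkMCF.gA u) z
          = ∑ a, sd j (fun x => ∑ b, MinkMCF.gB u a b x * MinkMCF.gB u b a x) z :=
        dir_sum (fun a _ => SmoothNear.sum fun b _ => (hsB a b).mul (hsB b a)) _
      rw [e1]
      refine Finset.sum_congr rfl fun a _ => ?_
      have e2 : sd j (fun x => ∑ b, MinkMCF.gB u a b x * MinkMCF.gB u b a x) z
          = ∑ b, sd j (fun x => MinkMCF.gB u a b x * MinkMCF.gB u b a x) z :=
        dir_sum (fun b _ => (hsB a b).mul (hsB b a)) _
      rw [e2]
      exact Finset.sum_congr rfl fun b _ => dir_mul (hsB a b) (hsB b a) _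
    rw [this]
    simp only [Finset.sum_add_distrib, two_mul]
    congr 1
    · exact Finset.sum_congr rfl fun a _ => Finset.sum_congr rfl fun b _ => mul_comm _ _
    · rw [Finset.sum_comm]
  have hmain : ∑ i, ∑ j, B j i * box N (MinkMCF.gB u i j) z
      = 2 * (∑ i, ∑ j, (B * B) j i * ∑ k, N k * C k i j)
        - 2 * (∑ k, (Matrix.mulVec B N) k * ∑ a, ∑ b, B b a * C k a b)
        - MinkMCF.gA u z * MinkMCF.gA u z := by
    have t1 : ∑ i, ∑ j, B j i * (2 * ∑ a, B a j * ∑ k, N k * C k i a)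
        = 2 * ∑ i, ∑ j, (B * B) j i * ∑ k, N k * C k i j := by
      rw [Finset.mul_sum]
      refine Finset.sum_congr rfl fun i _ => ?_
      simp only [Matrix.mul_apply, Finset.sum_mul, Finset.mul_sum]
      rw [Finset.sum_comm]
      refine Finset.sum_congr rfl fun a _ => ?_
      rw [Finset.sum_comm]
      exact Finset.sum_congr rfl fun b _ => Finset.sum_congr rfl fun k _ => by ring
    have t2 : ∑ i, ∑ j, B j i * (N i * sd j (MinkMCF.gA u) z)
        = 2 * ∑ k, (Matrix.mulVec B N) k * ∑ a, ∑ b, B b a * C k a b := by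
      rw [Finset.sum_comm, Finset.mul_sum]
      refine Finset.sum_congr rfl fun j _ => ?_
      rw [hdA]
      generalize ∑ a, ∑ b, B b a * C j a b = Q
      simp only [Matrix.mulVec, dotProduct]
      rw [Finset.sum_mul, Finset.mul_sum]
      exact Finset.sum_congr rfl fun i _ => by ring
    have t3 : ∑ i, ∑ j, B j i * (MinkMCF.gA u z * B i j) = MinkMCF.gA u z * MinkMCF.gA u z := by
      nth_rewrite 3 [MinkMCF.gA]
      simp only [Finset.mul_sum]
      exact Finset.sum_congr rfl fun a _ => Finset.sum_congr rfl fun b _ => by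
        simp only [hB]; ring
    rw [← t1, ← t2, ← t3]
    simp only [← Finset.sum_sub_distrib]
    refine Finset.sum_congr rfl fun i _ => Finset.sum_congr rfl fun j _ => ?_
    rw [h.box_gB i j]; ring
  rw [hbox2, hgam, hmain]
  linarith

/-- The `i`-th spatial coordinate. -/
def xc (i : Fin n) (y : ST n) : ℝ := y.1 i

theorem smoothNear_xc (i : Fin n) (z : ST n) : SmoothNear (xc i) z :=
  ContDiff.smoothNear (((EuclideanSpace.proj i : Euc n →L[ℝ] ℝ).comp
    (ContinuousLinearMap.fst ℝ (Euc n) ℝ)).contDiff) z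

theorem dir_xc (v : ST n) (i : Fin n) (z : ST n) : dir v (xc i) z = v.1 i := by
  have : HasFDerivAt (xc i) ((EuclideanSpace.proj i : Euc n →L[ℝ] ℝ).comp
    (ContinuousLinearMap.fst ℝ (Euc n) ℝ)) z :=
    HasFDerivAt.congr_of_eventuallyEq (ContinuousLinearMap.hasFDerivAt _)
      (Eventually.of_forall fun _ => rfl)
  rw [dir, this.fderiv]; rfl

theorem sd_xc (i j : Fin n) (z : ST n) : sd j (xc i) z = if i = j then 1 else 0 := by
  rw [sd, dir_xc]; simp [eb, Pi.single_apply]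

theorem box_xc (N : Fin n → ℝ) (i : Fin n) (z : ST n) : box N (xc i) z = 0 := by
  have : ∀ v : ST n, dir v (xc i) = fun _ => v.1 i := fun v => funext fun y => dir_xc v i y
  unfold box
  simp only [this, dir_const]
  simp [et]

theorem gam_xc (N : Fin n → ℝ) (i : Fin n) (f : ST n → ℝ) (z : ST n) :
    gam N (xc i) f z = sd i f z + N i * ∑ j, N j * sd j f z := by
  simp [gam, sd_xc]

theorem Adm.sum_gn_sq (h : Adm eb u z) :
    ∑ i, MinkMCF.gn u i z * MinkMCF.gn u i z = MinkMCF.gw u z ^ 2 - 1 := by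
  have e : ∑ i, MinkMCF.gn u i z * MinkMCF.gn u i z
      = MinkMCF.gw u z ^ 2 * ∑ i, sd i u z * sd i u z := by
    rw [Finset.mul_sum]; exact Finset.sum_congr rfl fun i _ => by rw [gn_eq]; ring
  have := h.gw_sq_mul
  rw [e]; linarith

/-- The function `-⟨F, F⟩` on the graph `F = (x, u)`. -/
def gF (u : ST n → ℝ) (y : ST n) : ℝ := u y * u y - ∑ i, xc i y * xc i y

theorem smoothNear_gF (h : SmoothNear u z) : SmoothNear (gF u) z :=
  (h.mul h).sub (SmoothNear.sum fun i _ => (smoothNear_xc i z).mul (smoothNear_xc i z))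

/-- `box F² = 2n`. -/
theorem FlowGraph.box_gF (h : FlowGraph u z) :
    box (fun i => MinkMCF.gn u i z) (MinkMCF.gF u) z = 2 * n := by
  have hA := h.1
  set N : Fin n → ℝ := fun i => MinkMCF.gn u i z with hN
  have hx : ∀ i ∈ Finset.univ, SmoothNear (fun y : ST n => xc i y * xc i y) z :=
    fun i _ => (smoothNear_xc i z).mul (smoothNear_xc i z)
  have h1 : box N (MinkMCF.gF u) z = box N (fun y => u y * u y) z
      - ∑ i, box N (fun y : ST n => xc i y * xc i y) z := by
    rw [← box_sum hx]; exact box_sub (hA.1.mul hA.1) (SmoothNear.sum hx)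
  have h2 : ∀ i, box N (fun y : ST n => xc i y * xc i y) z = -2 * (1 + N i * N i) := by
    intro i
    rw [box_mul (smoothNear_xc i z) (smoothNear_xc i z), box_xc, gam_xc]
    simp [sd_xc]
  have h3 : gam N u u z = ∑ i, N i * N i := by
    rw [hA.sum_gn_sq, hA.gam_formula]
    have := hA.gw_sq_mul
    set q := ∑ i, sd i u z * sd i u z
    set w := MinkMCF.gw u z
    linear_combination (-q - 1 / w ^ 2 * 0 - 1 ) * this + (0 : ℝ) * (w * q)
  rw [h1, box_mul hA.1 hA.1, h.box_self, h3]
  simp only [h2, ← Finset.mul_sum, Finset.sum_add_distrib]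
  simp; ring

/-- The function `-⟨F, e⟩` on the graph `F = (x, u)`. -/
def gE (e : Mink n) (u : ST n → ℝ) (y : ST n) : ℝ := e.2 * u y - ∑ i, e.1 i * xc i y

theorem smoothNear_gE (e : Mink n) (h : SmoothNear u z) : SmoothNear (gE e u) z :=
  (h.const_mul _).sub (SmoothNear.sum fun i _ => (smoothNear_xc i z).const_mul _)

/-- The coordinate functions satisfy the heat equation. -/
theorem FlowGraph.box_gE (h : FlowGraph u z) (e : Mink n) :
    box (fun i => MinkMCF.gn u i z) (MinkMCF.gE e u) z = 0 := by
  have hx : ∀ i ∈ Finset.univ, SmoothNear (fun y : ST n => e.1 i * xc i y) z :=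
    fun i _ => (smoothNear_xc i z).const_mul _
  have h1 : box (fun i => MinkMCF.gn u i z) (MinkMCF.gE e u) z
      = box (fun i => MinkMCF.gn u i z) (fun y => e.2 * u y) z
      - ∑ i, box (fun i => MinkMCF.gn u i z) (fun y : ST n => e.1 i * xc i y) z := by
    rw [← box_sum hx]; exact box_sub (h.1.1.const_mul _) (SmoothNear.sum hx)
  rw [h1, box_const_mul _ h.1.1, h.box_self]
  simp [box_const_mul _ (smoothNear_xc _ z), box_xc]

theorem Adm.sd_gE (h : Adm eb u z) (e : Mink n) (i : Fin n) :
    sd i (MinkMCF.gE e u) z = e.2 * sd i u z - e.1 i := by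
  have hx : ∀ j ∈ Finset.univ, SmoothNear (fun y : ST n => e.1 j * xc j y) z :=
    fun j _ => (smoothNear_xc j z).const_mul _
  have h1 : sd i (MinkMCF.gE e u) z = dir (eb i) (fun y => e.2 * u y) z
      - ∑ j, dir (eb i) (fun y : ST n => e.1 j * xc j y) z := by
    rw [← dir_sum hx]; exact dir_sub (h.1.const_mul _) (SmoothNear.sum hx) _
  rw [h1, dir_const_mul _ h.1]
  have h2 : ∀ j, dir (eb i) (fun y : ST n => e.1 j * xc j y) z = e.1 j * if j = i then 1 else 0 := by
    intro j; rw [dir_const_mul _ (smoothNear_xc j z)]; rw [← sd_xc j i z]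
  simp [h2]

theorem Adm.sd_gF (h : Adm eb u z) (i : Fin n) :
    sd i (MinkMCF.gF u) z = 2 * (u z * sd i u z) - 2 * z.1 i := by
  have hx : ∀ j ∈ Finset.univ, SmoothNear (fun y : ST n => xc j y * xc j y) z :=
    fun j _ => (smoothNear_xc j z).mul (smoothNear_xc j z)
  have h1 : sd i (MinkMCF.gF u) z = dir (eb i) (fun y => u y * u y) z
      - ∑ j, dir (eb i) (fun y : ST n => xc j y * xc j y) z := by
    rw [← dir_sum hx]; exact dir_sub (h.1.mul h.1) (SmoothNear.sum hx) _
  rw [h1, dir_mul h.1 h.1]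
  have h2 : ∀ j, dir (eb i) (fun y : ST n => xc j y * xc j y) z
      = 2 * (z.1 j * if j = i then 1 else 0) := by
    intro j
    rw [dir_mul (smoothNear_xc j z) (smoothNear_xc j z), ← sd_xc j i z]
    simp only [xc, sd]; ring
  simp [h2]; ring

/-- The support function `-⟨F, ν⟩` of the graph `F = (x, u)`. -/
def gS (u : ST n → ℝ) (y : ST n) : ℝ := u y * gw u y - ∑ i, xc i y * gn u i y

theorem Adm.gS (h : Adm eb u z) : SmoothNear (gS u) z :=
  (h.1.mul h.gw).sub (SmoothNear.sum fun i _ => (smoothNear_xc i z).mul (h.gn i))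

/-- The evolution of the support function. -/
theorem FlowGraph.box_gS (h : FlowGraph u z) :
    box (fun i => MinkMCF.gn u i z) (MinkMCF.gS u) z
      = -MinkMCF.gA u z * MinkMCF.gS u z + 2 * ∑ i, MinkMCF.gB u i i z := by
  have hA := h.1
  set N : Fin n → ℝ := fun i => MinkMCF.gn u i z with hN
  have hx : ∀ i ∈ Finset.univ, SmoothNear (fun y : ST n => xc i y * MinkMCF.gn u i y) z :=
    fun i _ => (smoothNear_xc i z).mul (hA.gn i)
  have h1 : box N (MinkMCF.gS u) z = box N (fun y => u y * MinkMCF.gw u y) z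
      - ∑ i, box N (fun y : ST n => xc i y * MinkMCF.gn u i y) z := by
    rw [← box_sum hx]; exact box_sub (hA.1.mul hA.gw) (SmoothNear.sum hx)
  have h2 : ∀ i, box N (fun y : ST n => xc i y * MinkMCF.gn u i y) z
      = -MinkMCF.gA u z * (xc i z * MinkMCF.gn u i z)
        - 2 * (MinkMCF.gB u i i z + N i * ∑ j, N j * MinkMCF.gB u i j z) := by
    intro i
    rw [box_mul (smoothNear_xc i z) (hA.gn i), box_xc, gam_xc, h.box_gn]
    simp only [MinkMCF.gB]; ring
  have h3 : gam N u (MinkMCF.gw u) z = ∑ i, N i * ∑ j, N j * MinkMCF.gB u i j z := by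
    rw [hA.gam_formula]
    simp only [hA.sd_gw, hA.gB_eq]
    set w := MinkMCF.gw u z with hw
    have a1 : ∑ i, sd i u z * (w ^ 3 * gy u i z) = w ^ 3 * gpy u z := by
      rw [gpy, Finset.mul_sum]; exact Finset.sum_congr rfl fun i _ => by ring
    have a2 : ∀ i, N i * ∑ j, N j * (w ^ 3 * gy u j z * sd i u z + w * sd j (sd i u) z)
        = w ^ 5 * gpy u z * (sd i u z * sd i u z) + w ^ 3 * (sd i u z * gy u i z) := by
      intro i
      have b1 : ∑ j, N j * (w ^ 3 * gy u j z * sd i u z + w * sd j (sd i u) z)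
          = w ^ 4 * gpy u z * sd i u z + w ^ 2 * gy u i z := by
        rw [gpy, gy, Finset.mul_sum, Finset.mul_sum, Finset.sum_mul, ← Finset.sum_add_distrib]
        refine Finset.sum_congr rfl fun j _ => ?_
        have : N j = w * sd j u z := rfl
        rw [this, hess_symm hA.1 j i]; ring
      have : N i = w * sd i u z := rfl
      rw [b1, this]; ring
    simp only [a1, a2, Finset.sum_add_distrib, ← Finset.mul_sum]
    have := hA.gw_sq_mul
    rw [← gpy]
    ring
  rw [h1, box_mul hA.1 hA.gw, h.box_self, h.box_gw, h3]
  simp only [h2, Finset.sum_sub_distrib, Finset.sum_add_distrib, ← Finset.mul_sum]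
  rw [MinkMCF.gS]; ring

theorem Adm.sq_trace_le (h : Adm eb u z) :
    (∑ i, MinkMCF.gB u i i z) ^ 2 ≤ (2 * n + 2) * MinkMCF.gA u z := by
  set w := MinkMCF.gw u z with hw
  have e : ∑ i, MinkMCF.gB u i i z = w ^ 3 * gpy u z + w * ∑ i, sd i (sd i u) z := by
    simp only [h.gB_eq, Finset.sum_add_distrib, gpy, Finset.mul_sum]
    congr 1
    exact Finset.sum_congr rfl fun i _ => by ring
  have h1 : (∑ i, sd i (sd i u) z) ^ 2 ≤ n * ghh u z := by
    have := sq_sum_le_card_mul_sum_sq (s := Finset.univ) (f := fun i : Fin n => sd i (sd i u) z)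
    refine this.trans ?_
    simp only [Finset.card_univ, Fintype.card_fin]
    refine mul_le_mul_of_nonneg_left (Finset.sum_le_sum fun i _ => ?_) (by positivity)
    rw [sq]
    exact Finset.single_le_sum (f := fun k => sd i (sd k u) z * sd i (sd k u) z)
      (fun k _ => mul_self_nonneg _) (Finset.mem_univ i)
  have h2 : 0 ≤ ghh u z := Finset.sum_nonneg fun i _ => Finset.sum_nonneg fun j _ =>
    mul_self_nonneg _
  have h3 : 0 ≤ gyy u z := Finset.sum_nonneg fun i _ => mul_self_nonneg _
  have hA := h.gA_eq
  rw [← hw] at hA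
  have h5 : 0 ≤ w ^ 4 * gyy u z := by positivity
  have h6 : 0 ≤ w ^ 6 * gpy u z ^ 2 := by positivity
  have h7 : 0 ≤ w ^ 2 * ghh u z := by positivity
  have h8 : w ^ 2 * (∑ i, sd i (sd i u) z) ^ 2 ≤ n * (w ^ 2 * ghh u z) := by
    have := mul_le_mul_of_nonneg_left h1 (sq_nonneg w); linarith
  rw [e, hA]
  have h9 : (w ^ 3 * gpy u z + w * ∑ i, sd i (sd i u) z) ^ 2
      ≤ 2 * (w ^ 6 * gpy u z ^ 2) + 2 * (w ^ 2 * (∑ i, sd i (sd i u) z) ^ 2) := by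
    nlinarith [sq_nonneg (w ^ 3 * gpy u z - w * ∑ i, sd i (sd i u) z)]
  have hn : (0 : ℝ) ≤ n := Nat.cast_nonneg n
  nlinarith [mul_nonneg hn h5, mul_nonneg hn h6, mul_nonneg hn h7]

/-- The square of the support function grows at most linearly: the reaction term `-|A|²` absorbs the
trace of the Weingarten map. -/
theorem FlowGraph.box_gS_sq_le (h : FlowGraph u z) :
    box (fun i => MinkMCF.gn u i z) (fun y => MinkMCF.gS u y * MinkMCF.gS u y) z ≤ 4 * n + 4 := by
  have h1 := h.1.sq_trace_le
  have h2 := gam_self_nonneg (N := fun i => MinkMCF.gn u i z) (f := MinkMCF.gS u) (z := z)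
  rw [box_mul h.1.gS h.1.gS, h.box_gS]
  set s := MinkMCF.gS u z
  set t := ∑ i, MinkMCF.gB u i i z
  have hn : (0 : ℝ) < 2 * n + 2 := by positivity
  -- `4 s t ≤ 2 s² t² / (2n+2) + 2 (2n+2)`
  have h3 : s ^ 2 * (t ^ 2) ≤ s ^ 2 * ((2 * n + 2) * MinkMCF.gA u z) :=
    mul_le_mul_of_nonneg_left h1 (sq_nonneg s)
  have h4 : 0 ≤ (s * t - (2 * n + 2)) ^ 2 := sq_nonneg _
  have h5 : (2 * n + 2) * (2 * s * t - s ^ 2 * MinkMCF.gA u z - (2 * n + 2)) ≤ 0 := by nlinarith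
  have h6 : 2 * s * t - s ^ 2 * MinkMCF.gA u z - (2 * n + 2) ≤ 0 := by
    by_contra! hlt
    nlinarith [mul_pos hn hlt]
  nlinarith

theorem Adm.gam_self_le (h : Adm eb u z) (f : ST n → ℝ) :
    gam (fun i => MinkMCF.gn u i z) f f z ≤ MinkMCF.gw u z ^ 2 * ∑ i, sd i f z ^ 2 := by
  have h1 := gam_le (N := fun i => MinkMCF.gn u i z) (f := f) (z := z)
  have h2 := h.sum_gn_sq
  have : (1 + ∑ i, MinkMCF.gn u i z ^ 2) = MinkMCF.gw u z ^ 2 := by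
    simp only [sq] at h2 ⊢; linarith
  rwa [this] at h1

end Graph


/-! ### Interior estimates at the maximum of a localised quantity -/

section Bernstein

variable {n : ℕ} {u : ST n → ℝ} {z : ST n}

/-- The scale `R + 2nt`, comparable with `-⟨F, F⟩` along the flow. -/
def th (R : ℝ) (y : ST n) : ℝ := R + 2 * n * y.2

theorem smoothNear_th (R : ℝ) (z : ST n) : SmoothNear (th R) z := by
  apply ContDiff.smoothNear
  unfold th
  fun_prop

theorem dir_th (R : ℝ) (v z : ST n) : dir v (th R) z = 2 * n * v.2 := by
  have : HasFDerivAt (th R : ST n → ℝ) ((2 * n : ℝ) • ContinuousLinearMap.snd ℝ (Euc n) ℝ) z := by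
    have h := ((ContinuousLinearMap.snd ℝ (Euc n) ℝ).hasFDerivAt (x := z)).const_mul (2 * n : ℝ)
    exact h.const_add R
  rw [dir, this.fderiv]; simp

theorem dir_th_pow (R : ℝ) (v z : ST n) (j : ℕ) :
    dir v (fun y => th R y ^ j) z = j * th R z ^ (j - 1) * (2 * n * v.2) := by
  have h : HasFDerivAt (th R : ST n → ℝ) (fderiv ℝ (th R) z) z :=
    (smoothNear_th R z).differentiableAt.hasFDerivAt
  have := h.pow j
  rw [dir, this.fderiv]
  have e := dir_th R v z
  unfold dir at e
  simp [e]

theorem sd_th_pow (R : ℝ) (i : Fin n) (j : ℕ) : sd i (fun y => th R y ^ j) = fun _ => 0 := by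
  funext z; rw [sd, dir_th_pow]; simp [eb]

theorem gam_th_pow (N : Fin n → ℝ) (R : ℝ) (j : ℕ) (f : ST n → ℝ) (z : ST n) :
    gam N (fun y => th R y ^ j) f z = 0 := by
  simp [gam, sd_th_pow]

theorem box_th_pow (N : Fin n → ℝ) (R : ℝ) (j : ℕ) (z : ST n) :
    box N (fun y => th R y ^ j) z = 2 * n * j * th R z ^ (j - 1) := by
  unfold box
  simp only [sd_th_pow, dir_th_pow, dir_const]
  simp [et]; ring

theorem box_th_pow_mul (N : Fin n → ℝ) (R : ℝ) (j : ℕ) {f : ST n → ℝ} (hf : SmoothNear f z) :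
    box N (fun y => th R y ^ j * f y) z
      = th R z ^ j * box N f z + 2 * n * j * th R z ^ (j - 1) * f z := by
  rw [box_mul ((smoothNear_th R z).pow j) hf, gam_th_pow, box_th_pow]; ring

/-- A maximum over the past of `φ² P / θ²`, where `φ` has the size and the derivatives of a squared
distance at scale `θ` and `box P ≤ (K - δP²)/θ`, is bounded in terms of the constants. -/
theorem exists_cutoff_bound {K δ B : ℝ} (hK : 0 ≤ K) (hδ : 0 < δ) (hB : 0 ≤ B) :
    ∃ C : ℝ, 0 ≤ C ∧ ∀ (N : Fin n → ℝ) (R : ℝ) (φ P : ST n → ℝ) (z : ST n), 0 < th R z →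
      SmoothNear φ z → SmoothNear P z → 0 < φ z → 0 ≤ P z →
      φ z ≤ B * th R z → box N φ z ≤ B → gam N φ φ z ≤ B * th R z →
      th R z * box N P z ≤ K - δ * P z ^ 2 →
      (∀ᶠ y in 𝓝 z, y.2 ≤ z.2 → φ y ^ 2 * P y * th R z ^ 2 ≤ φ z ^ 2 * P z * th R y ^ 2) →
      φ z ^ 2 * P z ≤ C * th R z ^ 2 := by
  set a := 2 * B * B + 6 * B with ha
  have ha0 : 0 ≤ a := by positivity
  refine ⟨(K * B ^ 4 + 1) / δ + a / δ + 1, by positivity,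
    fun N R φ P z hθ hφ hP hφ0 hP0 h1 h2 h3 h4 hmax => ?_⟩
  set θ := th R z with hθd
  -- the maximum is one of `φ² P - ψ θ²`, which avoids differentiating a quotient
  set ψ := φ z ^ 2 * P z / θ ^ 2 with hψ
  have hψ0 : 0 ≤ ψ := by positivity
  have hφ2 : SmoothNear (fun y => φ y * φ y) z := hφ.mul hφ
  have hφP : SmoothNear (fun y => (φ y * φ y) * P y) z := hφ2.mul hP
  have hθ2 : SmoothNear (fun y => ψ * th R y ^ 2) z := ((smoothNear_th R z).pow 2).const_mul ψ
  obtain ⟨g1, g2⟩ := box_nonneg_of_max (N := N) (hφP.sub hθ2) (by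
    filter_upwards [hmax] with y hy hyz
    have := hy hyz
    have e : ψ * th R z ^ 2 = φ z ^ 2 * P z := by rw [hψ, ← hθd]; field_simp
    have e2 : φ y ^ 2 * P y ≤ ψ * th R y ^ 2 := by
      rw [hψ, div_mul_eq_mul_div, le_div_iff₀ (by positivity)]; exact this
    rw [e]; nlinarith)
  have hgrad : ∀ i, φ z * sd i P z = -2 * P z * sd i φ z := by
    intro i
    have e := g1 i
    have e1 : sd i (fun y => φ y * φ y * P y - ψ * th R y ^ 2) z
        = sd i (fun y => φ y * φ y * P y) z - sd i (fun y => ψ * th R y ^ 2) z := dir_sub hφP hθ2 _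
    have e2 : sd i (fun y => ψ * th R y ^ 2) z = 0 := by
      have : sd i (fun y => ψ * th R y ^ 2) z = ψ * sd i (fun y => th R y ^ 2) z :=
        dir_const_mul ψ ((smoothNear_th R z).pow 2) _
      rw [this, sd_th_pow]; simp
    have e3 : sd i (fun y => φ y * φ y * P y) z
        = (sd i φ z * φ z + φ z * sd i φ z) * P z + φ z * φ z * sd i P z := by
      have : sd i (fun y => φ y * φ y * P y) z
        = sd i (fun y => φ y * φ y) z * P z + φ z * φ z * sd i P z := dir_mul hφ2 hP _
      rw [this]; congr 2; exact dir_mul hφ hφ _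
    rw [e1, e2, e3] at e
    apply mul_left_cancel₀ hφ0.ne'
    linarith
  have hgam : φ z * gam N φ P z = -2 * P z * gam N φ φ z := by
    unfold gam
    have a1 : φ z * ∑ i, sd i φ z * sd i P z = -2 * P z * ∑ i, sd i φ z * sd i φ z := by
      rw [Finset.mul_sum, Finset.mul_sum]
      exact Finset.sum_congr rfl fun i _ => by linear_combination sd i φ z * hgrad i
    have a2 : φ z * ∑ i, N i * sd i P z = -2 * P z * ∑ i, N i * sd i φ z := by
      rw [Finset.mul_sum, Finset.mul_sum]
      exact Finset.sum_congr rfl fun i _ => by linear_combination N i * hgrad i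
    linear_combination a1 + (∑ i, N i * sd i φ z) * a2
  have hbox : box N (fun y => φ y * φ y * P y - ψ * th R y ^ 2) z
      = φ z ^ 2 * box N P z + P z * (2 * φ z * box N φ z + 6 * gam N φ φ z)
        - ψ * (2 * n * 2 * θ) := by
    rw [box_sub hφP hθ2, box_const_mul ψ ((smoothNear_th R z).pow 2), box_th_pow, box_mul hφ2 hP,
      box_mul hφ hφ, gam_mul_left hφ hφ]
    simp only [Nat.add_one_sub_one, pow_one, Nat.cast_ofNat]
    linear_combination (-4 : ℝ) * hgam
  rw [hbox] at g2
  have hψ1 : 0 ≤ ψ * (2 * n * 2 * θ) := by positivity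
  have b1 : 2 * φ z * box N φ z + 6 * gam N φ φ z ≤ a * θ := by
    have : φ z * box N φ z ≤ φ z * B := mul_le_mul_of_nonneg_left h2 hφ0.le
    have : φ z * B ≤ B * θ * B := mul_le_mul_of_nonneg_right h1 hB
    nlinarith
  have b2 : P z * (2 * φ z * box N φ z + 6 * gam N φ φ z) ≤ P z * (a * θ) :=
    mul_le_mul_of_nonneg_left b1 hP0
  have b3 : 0 ≤ φ z ^ 2 * (K - δ * P z ^ 2) + P z * a * θ ^ 2 := by
    have c1 : φ z ^ 2 * (θ * box N P z) ≤ φ z ^ 2 * (K - δ * P z ^ 2) :=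
      mul_le_mul_of_nonneg_left h4 (by positivity)
    have c2 : 0 ≤ θ * (φ z ^ 2 * box N P z + P z * (a * θ)) := mul_nonneg hθ.le (by linarith)
    nlinarith
  have e : φ z ^ 2 * P z = ψ * θ ^ 2 := by rw [hψ]; field_simp
  have b4 : δ * ψ ^ 2 ≤ K * B ^ 4 + a * ψ := by
    have c1 : 0 ≤ φ z ^ 2 * (φ z ^ 2 * (K - δ * P z ^ 2) + P z * a * θ ^ 2) :=
      mul_nonneg (by positivity) b3
    have c2 : φ z ^ 2 * (φ z ^ 2 * (K - δ * P z ^ 2) + P z * a * θ ^ 2)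
        = K * φ z ^ 4 - δ * (ψ * θ ^ 2) ^ 2 + a * (ψ * θ ^ 2) * θ ^ 2 := by rw [← e]; ring
    have c3 : φ z ^ 4 ≤ (B * θ) ^ 4 := pow_le_pow_left₀ hφ0.le h1 4
    have c4 : K * φ z ^ 4 ≤ K * (B * θ) ^ 4 := mul_le_mul_of_nonneg_left c3 hK
    have c5 : 0 ≤ (K * B ^ 4 + a * ψ - δ * ψ ^ 2) * θ ^ 4 := by nlinarith
    have := nonneg_of_mul_nonneg_left c5 (by positivity)
    linarith
  rw [e]
  refine mul_le_mul_of_nonneg_right ?_ (by positivity)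
  by_contra! hlt
  have hψa : ψ * δ > K * B ^ 4 + 1 + a + δ := by
    have : ((K * B ^ 4 + 1) / δ + a / δ + 1) * δ = K * B ^ 4 + 1 + a + δ := by field_simp
    nlinarith
  have hψb : 1 < ψ := lt_of_le_of_lt (by
    have : 0 ≤ (K * B ^ 4 + 1) / δ + a / δ := by positivity
    linarith) hlt
  have hKB : 0 ≤ K * B ^ 4 := by positivity
  nlinarith

/-- The localising function `c²(-⟨F, F⟩) - ⟨F, e⟩²` on the graph `F = (x, u)`. -/
def gP (c : ℝ) (e : Mink n) (u : ST n → ℝ) (y : ST n) : ℝ := c ^ 2 * gF u y - gE e u y * gE e u y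

theorem smoothNear_gP (c : ℝ) (e : Mink n) (h : SmoothNear u z) : SmoothNear (gP c e u) z :=
  ((smoothNear_gF h).const_mul _).sub ((smoothNear_gE e h).mul (smoothNear_gE e h))

theorem Adm.sd_sq_le (h : Adm eb u z) (i : Fin n) : sd i u z ^ 2 ≤ 1 := by
  have h1 := norm_sq_eq_sum (grad eb u z)
  have h2 : sd i u z * sd i u z ≤ ∑ j, sd j u z * sd j u z :=
    Finset.single_le_sum (f := fun j => sd j u z * sd j u z)
      (fun j _ => mul_self_nonneg _) (Finset.mem_univ i)
  have h3 : ‖grad eb u z‖ ^ 2 ≤ 1 := pow_le_one₀ (norm_nonneg _) h.2.le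
  rw [h1] at h3
  rw [sq]; exact h2.trans h3

/-- In a region where the slope is bounded and the Euclidean size is at most the scale `θ`, the
localising function satisfies the requirements of `exists_cutoff_bound`. -/
theorem exists_gP_bounds {c W b D : ℝ} (hb : 0 ≤ b) (hD : 0 ≤ D) (hW : 0 ≤ W) :
    ∃ B : ℝ, 0 ≤ B ∧ ∀ (u : ST n → ℝ) (z : ST n) (e : Mink n) (θ : ℝ), 0 ≤ θ → FlowGraph u z →
      gw u z ≤ W → |e.2| ≤ b → (∀ i, |e.1 i| ≤ b) → u z ^ 2 ≤ D * θ → (∀ i, z.1 i ^ 2 ≤ D * θ) →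
      gP c e u z ≤ B * θ ∧ box (fun i => gn u i z) (gP c e u) z ≤ B ∧
      gam (fun i => gn u i z) (gP c e u) (gP c e u) z ≤ B * θ := by
  set B1 := c ^ 2 * D
  set E := (n + 1) * (b ^ 2 * D * (n + 1))
  set B2 := c ^ 2 * (2 * n) + 2 * (W ^ 2 * (n * (4 * b ^ 2)))
  set B3 := W ^ 2 * (n * (2 * (c ^ 4 * (16 * D)) + 2 * (16 * b ^ 2 * E)))
  have p1 : 0 ≤ B1 := by positivity
  have p2 : 0 ≤ B2 := by positivity
  have p3 : 0 ≤ B3 := by positivity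
  refine ⟨B1 + B2 + B3, by positivity, fun u z e θ hθ h hw he2 he1 hu hx => ?_⟩
  have hA := h.1
  have hF : gF u z ≤ D * θ := by
    have : 0 ≤ ∑ i, xc i z * xc i z := Finset.sum_nonneg fun i _ => mul_self_nonneg _
    unfold MinkMCF.gF; nlinarith
  have hw2 : gw u z ^ 2 ≤ W ^ 2 := pow_le_pow_left₀ hA.gw_pos.le hw 2
  have hsE : ∀ i, sd i (gE e u) z ^ 2 ≤ 4 * b ^ 2 := by
    intro i
    rw [hA.sd_gE]
    have h1 := hA.sd_sq_le i
    have h2 : e.2 ^ 2 ≤ b ^ 2 := sq_le_sq' (by linarith [abs_le.1 he2]) (abs_le.1 he2).2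
    have h3 : e.1 i ^ 2 ≤ b ^ 2 := sq_le_sq' (by linarith [abs_le.1 (he1 i)]) (abs_le.1 (he1 i)).2
    have h4 : (e.2 * sd i u z) ^ 2 ≤ b ^ 2 := by
      rw [mul_pow]; nlinarith [sq_nonneg e.2]
    nlinarith [sq_nonneg (e.2 * sd i u z + e.1 i)]
  have hE : gE e u z ^ 2 ≤ E * θ := by
    have h2 : e.2 ^ 2 ≤ b ^ 2 := sq_le_sq' (by linarith [abs_le.1 he2]) (abs_le.1 he2).2
    have a1 : (e.2 * u z) ^ 2 ≤ b ^ 2 * (D * θ) := by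
      rw [mul_pow]; exact mul_le_mul h2 hu (sq_nonneg _) (sq_nonneg _)
    have a2 : (∑ i, e.1 i * xc i z) ^ 2 ≤ n * (n * (b ^ 2 * (D * θ))) := by
      have := sq_sum_le_card_mul_sum_sq (s := Finset.univ) (f := fun i : Fin n => e.1 i * xc i z)
      refine this.trans ?_
      simp only [Finset.card_univ, Fintype.card_fin]
      refine mul_le_mul_of_nonneg_left ?_ (by positivity)
      have : ∀ i ∈ Finset.univ, (e.1 i * xc i z) ^ 2 ≤ b ^ 2 * (D * θ) := by
        intro i _
        have h3 : e.1 i ^ 2 ≤ b ^ 2 :=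
          sq_le_sq' (by linarith [abs_le.1 (he1 i)]) (abs_le.1 (he1 i)).2
        rw [mul_pow]; exact mul_le_mul h3 (hx i) (sq_nonneg _) (sq_nonneg _)
      have := Finset.sum_le_sum this
      simpa using this
    have a3 : 0 ≤ b ^ 2 * (D * θ) := by positivity
    have hn : (0 : ℝ) ≤ n := Nat.cast_nonneg n
    unfold MinkMCF.gE
    set p := e.2 * u z
    set q := ∑ i, e.1 i * xc i z
    set m := b ^ 2 * (D * θ)
    have hE' : E * θ = (n + 1) * ((n + 1) * m) := by simp only [E, m]; ring
    rw [hE']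
    -- `(p - q)² ≤ (n + 1) (p² + q² / n)`, written without the division
    have a4 : (n : ℝ) * (p - q) ^ 2 ≤ (n + 1) * (n * p ^ 2 + q ^ 2) := by
      nlinarith [sq_nonneg (n * p + q)]
    rcases Nat.eq_zero_or_pos n with h0 | h0
    · subst h0
      simp only [q, Finset.univ_eq_empty, Finset.sum_empty]; simp; simpa using a1
    · have h0' : (0 : ℝ) < n := by exact_mod_cast h0
      have : (n : ℝ) * (p - q) ^ 2 ≤ n * ((n + 1) * ((n + 1) * m)) := by
        have a5 : n * p ^ 2 + q ^ 2 ≤ n * m + n * (n * m) :=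
          add_le_add (mul_le_mul_of_nonneg_left a1 hn) a2
        have := mul_le_mul_of_nonneg_left a5 (by positivity : (0 : ℝ) ≤ n + 1)
        linarith
      exact le_of_mul_le_mul_left this h0'
  have hgE : gam (fun i => gn u i z) (gE e u) (gE e u) z ≤ W ^ 2 * (n * (4 * b ^ 2)) := by
    refine (hA.gam_self_le _).trans (mul_le_mul hw2 ?_ (Finset.sum_nonneg fun i _ => sq_nonneg _)
      (sq_nonneg _))
    have := Finset.sum_le_sum fun i (_ : i ∈ Finset.univ) => hsE i
    simpa using this
  have hbox : box (fun i => gn u i z) (gP c e u) z ≤ B2 := by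
    have : box (fun i => gn u i z) (gP c e u) z
        = c ^ 2 * (2 * n) + 2 * gam (fun i => gn u i z) (gE e u) (gE e u) z := by
      have e1 := box_sub (N := fun i => gn u i z) ((smoothNear_gF hA.1).const_mul (c ^ 2))
        ((smoothNear_gE e hA.1).mul (smoothNear_gE e hA.1))
      rw [box_const_mul _ (smoothNear_gF hA.1), h.box_gF,
        box_mul (smoothNear_gE e hA.1) (smoothNear_gE e hA.1), h.box_gE] at e1
      exact e1.trans (by ring)
    rw [this]; simp only [B2]; linarith
  have hgam : gam (fun i => gn u i z) (gP c e u) (gP c e u) z ≤ B3 * θ := by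
    have hs : ∀ i ∈ Finset.univ, sd i (gP c e u) z ^ 2
        ≤ (2 * (c ^ 4 * (16 * D)) + 2 * (16 * b ^ 2 * E)) * θ := by
      intro i _
      have e1 : sd i (gP c e u) z = sd i (fun y => c ^ 2 * gF u y) z
          - sd i (fun y => gE e u y * gE e u y) z :=
        dir_sub ((smoothNear_gF hA.1).const_mul (c ^ 2))
          ((smoothNear_gE e hA.1).mul (smoothNear_gE e hA.1)) _
      have e2 : sd i (fun y => c ^ 2 * gF u y) z = c ^ 2 * sd i (gF u) z :=
        dir_const_mul _ (smoothNear_gF hA.1) _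
      have e3 : sd i (fun y => gE e u y * gE e u y) z
          = sd i (gE e u) z * gE e u z + gE e u z * sd i (gE e u) z :=
        dir_mul (smoothNear_gE e hA.1) (smoothNear_gE e hA.1) _
      rw [e1, e2, e3]
      have f1 : sd i (gF u) z ^ 2 ≤ 16 * D * θ := by
        rw [hA.sd_gF]
        have h1 := hA.sd_sq_le i
        have : (u z * sd i u z) ^ 2 ≤ D * θ := by rw [mul_pow]; nlinarith [sq_nonneg (u z)]
        nlinarith [hx i, sq_nonneg (u z * sd i u z + z.1 i)]
      have f2 : sd i (gE e u) z ^ 2 * gE e u z ^ 2 ≤ 4 * b ^ 2 * (E * θ) :=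
        mul_le_mul (hsE i) hE (sq_nonneg _) (by positivity)
      have f3 : c ^ 4 * sd i (gF u) z ^ 2 ≤ c ^ 4 * (16 * D * θ) :=
        mul_le_mul_of_nonneg_left f1 (by positivity)
      set p := sd i (gF u) z
      set q := sd i (gE e u) z
      set r := gE e u z
      nlinarith [sq_nonneg (c ^ 2 * p + (q * r + r * q))]
    have := Finset.sum_le_sum hs
    refine (hA.gam_self_le _).trans ?_
    have t : W ^ 2 * ∑ i, sd i (gP c e u) z ^ 2 ≤ B3 * θ := by
      have := mul_le_mul_of_nonneg_left this (sq_nonneg W)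
      simp only [Finset.sum_const, Finset.card_univ, Fintype.card_fin, nsmul_eq_mul] at this
      simp only [B3]; linarith
    exact (mul_le_mul_of_nonneg_right hw2 (Finset.sum_nonneg fun i _ => sq_nonneg _)).trans t
  refine ⟨?_, by linarith, ?_⟩
  · have : gP c e u z ≤ B1 * θ := by
      unfold gP
      have := mul_le_mul_of_nonneg_left hF (sq_nonneg c)
      simp only [B1]; nlinarith [mul_self_nonneg (gE e u z)]
    have := mul_nonneg p2 hθ
    have := mul_nonneg p3 hθ
    rw [add_mul, add_mul]; linarith
  · have := mul_nonneg p1 hθ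
    have := mul_nonneg p2 hθ
    rw [add_mul, add_mul]; linarith

/-- The scale invariant form of `box |A|² ≤ -2|A|⁴`. -/
theorem FlowGraph.th_box_gA_le (h : FlowGraph u z) (R : ℝ) (hR : 0 < th R z) :
    th R z * box (fun i => MinkMCF.gn u i z) (fun y => th R y ^ 1 * MinkMCF.gA u y) z
      ≤ n ^ 2 - 1 * (th R z ^ 1 * MinkMCF.gA u z) ^ 2 := by
  rw [box_th_pow_mul _ _ _ h.1.gA]
  have h1 := h.box_gA_le
  set θ := th R z
  set A := MinkMCF.gA u z
  have h2 : θ * (θ ^ 1 * box (fun i => MinkMCF.gn u i z) (MinkMCF.gA u) z)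
      ≤ θ * (θ ^ 1 * (-2 * A ^ 2)) :=
    mul_le_mul_of_nonneg_left (mul_le_mul_of_nonneg_left h1 (by positivity)) hR.le
  simp only [pow_one, Nat.cast_one, tsub_self, pow_zero, mul_one] at h2 ⊢
  nlinarith [sq_nonneg (θ * A - n)]

end Bernstein


/-! ### Derivatives of order at least three -/

section Higher

variable {n : ℕ} {u : ST n → ℝ} {z : ST n}

/-- The squared length `|Dᵏu|²` of the array of `k`-th spatial derivatives. -/
def gD (k : ℕ) (u : ST n → ℝ) (y : ST n) : ℝ :=
  ∑ I : Fin k → Fin n, iter eb (List.ofFn I) u y * iter eb (List.ofFn I) u y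

theorem smoothNear_gD (k : ℕ) (h : SmoothNear u z) : SmoothNear (gD k u) z :=
  SmoothNear.sum fun _ _ => (h.iter _).mul (h.iter _)

theorem gD_nonneg (k : ℕ) (u : ST n → ℝ) (z : ST n) : 0 ≤ gD k u z :=
  Finset.sum_nonneg fun _ _ => mul_self_nonneg _

theorem iter_sq_le_gD (I : List (Fin n)) (u : ST n → ℝ) (z : ST n) :
    iter eb I u z ^ 2 ≤ gD I.length u z := by
  have := Finset.single_le_sum (f := fun J : Fin I.length → Fin n =>
    iter eb (List.ofFn J) u z * iter eb (List.ofFn J) u z)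
    (fun J _ => mul_self_nonneg _) (Finset.mem_univ I.get)
  simp only [List.ofFn_get] at this
  rw [sq]; exact this

theorem gD_succ (k : ℕ) (u : ST n → ℝ) (z : ST n) :
    gD (k + 1) u z = ∑ I : Fin k → Fin n, ∑ i, sd i (iter eb (List.ofFn I) u) z ^ 2 := by
  rw [gD, Finset.sum_comm, ← (Fin.consEquiv fun _ => Fin n).sum_comp]
  rw [Fintype.sum_prod_type]
  refine Finset.sum_congr rfl fun i _ => Finset.sum_congr rfl fun I _ => ?_
  simp [Fin.consEquiv, List.ofFn_succ, iter, sq]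

theorem sum_abs_iter_le (k : ℕ) (u : ST n → ℝ) (z : ST n) :
    ∑ I : Fin k → Fin n, |iter eb (List.ofFn I) u z| ≤ (n : ℝ) ^ k * √(gD k u z) := by
  have : ∀ I ∈ (Finset.univ : Finset (Fin k → Fin n)),
      |iter eb (List.ofFn I) u z| ≤ √(gD k u z) := by
    intro I _
    have := iter_sq_le_gD (List.ofFn I) u z
    rw [List.length_ofFn] at this
    exact Real.abs_le_sqrt this
  have := Finset.sum_le_sum this
  simpa using this

/-- The evolution of `|Dᵏu|²` when the commutators are bounded by `c`. -/
theorem FlowGraph.box_gD_le (h : FlowGraph u z) (k : ℕ) {c : ℝ}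
    (hc : ∀ I : List (Fin n), I.length = k → |commutator eb I u z| ≤ c) :
    box (fun i => MinkMCF.gn u i z) (gD k u) z
      ≤ 2 * ((n : ℝ) ^ k * √(gD k u z)) * c - 2 * gD (k + 1) u z := by
  have h1 : box (fun i => MinkMCF.gn u i z) (gD k u) z = ∑ I : Fin k → Fin n,
      box (fun i => MinkMCF.gn u i z) (fun y => iter eb (List.ofFn I) u y
        * iter eb (List.ofFn I) u y) z :=
    box_sum fun I _ => (h.1.1.iter _).mul (h.1.1.iter _)
  have h2 : ∀ I ∈ (Finset.univ : Finset (Fin k → Fin n)),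
      box (fun i => MinkMCF.gn u i z) (fun y => iter eb (List.ofFn I) u y
        * iter eb (List.ofFn I) u y) z
      ≤ 2 * |iter eb (List.ofFn I) u z| * c
        - 2 * ∑ i, sd i (iter eb (List.ofFn I) u) z ^ 2 := by
    intro I _
    rw [box_mul (h.1.1.iter _) (h.1.1.iter _), h.box_iter]
    have a1 := sum_sq_le_gam (N := fun i => MinkMCF.gn u i z) (f := iter eb (List.ofFn I) u) (z := z)
    have a2 := hc (List.ofFn I) (List.length_ofFn)
    have a3 : iter eb (List.ofFn I) u z * commutator eb (List.ofFn I) u z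
        ≤ |iter eb (List.ofFn I) u z| * c :=
      (le_abs_self _).trans (by rw [abs_mul]; exact mul_le_mul_of_nonneg_left a2 (abs_nonneg _))
    linarith
  rw [h1, gD_succ]
  refine (Finset.sum_le_sum h2).trans ?_
  rw [Finset.sum_sub_distrib, ← Finset.mul_sum, ← Finset.sum_mul, ← Finset.mul_sum]
  have hc0 : (0 : ℝ) ≤ 2 * c ∨ IsEmpty (Fin k → Fin n) := by
    rcases isEmpty_or_nonempty (Fin k → Fin n) with h0 | ⟨⟨I⟩⟩
    · exact Or.inr h0
    · exact Or.inl (by have := (abs_nonneg _).trans (hc (List.ofFn I) (List.length_ofFn)); linarith)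
  have h3 := sum_abs_iter_le k u z
  rcases hc0 with h0 | h0
  · nlinarith
  · have : gD k u z = 0 := by simp [gD]
    simp [this]

theorem FlowGraph.gam_gD_self_le (h : FlowGraph u z) (k : ℕ) :
    gam (fun i => MinkMCF.gn u i z) (gD k u) (gD k u) z
      ≤ 4 * MinkMCF.gw u z ^ 2 * (gD k u z * gD (k + 1) u z) := by
  refine (h.1.gam_self_le _).trans ?_
  have h1 : ∀ i ∈ Finset.univ, sd i (gD k u) z ^ 2
      ≤ 4 * (gD k u z * ∑ I : Fin k → Fin n, sd i (iter eb (List.ofFn I) u) z ^ 2) := by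
    intro i _
    have e : sd i (gD k u) z = 2 * ∑ I : Fin k → Fin n, iter eb (List.ofFn I) u z
        * sd i (iter eb (List.ofFn I) u) z := by
      have : sd i (gD k u) z = ∑ I : Fin k → Fin n, sd i (fun y => iter eb (List.ofFn I) u y
        * iter eb (List.ofFn I) u y) z :=
        dir_sum (fun I _ => (h.1.1.iter _).mul (h.1.1.iter _)) _
      rw [this, Finset.mul_sum]
      refine Finset.sum_congr rfl fun I _ => ?_
      rw [sd, dir_mul (h.1.1.iter _) (h.1.1.iter _)]; ring
    have h2 := Finset.sum_mul_sq_le_sq_mul_sq Finset.univ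
      (fun I : Fin k → Fin n => iter eb (List.ofFn I) u z)
      (fun I : Fin k → Fin n => sd i (iter eb (List.ofFn I) u) z)
    have e2 : gD k u z = ∑ I : Fin k → Fin n, iter eb (List.ofFn I) u z ^ 2 :=
      Finset.sum_congr rfl fun I _ => (sq _).symm
    rw [e, e2]; nlinarith
  have h2 := Finset.sum_le_sum h1
  rw [← Finset.mul_sum, ← Finset.mul_sum, Finset.sum_comm, ← gD_succ] at h2
  have := mul_le_mul_of_nonneg_left h2 (sq_nonneg (MinkMCF.gw u z))
  linarith

/-- The algebra of the estimate: with `y = √(1 + f)` and `a² ` the good gradient term, the product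
`f (Λ + g)` has a reaction term of order `-f²`. -/
theorem exists_reaction_bound (C C1 : ℝ) (hC : 0 ≤ C) (hC1 : 0 ≤ C1) :
    ∃ Λ K : ℝ, 1 ≤ Λ ∧ 0 ≤ K ∧ ∀ f g a y : ℝ, 0 ≤ f → 0 ≤ g → g ≤ C1 → 0 ≤ a → 0 ≤ y →
      y ^ 2 = 1 + f →
      (Λ + g) * (-2 * a ^ 2 + C * y * a + C * y ^ 3) + f * (-2 * f + C * y) + C * f * a
        ≤ K - f ^ 2 / 2 := by
  set Λ := 1 + C ^ 2
  set c := (Λ + C1) * (C ^ 2 + C) + C with hc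
  have hΛ : 1 ≤ Λ := by simp only [Λ]; nlinarith
  have hc0 : 0 ≤ c := by positivity
  refine ⟨Λ, 512 * c ^ 4 + 1, hΛ, by positivity, fun f g a y hf hg hg1 ha hy hy2 => ?_⟩
  have hy1 : 1 ≤ y := by nlinarith
  have b1 : C * y * a ≤ a ^ 2 + C ^ 2 * y ^ 2 := by nlinarith [sq_nonneg (C * y - a)]
  have b2 : C * f * a ≤ f ^ 2 / 2 + C ^ 2 * a ^ 2 := by nlinarith [sq_nonneg (C * a - f)]
  have b3 : y ^ 2 ≤ y ^ 3 := pow_le_pow_right₀ hy1 (by norm_num)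
  have b4 : (Λ + g) * (-2 * a ^ 2 + C * y * a + C * y ^ 3)
      ≤ -(C ^ 2 * a ^ 2) + (Λ + C1) * (C ^ 2 + C) * y ^ 3 := by
    have d1 : -2 * a ^ 2 + C * y * a + C * y ^ 3 ≤ -a ^ 2 + (C ^ 2 + C) * y ^ 3 := by
      have := mul_le_mul_of_nonneg_left b3 (sq_nonneg C)
      linarith
    have d2 := mul_le_mul_of_nonneg_left d1 (by linarith : 0 ≤ Λ + g)
    have d3 : (Λ + g) * ((C ^ 2 + C) * y ^ 3) ≤ (Λ + C1) * ((C ^ 2 + C) * y ^ 3) :=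
      mul_le_mul_of_nonneg_right (by linarith) (by positivity)
    have d4 : C ^ 2 * a ^ 2 ≤ (Λ + g) * a ^ 2 :=
      mul_le_mul_of_nonneg_right (by simp only [Λ]; linarith) (sq_nonneg a)
    linarith
  have b5 : f * (C * y) ≤ C * y ^ 3 := by
    have : f ≤ y ^ 2 := by linarith
    nlinarith [mul_nonneg hC hy]
  -- absorb the cubic term: either `y` is small or the quartic term dominates
  have b6 : c * y ^ 3 ≤ y ^ 4 / 8 + 512 * c ^ 4 := by
    rcases le_or_gt (8 * c) y with h | h
    · have : 8 * c * y ^ 3 ≤ y * y ^ 3 := mul_le_mul_of_nonneg_right h (by positivity)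
      have : 0 ≤ 512 * c ^ 4 := by positivity
      nlinarith
    · have h3 : y ^ 3 ≤ (8 * c) ^ 3 := pow_le_pow_left₀ hy h.le 3
      have := mul_le_mul_of_nonneg_left h3 hc0
      have : 0 ≤ y ^ 4 := by positivity
      nlinarith
  have b7 : y ^ 4 = 1 + 2 * f + f ^ 2 := by
    have : y ^ 4 = (y ^ 2) ^ 2 := by ring
    rw [this, hy2]; ring
  rw [b7] at b6
  have b8 : (Λ + C1) * (C ^ 2 + C) * y ^ 3 + C * y ^ 3 = c * y ^ 3 := by rw [hc]; ring
  nlinarith [sq_nonneg (f - 1)]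

/-- A bound for the tilt of the unit normal keeps the gradient away from the unit sphere. -/
theorem exists_norm_le_of_wgt_le (n : ℕ) (W : ℝ) : ∃ κ : ℝ, κ < 1 ∧ ∀ p : Euc n, ‖p‖ < 1 →
    wgt p ≤ W → ‖p‖ ≤ κ := by
  refine ⟨√(1 - ((|W| + 1) ^ 2)⁻¹), ?_, fun p hp hw => ?_⟩
  · rw [Real.sqrt_lt' one_pos]
    have : 0 < ((|W| + 1) ^ 2)⁻¹ := by positivity
    linarith
  · apply Real.le_sqrt_of_sq_le
    have h1 := wgt_sq_mul hp
    have h2 : wgt p ≤ |W| + 1 := hw.trans (by linarith [le_abs_self W])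
    have h3 : wgt p ^ 2 ≤ (|W| + 1) ^ 2 := pow_le_pow_left₀ (wgt_pos hp).le h2 2
    have h4 : (wgt p ^ 2)⁻¹ = 1 - ‖p‖ ^ 2 := by
      rw [inv_eq_iff_eq_inv]
      apply eq_inv_of_mul_eq_one_left; rw [sq]; exact h1
    have h5 : ((|W| + 1) ^ 2)⁻¹ ≤ (wgt p ^ 2)⁻¹ := inv_anti₀ (pow_pos (wgt_pos hp) 2) h3
    linarith

theorem exists_grad_bound (W : ℝ) : ∃ κ : ℝ, κ < 1 ∧ ∀ (u : ST n → ℝ) (z : ST n), Adm eb u z →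
    gw u z ≤ W → ‖grad eb u z‖ ≤ κ := by
  obtain ⟨κ, hκ, h⟩ := exists_norm_le_of_wgt_le n W
  exact ⟨κ, hκ, fun u z hu hw => h _ hu.2 hw⟩

/-- `P = f (Λ + g)` with `f = θᵏ⁻¹|Dᵏu|²` and `g = θᵏ⁻²|Dᵏ⁻¹u|²`, for `k = j + 2`. -/
def gQ (j : ℕ) (Λ R : ℝ) (u : ST n → ℝ) (y : ST n) : ℝ :=
  th R y ^ (j + 1) * gD (j + 2) u y * (Λ + th R y ^ j * gD (j + 1) u y)

theorem smoothNear_gQ (j : ℕ) (Λ R : ℝ) (h : SmoothNear u z) : SmoothNear (gQ j Λ R u) z :=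
  (((smoothNear_th R z).pow _).mul (smoothNear_gD _ h)).mul
    ((smoothNear_const Λ z).add (((smoothNear_th R z).pow _).mul (smoothNear_gD _ h)))

/-- If the second derivatives have size `r`, and the derivatives of order at most `k` have the scaling
of the length `1/l`, then the commutator with `D^I` is controlled by `l` and by `r` times the derivatives
of order `k + 1`. -/
theorem exists_commutator_bound (k : ℕ) (hk : 2 ≤ k) (K W : ℝ) (hK : 1 ≤ K) :
    ∃ C : ℝ, 0 ≤ C ∧ ∀ (u : ST n → ℝ) (z : ST n) (r l B : ℝ), 0 ≤ r → r ≤ l → 0 ≤ B → Adm eb u z →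
      gw u z ≤ W →
      (∀ I : List (Fin n), I.length = 2 → |iter eb I u z| ≤ K * r) →
      (∀ I : List (Fin n), 2 ≤ I.length → I.length ≤ k → |iter eb I u z| ≤ K * l ^ (I.length - 1)) →
      (∀ I : List (Fin n), I.length = k + 1 → |iter eb I u z| ≤ B) →
      ∀ I : List (Fin n), I.length = k → |commutator eb I u z| ≤ C * (l ^ (k + 1) + r * B) := by
  obtain ⟨κ, hκ, hgr⟩ := exists_grad_bound (n := n) W
  have h1 : ∀ I : Fin k → Fin n, ∃ C : ℝ, 0 ≤ C ∧ ∀ (u : ST n → ℝ) (z : ST n) (l μ B : ℝ),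
      0 ≤ l → 0 ≤ μ → 0 ≤ B → Adm eb u z → ‖grad eb u z‖ ≤ κ →
      (∀ I : List (Fin n), 2 ≤ I.length → I.length ≤ k → |iter eb I u z| ≤ K * l ^ (I.length - 1)) →
      (∀ I : List (Fin n), I.length = 2 → |iter eb I u z| ≤ μ) →
      (∀ I : List (Fin n), I.length = k + 1 → |iter eb I u z| ≤ B) →
      |commutator eb (List.ofFn I) u z| ≤ C * (l ^ (k + 1) + μ * B) := by
    intro I
    have := topForm_commutator (b := (eb : Fin n → ST n)) (List.ofFn I) (by simp; omega)
    rw [List.length_ofFn] at this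
    exact this.bound K κ hκ
  choose C hC0 hC using h1
  refine ⟨K * ∑ I, C I, mul_nonneg (by linarith) (Finset.sum_nonneg fun I _ => hC0 I), ?_⟩
  intro u z r l B hr hl hB hA hw h2 hj hB' I hI
  obtain ⟨J, hJ⟩ : ∃ J : Fin k → Fin n, List.ofFn J = I := by
    subst hI; exact ⟨I.get, List.ofFn_get I⟩
  have := hC J u z l (K * r) B (hr.trans hl) (by positivity) hB hA (hgr u z hA hw) hj h2 hB'
  rw [hJ] at this
  refine this.trans ?_
  have hs : C J ≤ ∑ I, C I := Finset.single_le_sum (fun I _ => hC0 I) (Finset.mem_univ J)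
  have hl0 : 0 ≤ l ^ (k + 1) := pow_nonneg (hr.trans hl) _
  have hrB := mul_nonneg hr hB
  have : l ^ (k + 1) + K * r * B ≤ K * (l ^ (k + 1) + r * B) := by nlinarith
  calc C J * (l ^ (k + 1) + K * r * B) ≤ (∑ I, C I) * (K * (l ^ (k + 1) + r * B)) :=
        mul_le_mul hs this (by positivity) (Finset.sum_nonneg fun I _ => hC0 I)
    _ = _ := by ring

end Higher


section HigherBound

variable {n : ℕ} {u : ST n → ℝ} {z : ST n}

theorem gD_le_of_jets (k : ℕ) {c : ℝ}
    (h : ∀ I : List (Fin n), I.length = k → |iter eb I u z| ≤ c) :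
    gD k u z ≤ (n : ℝ) ^ k * c ^ 2 := by
  have : ∀ I ∈ (Finset.univ : Finset (Fin k → Fin n)),
      iter eb (List.ofFn I) u z * iter eb (List.ofFn I) u z ≤ c ^ 2 := by
    intro I _
    have h1 := h (List.ofFn I) (List.length_ofFn)
    rw [← sq, ← sq_abs]
    exact pow_le_pow_left₀ (abs_nonneg _) h1 2
  have := Finset.sum_le_sum this
  simpa [gD] using this

set_option maxHeartbeats 1600000 in
/-- Given scale invariant bounds on the derivatives of order between `2` and `j + 1`, the quantity
`gQ j Λ R u` satisfies the differential inequality of `exists_cutoff_bound`. -/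
theorem exists_gQ_evolution (j : ℕ) (hj : 1 ≤ j) (K W : ℝ) (hK : 1 ≤ K) :
    ∃ Λ K' δ : ℝ, 1 ≤ Λ ∧ 0 ≤ K' ∧ 0 < δ ∧ ∀ (u : ST n → ℝ) (z : ST n) (R ρ : ℝ), 0 < th R z →
      0 < ρ → ρ ^ 2 * th R z = 1 → FlowGraph u z → gw u z ≤ W →
      (∀ I : List (Fin n), 2 ≤ I.length → I.length ≤ j + 1 →
        |iter eb I u z| ≤ K * ρ ^ (I.length - 1)) →
      th R z * box (fun i => gn u i z) (gQ j Λ R u) z ≤ K' - δ * gQ j Λ R u z ^ 2 := by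
  obtain ⟨Ca, hCa0, hCa⟩ := exists_commutator_bound (n := n) (j + 2) (by omega) K W hK
  obtain ⟨Cb, hCb0, hCb⟩ := exists_commutator_bound (n := n) (j + 1) (by omega) K W hK
  obtain ⟨C1, hC1⟩ : ∃ x, x = (n : ℝ) ^ (j + 1) * K ^ 2 := ⟨_, rfl⟩
  have hC10 : 0 ≤ C1 := by rw [hC1]; positivity
  obtain ⟨A1, hA1⟩ : ∃ x, x = 2 * (n : ℝ) ^ (j + 2) * Ca := ⟨_, rfl⟩
  obtain ⟨A2, hA2⟩ : ∃ x, x = 2 * n * (j + 1 : ℝ) := ⟨_, rfl⟩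
  obtain ⟨A3, hA3⟩ : ∃ x, x = 2 * (n : ℝ) ^ (j + 1) * (1 + C1) * Cb := ⟨_, rfl⟩
  obtain ⟨A4, hA4⟩ : ∃ x, x = 2 * n * (j : ℝ) * C1 := ⟨_, rfl⟩
  obtain ⟨A5, hA5⟩ : ∃ x, x = 8 * W ^ 2 * (1 + C1) := ⟨_, rfl⟩
  have p1 : 0 ≤ A1 := by rw [hA1]; positivity
  have p2 : 0 ≤ A2 := by rw [hA2]; positivity
  have p3 : 0 ≤ A3 := by rw [hA3]; positivity
  have p4 : 0 ≤ A4 := by rw [hA4]; positivity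
  have p5 : 0 ≤ A5 := by rw [hA5]; positivity
  obtain ⟨C, hC⟩ : ∃ x, x = A1 + A2 + 2 * A3 + A4 + A5 := ⟨_, rfl⟩
  have hC0 : 0 ≤ C := by rw [hC]; positivity
  obtain ⟨Λ, K', hΛ, hK', hreact⟩ := exists_reaction_bound C C1 hC0 hC10
  refine ⟨Λ, K', (2 * (Λ + C1) ^ 2)⁻¹, hΛ, hK', by positivity, ?_⟩
  intro u z R ρ hθ hρ hρθ h hw hjet
  have hA := h.1
  set θ := th R z with hθd
  have hcancel : ∀ m : ℕ, θ ^ m * ρ ^ (2 * m) = 1 := by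
    intro m; rw [pow_mul, ← mul_pow, mul_comm, hρθ, one_pow]
  set D1 := gD (j + 1) u z with hD1
  set D2 := gD (j + 2) u z with hD2
  set D3 := gD (j + 3) u z with hD3
  have d1 : 0 ≤ D1 := gD_nonneg _ _ _
  have d2 : 0 ≤ D2 := gD_nonneg _ _ _
  have d3 : 0 ≤ D3 := gD_nonneg _ _ _
  set f := θ ^ (j + 1) * D2 with hf
  set g := θ ^ j * D1 with hg
  set G := θ ^ (j + 2) * D3 with hG
  have hf0 : 0 ≤ f := by positivity
  have hg0 : 0 ≤ g := by positivity
  have hG0 : 0 ≤ G := by positivity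
  have hD1f : D1 = ρ ^ (2 * j) * g := by rw [hg]; linear_combination (-D1) * hcancel j
  have hD2f : D2 = ρ ^ (2 * (j + 1)) * f := by rw [hf]; linear_combination (-D2) * hcancel (j + 1)
  have hD3f : D3 = ρ ^ (2 * (j + 2)) * G := by rw [hG]; linear_combination (-D3) * hcancel (j + 2)
  set a := √G with ha
  set y := √(1 + f) with hy
  have ha0 : 0 ≤ a := Real.sqrt_nonneg _
  have haG : a ^ 2 = G := Real.sq_sqrt hG0
  have hy0 : 0 ≤ y := Real.sqrt_nonneg _
  have hy2 : y ^ 2 = 1 + f := Real.sq_sqrt (by positivity)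
  have hy1 : 1 ≤ y := by nlinarith
  have hy3 : y ^ 2 ≤ y ^ 3 := pow_le_pow_right₀ hy1 (by norm_num)
  have hgC : g ≤ C1 := by
    have := gD_le_of_jets (u := u) (z := z) (j + 1) (c := K * ρ ^ j) fun I hI => by
      have := hjet I (by omega) (by omega)
      simpa [hI] using this
    have t := mul_le_mul_of_nonneg_left this (by positivity : 0 ≤ θ ^ j)
    have e : θ ^ j * ((n : ℝ) ^ (j + 1) * (K * ρ ^ j) ^ 2) = C1 := by
      have := hcancel j
      rw [hC1]
      calc _ = (n : ℝ) ^ (j + 1) * K ^ 2 * (θ ^ j * ρ ^ (2 * j)) := by ring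
        _ = _ := by rw [this, mul_one]
    rw [e] at t; exact t
  have hsg : √g ≤ 1 + C1 := by
    rw [Real.sqrt_le_left (by positivity)]; nlinarith
  have hsD1 : √D1 = ρ ^ j * √g := by
    rw [hD1f, mul_comm 2 j, pow_mul, Real.sqrt_mul (by positivity), Real.sqrt_sq (by positivity)]
  have hsD2 : √D2 ≤ ρ ^ (j + 1) * y := by
    rw [hD2f, mul_comm 2 (j + 1), pow_mul, Real.sqrt_mul (by positivity),
      Real.sqrt_sq (by positivity)]
    exact mul_le_mul_of_nonneg_left (Real.sqrt_le_sqrt (by linarith)) (by positivity)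
  have hsD3 : √D3 = ρ ^ (j + 2) * a := by
    rw [hD3f, mul_comm 2 (j + 2), pow_mul, Real.sqrt_mul (by positivity),
      Real.sqrt_sq (by positivity)]
  have hI2 : ∀ I : List (Fin n), I.length = j + 2 → |iter eb I u z| ≤ ρ ^ (j + 1) * y := by
    intro I hI
    have := iter_sq_le_gD I u z
    rw [hI] at this
    exact (Real.abs_le_sqrt this).trans hsD2
  have hI3 : ∀ I : List (Fin n), I.length = j + 3 → |iter eb I u z| ≤ ρ ^ (j + 2) * a := by
    intro I hI
    have := iter_sq_le_gD I u z
    rw [hI] at this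
    exact (Real.abs_le_sqrt this).trans hsD3.le
  have hJ2 : ∀ I : List (Fin n), I.length = 2 → |iter eb I u z| ≤ K * ρ := by
    intro I hI
    have := hjet I (by omega) (by omega)
    simpa [hI] using this
  -- the length scale at which the derivatives of order `j + 2` have size one
  obtain ⟨l, hl⟩ : ∃ x, x = ρ * y ^ ((j + 1 : ℝ)⁻¹) := ⟨_, rfl⟩
  have hyl : 1 ≤ y ^ ((j + 1 : ℝ)⁻¹) := Real.one_le_rpow hy1 (by positivity)
  have hlj : l ^ (j + 1) = ρ ^ (j + 1) * y := by
    rw [hl, mul_pow]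
    congr 1
    have := Real.rpow_inv_natCast_pow hy0 (n := j + 1) (by omega)
    push_cast at this
    exact this
  have hρl : ρ ≤ l := hl ▸ le_mul_of_one_le_right hρ.le hyl
  have hl3 : l ^ (j + 3) ≤ ρ ^ (j + 3) * y ^ 2 := by
    have e : (y ^ ((j + 1 : ℝ)⁻¹)) ^ 2 ≤ y := by
      have e1 : (y ^ ((j + 1 : ℝ)⁻¹)) ^ (j + 1) = y := by
        have := Real.rpow_inv_natCast_pow hy0 (n := j + 1) (by omega)
        push_cast at this
        exact this
      calc (y ^ ((j + 1 : ℝ)⁻¹)) ^ 2 ≤ (y ^ ((j + 1 : ℝ)⁻¹)) ^ (j + 1) :=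
            pow_le_pow_right₀ hyl (by omega)
        _ = y := e1
    calc l ^ (j + 3) = l ^ (j + 1) * (ρ ^ 2 * (y ^ ((j + 1 : ℝ)⁻¹)) ^ 2) := by rw [hl]; ring
      _ ≤ l ^ (j + 1) * (ρ ^ 2 * y) :=
          mul_le_mul_of_nonneg_left (mul_le_mul_of_nonneg_left e (by positivity))
            (pow_nonneg (hρ.le.trans hρl) _)
      _ = _ := by rw [hlj]; ring
  have hcom2 : ∀ I : List (Fin n), I.length = j + 2 → |commutator eb I u z|
      ≤ Ca * (ρ ^ (j + 3) * (y ^ 2 + a)) := by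
    intro I hI
    refine (hCa u z ρ l (ρ ^ (j + 2) * a) hρ.le hρl (by positivity) hA hw hJ2 ?_ hI3 I hI).trans ?_
    · intro J h1 h2
      rcases Nat.lt_or_ge J.length (j + 2) with h3 | h3
      · exact (hjet J h1 (by omega)).trans (mul_le_mul_of_nonneg_left
          (pow_le_pow_left₀ hρ.le hρl _) (by linarith))
      · have h4 : J.length = j + 2 := by omega
        rw [h4, show j + 2 - 1 = j + 1 by omega, hlj]
        exact (hI2 J h4).trans (le_mul_of_one_le_left (by positivity) hK)
    · refine mul_le_mul_of_nonneg_left ?_ hCa0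
      have : ρ * (ρ ^ (j + 2) * a) = ρ ^ (j + 3) * a := by ring
      rw [this, mul_add]; linarith
  have hcom1 : ∀ I : List (Fin n), I.length = j + 1 → |commutator eb I u z|
      ≤ Cb * (ρ ^ (j + 2) * (1 + y)) := by
    intro I hI
    refine (hCb u z ρ ρ (ρ ^ (j + 1) * y) hρ.le le_rfl (by positivity) hA hw hJ2 hjet hI2 I hI).trans
      ?_
    refine mul_le_mul_of_nonneg_left ?_ hCb0
    have : ρ * (ρ ^ (j + 1) * y) = ρ ^ (j + 2) * y := by ring
    rw [this, mul_add]; linarith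
  set N : Fin n → ℝ := fun i => gn u i z with hN
  have hs : ∀ k, SmoothNear (gD k u) z := fun k => smoothNear_gD k hA.1
  have hfs : SmoothNear (fun x => th R x ^ (j + 1) * gD (j + 2) u x) z :=
    ((smoothNear_th R z).pow _).mul (hs _)
  have hgs : SmoothNear (fun x => th R x ^ j * gD (j + 1) u x) z :=
    ((smoothNear_th R z).pow _).mul (hs _)
  have hbf : θ * box N (fun x => th R x ^ (j + 1) * gD (j + 2) u x) z
      ≤ -2 * a ^ 2 + A1 * y * a + (A1 + A2) * y ^ 3 := by
    rw [box_th_pow_mul _ _ _ (hs _)]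
    have b1 := h.box_gD_le (j + 2) hcom2
    have b2 : 2 * ((n : ℝ) ^ (j + 2) * √D2) * (Ca * (ρ ^ (j + 3) * (y ^ 2 + a)))
        ≤ 2 * ((n : ℝ) ^ (j + 2) * (ρ ^ (j + 1) * y)) * (Ca * (ρ ^ (j + 3) * (y ^ 2 + a))) :=
      mul_le_mul_of_nonneg_right (mul_le_mul_of_nonneg_left
        (mul_le_mul_of_nonneg_left hsD2 (by positivity)) (by norm_num)) (by positivity)
    have b3 := mul_le_mul_of_nonneg_left (b1.trans (sub_le_sub_right b2 _))
      (by positivity : 0 ≤ θ ^ (j + 2))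
    have e1 : θ ^ (j + 2) * (2 * ((n : ℝ) ^ (j + 2) * (ρ ^ (j + 1) * y))
        * (Ca * (ρ ^ (j + 3) * (y ^ 2 + a))) - 2 * gD (j + 2 + 1) u z)
        = A1 * (y * (y ^ 2 + a)) - 2 * a ^ 2 := by
      have := hcancel (j + 2)
      rw [haG, hG]
      calc _ = A1 * (y * (y ^ 2 + a)) * (θ ^ (j + 2) * ρ ^ (2 * (j + 2)))
            - 2 * (θ ^ (j + 2) * D3) := by simp only [hA1, D3]; ring
        _ = _ := by rw [this]; ring
    rw [e1] at b3
    have e2 : θ * (2 * n * ((j + 1 : ℕ) : ℝ) * θ ^ (j + 1 - 1) * gD (j + 2) u z) = A2 * f := by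
      simp only [hf, hA2, Nat.add_sub_cancel]; push_cast; ring
    have b4 : A2 * f ≤ A2 * y ^ 3 := mul_le_mul_of_nonneg_left (by linarith) p2
    have e3 : θ * (θ ^ (j + 1) * box N (gD (j + 2) u) z) = θ ^ (j + 2) * box N (gD (j + 2) u) z := by
      ring
    rw [mul_add, e2, e3]
    have e4 : A1 * (y * (y ^ 2 + a)) = A1 * y ^ 3 + A1 * y * a := by ring
    linarith
  have hbg : θ * box N (fun x => th R x ^ j * gD (j + 1) u x) z
      ≤ -2 * f + (2 * A3 + A4) * y := by
    rw [box_th_pow_mul _ _ _ (hs _)]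
    have b1 := h.box_gD_le (j + 1) hcom1
    have b2 : 2 * ((n : ℝ) ^ (j + 1) * √D1) * (Cb * (ρ ^ (j + 2) * (1 + y)))
        ≤ 2 * ((n : ℝ) ^ (j + 1) * (ρ ^ j * (1 + C1))) * (Cb * (ρ ^ (j + 2) * (1 + y))) := by
      rw [hsD1]
      exact mul_le_mul_of_nonneg_right (mul_le_mul_of_nonneg_left
        (mul_le_mul_of_nonneg_left (mul_le_mul_of_nonneg_left hsg (by positivity))
          (by positivity)) (by norm_num)) (by positivity)
    have b3 := mul_le_mul_of_nonneg_left (b1.trans (sub_le_sub_right b2 _))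
      (by positivity : 0 ≤ θ ^ (j + 1))
    have e1 : θ ^ (j + 1) * (2 * ((n : ℝ) ^ (j + 1) * (ρ ^ j * (1 + C1)))
        * (Cb * (ρ ^ (j + 2) * (1 + y))) - 2 * gD (j + 1 + 1) u z)
        = A3 * (1 + y) - 2 * f := by
      have := hcancel (j + 1)
      calc _ = A3 * (1 + y) * (θ ^ (j + 1) * ρ ^ (2 * (j + 1)))
            - 2 * (θ ^ (j + 1) * D2) := by simp only [hA3, D2]; ring
        _ = _ := by rw [this, hf]; ring
    rw [e1] at b3
    have e2 : θ * (2 * n * (j : ℝ) * θ ^ (j - 1) * gD (j + 1) u z) = 2 * n * (j : ℝ) * g := by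
      have : θ * θ ^ (j - 1) = θ ^ j := by rw [← pow_succ', Nat.sub_add_cancel hj]
      rw [hg, ← this]; ring
    have b4 : 2 * n * (j : ℝ) * g ≤ A4 := by
      rw [hA4]; exact mul_le_mul_of_nonneg_left hgC (by positivity)
    have e3 : θ * (θ ^ j * box N (gD (j + 1) u) z) = θ ^ (j + 1) * box N (gD (j + 1) u) z := by
      ring
    rw [mul_add, e2, e3]
    have := mul_le_mul_of_nonneg_left hy1 p3
    have := mul_le_mul_of_nonneg_left hy1 p4
    linarith
  have hgam : |2 * (θ * gam N (fun x => th R x ^ (j + 1) * gD (j + 2) u x)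
      (fun x => th R x ^ j * gD (j + 1) u x) z)| ≤ A5 * f * a := by
    have e : θ * gam N (fun x => th R x ^ (j + 1) * gD (j + 2) u x)
        (fun x => th R x ^ j * gD (j + 1) u x) z
        = θ ^ (2 * j + 2) * gam N (gD (j + 2) u) (gD (j + 1) u) z := by
      rw [gam_mul_left ((smoothNear_th R z).pow _) (hs _), gam_th_pow, gam_comm (f := gD (j + 2) u),
        gam_mul_left ((smoothNear_th R z).pow _) (hs _), gam_th_pow,
        gam_comm (f := gD (j + 1) u)]
      ring
    have b1 := abs_gam_le (N := N) (f := gD (j + 2) u) (g := gD (j + 1) u) (z := z)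
    have b2 := h.gam_gD_self_le (j + 2)
    have b3 := h.gam_gD_self_le (j + 1)
    have hw2 : gw u z ^ 2 ≤ W ^ 2 := pow_le_pow_left₀ hA.gw_pos.le hw 2
    have b2' : gam N (gD (j + 2) u) (gD (j + 2) u) z ≤ 4 * W ^ 2 * (D2 * D3) :=
      b2.trans (mul_le_mul_of_nonneg_right (by linarith) (by positivity))
    have b3' : gam N (gD (j + 1) u) (gD (j + 1) u) z ≤ 4 * W ^ 2 * (D1 * D2) :=
      b3.trans (mul_le_mul_of_nonneg_right (by linarith) (by positivity))
    have b4 := b1.trans (mul_le_mul b2' b3' gam_self_nonneg (by positivity))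
    have b5 : |gam N (gD (j + 2) u) (gD (j + 1) u) z| ≤ 4 * W ^ 2 * D2 * (√D3 * √D1) := by
      apply abs_le_of_sq_le_sq _ (by positivity)
      rw [mul_pow, mul_pow √D3, Real.sq_sqrt d3, Real.sq_sqrt d1]
      refine b4.trans (le_of_eq (by ring))
    rw [e, abs_mul, abs_mul, abs_of_pos (by positivity : 0 < θ ^ (2 * j + 2)), abs_two]
    have b6 := mul_le_mul_of_nonneg_left b5 (by positivity : 0 ≤ 2 * θ ^ (2 * j + 2))
    have e2 : 2 * θ ^ (2 * j + 2) * (4 * W ^ 2 * D2 * (√D3 * √D1)) = 8 * W ^ 2 * f * a * √g := by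
      have := hcancel (j + 1)
      rw [hsD1, hsD3, hf]
      calc _ = 8 * W ^ 2 * (θ ^ (j + 1) * D2) * a * √g * (θ ^ (j + 1) * ρ ^ (2 * (j + 1))) := by ring
        _ = _ := by rw [this, mul_one]
    rw [e2] at b6
    have b7 : 8 * W ^ 2 * f * a * √g ≤ 8 * W ^ 2 * f * a * (1 + C1) :=
      mul_le_mul_of_nonneg_left hsg (by positivity)
    have e3 : 8 * W ^ 2 * f * a * (1 + C1) = A5 * f * a := by rw [hA5]; ring
    rw [← mul_assoc]; linarith
  have hbox : θ * box N (gQ j Λ R u) z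
      = (Λ + g) * (θ * box N (fun x => th R x ^ (j + 1) * gD (j + 2) u x) z)
        + f * (θ * box N (fun x => th R x ^ j * gD (j + 1) u x) z)
        - 2 * (θ * gam N (fun x => th R x ^ (j + 1) * gD (j + 2) u x)
      (fun x => th R x ^ j * gD (j + 1) u x) z) := by
    have e1 := box_mul (N := N) hfs ((smoothNear_const Λ z).add hgs)
    rw [box_add (smoothNear_const Λ z) hgs, box_const, gam_comm,
      gam_add_left (smoothNear_const Λ z) hgs, gam_const_left, gam_comm] at e1
    have e2 : box N (gQ j Λ R u) z = _ := e1
    rw [e2, hf, hg, hD1, hD2, hθd]; ring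
  have hr := hreact f g a y hf0 hg0 hgC ha0 hy0 hy2
  have hΛg : 0 ≤ Λ + g := by linarith
  have hya : 0 ≤ y * a := by positivity
  have hy30 : 0 ≤ y ^ 3 := by positivity
  have c1 : (Λ + g) * (θ * box N (fun x => th R x ^ (j + 1) * gD (j + 2) u x) z)
      ≤ (Λ + g) * (-2 * a ^ 2 + C * y * a + C * y ^ 3) := by
    refine mul_le_mul_of_nonneg_left (hbf.trans ?_) hΛg
    have t1 : A1 * (y * a) ≤ C * (y * a) := mul_le_mul_of_nonneg_right (by linarith) hya
    have t2 : (A1 + A2) * y ^ 3 ≤ C * y ^ 3 := mul_le_mul_of_nonneg_right (by linarith) hy30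
    linarith
  have c2 : f * (θ * box N (fun x => th R x ^ j * gD (j + 1) u x) z) ≤ f * (-2 * f + C * y) := by
    refine mul_le_mul_of_nonneg_left (hbg.trans ?_) hf0
    have := mul_le_mul_of_nonneg_right (by linarith : 2 * A3 + A4 ≤ C) hy0
    linarith
  have c3 : -(2 * (θ * gam N (fun x => th R x ^ (j + 1) * gD (j + 2) u x)
      (fun x => th R x ^ j * gD (j + 1) u x) z)) ≤ C * f * a := by
    refine (neg_le_abs _).trans (hgam.trans ?_)
    have := mul_le_mul_of_nonneg_right (by linarith : A5 ≤ C) (by positivity : 0 ≤ f * a)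
    linarith
  have hQ : gQ j Λ R u z = f * (Λ + g) := rfl
  have hδ : (2 * (Λ + C1) ^ 2)⁻¹ * gQ j Λ R u z ^ 2 ≤ f ^ 2 / 2 := by
    rw [hQ, inv_mul_le_iff₀ (by positivity), mul_pow]
    have : (Λ + g) ^ 2 ≤ (Λ + C1) ^ 2 := pow_le_pow_left₀ hΛg (by linarith) 2
    have := mul_le_mul_of_nonneg_left this (sq_nonneg f)
    linarith
  rw [hbox]
  linarith

end HigherBound


/-! ### Behaviour of the geometric quantities under reparametrisation -/

section Minkowski

variable {n : ℕ}

theorem ip_comm (x y : Mink n) : ip x y = ip y x := by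
  unfold ip; rw [real_inner_comm, mul_comm]

theorem ip_add_left (x y z : Mink n) : ip (x + y) z = ip x z + ip y z := by
  simp only [ip, Prod.fst_add, Prod.snd_add, inner_add_left]; ring

theorem ip_smul_left (c : ℝ) (x y : Mink n) : ip (c • x) y = c * ip x y := by
  simp only [ip, Prod.smul_fst, Prod.smul_snd, real_inner_smul_left, smul_eq_mul]; ring

theorem ip_add_right (x y z : Mink n) : ip x (y + z) = ip x y + ip x z := by
  rw [ip_comm, ip_add_left, ip_comm y, ip_comm z]

theorem ip_smul_right (c : ℝ) (x y : Mink n) : ip x (c • y) = c * ip x y := by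
  rw [ip_comm, ip_smul_left, ip_comm]

theorem ip_zero_left (x : Mink n) : ip 0 x = 0 := by simp [ip]

theorem ip_zero_right (x : Mink n) : ip x 0 = 0 := by simp [ip]

theorem ip_neg_left (x y : Mink n) : ip (-x) y = -ip x y := by
  rw [← neg_one_smul ℝ, ip_smul_left]; ring

theorem ip_neg_right (x y : Mink n) : ip x (-y) = -ip x y := by
  rw [ip_comm, ip_neg_left, ip_comm]

theorem ip_sub_left (x y z : Mink n) : ip (x - y) z = ip x z - ip y z := by
  rw [sub_eq_add_neg, ip_add_left, ip_neg_left]; ring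

theorem ip_sub_right (x y z : Mink n) : ip x (y - z) = ip x y - ip x z := by
  rw [ip_comm, ip_sub_left, ip_comm y, ip_comm z]

theorem ip_sum_left {ι : Type*} (s : Finset ι) (f : ι → Mink n) (y : Mink n) :
    ip (∑ i ∈ s, f i) y = ∑ i ∈ s, ip (f i) y := by
  classical
  induction s using Finset.induction_on with
  | empty => simp [ip_zero_left]
  | insert a s ha ih => rw [Finset.sum_insert ha, Finset.sum_insert ha, ip_add_left, ih]

theorem ip_sum_right {ι : Type*} (s : Finset ι) (f : ι → Mink n) (y : Mink n) :
    ip y (∑ i ∈ s, f i) = ∑ i ∈ s, ip y (f i) := by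
  simp only [ip_comm y, ip_sum_left]

variable {V : Type*} [NormedAddCommGroup V] [NormedSpace ℝ V] {f g : V → Mink n} {z : V}

theorem SmoothNear.ip (hf : SmoothNear f z) (hg : SmoothNear g z) :
    SmoothNear (fun y => ip (f y) (g y)) z := by
  filter_upwards [hf, hg] with y h1 h2
  exact (h1.fst.inner ℝ h2.fst).sub (h1.snd.mul h2.snd)

theorem hasFDerivAt_ip {f' g' : V →L[ℝ] Mink n} (hf : HasFDerivAt f f' z)
    (hg : HasFDerivAt g g' z) (v : V) :
    fderiv ℝ (fun y => ip (f y) (g y)) z v = ip (f' v) (g z) + ip (f z) (g' v) := by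
  have h1 := (hf.fst.inner ℝ hg.fst).sub (hf.snd.mul hg.snd)
  have h2 : HasFDerivAt (fun y => MinkMCF.ip (f y) (g y)) _ z := h1
  rw [h2.fderiv]
  simp [MinkMCF.ip, fderivInnerCLM_apply]
  ring

theorem dir_ip (hf : SmoothNear f z) (hg : SmoothNear g z) (v : V) :
    dir v (fun y => MinkMCF.ip (f y) (g y)) z
      = MinkMCF.ip (dir v f z) (g z) + MinkMCF.ip (f z) (dir v g z) :=
  hasFDerivAt_ip hf.differentiableAt.hasFDerivAt hg.differentiableAt.hasFDerivAt v

end Minkowski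

section Reparam

variable {n : ℕ}

/-- The standard basis vectors of `ℝⁿ`. -/
abbrev ec (i : Fin n) : Euc n := EuclideanSpace.single i 1

theorem pd_univ {W : Type*} [NormedAddCommGroup W] [NormedSpace ℝ W] (f : Euc n → W) (i : Fin n) :
    pd Set.univ f i = dir (ec i) f := by
  funext x; simp [pd, dir]

section Local

variable {s : Set (Euc n)} {X Y : Euc n → Mink n} {x : Euc n}

theorem pd_eventuallyEq {W : Type*} [NormedAddCommGroup W] [NormedSpace ℝ W] {f g : Euc n → W}
    (hx : s ∈ 𝓝 x) (h : f =ᶠ[𝓝 x] g) (i : Fin n) : pd s f i =ᶠ[𝓝 x] pd Set.univ g i := by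
  filter_upwards [eventually_mem_nhds_iff.2 hx, h.eventuallyEq_nhds] with y hy hfg
  rw [pd_univ, pd, fderivWithin_of_mem_nhds hy, hfg.fderiv_eq]; rfl

theorem metric_eventuallyEq (hx : s ∈ 𝓝 x) (h : X =ᶠ[𝓝 x] Y) :
    metric s X =ᶠ[𝓝 x] metric Set.univ Y := by
  have := eventually_all.2 fun i => pd_eventuallyEq hx h i
  filter_upwards [this] with y hy
  simp only [metric, hy]

theorem christoffel_eventuallyEq (hx : s ∈ 𝓝 x) (h : X =ᶠ[𝓝 x] Y) :
    christoffel s X =ᶠ[𝓝 x] christoffel Set.univ Y := by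
  have hm := metric_eventuallyEq hx h
  have h1 : ∀ᶠ y in 𝓝 x, ∀ a b c, pd s (fun y => metric s X y a b) c y
      = pd Set.univ (fun y => metric Set.univ Y y a b) c y :=
    eventually_all.2 fun a => eventually_all.2 fun b => eventually_all.2 fun c =>
      pd_eventuallyEq hx (hm.mono fun y hy => by simp only [hy]) c
  filter_upwards [h1, hm] with y h1 h2
  funext k i j
  simp only [christoffel, h1, h2]

theorem unitNormal_eventuallyEq (hx : s ∈ 𝓝 x) (h : X =ᶠ[𝓝 x] Y) :
    unitNormal s X =ᶠ[𝓝 x] unitNormal Set.univ Y := by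
  have := eventually_all.2 fun i => pd_eventuallyEq hx h i
  filter_upwards [this, metric_eventuallyEq hx h] with y h1 h2
  simp only [unitNormal, normalPart, h1, h2]

theorem secondForm_eventuallyEq (hx : s ∈ 𝓝 x) (h : X =ᶠ[𝓝 x] Y) :
    secondForm s X =ᶠ[𝓝 x] secondForm Set.univ Y := by
  have : ∀ᶠ y in 𝓝 x, ∀ i j, pd s (pd s X j) i y = pd Set.univ (pd Set.univ Y j) i y :=
    eventually_all.2 fun i => eventually_all.2 fun j =>
      pd_eventuallyEq hx (pd_eventuallyEq hx h j) i
  filter_upwards [this, unitNormal_eventuallyEq hx h] with y h1 h2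
  funext i j
  simp only [secondForm, h1, h2]

theorem meanCurv_eventuallyEq (hx : s ∈ 𝓝 x) (h : X =ᶠ[𝓝 x] Y) :
    meanCurv s X =ᶠ[𝓝 x] meanCurv Set.univ Y := by
  filter_upwards [secondForm_eventuallyEq hx h, metric_eventuallyEq hx h] with y h1 h2
  simp only [meanCurv, h1, h2]

theorem nablaA_eventuallyEq (hx : s ∈ 𝓝 x) (h : X =ᶠ[𝓝 x] Y) (m : ℕ) :
    nablaA s X m =ᶠ[𝓝 x] nablaA Set.univ Y m := by
  induction m with
  | zero =>
    filter_upwards [secondForm_eventuallyEq hx h] with y hy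
    funext I; simp only [nablaA, hy]
  | succ m ih =>
    have h1 : ∀ᶠ y in 𝓝 x, ∀ (I : Fin (m + 2) → Fin n) c,
        pd s (fun y => nablaA s X m y I) c y
          = pd Set.univ (fun y => nablaA Set.univ Y m y I) c y :=
      eventually_all.2 fun I => eventually_all.2 fun c =>
        pd_eventuallyEq hx (ih.mono fun y hy => by simp only [hy]) c
    filter_upwards [h1, ih, christoffel_eventuallyEq hx h] with y h1 h2 h3
    funext I
    simp only [nablaA, covDeriv, h1, h2, h3]

end Local

variable {G : Euc n → Mink n} {φ : Euc n → Euc n} {x : Euc n}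

/-- The Jacobian matrix of `φ`. -/
def jac (φ : Euc n → Euc n) (x : Euc n) : Matrix (Fin n) (Fin n) ℝ :=
  Matrix.of fun a i => dir (ec i) φ x a

/-- Near `x` the map `φ` is a change of parameters and `G` an immersion with nondegenerate induced
metric. -/
structure Reparam (G : Euc n → Mink n) (φ : Euc n → Euc n) (x : Euc n) : Prop where
  smooth_left : SmoothNear G (φ x)
  smooth_right : SmoothNear φ x
  jac_det : (jac φ x).det ≠ 0
  metric_det : (metric Set.univ G (φ x)).det ≠ 0

theorem SmoothNear.metric (hG : SmoothNear G x) (i j : Fin n) :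
    SmoothNear (fun y => metric Set.univ G y i j) x := by
  simp only [MinkMCF.metric, pd_univ, Matrix.of_apply]
  exact (hG.dir _).ip (hG.dir _)

theorem continuousAt_matrix {V : Type*} [TopologicalSpace V] {A : V → Matrix (Fin n) (Fin n) ℝ}
    {z : V} (h : ∀ i j, ContinuousAt (fun y => A y i j) z) : ContinuousAt A z :=
  continuousAt_pi.2 fun i => continuousAt_pi.2 fun j => h i j

theorem SmoothNear.jac (h : SmoothNear φ x) (a i : Fin n) : SmoothNear (fun y => jac φ y a i) x := by
  filter_upwards [h.dir (ec i)] with y hy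
  exact (EuclideanSpace.proj a : Euc n →L[ℝ] ℝ).contDiff.contDiffAt.comp y hy

theorem Reparam.eventually (h : Reparam G φ x) : ∀ᶠ y in 𝓝 x, Reparam G φ y := by
  have c1 : ContinuousAt (fun y => (jac φ y).det) x :=
    Continuous.matrix_det continuous_id |>.continuousAt.comp
      (continuousAt_matrix fun i j => (h.smooth_right.jac i j).continuousAt)
  have c2 : ContinuousAt (fun y => (metric Set.univ G y).det) (φ x) :=
    Continuous.matrix_det continuous_id |>.continuousAt.comp
      (continuousAt_matrix fun i j => (h.smooth_left.metric i j).continuousAt)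
  have c3 := c2.comp (f := φ) (x := x) h.smooth_right.continuousAt
  filter_upwards [h.smooth_right.eventually, h.smooth_right.continuousAt.eventually
    h.smooth_left.eventually, c1.eventually_ne h.jac_det, c3.eventually_ne h.metric_det]
    with y h1 h2 h3 h4 using ⟨h2, h1, h3, h4⟩

theorem euc_eq_sum (v : Euc n) : v = ∑ a, v a • ec a := by
  have := (EuclideanSpace.basisFun (Fin n) ℝ).sum_repr v
  simpa using this.symm

theorem dir_comp {W : Type*} [NormedAddCommGroup W] [NormedSpace ℝ W] {f : Euc n → W}
    (hf : SmoothNear f (φ x)) (hφ : SmoothNear φ x) (i : Fin n) :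
    dir (ec i) (fun y => f (φ y)) x = ∑ a, jac φ x a i • dir (ec a) f (φ x) := by
  have h := hf.differentiableAt.hasFDerivAt.comp x hφ.differentiableAt.hasFDerivAt
  have h' : HasFDerivAt (fun y => f (φ y)) _ x := h
  rw [dir, h'.fderiv, ContinuousLinearMap.comp_apply]
  conv_lhs => rw [euc_eq_sum (fderiv ℝ φ x (ec i)), map_sum]
  exact Finset.sum_congr rfl fun a _ => by rw [map_smul]; rfl

namespace Reparam

theorem dir_dir (h : Reparam G φ x) (i j : Fin n) :
    dir (ec i) (dir (ec j) fun y => G (φ y)) x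
      = ∑ a, dir (ec i) (fun y => jac φ y a j) x • dir (ec a) G (φ x)
        + ∑ b, ∑ a, (jac φ x a j * jac φ x b i) • dir (ec b) (dir (ec a) G) (φ x) := by
  have e : dir (ec j) (fun y => G (φ y)) =ᶠ[𝓝 x]
      fun y => ∑ a, jac φ y a j • dir (ec a) G (φ y) := by
    filter_upwards [h.eventually] with y hy using dir_comp hy.smooth_left hy.smooth_right j
  have hs : ∀ a, SmoothNear (fun y => dir (ec a) G (φ y)) x := fun a =>
    (h.smooth_left.dir (ec a)).comp h.smooth_right
  have hp : ∀ a, SmoothNear (fun y => jac φ y a j • dir (ec a) G (φ y)) x := fun a => by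
    filter_upwards [h.smooth_right.jac a j, hs a] with y h1 h2 using h1.smul h2
  rw [dir_congr' e, dir_sum fun a _ => hp a, Finset.sum_comm, ← Finset.sum_add_distrib]
  refine Finset.sum_congr rfl fun a _ => ?_
  have h1 := ((h.smooth_right.jac a j).differentiableAt.hasFDerivAt).smul
    ((hs a).differentiableAt.hasFDerivAt)
  have h2 : HasFDerivAt (fun y => jac φ y a j • dir (ec a) G (φ y)) _ x := h1
  have h3 := dir_comp (h.smooth_left.dir (ec a)) h.smooth_right i
  rw [dir] at h3 ⊢
  rw [h2.fderiv]
  simp only [add_apply, ContinuousLinearMap.coe_smul', Pi.smul_apply,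
    ContinuousLinearMap.smulRight_apply]
  rw [h3, add_comm, Finset.smul_sum]
  congr 1
  exact Finset.sum_congr rfl fun b _ => by rw [smul_smul]

theorem metric_eq (h : Reparam G φ x) : metric Set.univ (fun y => G (φ y)) x
    = (jac φ x).transpose * metric Set.univ G (φ x) * jac φ x := by
  ext i j
  simp only [metric, pd_univ, Matrix.of_apply, Matrix.mul_apply, Matrix.transpose_apply,
    dir_comp h.smooth_left h.smooth_right, ip_sum_left, ip_sum_right, ip_smul_left, ip_smul_right,
    Finset.sum_mul]
  refine Finset.sum_congr rfl fun a _ => ?_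
  rw [Finset.mul_sum]
  exact Finset.sum_congr rfl fun b _ => by ring

/-- `J g⁻¹ Jᵀ` is the inverse metric in the new parameters. -/
theorem jac_inv_metric (h : Reparam G φ x) :
    jac φ x * (metric Set.univ (fun y => G (φ y)) x)⁻¹ * (jac φ x).transpose
      = (metric Set.univ G (φ x))⁻¹ := by
  have u1 : IsUnit (jac φ x).det := isUnit_iff_ne_zero.2 h.jac_det
  have u2 : IsUnit (jac φ x).transpose.det := by rwa [Matrix.det_transpose]
  rw [h.metric_eq, Matrix.mul_inv_rev, Matrix.mul_inv_rev]
  rw [← Matrix.mul_assoc, Matrix.mul_nonsing_inv _ u1, Matrix.one_mul, Matrix.mul_assoc,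
    Matrix.nonsing_inv_mul _ u2, Matrix.mul_one]

theorem sum_inv_metric (h : Reparam G φ x) (P : Fin n → Fin n → ℝ) :
    ∑ i, ∑ j, (metric Set.univ (fun y => G (φ y)) x)⁻¹ i j
        * ∑ a, ∑ b, jac φ x a i * jac φ x b j * P a b
      = ∑ a, ∑ b, (metric Set.univ G (φ x))⁻¹ a b * P a b := by
  rw [← h.jac_inv_metric]
  generalize (metric Set.univ (fun y => G (φ y)) x)⁻¹ = A
  simp only [Matrix.mul_apply, Matrix.transpose_apply, Finset.sum_mul, Finset.mul_sum]
  have e1 : ∀ i, ∑ j, ∑ a, ∑ b, A i j * (jac φ x a i * jac φ x b j * P a b)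
      = ∑ a, ∑ b, ∑ j, A i j * (jac φ x a i * jac φ x b j * P a b) := fun i => by
    rw [Finset.sum_comm]
    exact Finset.sum_congr rfl fun a _ => Finset.sum_comm
  simp only [e1]
  rw [Finset.sum_comm]
  refine Finset.sum_congr rfl fun a _ => ?_
  rw [Finset.sum_comm]
  refine Finset.sum_congr rfl fun b _ => ?_
  rw [Finset.sum_comm]
  exact Finset.sum_congr rfl fun i _ => Finset.sum_congr rfl fun j _ => by ring

theorem normalPart_eq (h : Reparam G φ x) : normalPart Set.univ (fun y => G (φ y)) x
    = normalPart Set.univ G (φ x) := by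
  unfold normalPart
  congr 1
  simp only [pd_univ, dir_comp h.smooth_left h.smooth_right, ip_sum_right, ip_smul_right]
  -- compare the two sums through their pairings with the coordinate functions
  have key : ∀ L : Mink n →ₗ[ℝ] ℝ, L (∑ i, ∑ j, ((metric Set.univ (fun y => G (φ y)) x)⁻¹ i j
      * ∑ b, jac φ x b j * ip ((0, 1) : Mink n) (dir (ec b) G (φ x)))
        • ∑ a, jac φ x a i • dir (ec a) G (φ x))
      = L (∑ a, ∑ b, ((metric Set.univ G (φ x))⁻¹ a b
        * ip ((0, 1) : Mink n) (dir (ec b) G (φ x))) • dir (ec a) G (φ x)) := by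
    intro L
    simp only [map_sum, map_smul, smul_eq_mul]
    have := h.sum_inv_metric fun a b =>
      ip ((0, 1) : Mink n) (dir (ec b) G (φ x)) * L (dir (ec a) G (φ x))
    refine Eq.trans (Finset.sum_congr rfl fun i _ => Finset.sum_congr rfl fun j _ => ?_)
      (this.trans (Finset.sum_congr rfl fun a _ => Finset.sum_congr rfl fun b _ => by ring))
    rw [mul_assoc]
    congr 1
    rw [Finset.sum_mul_sum, Finset.sum_comm]
    exact Finset.sum_congr rfl fun a _ => Finset.sum_congr rfl fun b _ => by ring
  refine Prod.ext ?_ ?_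
  · ext a
    exact key ((EuclideanSpace.proj a : Euc n →L[ℝ] ℝ).toLinearMap ∘ₗ LinearMap.fst ℝ _ _)
  · exact key (LinearMap.snd ℝ _ _)

theorem unitNormal_eq (h : Reparam G φ x) : unitNormal Set.univ (fun y => G (φ y)) x
    = unitNormal Set.univ G (φ x) := by
  unfold unitNormal; rw [h.normalPart_eq]

end Reparam

theorem ip_pd_normalPart (hdet : (metric Set.univ G x).det ≠ 0) (c : Fin n) :
    ip (dir (ec c) G x) (normalPart Set.univ G x) = 0 := by
  unfold normalPart
  simp only [pd_univ, ip_sub_right, ip_sum_right, ip_smul_right]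
  have u : IsUnit (metric Set.univ G x).det := isUnit_iff_ne_zero.2 hdet
  have h1 := Matrix.mul_nonsing_inv _ u
  have h2 : ∀ j, ∑ i, (metric Set.univ G x) c i * (metric Set.univ G x)⁻¹ i j
      = (1 : Matrix (Fin n) (Fin n) ℝ) c j := fun j => by rw [← h1, Matrix.mul_apply]
  have h3 : ∀ i, ip (dir (ec c) G x) (dir (ec i) G x) = metric Set.univ G x c i := fun i => by
    simp [metric, pd_univ]
  simp only [h3]
  rw [Finset.sum_comm]
  have : ∀ j, ∑ i, (metric Set.univ G x)⁻¹ i j * ip ((0, 1) : Mink n) (dir (ec j) G x)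
      * metric Set.univ G x c i = (1 : Matrix (Fin n) (Fin n) ℝ) c j
        * ip ((0, 1) : Mink n) (dir (ec j) G x) := fun j => by
    rw [← h2, Finset.sum_mul]; exact Finset.sum_congr rfl fun i _ => by ring
  simp only [this, Matrix.one_apply]
  simp [ip_comm]

theorem ip_pd_unitNormal (hdet : (metric Set.univ G x).det ≠ 0) (c : Fin n) :
    ip (dir (ec c) G x) (unitNormal Set.univ G x) = 0 := by
  unfold unitNormal; rw [ip_smul_right, ip_pd_normalPart hdet, mul_zero]

/-- The Christoffel symbols as the tangential components of the second derivatives. -/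
theorem christoffel_eq (hG : SmoothNear G x) (k i j : Fin n) :
    christoffel Set.univ G x k i j = ∑ l, (metric Set.univ G x)⁻¹ k l
      * ip (dir (ec i) (dir (ec j) G) x) (dir (ec l) G x) := by
  have h : ∀ a b c, pd Set.univ (fun y => metric Set.univ G y a b) c x
      = ip (dir (ec c) (dir (ec a) G) x) (dir (ec b) G x)
        + ip (dir (ec a) G x) (dir (ec c) (dir (ec b) G) x) := by
    intro a b c
    simp only [metric, pd_univ, Matrix.of_apply]
    exact dir_ip (hG.dir _) (hG.dir _) _
  have hs : ∀ a b, dir (ec a) (dir (ec b) G) x = dir (ec b) (dir (ec a) G) x := by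
    intro a b
    have := (hG.contDiffAt.of_le two_le_infty).isSymmSndFDerivAt (by simp)
    have hd : DifferentiableAt ℝ (fderiv ℝ G) x :=
      ((hG.contDiffAt.of_le two_le_infty).fderiv_right (m := 1) (by norm_num)).differentiableAt
        (by norm_num)
    have e : ∀ v w : Euc n, dir v (dir w G) x = fderiv ℝ (fderiv ℝ G) x v w := by
      intro v w
      have h1 : HasFDerivAt (fun y => fderiv ℝ G y w) _ x := hd.hasFDerivAt.clm_apply
        (hasFDerivAt_const w x)
      have : dir v (dir w G) x = fderiv ℝ (fun y => fderiv ℝ G y w) x v := rfl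
      rw [this, h1.fderiv]; simp
    rw [e, e]; exact this _ _
  unfold christoffel
  rw [Finset.mul_sum]
  refine Finset.sum_congr rfl fun l _ => ?_
  rw [h, h, h, hs j i, hs l i, hs l j, ip_comm (dir (ec j) G x), ip_comm (dir (ec i) G x)]
  ring

namespace Reparam

/-- The transformation law of the Christoffel symbols. -/
theorem christoffel_law (h : Reparam G φ x) (c i j : Fin n) :
    dir (ec i) (fun y => jac φ y c j) x
      = ∑ k, christoffel Set.univ (fun y => G (φ y)) x k i j * jac φ x c k
        - ∑ b, ∑ a, christoffel Set.univ G (φ x) c b a * (jac φ x b i * jac φ x a j) := by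
  have hX : SmoothNear (fun y => G (φ y)) x := h.smooth_left.comp h.smooth_right
  set Z := dir (ec i) (dir (ec j) fun y => G (φ y)) x with hZ
  have e1 : ∑ k, christoffel Set.univ (fun y => G (φ y)) x k i j * jac φ x c k
      = ∑ e, (metric Set.univ G (φ x))⁻¹ c e * ip Z (dir (ec e) G (φ x)) := by
    simp only [christoffel_eq hX, ← hZ, dir_comp h.smooth_left h.smooth_right, ip_sum_right,
      ip_smul_right]
    rw [← h.jac_inv_metric]
    simp only [Matrix.mul_apply, Matrix.transpose_apply, Finset.sum_mul, Finset.mul_sum]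
    have a1 : ∀ k, ∑ l, ∑ e, (metric Set.univ (fun y => G (φ y)) x)⁻¹ k l
        * (jac φ x e l * ip Z (dir (ec e) G (φ x))) * jac φ x c k
        = ∑ e, ∑ l, (metric Set.univ (fun y => G (φ y)) x)⁻¹ k l
        * (jac φ x e l * ip Z (dir (ec e) G (φ x))) * jac φ x c k := fun k => Finset.sum_comm
    simp only [a1]
    rw [Finset.sum_comm]
    refine Finset.sum_congr rfl fun e _ => ?_
    rw [Finset.sum_comm]
    exact Finset.sum_congr rfl fun k _ => Finset.sum_congr rfl fun l _ => by ring
  have u : IsUnit (metric Set.univ G (φ x)).det := isUnit_iff_ne_zero.2 h.metric_det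
  have h2 : ∀ a, ∑ e, (metric Set.univ G (φ x))⁻¹ c e
      * ip (dir (ec a) G (φ x)) (dir (ec e) G (φ x)) = if c = a then 1 else 0 := by
    intro a
    have := congr_fun (congr_fun (Matrix.nonsing_inv_mul _ u) c) a
    rw [Matrix.mul_apply, Matrix.one_apply] at this
    rw [← this]
    exact Finset.sum_congr rfl fun e _ => by simp [metric, pd_univ, ip_comm]
  rw [e1, hZ, h.dir_dir]
  simp only [ip_add_left, ip_sum_left, ip_smul_left, mul_add, Finset.sum_add_distrib]
  have e2 : ∑ e, (metric Set.univ G (φ x))⁻¹ c e * ∑ a, dir (ec i) (fun y => jac φ y a j) x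
      * ip (dir (ec a) G (φ x)) (dir (ec e) G (φ x)) = dir (ec i) (fun y => jac φ y c j) x := by
    simp only [Finset.mul_sum]
    rw [Finset.sum_comm]
    have : ∀ a, ∑ e, (metric Set.univ G (φ x))⁻¹ c e * (dir (ec i) (fun y => jac φ y a j) x
      * ip (dir (ec a) G (φ x)) (dir (ec e) G (φ x)))
        = dir (ec i) (fun y => jac φ y a j) x * if c = a then 1 else 0 := fun a => by
      rw [← h2, Finset.mul_sum]; exact Finset.sum_congr rfl fun e _ => by ring
    simp [this]
  have e3 : ∑ e, (metric Set.univ G (φ x))⁻¹ c e * ∑ b, ∑ a, jac φ x a j * jac φ x b i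
      * ip (dir (ec b) (dir (ec a) G) (φ x)) (dir (ec e) G (φ x))
      = ∑ b, ∑ a, christoffel Set.univ G (φ x) c b a * (jac φ x b i * jac φ x a j) := by
    simp only [Finset.mul_sum, christoffel_eq h.smooth_left, Finset.sum_mul]
    rw [Finset.sum_comm]
    refine Finset.sum_congr rfl fun b _ => ?_
    rw [Finset.sum_comm]
    exact Finset.sum_congr rfl fun a _ => Finset.sum_congr rfl fun e _ => by ring
  rw [e2, e3]; ring

theorem secondForm_eq (h : Reparam G φ x) (i j : Fin n) :
    secondForm Set.univ (fun y => G (φ y)) x i j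
      = ∑ a, ∑ b, jac φ x a i * jac φ x b j * secondForm Set.univ G (φ x) a b := by
  unfold secondForm
  simp only [pd_univ]
  rw [h.dir_dir, h.unitNormal_eq]
  simp only [ip_add_left, ip_sum_left, ip_smul_left, ip_pd_unitNormal h.metric_det, mul_zero,
    Finset.sum_const_zero, zero_add, mul_neg, Finset.sum_neg_distrib]
  congr 1
  exact Finset.sum_congr rfl fun a _ => Finset.sum_congr rfl fun b _ => by ring

theorem meanCurv_eq (h : Reparam G φ x) :
    meanCurv Set.univ (fun y => G (φ y)) x = meanCurv Set.univ G (φ x) := by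
  unfold meanCurv
  simp only [h.secondForm_eq]
  exact h.sum_inv_metric _

end Reparam

/-- The pull back of a covariant tensor with components `S` under a linear map with matrix `J`. -/
def pull {r : ℕ} (J : Matrix (Fin n) (Fin n) ℝ) (S : (Fin r → Fin n) → ℝ) (I : Fin r → Fin n) : ℝ :=
  ∑ K : Fin r → Fin n, S K * ∏ a, J (K a) (I a)

theorem sum_update_swap {r : ℕ} (a : Fin r) (F : (Fin r → Fin n) → Fin n → ℝ) :
    ∑ K : Fin r → Fin n, ∑ l, F K l
      = ∑ K : Fin r → Fin n, ∑ l, F (Function.update K a l) (K a) := by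
  rw [← Fintype.sum_prod_type' F, ← Fintype.sum_prod_type' fun K l => F (Function.update K a l) (K a)]
  have hinv : Function.Involutive fun p : (Fin r → Fin n) × Fin n =>
      ((Function.update p.1 a p.2, p.1 a) : (Fin r → Fin n) × Fin n) := by
    rintro ⟨K, l⟩; simp
  exact (Equiv.sum_comp (hinv.toPerm _) fun p : (Fin r → Fin n) × Fin n => F p.1 p.2).symm

theorem prod_update_left {r : ℕ} (J : Matrix (Fin n) (Fin n) ℝ) (K I : Fin r → Fin n) (a : Fin r)
    (l : Fin n) : ∏ b, J (Function.update K a l b) (I b)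
      = J l (I a) * ∏ b ∈ Finset.univ.erase a, J (K b) (I b) := by
  rw [← Finset.mul_prod_erase _ _ (Finset.mem_univ a)]
  congr 1
  · simp
  · refine Finset.prod_congr rfl fun b hb => ?_
    rw [Function.update_of_ne (Finset.ne_of_mem_erase hb)]

theorem prod_update_right {r : ℕ} (J : Matrix (Fin n) (Fin n) ℝ) (K I : Fin r → Fin n) (a : Fin r)
    (l : Fin n) : ∏ b, J (K b) (Function.update I a l b)
      = J (K a) l * ∏ b ∈ Finset.univ.erase a, J (K b) (I b) := by
  rw [← Finset.mul_prod_erase _ _ (Finset.mem_univ a)]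
  congr 1
  · simp
  · refine Finset.prod_congr rfl fun b hb => ?_
    rw [Function.update_of_ne (Finset.ne_of_mem_erase hb)]

/-- The covariant derivative commutes with changes of parameters. -/
theorem Reparam.covDeriv_eq {r : ℕ} (h : Reparam G φ x) {S T : Euc n → (Fin r → Fin n) → ℝ}
    (hS : ∀ K, SmoothNear (fun y => S y K) (φ x))
    (hT : ∀ᶠ y in 𝓝 x, T y = pull (jac φ y) (S (φ y))) (I : Fin (r + 1) → Fin n) :
    covDeriv Set.univ (fun y => G (φ y)) T x I
      = pull (jac φ x) (covDeriv Set.univ G S (φ x)) I := by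
  set i := I 0 with hi
  set I' := Fin.tail I with hI'
  set J := jac φ x with hJ
  have hJs : ∀ a b, SmoothNear (fun y => jac φ y a b) x := fun a b => h.smooth_right.jac a b
  have hSs : ∀ K, SmoothNear (fun y => S (φ y) K) x := fun K => (hS K).comp h.smooth_right
  -- the derivative of the pulled back components
  have d1 : pd Set.univ (fun y => T y I') i x
      = ∑ K : Fin r → Fin n, ((∑ d, J d i * dir (ec d) (fun y => S y K) (φ x)) * ∏ a, J (K a) (I' a)
        + S (φ x) K * ∑ a, (∏ b ∈ Finset.univ.erase a, J (K b) (I' b))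
          * dir (ec i) (fun y => jac φ y (K a) (I' a)) x) := by
    rw [pd_univ]
    have e : (fun y => T y I') =ᶠ[𝓝 x]
        fun y => ∑ K : Fin r → Fin n, S (φ y) K * ∏ a, jac φ y (K a) (I' a) := by
      filter_upwards [hT] with y hy; rw [hy]; rfl
    have hp : ∀ K : Fin r → Fin n, SmoothNear (fun y => ∏ a, jac φ y (K a) (I' a)) x := by
      intro K
      have := eventually_all.2 fun a => hJs (K a) (I' a)
      filter_upwards [this] with y hy
      exact contDiffAt_prod fun a _ => hy a
    rw [dir_congr' e, dir_sum fun K _ => (hSs K).mul (hp K)]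
    refine Finset.sum_congr rfl fun K _ => ?_
    rw [dir_mul (hSs K) (hp K), dir_comp (hS K) h.smooth_right]
    congr 2
    have hd := HasFDerivAt.finsetProd (u := Finset.univ) fun a (_ : a ∈ Finset.univ) =>
      (hJs (K a) (I' a)).differentiableAt.hasFDerivAt
    rw [dir, hd.fderiv]
    simp [dir, hJ]
  have d2 : ∀ a j, dir (ec i) (fun y => jac φ y a j) x
      = ∑ k, christoffel Set.univ (fun y => G (φ y)) x k i j * J a k
        - ∑ d, ∑ b, christoffel Set.univ G (φ x) a d b * (J d i * J b j) :=
    fun a j => h.christoffel_law a i j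
  have hTx : T x = pull J (S (φ x)) := hT.self_of_nhds
  rw [covDeriv, d1]
  simp only [d2, hTx]
  -- the terms with the Christoffel symbols of the old parameters cancel
  have c1 : ∑ K : Fin r → Fin n, S (φ x) K * ∑ a, (∏ b ∈ Finset.univ.erase a, J (K b) (I' b))
      * ∑ k, christoffel Set.univ (fun y => G (φ y)) x k i (I' a) * J (K a) k
      = ∑ a, ∑ l, christoffel Set.univ (fun y => G (φ y)) x l i (I' a)
        * pull J (S (φ x)) (Function.update I' a l) := by
    simp only [pull, prod_update_right, Finset.mul_sum]
    rw [Finset.sum_comm]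
    refine Finset.sum_congr rfl fun a _ => ?_
    rw [Finset.sum_comm]
    exact Finset.sum_congr rfl fun l _ => Finset.sum_congr rfl fun K _ => by ring
  -- exchange the summation index with the `a`-th index of the tensor
  have c2 : ∑ K : Fin r → Fin n, S (φ x) K * ∑ a, (∏ b ∈ Finset.univ.erase a, J (K b) (I' b))
      * ∑ d, ∑ b, christoffel Set.univ G (φ x) (K a) d b * (J d i * J b (I' a))
      = ∑ d, ∑ K : Fin r → Fin n, (∑ a, ∑ l, christoffel Set.univ G (φ x) l d (K a)
        * S (φ x) (Function.update K a l)) * (J d i * ∏ a, J (K a) (I' a)) := by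
    have a1 : ∀ a d, ∑ K : Fin r → Fin n, ∑ l, christoffel Set.univ G (φ x) l d (K a)
        * S (φ x) (Function.update K a l) * (J d i * ∏ a, J (K a) (I' a))
        = ∑ K : Fin r → Fin n, ∑ l, S (φ x) K * ((∏ b ∈ Finset.univ.erase a, J (K b) (I' b))
          * (christoffel Set.univ G (φ x) (K a) d l * (J d i * J l (I' a)))) := by
      intro a d
      rw [sum_update_swap a]
      refine Finset.sum_congr rfl fun K _ => Finset.sum_congr rfl fun l _ => ?_
      rw [prod_update_left]
      simp only [Function.update_self, Function.update_idem, Function.update_eq_self]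
      ring
    calc _ = ∑ K : Fin r → Fin n, ∑ d, ∑ a, ∑ l, S (φ x) K
          * ((∏ b ∈ Finset.univ.erase a, J (K b) (I' b))
          * (christoffel Set.univ G (φ x) (K a) d l * (J d i * J l (I' a)))) := by
            refine Finset.sum_congr rfl fun K _ => ?_
            simp only [Finset.mul_sum]
            exact Finset.sum_comm
      _ = ∑ d, ∑ a, ∑ K : Fin r → Fin n, ∑ l, S (φ x) K
          * ((∏ b ∈ Finset.univ.erase a, J (K b) (I' b))
          * (christoffel Set.univ G (φ x) (K a) d l * (J d i * J l (I' a)))) := by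
            rw [Finset.sum_comm]
            exact Finset.sum_congr rfl fun d _ => Finset.sum_comm
      _ = _ := by
            simp only [← a1]
            refine Finset.sum_congr rfl fun d _ => ?_
            rw [Finset.sum_comm]
            simp only [Finset.sum_mul]
  have c3 : pull J (fun I => pd Set.univ (fun y => S y (Fin.tail I)) (I 0) (φ x)
      - ∑ a, ∑ l, christoffel Set.univ G (φ x) l (I 0) (Fin.tail I a)
        * S (φ x) (Function.update (Fin.tail I) a l)) I
      = ∑ d, ∑ K : Fin r → Fin n, (dir (ec d) (fun y => S y K) (φ x)
        - ∑ a, ∑ l, christoffel Set.univ G (φ x) l d (K a)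
          * S (φ x) (Function.update K a l)) * (J d i * ∏ a, J (K a) (I' a)) := by
    rw [pull, ← (Fin.consEquiv fun _ => Fin n).sum_comp, Fintype.sum_prod_type]
    refine Finset.sum_congr rfl fun d _ => Finset.sum_congr rfl fun K _ => ?_
    rw [Fin.prod_univ_succ]
    simp only [Fin.consEquiv, Equiv.coe_fn_mk, Fin.cons_zero, Fin.cons_succ, Fin.tail_cons, pd_univ]
    rfl
  have c4 : covDeriv Set.univ G S (φ x) = fun I => pd Set.univ (fun y => S y (Fin.tail I)) (I 0) (φ x)
      - ∑ a, ∑ l, christoffel Set.univ G (φ x) l (I 0) (Fin.tail I a)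
        * S (φ x) (Function.update (Fin.tail I) a l) := rfl
  rw [c4, c3]
  simp only [mul_sub, sub_mul, Finset.sum_sub_distrib, Finset.sum_add_distrib]
  rw [← c2, c1]
  have c5 : ∑ K : Fin r → Fin n, (∑ d, J d i * dir (ec d) (fun y => S y K) (φ x))
      * ∏ a, J (K a) (I' a) = ∑ d, ∑ K : Fin r → Fin n, dir (ec d) (fun y => S y K) (φ x)
        * (J d i * ∏ a, J (K a) (I' a)) := by
    rw [Finset.sum_comm]
    refine Finset.sum_congr rfl fun K _ => ?_
    rw [Finset.sum_mul]
    exact Finset.sum_congr rfl fun d _ => by ring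
  rw [c5]; ring

/-- The covariant derivatives of the second fundamental form are tensors. -/
theorem Reparam.nablaA_eq (h : Reparam G φ x) (hG : ∀ m K, SmoothNear
    (fun y => nablaA Set.univ G m y K) (φ x)) (m : ℕ) : ∀ᶠ y in 𝓝 x,
    nablaA Set.univ (fun y => G (φ y)) m y = pull (jac φ y) (nablaA Set.univ G m (φ y)) := by
  have hG' : ∀ᶠ y in 𝓝 x, ∀ K, SmoothNear (fun y => nablaA Set.univ G m y K) (φ y) :=
    eventually_all.2 fun K => h.smooth_right.continuousAt.eventually (hG m K).eventually
  induction m with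
  | zero =>
    filter_upwards [h.eventually] with y hy
    funext I
    simp only [nablaA, pull]
    rw [hy.secondForm_eq, ← (finTwoArrowEquiv (Fin n)).symm.sum_comp, Fintype.sum_prod_type]
    refine Finset.sum_congr rfl fun a _ => Finset.sum_congr rfl fun b _ => ?_
    simp [finTwoArrowEquiv, Fin.prod_univ_two]; ring
  | succ m ih =>
    have hm : ∀ᶠ y in 𝓝 x, ∀ K, SmoothNear (fun y => nablaA Set.univ G m y K) (φ y) :=
      eventually_all.2 fun K => h.smooth_right.continuousAt.eventually (hG m K).eventually
    filter_upwards [h.eventually, hm, (ih hm).eventually_nhds] with y h1 h2 h3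
    funext I
    exact h1.covDeriv_eq h2 h3 I

/-- The norm of a tensor does not depend on the coordinates. -/
theorem Reparam.tensorNormSq_eq {r : ℕ} (h : Reparam G φ x) (S : (Fin r → Fin n) → ℝ) :
    tensorNormSq Set.univ (fun y => G (φ y)) x (pull (jac φ x) S)
      = tensorNormSq Set.univ G (φ x) S := by
  unfold tensorNormSq
  rw [← h.jac_inv_metric]
  set A := (metric Set.univ (fun y => G (φ y)) x)⁻¹
  set J := jac φ x
  have key : ∀ K L : Fin r → Fin n, ∏ a, (J * A * J.transpose) (K a) (L a)
      = ∑ I : Fin r → Fin n, ∑ I' : Fin r → Fin n,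
        ∏ a, (J (K a) (I a) * A (I a) (I' a) * J (L a) (I' a)) := by
    intro K L
    have e : ∀ a, (J * A * J.transpose) (K a) (L a)
        = ∑ i, ∑ j, J (K a) i * A i j * J (L a) j := by
      intro a
      simp only [Matrix.mul_apply, Matrix.transpose_apply, Finset.sum_mul]
      exact Finset.sum_comm
    simp only [e]
    rw [Fintype.prod_sum]
    exact Finset.sum_congr rfl fun I _ => Fintype.prod_sum _
  simp only [key, pull, Finset.sum_mul, Finset.mul_sum, Finset.prod_mul_distrib]
  have s1 : ∀ (F : (Fin r → Fin n) → (Fin r → Fin n) → (Fin r → Fin n) → (Fin r → Fin n) → ℝ),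
      ∑ I, ∑ I', ∑ L, ∑ K, F I I' K L = ∑ K, ∑ L, ∑ I, ∑ I', F I I' K L := by
    intro F
    calc ∑ I, ∑ I', ∑ L, ∑ K, F I I' K L = ∑ I, ∑ L, ∑ I', ∑ K, F I I' K L :=
          Finset.sum_congr rfl fun I _ => Finset.sum_comm
      _ = ∑ I, ∑ L, ∑ K, ∑ I', F I I' K L :=
          Finset.sum_congr rfl fun I _ => Finset.sum_congr rfl fun L _ => Finset.sum_comm
      _ = ∑ L, ∑ I, ∑ K, ∑ I', F I I' K L := Finset.sum_comm
      _ = ∑ L, ∑ K, ∑ I, ∑ I', F I I' K L := Finset.sum_congr rfl fun L _ => Finset.sum_comm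
      _ = _ := Finset.sum_comm
  rw [s1 fun I I' K L => _]
  refine Finset.sum_congr rfl fun K _ => Finset.sum_congr rfl fun L _ =>
    Finset.sum_congr rfl fun I _ => Finset.sum_congr rfl fun I' _ => by ring

end Reparam


/-! ### The geometry of a spacelike graph -/

section GraphGeometry

variable {n : ℕ} {v : Euc n → ℝ} {y : Euc n}

/-- The graph parametrisation `x ↦ (x, v x)`. -/
def gmap (v : Euc n → ℝ) (y : Euc n) : Mink n := (y, v y)

theorem smoothNear_gmap (h : SmoothNear v y) : SmoothNear (gmap v) y := by
  filter_upwards [h] with x hx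
  exact contDiffAt_id.prodMk hx

theorem dir_gmap (h : SmoothNear v y) (i : Fin n) :
    dir (ec i) (gmap v) y = (ec i, dir (ec i) v y) := by
  have : HasFDerivAt (gmap v) _ y := (hasFDerivAt_id y).prodMk h.differentiableAt.hasFDerivAt
  rw [dir, this.fderiv]; rfl

theorem dir_dir_gmap (h : SmoothNear v y) (i j : Fin n) :
    dir (ec i) (dir (ec j) (gmap v)) y = (0, dir (ec i) (dir (ec j) v) y) := by
  have e : dir (ec j) (gmap v) =ᶠ[𝓝 y] fun x => (ec j, dir (ec j) v x) := by
    filter_upwards [h.eventually] with x hx using dir_gmap hx j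
  have : HasFDerivAt (fun x => ((ec j : Euc n), dir (ec j) v x)) _ y :=
    (hasFDerivAt_const (ec j : Euc n) y).prodMk (h.dir (ec j)).differentiableAt.hasFDerivAt
  rw [dir_congr' e, dir, this.fderiv]; rfl

theorem metric_gmap (h : SmoothNear v y) : metric Set.univ (gmap v) y
    = Matrix.of fun i j => (if i = j then 1 else 0) - dir (ec i) v y * dir (ec j) v y := by
  ext i j
  simp only [metric, pd_univ, dir_gmap h, Matrix.of_apply, ip]
  congr 1
  simp [EuclideanSpace.inner_single_left, Pi.single_apply]

/-- The inverse metric `δᵢⱼ + νᵢνⱼ` of a graph with gradient `p`. -/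
def ginv (p : Euc n) : Matrix (Fin n) (Fin n) ℝ :=
  Matrix.of fun i j => (if i = j then 1 else 0) + nrm p i * nrm p j

theorem Adm.metric_mul_ginv (h : Adm ec v y) :
    metric Set.univ (gmap v) y * ginv (grad ec v y) = 1 := by
  rw [metric_gmap h.1]
  set p := grad ec v y with hp
  have hw := wgt_sq_mul h.2
  rw [norm_sq_eq_sum, ← hp] at hw
  ext i j
  simp only [ginv, Matrix.mul_apply, Matrix.of_apply, Matrix.one_apply, nrm, ← grad_apply ec v y, ← hp]
  have e : ∀ k, ((if i = k then (1 : ℝ) else 0) - p i * p k)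
      * ((if k = j then 1 else 0) + wgt p * p k * (wgt p * p j))
      = (if i = k then (if k = j then 1 else 0) else 0)
        + (if i = k then wgt p * p k * (wgt p * p j) else 0)
        - (if k = j then p i * p k else 0) - p i * wgt p * wgt p * p j * (p k * p k) := by
    intro k; split_ifs <;> ring
  simp only [e, Finset.sum_sub_distrib, Finset.sum_add_distrib, ← Finset.mul_sum,
    Finset.sum_ite_eq, Finset.sum_ite_eq', Finset.mem_univ, if_true]
  linear_combination (p i * p j) * hw

theorem Adm.metric_det (h : Adm ec v y) : (metric Set.univ (gmap v) y).det ≠ 0 := by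
  have := congr_arg Matrix.det h.metric_mul_ginv
  rw [Matrix.det_mul, Matrix.det_one] at this
  exact left_ne_zero_of_mul_eq_one this

theorem Adm.inv_metric (h : Adm ec v y) :
    (metric Set.univ (gmap v) y)⁻¹ = ginv (grad ec v y) :=
  Matrix.inv_eq_right_inv h.metric_mul_ginv

theorem Adm.normalPart_gmap (h : Adm ec v y) : normalPart Set.univ (gmap v) y
    = (wgt (grad ec v y) ^ 2) • ((grad ec v y, 1) : Mink n) := by
  set p := grad ec v y with hp
  have hw := wgt_sq_mul h.2
  rw [norm_sq_eq_sum, ← hp] at hw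
  have e0 : ∀ j, ip ((0, 1) : Mink n) (dir (ec j) (gmap v) y) = -p j := by
    intro j; rw [dir_gmap h.1]; simp [ip]; rfl
  have e1 : ∀ i, ∑ j, ginv p i j * -p j = -(wgt p ^ 2 * p i) := by
    intro i
    simp only [ginv, Matrix.of_apply, nrm]
    have : ∀ j, ((if i = j then (1 : ℝ) else 0) + wgt p * p i * (wgt p * p j)) * -p j
        = -(if i = j then p j else 0) - wgt p * wgt p * p i * (p j * p j) := by
      intro j; split_ifs <;> ring
    simp only [this, Finset.sum_sub_distrib, Finset.sum_neg_distrib, ← Finset.mul_sum,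
      Finset.sum_ite_eq, Finset.mem_univ, if_true]
    linear_combination p i * hw
  unfold normalPart
  simp only [pd_univ, h.inv_metric, ← hp, e0, ← Finset.sum_smul, e1]
  simp only [dir_gmap h.1]
  refine Prod.ext ?_ ?_
  · rw [Prod.fst_sub, Prod.fst_sum]
    have : ∀ i, ((-(wgt p ^ 2 * p i)) • ((ec i, dir (ec i) v y) : Mink n)).1
        = (-(wgt p ^ 2)) • p i • ec i := fun i => by
      rw [Prod.smul_fst, smul_smul]; congr 1; ring
    simp only [this, ← Finset.smul_sum]
    rw [← euc_eq_sum]; simp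
  · rw [Prod.snd_sub, Prod.snd_sum]
    simp only [Prod.smul_snd, smul_eq_mul, ← grad_apply ec v y, ← hp]
    have : ∀ i, -(wgt p ^ 2 * p i) * p i = -(wgt p ^ 2) * (p i * p i) := fun i => by ring
    simp only [this, ← Finset.mul_sum]
    linear_combination -hw

theorem Adm.unitNormal_gmap (h : Adm ec v y) : unitNormal Set.univ (gmap v) y
    = wgt (grad ec v y) • ((grad ec v y, 1) : Mink n) := by
  unfold unitNormal
  rw [h.normalPart_gmap]
  set p := grad ec v y with hp
  have hw := wgt_sq_mul h.2
  have hw0 := wgt_pos h.2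
  rw [← hp] at hw hw0
  have : -ip (wgt p ^ 2 • ((p, 1) : Mink n)) (wgt p ^ 2 • ((p, 1) : Mink n)) = wgt p ^ 2 := by
    rw [ip_smul_left, ip_smul_right]
    simp only [ip, real_inner_self_eq_norm_sq]
    linear_combination (wgt p ^ 2) * hw
  rw [this, Real.sqrt_sq hw0.le, smul_smul]
  congr 1
  field_simp

theorem Adm.secondForm_gmap (h : Adm ec v y) (i j : Fin n) :
    secondForm Set.univ (gmap v) y i j = wgt (grad ec v y) * iter ec [i, j] v y := by
  unfold secondForm
  rw [pd_univ, pd_univ, dir_dir_gmap h.1, h.unitNormal_gmap]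
  simp [ip, iter]; ring

theorem Adm.meanCurv_gmap (h : Adm ec v y) :
    meanCurv Set.univ (gmap v) y = wgt (grad ec v y) * MinkMCF.lop ec v v y := by
  unfold meanCurv MinkMCF.lop
  simp only [h.secondForm_gmap, h.inv_metric, ginv, Matrix.of_apply, iter]
  have : ∀ i j, ((if i = j then (1 : ℝ) else 0) + nrm (grad ec v y) i * nrm (grad ec v y) j)
      * (wgt (grad ec v y) * dir (ec i) (dir (ec j) v) y)
      = wgt (grad ec v y) * (if i = j then dir (ec i) (dir (ec j) v) y else 0)
        + wgt (grad ec v y) * (nrm (grad ec v y) i * nrm (grad ec v y) j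
          * dir (ec i) (dir (ec j) v) y) := by
    intro i j; split_ifs <;> ring
  simp only [this, Finset.sum_add_distrib, ← Finset.mul_sum, Finset.sum_ite_eq, Finset.mem_univ,
    if_true, mul_add]

theorem contDiffOn_ginv (i j : Fin n) :
    ContDiffOn ℝ ∞ (fun p : Euc n => ginv p i j) (Metric.ball 0 1) :=
  contDiffOn_const.add ((contDiffOn_nrm i).mul (contDiffOn_nrm j))

theorem jetFun_inv_metric (k : ℕ) (i j : Fin n) :
    JetFun (ec (n := n)) k 0 fun v y => (metric Set.univ (gmap v) y)⁻¹ i j :=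
  (JetFun.coef _ (contDiffOn_ginv i j)).congr fun v y h => by rw [h.inv_metric]

theorem jetFun_christoffel (k : ℕ) (hk : 2 ≤ k) (c i j : Fin n) :
    JetFun (ec (n := n)) k 1 fun v y => christoffel Set.univ (gmap v) y c i j := by
  have hp : ∀ l : Fin n, ContDiffOn ℝ ∞ (fun p : Euc n => -p l) (Metric.ball 0 1) := fun l =>
    (EuclideanSpace.proj l : Euc n →L[ℝ] ℝ).contDiff.contDiffOn.neg
  have h1 : JetFun (ec (n := n)) k 1 fun v y => ∑ l, (metric Set.univ (gmap v) y)⁻¹ c l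
      * (iter ec [i, j] v y * -grad ec v y l) :=
    JetFun.sum _ fun l _ => (((jetFun_inv_metric k c l).mul
      ((JetFun.jet [i, j] le_rfl hk).mul (JetFun.coef _ (hp l)))).cast (by simp))
  refine h1.congr fun v y h => ?_
  rw [christoffel_eq (smoothNear_gmap h.1)]
  refine Finset.sum_congr rfl fun l _ => ?_
  rw [dir_dir_gmap h.1, dir_gmap h.1]
  simp [ip, iter, grad_apply]

/-- The components of `∇ᵐA` are polynomials in the derivatives of the graph function, homogeneous of
degree `m + 1` under scaling. -/
theorem jetFun_nablaA (m : ℕ) (I : Fin (m + 2) → Fin n) :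
    JetFun (ec (n := n)) (m + 2) (m + 1) fun v y => nablaA Set.univ (gmap v) m y I := by
  induction m with
  | zero =>
    have h1 : JetFun (ec (n := n)) (0 + 2) (0 + 1) fun v y =>
        wgt (grad ec v y) * iter ec [I 0, I 1] v y :=
      ((JetFun.coef _ contDiffOn_wgt).mul (JetFun.jet [I 0, I 1] le_rfl le_rfl)).cast (by simp)
    exact h1.congr fun v y h => h.secondForm_gmap (I 0) (I 1)
  | succ m ih =>
    have h1 := (ih (Fin.tail I)).dir (by omega) (I 0)
    have h2 : JetFun (ec (n := n)) (m + 1 + 2) (m + 1 + 1) fun v y => ∑ a : Fin (m + 2), ∑ l : Fin n,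
        christoffel Set.univ (gmap v) y l (I 0) (Fin.tail I a)
          * nablaA Set.univ (gmap v) m y (Function.update (Fin.tail I) a l) :=
      JetFun.sum _ fun a _ => JetFun.sum _ fun l _ =>
        ((jetFun_christoffel _ (by omega) _ _ _).mul ((ih _).mono (by omega))).cast (by omega)
    refine ((h1.mono (by omega)).sub h2).congr fun v y h => ?_
    simp only [nablaA, covDeriv, pd_univ]

/-- A scale invariant bound on the derivatives of the graph function bounds `|∇ᵐA|²`. -/
theorem exists_nablaA_bound (n m : ℕ) (K κ : ℝ) (hκ : κ < 1) :
    ∃ C : ℝ, 0 ≤ C ∧ ∀ (v : Euc n → ℝ) (y : Euc n) (l : ℝ), 0 ≤ l → Adm ec v y →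
      ‖grad ec v y‖ ≤ κ →
      (∀ I : List (Fin n), 2 ≤ I.length → I.length ≤ m + 2 →
        |iter ec I v y| ≤ K * l ^ (I.length - 1)) →
      tensorNormSq Set.univ (gmap v) y (nablaA Set.univ (gmap v) m y) ≤ C * l ^ (2 * (m + 1)) := by
  have h : JetFun (ec (n := n)) (m + 2) (2 * (m + 1)) fun v y =>
      tensorNormSq Set.univ (gmap v) y (nablaA Set.univ (gmap v) m y) := by
    unfold tensorNormSq
    refine JetFun.sum _ fun I _ => JetFun.sum _ fun J _ => ?_
    have h1 := JetFun.prod (b := ec (n := n)) (k := m + 2) Finset.univ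
      (F := fun a v y => (metric Set.univ (gmap v) y)⁻¹ (I a) (J a))
      fun a _ => jetFun_inv_metric (m + 2) (I a) (J a)
    exact ((h1.mul (jetFun_nablaA m I)).mul (jetFun_nablaA m J)).cast (by ring)
  obtain ⟨C, hC0, hC⟩ := h.bound K κ hκ
  exact ⟨C, hC0, fun v y l hl hA hg hI => (le_abs_self _).trans (hC v y l hl hA hg hI)⟩

variable {s : Set (Euc n)} {X : Euc n → Mink n} {φ : Euc n → Euc n} {x : Euc n}

theorem Adm.reparam (h : Adm ec v (φ x)) (hφ : SmoothNear φ x) (hJ : (jac φ x).det ≠ 0) :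
    Reparam (gmap v) φ x :=
  ⟨smoothNear_gmap h.1, hφ, hJ, h.metric_det⟩

theorem unitNormal_of_graph (hs : s ∈ 𝓝 x) (hX : X =ᶠ[𝓝 x] fun y => gmap v (φ y))
    (h : Adm ec v (φ x)) (hφ : SmoothNear φ x) (hJ : (jac φ x).det ≠ 0) :
    unitNormal s X x = wgt (grad ec v (φ x)) • ((grad ec v (φ x), 1) : Mink n) := by
  rw [(unitNormal_eventuallyEq hs hX).self_of_nhds, (h.reparam hφ hJ).unitNormal_eq,
    h.unitNormal_gmap]

theorem meanCurv_of_graph (hs : s ∈ 𝓝 x) (hX : X =ᶠ[𝓝 x] fun y => gmap v (φ y))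
    (h : Adm ec v (φ x)) (hφ : SmoothNear φ x) (hJ : (jac φ x).det ≠ 0) :
    meanCurv s X x = wgt (grad ec v (φ x)) * lop ec v v (φ x) := by
  rw [(meanCurv_eventuallyEq hs hX).self_of_nhds, (h.reparam hφ hJ).meanCurv_eq,
    h.meanCurv_gmap]

/-- A parametrised hypersurface that lies on the graph of `v` near a point has the geometric quantities
of the graph. -/
theorem tensorNormSq_nablaA_of_graph (hs : s ∈ 𝓝 x) (hX : X =ᶠ[𝓝 x] fun y => gmap v (φ y))
    (h : Adm ec v (φ x)) (hφ : SmoothNear φ x) (hJ : (jac φ x).det ≠ 0) (m : ℕ) :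
    tensorNormSq s X x (nablaA s X m x)
      = tensorNormSq Set.univ (gmap v) (φ x) (nablaA Set.univ (gmap v) m (φ x)) := by
  have h1 := h.reparam hφ hJ
  have h2 := (h1.nablaA_eq (fun m K => (jetFun_nablaA m K).smoothNear h) m).self_of_nhds
  rw [← h1.tensorNormSq_eq, ← h2, (nablaA_eventuallyEq hs hX m).self_of_nhds]
  unfold tensorNormSq
  rw [(metric_eventuallyEq hs hX).self_of_nhds]

end GraphGeometry

section Slice

variable {n : ℕ} {u : ST n → ℝ} {x : Euc n} {t : ℝ}

theorem contDiff_slice (t : ℝ) : ContDiff ℝ ∞ fun x : Euc n => ((x, t) : ST n) := by fun_prop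

theorem tendsto_slice (x : Euc n) (t : ℝ) :
    Tendsto (fun x' : Euc n => ((x', t) : ST n)) (𝓝 x) (𝓝 (x, t)) :=
  (contDiff_slice t).continuous.continuousAt

theorem iter_slice (h : SmoothNear u (x, t)) (I : List (Fin n)) :
    (fun y => iter ec I (fun x => u (x, t)) y) =ᶠ[𝓝 x] fun y => iter eb I u (y, t) := by
  induction I with
  | nil => exact EventuallyEq.rfl
  | cons i I ih =>
    filter_upwards [ih.eventuallyEq_nhds, (tendsto_slice x t).eventually h.eventually]
      with y h1 h2
    have h3 : iter ec (i :: I) (fun x => u (x, t)) y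
        = dir (ec i) (fun y => iter eb I u (y, t)) y := dir_congr' h1 _
    have hs : HasFDerivAt (𝕜 := ℝ) (fun x : Euc n => ((x, t) : ST n)) _ y :=
      (hasFDerivAt_id y).prodMk (hasFDerivAt_const t y)
    have h4 : HasFDerivAt (fun y => iter eb I u (y, t)) _ y :=
      (h2.iter (b := eb) I).differentiableAt.hasFDerivAt.comp y hs
    rw [h3, dir, h4.fderiv]; rfl

theorem grad_slice (h : SmoothNear u (x, t)) : grad ec (fun x => u (x, t)) x = grad eb u (x, t) := by
  ext i
  exact (iter_slice h [i]).self_of_nhds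

theorem Adm.slice (h : Adm eb u (x, t)) : Adm ec (fun x => u (x, t)) x := by
  refine ⟨?_, by rw [grad_slice h.1]; exact h.2⟩
  exact h.1.comp (f := fun x : Euc n => ((x, t) : ST n)) (ContDiff.smoothNear (contDiff_slice t) x)

end Slice


/-! ### Local graph representations -/

section InverseFunction

variable {V W : Type*} [NormedAddCommGroup V] [NormedSpace ℝ V] [NormedAddCommGroup W]
  [NormedSpace ℝ W] [FiniteDimensional ℝ V] [FiniteDimensional ℝ W]

/-- The smooth inverse function theorem, with smoothness of the inverse on a neighbourhood. -/
theorem exists_smooth_inverse {φ : V → W} {x : V} (h : SmoothNear φ x)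
    (hinj : ∀ w, fderiv ℝ φ x w = 0 → w = 0)
    (hdim : Module.finrank ℝ V = Module.finrank ℝ W) :
    ∃ ψ : W → V, SmoothNear ψ (φ x) ∧ ψ (φ x) = x ∧ (∀ᶠ y in 𝓝 (φ x), φ (ψ y) = y) ∧
      ∀ᶠ x' in 𝓝 x, ψ (φ x') = x' := by
  have : CompleteSpace V := FiniteDimensional.complete ℝ V
  have key : ∀ y, (∀ w, fderiv ℝ φ y w = 0 → w = 0) →
      ∃ e : V ≃L[ℝ] W, (e : V →L[ℝ] W) = fderiv ℝ φ y := by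
    intro y hy
    have hi : Function.Injective (fderiv ℝ φ y).toLinearMap :=
      (injective_iff_map_eq_zero _).2 hy
    refine ⟨(LinearEquiv.ofInjectiveOfFinrankEq _ hi hdim).toContinuousLinearEquiv, ?_⟩
    ext w; rfl
  obtain ⟨e, he⟩ := key x hinj
  have hd : HasFDerivAt φ (e : V →L[ℝ] W) x := he ▸ h.differentiableAt.hasFDerivAt
  have hn : (∞ : WithTop ℕ∞) ≠ 0 := by simp
  set R := h.contDiffAt.toOpenPartialHomeomorph φ hd hn with hR
  have hxs : x ∈ R.source := ContDiffAt.mem_toOpenPartialHomeomorph_source _ _ _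
  have hys : φ x ∈ R.target := ContDiffAt.image_mem_toOpenPartialHomeomorph_target _ _ _
  have hRx : R.symm (φ x) = x := R.left_inv hxs
  have hc : ContinuousAt R.symm (φ x) := R.continuousAt_symm hys
  refine ⟨R.symm, ?_, hRx, ?_, ?_⟩
  · -- invertibility of the derivative is an open condition
    have ho : ∀ᶠ y in 𝓝 x, ∃ e : V ≃L[ℝ] W, (e : V →L[ℝ] W) = fderiv ℝ φ y := by
      have c : ContinuousAt (fderiv ℝ φ) x :=
        (h.contDiffAt.fderiv_right (m := 0) (by simp)).continuousAt
      exact c.eventually (he ▸ ContinuousLinearEquiv.isOpen.mem_nhds ⟨e, rfl⟩)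
    have h2 : ∀ᶠ y in 𝓝 (R.symm (φ x)), SmoothNear φ y ∧
        ∃ e : V ≃L[ℝ] W, (e : V →L[ℝ] W) = fderiv ℝ φ y := by
      rw [hRx]; exact h.eventually.and ho
    filter_upwards [R.open_target.mem_nhds hys, hc.eventually h2] with y hy ⟨h3, e', he'⟩
    exact R.contDiffAt_symm hy (f₀' := e') (he' ▸ h3.differentiableAt.hasFDerivAt) h3.contDiffAt
  · filter_upwards [R.open_target.mem_nhds hys] with y hy using R.right_inv hy
  · filter_upwards [R.open_source.mem_nhds hxs] with y hy using R.left_inv hy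

end InverseFunction

section Spacelike

variable {n : ℕ} {s : Set (Euc n)} {X : Euc n → Mink n} {x : Euc n}

theorem fderivWithin_eq_sum_pd (w : Euc n) :
    fderivWithin ℝ X s x w = ∑ i, w i • pd s X i x := by
  conv_lhs => rw [euc_eq_sum w, map_sum]
  exact Finset.sum_congr rfl fun i _ => by rw [map_smul]; rfl

theorem ip_fderivWithin (w w' : Euc n) :
    ip (fderivWithin ℝ X s x w) (fderivWithin ℝ X s x w')
      = ∑ i, ∑ j, w i * w' j * metric s X x i j := by
  rw [fderivWithin_eq_sum_pd w, fderivWithin_eq_sum_pd w', ip_sum_left]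
  refine Finset.sum_congr rfl fun i _ => ?_
  rw [ip_smul_left, ip_sum_right, Finset.mul_sum]
  refine Finset.sum_congr rfl fun j _ => ?_
  rw [ip_smul_right, metric, Matrix.of_apply]; ring

theorem posDef_iff : (metric s X x).PosDef ↔
    ∀ w : Euc n, w ≠ 0 → 0 < ip (fderivWithin ℝ X s x w) (fderivWithin ℝ X s x w) := by
  have key : ∀ w : Euc n, dotProduct (star (w : Fin n → ℝ)) ((metric s X x).mulVec w)
      = ip (fderivWithin ℝ X s x w) (fderivWithin ℝ X s x w) := by
    intro w
    rw [ip_fderivWithin]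
    simp only [dotProduct, Matrix.mulVec, Finset.mul_sum, star_trivial]
    exact Finset.sum_congr rfl fun i _ => Finset.sum_congr rfl fun j _ => by ring
  constructor
  · intro h w hw
    rw [← key]
    refine h.dotProduct_mulVec_pos fun h0 => hw ?_
    ext i; exact congr_fun h0 i
  · intro h
    refine Matrix.PosDef.of_dotProduct_mulVec_pos ?_ fun w hw => ?_
    · ext i j
      simp [metric, ip_comm]
    · have := key (WithLp.toLp 2 w)
      rw [show ((WithLp.toLp 2 w : Euc n) : Fin n → ℝ) = w from rfl] at this
      rw [this]
      refine h _ fun h0 => hw ?_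
      funext i
      exact congr_arg (fun v : Euc n => v i) h0

/-- The vertical projection of a spacelike vector does not vanish. -/
theorem fst_ne_zero_of_spacelike {a : Mink n} (h : 0 < ip a a) : a.1 ≠ 0 := by
  intro h0
  simp only [ip, h0, inner_zero_left, zero_sub] at h
  nlinarith [mul_self_nonneg a.2]

/-- `D(πX)(x)` is injective for a spacelike immersion `X`. -/
theorem fst_fderivWithin_injective (h : (metric s X x).PosDef) (w : Euc n)
    (hw : (fderivWithin ℝ X s x w).1 = 0) : w = 0 := by
  by_contra h0
  exact fst_ne_zero_of_spacelike (posDef_iff.1 h w h0) hw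

theorem jac_det_ne_zero {φ : Euc n → Euc n} (h : ∀ w, fderiv ℝ φ x w = 0 → w = 0) :
    (jac φ x).det ≠ 0 := by
  intro h0
  obtain ⟨w, hw, hw0⟩ := Matrix.exists_mulVec_eq_zero_iff.2 h0
  refine hw ?_
  have : fderiv ℝ φ x (WithLp.toLp 2 w) = 0 := by
    rw [euc_eq_sum (WithLp.toLp 2 w), map_sum]
    ext a
    have := congr_fun hw0 a
    simp only [Matrix.mulVec, dotProduct, jac, Matrix.of_apply, dir] at this
    simp only [map_smul, WithLp.ofLp_sum, Finset.sum_apply, PiLp.smul_apply, smul_eq_mul]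
    simpa [mul_comm] using this
  have h1 := h _ this
  funext i
  exact congr_arg (fun v : Euc n => v i) h1

end Spacelike

section GraphAt

variable {n : ℕ} [NeZero n] {M : Type*} [TopologicalSpace M]
  [ChartedSpace (EuclideanHalfSpace n) M]

/-- Near the interior point `p` the hypersurface `f` is the graph of `v`, and `f` followed by the
vertical projection is an open map at `p`. -/
structure GraphAt (f : M → Mink n) (p : M) (v : Euc n → ℝ) : Prop where
  adm : Adm ec v (f p).1
  graph : ∀ᶠ q in 𝓝 p, (f q).2 = v (f q).1
  isOpen : 𝓝 (f p).1 ≤ map (fun q => (f q).1) (𝓝 p)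

/-- `f` is smooth near the interior point `p`, in the preferred chart, and spacelike at `p`. -/
structure SmoothAt (f : M → Mink n) (p : M) : Prop where
  interior : (𝓡∂ n).IsInteriorPoint p
  smooth : SmoothNear (localRep f p) (extChartAt (𝓡∂ n) p p)
  spacelike : (metric (Set.range (𝓡∂ n)) (localRep f p) (extChartAt (𝓡∂ n) p p)).PosDef

variable {f : M → Mink n} {p : M} {v : Euc n → ℝ}

theorem localRep_self (f : M → Mink n) (p : M) : localRep f p (extChartAt (𝓡∂ n) p p) = f p := by
  simp only [localRep, Function.comp_apply, extChartAt_to_inv]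

theorem tendsto_extChartAt_symm (p : M) :
    Tendsto (extChartAt (𝓡∂ n) p).symm (𝓝 (extChartAt (𝓡∂ n) p p)) (𝓝 p) := by
  have := continuousAt_extChartAt_symm (I := 𝓡∂ n) p
  rw [ContinuousAt, extChartAt_to_inv] at this
  exact this

namespace SmoothAt

theorem range_mem (h : SmoothAt f p) : Set.range (𝓡∂ n) ∈ 𝓝 (extChartAt (𝓡∂ n) p p) :=
  range_mem_nhds_isInteriorPoint h.interior

theorem fst_smooth (h : SmoothAt f p) :
    SmoothNear (fun y => (localRep f p y).1) (extChartAt (𝓡∂ n) p p) := by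
  filter_upwards [h.smooth] with y hy using hy.fst

theorem snd_smooth (h : SmoothAt f p) :
    SmoothNear (fun y => (localRep f p y).2) (extChartAt (𝓡∂ n) p p) := by
  filter_upwards [h.smooth] with y hy using hy.snd

theorem fderivWithin_eq (h : SmoothAt f p) :
    fderivWithin ℝ (localRep f p) (Set.range (𝓡∂ n)) (extChartAt (𝓡∂ n) p p)
      = fderiv ℝ (localRep f p) (extChartAt (𝓡∂ n) p p) :=
  fderivWithin_of_mem_nhds h.range_mem

theorem fderiv_fst (h : SmoothAt f p) (w : Euc n) :
    fderiv ℝ (fun y => (localRep f p y).1) (extChartAt (𝓡∂ n) p p) w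
      = (fderiv ℝ (localRep f p) (extChartAt (𝓡∂ n) p p) w).1 := by
  have := h.smooth.differentiableAt.hasFDerivAt.fst
  rw [this.fderiv]; rfl

theorem injective (h : SmoothAt f p) (w : Euc n)
    (hw : fderiv ℝ (fun y => (localRep f p y).1) (extChartAt (𝓡∂ n) p p) w = 0) : w = 0 := by
  rw [h.fderiv_fst, ← h.fderivWithin_eq] at hw
  exact fst_fderivWithin_injective h.spacelike w hw

theorem eventuallyEq_gmap (hg : ∀ᶠ q in 𝓝 p, (f q).2 = v (f q).1) :
    localRep f p =ᶠ[𝓝 (extChartAt (𝓡∂ n) p p)] fun y => gmap v (localRep f p y).1 := by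
  filter_upwards [(tendsto_extChartAt_symm p).eventually hg] with y hy
  exact Prod.ext rfl hy

/-- The gradient of a graph function of a spacelike hypersurface has length less than one. -/
theorem norm_grad_lt (h : SmoothAt f p) (hv : SmoothNear v (f p).1)
    (hg : ∀ᶠ q in 𝓝 p, (f q).2 = v (f q).1) : ‖grad ec v (f p).1‖ < 1 := by
  set x := extChartAt (𝓡∂ n) p p with hx
  set φ : Euc n → Euc n := fun y => (localRep f p y).1 with hφ
  have hφx : φ x = (f p).1 := by rw [hφ, hx]; simp only [localRep_self]
  set D := fderiv ℝ φ x with hD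
  have hsurj : Function.Surjective D := by
    have : Function.Injective D.toLinearMap := (injective_iff_map_eq_zero _).2 h.injective
    exact LinearMap.injective_iff_surjective.1 this
  set g := grad ec v (f p).1 with hg'
  obtain ⟨w, hw⟩ := hsurj g
  rcases eq_or_ne g 0 with h0 | h0
  · rw [h0]; simp
  have hw0 : w ≠ 0 := by rintro rfl; rw [map_zero] at hw; exact h0 hw.symm
  have hpos := posDef_iff.1 h.spacelike w hw0
  rw [h.fderivWithin_eq, ← hx] at hpos
  have e1 : (fderiv ℝ (localRep f p) x w).1 = g := by rw [← hw, hD, ← h.fderiv_fst]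
  have e2 : (fderiv ℝ (localRep f p) x w).2 = ‖g‖ ^ 2 := by
    have a1 := h.smooth.differentiableAt.hasFDerivAt.snd
    have a2 : (fun y => (localRep f p y).2) =ᶠ[𝓝 x] fun y => v (φ y) := by
      filter_upwards [(tendsto_extChartAt_symm p).eventually hg] with y hy using hy
    rw [← hφx] at hv
    have a3 : HasFDerivAt (fun y => v (φ y)) _ x :=
      hv.differentiableAt.hasFDerivAt.comp x h.fst_smooth.differentiableAt.hasFDerivAt
    have a4 : (fderiv ℝ (localRep f p) x w).2 = fderiv ℝ (fun y => (localRep f p y).2) x w := by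
      rw [a1.fderiv]; rfl
    rw [a4, a2.fderiv_eq, a3.fderiv, ContinuousLinearMap.comp_apply]
    change fderiv ℝ v (φ x) (D w) = _
    rw [hw]
    conv_lhs => rw [euc_eq_sum g, map_sum]
    rw [norm_sq_eq_sum, hφx]
    exact Finset.sum_congr rfl fun i _ => by rw [map_smul]; rfl
  simp only [ip, e1, e2, real_inner_self_eq_norm_sq] at hpos
  have hg0 : 0 < ‖g‖ := norm_pos_iff.2 h0
  by_contra! hlt
  have : ‖g‖ ^ 2 * 1 ≤ ‖g‖ ^ 2 * ‖g‖ ^ 2 :=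
    mul_le_mul_of_nonneg_left (one_le_pow₀ hlt) (by positivity)
  linarith

theorem exists_graphAt (h : SmoothAt f p) : ∃ v, GraphAt f p v := by
  set x := extChartAt (𝓡∂ n) p p with hx
  set φ : Euc n → Euc n := fun y => (localRep f p y).1 with hφ
  have hφx : φ x = (f p).1 := by rw [hφ, hx]; simp only [localRep_self]
  obtain ⟨ψ, h1, h2, h3, h4⟩ := exists_smooth_inverse h.fst_smooth h.injective rfl
  have h1' : SmoothNear ψ (f p).1 := hφx ▸ h1
  have hψ : ψ (f p).1 = x := hφx ▸ h2
  have hv : SmoothNear (fun y => (localRep f p (ψ y)).2) (f p).1 := by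
    have := h.snd_smooth
    rw [← hx, ← hψ] at this
    exact this.comp h1'
  have hgr : ∀ᶠ q in 𝓝 p, (f q).2 = (localRep f p (ψ (f q).1)).2 := by
    filter_upwards [(continuousAt_extChartAt (I := 𝓡∂ n) p).eventually h4,
      extChartAt_source_mem_nhds (I := 𝓡∂ n) p] with q hq hqs
    simp only [localRep, Function.comp_apply, (extChartAt (𝓡∂ n) p).left_inv hqs] at hq
    rw [hq]
    simp only [localRep, Function.comp_apply, (extChartAt (𝓡∂ n) p).left_inv hqs]
  refine ⟨_, ⟨hv, h.norm_grad_lt hv hgr⟩, hgr, ?_⟩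
  have h3' : ∀ᶠ y in 𝓝 (f p).1, φ (ψ y) = y := hφx ▸ h3
  have hc : Tendsto ψ (𝓝 (f p).1) (𝓝 x) := by
    have := h1'.continuousAt; rwa [ContinuousAt, hψ] at this
  calc 𝓝 (f p).1 = map (fun y => φ (ψ y)) (𝓝 (f p).1) := by rw [map_congr h3', map_id']
    _ = map φ (map ψ (𝓝 (f p).1)) := (map_map ..).symm
    _ ≤ map φ (𝓝 x) := map_mono hc
    _ = map (fun q => (f q).1) (map (extChartAt (𝓡∂ n) p).symm (𝓝 x)) := (map_map ..).symm
    _ ≤ map (fun q => (f q).1) (𝓝 p) := map_mono (tendsto_extChartAt_symm p)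

end SmoothAt

namespace SmoothAt

theorem normalAt_eq (h : SmoothAt f p) (ha : Adm ec v (f p).1)
    (hg : ∀ᶠ q in 𝓝 p, (f q).2 = v (f q).1) : normalAt f p
    = wgt (grad ec v (f p).1) • ((grad ec v (f p).1, 1) : Mink n) := by
  have ha' : Adm ec v (localRep f p (extChartAt (𝓡∂ n) p p)).1 := by rw [localRep_self]; exact ha
  have := unitNormal_of_graph h.range_mem (eventuallyEq_gmap hg) ha' h.fst_smooth
    (jac_det_ne_zero h.injective)
  rwa [localRep_self] at this

theorem meanCurvAt_eq (h : SmoothAt f p) (ha : Adm ec v (f p).1)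
    (hg : ∀ᶠ q in 𝓝 p, (f q).2 = v (f q).1) : meanCurvAt f p
    = wgt (grad ec v (f p).1) * lop ec v v (f p).1 := by
  have ha' : Adm ec v (localRep f p (extChartAt (𝓡∂ n) p p)).1 := by rw [localRep_self]; exact ha
  have := meanCurv_of_graph h.range_mem (eventuallyEq_gmap hg) ha' h.fst_smooth
    (jac_det_ne_zero h.injective)
  rwa [localRep_self] at this

theorem nablaASq_eq (h : SmoothAt f p) (ha : Adm ec v (f p).1)
    (hg : ∀ᶠ q in 𝓝 p, (f q).2 = v (f q).1) (m : ℕ) : nablaASq f m p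
    = tensorNormSq Set.univ (gmap v) (f p).1 (nablaA Set.univ (gmap v) m (f p).1) := by
  have ha' : Adm ec v (localRep f p (extChartAt (𝓡∂ n) p p)).1 := by rw [localRep_self]; exact ha
  have := tensorNormSq_nablaA_of_graph h.range_mem (eventuallyEq_gmap hg) ha' h.fst_smooth
    (jac_det_ne_zero h.injective) m
  rwa [localRep_self] at this

end SmoothAt

namespace GraphAt

/-- The germ of the graph function is unique. -/
theorem eventuallyEq (hg : GraphAt f p v) {v' : Euc n → ℝ}
    (hg' : ∀ᶠ q in 𝓝 p, (f q).2 = v' (f q).1) : v =ᶠ[𝓝 (f p).1] v' := by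
  refine hg.isOpen ?_
  rw [mem_map]
  filter_upwards [hg.graph, hg'] with q h1 h2
  exact h1.symm.trans h2

end GraphAt

end GraphAt


/-! ### Space-time graph representations of the flow -/

section FlowAt

variable {n : ℕ} [NeZero n] {M : Type*} [TopologicalSpace M]
  [ChartedSpace (EuclideanHalfSpace n) M]

/-- The map `(q, t) ↦ (πF(q, t), t)`. -/
def stProj (F : M → ℝ → Mink n) (z : M × ℝ) : ST n := ((F z.1 z.2).1, z.2)

/-- Near the interior space-time point `(p, t)` the flow is the graph of `u`. -/
structure FlowAt (F : M → ℝ → Mink n) (p : M) (t : ℝ) (u : ST n → ℝ) : Prop where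
  flow : FlowGraph u (stProj F (p, t))
  graph : ∀ᶠ z in 𝓝 (p, t), (F z.1 z.2).2 = u (stProj F z)
  isOpen : 𝓝 (stProj F (p, t)) ≤ map (stProj F) (𝓝 (p, t))

variable {F : M → ℝ → Mink n} {p : M} {t : ℝ} {u : ST n → ℝ}

/-- Maxima over the past transfer to the local graph. -/
theorem FlowAt.eventually_le (h : FlowAt F p t u) {Ψ : M × ℝ → ℝ} {f : ST n → ℝ}
    (hf : ∀ᶠ z in 𝓝 (p, t), Ψ z = f (stProj F z))
    (hmax : ∀ᶠ z in 𝓝 (p, t), z.2 ≤ t → Ψ z ≤ Ψ (p, t)) :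
    ∀ᶠ y in 𝓝 (stProj F (p, t)), y.2 ≤ (stProj F (p, t)).2 → f y ≤ f (stProj F (p, t)) := by
  refine h.isOpen ?_
  rw [mem_map]
  filter_upwards [hf, hmax] with z h1 h2 h3
  have := h2 h3
  rwa [h1, hf.self_of_nhds] at this

variable [IsManifold (𝓡∂ n) ∞ M] {S : Euc n → Euc n} {F₀ : M → Mink n} {T : ℝ}

theorem isInteriorPoint_of_mem {x : Euc n} (hx : x ∈ interior (extChartAt (𝓡∂ n) p).target) :
    (𝓡∂ n).IsInteriorPoint ((extChartAt (𝓡∂ n) p).symm x) := by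
  have hs : (extChartAt (𝓡∂ n) p).symm x ∈ (chartAt (EuclideanHalfSpace n) p).source := by
    have := (extChartAt (𝓡∂ n) p).map_target (interior_subset hx)
    rwa [extChartAt_source] at this
  rw [ModelWithCorners.isInteriorPoint_iff_of_mem_atlas (n := ∞) (by simp)
    (chart_mem_atlas _ p) hs]
  have := (extChartAt (𝓡∂ n) p).right_inv (interior_subset hx)
  change (extChartAt (𝓡∂ n) p) ((extChartAt (𝓡∂ n) p).symm x) ∈ interior (extChartAt (𝓡∂ n) p).target
  rwa [this]

theorem mem_interior_of_isInteriorPoint {q : M} (hq : (𝓡∂ n).IsInteriorPoint q)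
    (hqs : q ∈ (extChartAt (𝓡∂ n) p).source) :
    extChartAt (𝓡∂ n) p q ∈ interior (extChartAt (𝓡∂ n) p).target := by
  rw [extChartAt_source] at hqs
  exact (ModelWithCorners.isInteriorPoint_iff_of_mem_atlas (n := ∞) (by simp)
    (chart_mem_atlas _ p) hqs).1 hq

/-- The flow in a chart of the manifold. -/
def stRep (F : M → ℝ → Mink n) (p : M) (z : ST n) : Mink n :=
  F ((extChartAt (𝓡∂ n) p).symm z.1) z.2

namespace IsNeumannMCF

theorem contDiffOn_stRep (hF : IsNeumannMCF S F₀ T F) (p : M) :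
    ContDiffOn ℝ ∞ (stRep F p) (interior (extChartAt (𝓡∂ n) p).target ×ˢ Set.Icc 0 T) := by
  rw [← contMDiffOn_iff_contDiffOn]
  have h1 : ContMDiffOn 𝓘(ℝ, ST n) (𝓡∂ n) ∞
      (fun z : ST n => (extChartAt (𝓡∂ n) p).symm z.1)
      (interior (extChartAt (𝓡∂ n) p).target ×ˢ Set.Icc 0 T) := by
    refine (contMDiffOn_extChartAt_symm (I := 𝓡∂ n) (n := ∞) p).comp
      (contDiff_fst.contMDiff.contMDiffOn) fun z hz => ?_
    exact interior_subset (s := (extChartAt (𝓡∂ n) p).target) hz.1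
  have h2 : ContMDiffOn 𝓘(ℝ, ST n) 𝓘(ℝ, ℝ) ∞ (fun z : ST n => z.2)
      (interior (extChartAt (𝓡∂ n) p).target ×ˢ Set.Icc 0 T) := contDiff_snd.contMDiff.contMDiffOn
  refine hF.smooth.comp (h1.prodMk h2) fun z hz => ⟨⟨Set.mem_univ _, hz.2⟩, fun hb => ?_⟩
  exact ((𝓡∂ n).isInteriorPoint_iff_not_isBoundaryPoint _).1 (isInteriorPoint_of_mem hz.1) hb.1

theorem smoothAt (hF : IsNeumannMCF S F₀ T F) (hp : (𝓡∂ n).IsInteriorPoint p)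
    (ht : t ∈ Set.Icc 0 T) : SmoothAt (fun q => F q t) p where
  interior := hp
  smooth := by
    have hx : extChartAt (𝓡∂ n) p p ∈ interior (extChartAt (𝓡∂ n) p).target :=
      mem_interior_of_isInteriorPoint hp (mem_extChartAt_source p)
    filter_upwards [isOpen_interior.mem_nhds hx] with x hx
    have h1 : ContDiffOn ℝ ∞ (fun x => stRep F p (x, t))
        (interior (extChartAt (𝓡∂ n) p).target) :=
      (hF.contDiffOn_stRep p).comp (contDiff_slice t).contDiffOn fun x hx => ⟨hx, ht⟩
    exact h1.contDiffAt (isOpen_interior.mem_nhds hx)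
  spacelike := hF.spacelike t ht p

theorem smoothNear_stRep (hF : IsNeumannMCF S F₀ T F) (hp : (𝓡∂ n).IsInteriorPoint p)
    (ht : t ∈ Set.Ioo 0 T) : SmoothNear (stRep F p) (extChartAt (𝓡∂ n) p p, t) := by
  have hx : extChartAt (𝓡∂ n) p p ∈ interior (extChartAt (𝓡∂ n) p).target :=
    mem_interior_of_isInteriorPoint hp (mem_extChartAt_source p)
  have ho : IsOpen (interior (extChartAt (𝓡∂ n) p).target ×ˢ Set.Ioo 0 T) :=
    isOpen_interior.prod isOpen_Ioo
  filter_upwards [ho.mem_nhds ⟨hx, ht⟩] with z hz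
  exact ((hF.contDiffOn_stRep p).mono (Set.prod_mono le_rfl Set.Ioo_subset_Icc_self)).contDiffAt
    (ho.mem_nhds hz)

theorem continuousAt (hF : IsNeumannMCF S F₀ T F) (p : M) (ht : t ∈ Set.Ioo 0 T) :
    ContinuousAt (fun z : M × ℝ => F z.1 z.2) (p, t) :=
  hF.continuousOn.continuousAt (prod_mem_nhds univ_mem (Icc_mem_nhds ht.1 ht.2))

theorem continuousAt_stProj (hF : IsNeumannMCF S F₀ T F) (p : M) (ht : t ∈ Set.Ioo 0 T) :
    ContinuousAt (stProj F) (p, t) :=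
  (hF.continuousAt p ht).fst.prodMk continuousAt_snd

theorem eventually_isInteriorPoint (hp : (𝓡∂ n).IsInteriorPoint p) :
    ∀ᶠ q in 𝓝 p, (𝓡∂ n).IsInteriorPoint q :=
  (ModelWithCorners.isOpen_interior (I := 𝓡∂ n) (M := M) (n := ∞) (by simp)).mem_nhds hp

/-- A spacelike hypersurface moving by mean curvature is locally the graph of a solution of the
graphical equation. -/
theorem exists_flowAt (hF : IsNeumannMCF S F₀ T F) (hp : (𝓡∂ n).IsInteriorPoint p)
    (ht : t ∈ Set.Ioo 0 T) : ∃ u, FlowAt F p t u := by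
  set x := extChartAt (𝓡∂ n) p p with hx
  set X := stRep F p with hX
  have hXs : SmoothNear X (x, t) := hF.smoothNear_stRep hp ht
  set Φ : ST n → ST n := fun z => ((X z).1, z.2) with hΦ
  have hΦs : SmoothNear Φ (x, t) := by
    filter_upwards [hXs] with z hz using hz.fst.prodMk contDiffAt_snd
  have hXx : X (x, t) = F p t := by
    simp only [hX, hx, stRep, extChartAt_to_inv]
  have hΦx : Φ (x, t) = stProj F (p, t) := by
    simp only [hΦ, stProj]; rw [hXx]
  have hSm := hF.smoothAt hp (Set.Ioo_subset_Icc_self ht)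
  have hinj : ∀ w, fderiv ℝ Φ (x, t) w = 0 → w = 0 := by
    rintro ⟨w, τ⟩ hw
    have hd : HasFDerivAt Φ _ (x, t) :=
      hXs.differentiableAt.hasFDerivAt.fst.prodMk (hasFDerivAt_snd (p := (x, t)))
    rw [hd.fderiv] at hw
    have hτ : τ = 0 := congr_arg Prod.snd hw
    have hw1 : (fderiv ℝ X (x, t) (w, τ)).1 = 0 := congr_arg Prod.fst hw
    subst hτ
    have hsl : HasFDerivAt (𝕜 := ℝ) (fun x : Euc n => ((x, t) : ST n)) _ x :=
      (hasFDerivAt_id x).prodMk (hasFDerivAt_const t x)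
    have hc : HasFDerivAt (fun y => (localRep (fun q => F q t) p y).1) _ x :=
      (hXs.differentiableAt.hasFDerivAt.comp x hsl).fst
    have := hSm.injective w (by rw [hc.fderiv]; exact hw1)
    rw [this]; rfl
  obtain ⟨ψ, h1, h2, h3, h4⟩ := exists_smooth_inverse hΦs hinj rfl
  rw [hΦx] at h1 h2 h3
  have hu : SmoothNear (fun y => (X (ψ y)).2) (stProj F (p, t)) := by
    have : SmoothNear (fun z => (X z).2) (x, t) := by
      filter_upwards [hXs] with z hz using hz.snd
    rw [← h2] at this
    exact this.comp h1
  set u : ST n → ℝ := fun y => (X (ψ y)).2 with hu'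
  -- the chart on space-time
  set χ : M × ℝ → ST n := fun z => (extChartAt (𝓡∂ n) p z.1, z.2) with hχ
  have hχc : Tendsto χ (𝓝 (p, t)) (𝓝 (x, t)) := by
    have : ContinuousAt χ (p, t) :=
      ((continuousAt_extChartAt (I := 𝓡∂ n) p).comp continuousAt_fst).prodMk continuousAt_snd
    exact this
  have hsrc : ∀ᶠ z in 𝓝 (p, t), z.1 ∈ (extChartAt (𝓡∂ n) p).source :=
    continuousAt_fst.eventually (extChartAt_source_mem_nhds (I := 𝓡∂ n) p)
  have hXχ : ∀ z : M × ℝ, z.1 ∈ (extChartAt (𝓡∂ n) p).source → X (χ z) = F z.1 z.2 := by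
    intro z hz
    simp only [hX, hχ, stRep, (extChartAt (𝓡∂ n) p).left_inv hz]
  have hgr : ∀ᶠ z in 𝓝 (p, t), (F z.1 z.2).2 = u (stProj F z) := by
    filter_upwards [hχc.eventually h4, hsrc] with z hz hzs
    have e : Φ (χ z) = stProj F z := by
      simp only [hΦ, stProj]; rw [hXχ z hzs]
    rw [hu']; simp only
    rw [← e, hz, hXχ z hzs]
  have hopen : 𝓝 (stProj F (p, t)) ≤ map (stProj F) (𝓝 (p, t)) := by
    have hc : Tendsto ψ (𝓝 (stProj F (p, t))) (𝓝 (x, t)) := by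
      have := h1.continuousAt; rwa [ContinuousAt, h2] at this
    set σ : ST n → M × ℝ := fun z => ((extChartAt (𝓡∂ n) p).symm z.1, z.2) with hσ
    have hσc : Tendsto σ (𝓝 (x, t)) (𝓝 (p, t)) := by
      rw [nhds_prod_eq, nhds_prod_eq]
      exact ((tendsto_extChartAt_symm p).comp tendsto_fst).prodMk tendsto_snd
    calc 𝓝 (stProj F (p, t)) = map (fun y => Φ (ψ y)) (𝓝 (stProj F (p, t))) := by
          rw [map_congr h3, map_id']
      _ = map Φ (map ψ (𝓝 (stProj F (p, t)))) := (map_map (m := ψ) (m' := Φ)).symm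
      _ ≤ map Φ (𝓝 (x, t)) := map_mono hc
      _ = map (stProj F) (map σ (𝓝 (x, t))) := (map_map (m := σ) (m' := stProj F)).symm
      _ ≤ map (stProj F) (𝓝 (p, t)) := map_mono hσc
  have hslice : ∀ z : M × ℝ, Tendsto (fun q : M => (q, z.2)) (𝓝 z.1) (𝓝 z) := fun z => by
    have : Continuous fun q : M => (q, z.2) := by fun_prop
    exact this.continuousAt
  have hadm : Adm eb u (stProj F (p, t)) := by
    refine ⟨hu, ?_⟩
    have e := grad_slice (u := u) (x := (F p t).1) (t := t) hu
    have : stProj F (p, t) = ((F p t).1, t) := rfl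
    rw [this, ← e]
    refine hSm.norm_grad_lt ?_ ((hslice (p, t)).eventually hgr)
    exact SmoothNear.comp (f := fun x : Euc n => ((x, t) : ST n)) (z := (F p t).1) hu
      (ContDiff.smoothNear (contDiff_slice t) _)
  refine ⟨u, ⟨hadm, ?_⟩, hgr, hopen⟩
  -- the equation holds at every nearby point of the flow
  have hev : ∀ᶠ z in 𝓝 (p, t), dir et u (stProj F z) = lop eb u u (stProj F z) := by
    have hint : ∀ᶠ z in 𝓝 (p, t), (𝓡∂ n).IsInteriorPoint z.1 :=
      continuousAt_fst.eventually (eventually_isInteriorPoint hp)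
    have htime : ∀ᶠ z in 𝓝 (p, t), z.2 ∈ Set.Ioo 0 T :=
      continuousAt_snd.eventually (isOpen_Ioo.mem_nhds ht)
    filter_upwards [hint, htime, hgr.eventually_nhds,
      (hF.continuousAt_stProj p ht).eventually hadm.eventually] with z hz1 hz2 hz3 hz4
    obtain ⟨q, τ⟩ := z
    have hSq := hF.smoothAt hz1 (Set.Ioo_subset_Icc_self hz2)
    have ha : Adm ec (fun y => u (y, τ)) (F q τ).1 := hz4.slice
    have hgq : ∀ᶠ q' in 𝓝 q, (F q' τ).2 = u ((F q' τ).1, τ) := (hslice (q, τ)).eventually hz3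
    have hN := hSq.normalAt_eq ha hgq
    have hH := hSq.meanCurvAt_eq ha hgq
    have hev := (hF.evolution q τ (Set.Ioo_subset_Icc_self hz2)).hasDerivAt
      (Icc_mem_nhds hz2.1 hz2.2)
    have hgrad : grad ec (fun y => u (y, τ)) (F q τ).1 = grad eb u (stProj F (q, τ)) :=
      grad_slice hz4.1
    have hlop : lop ec (fun y => u (y, τ)) (fun y => u (y, τ)) (F q τ).1
        = lop eb u u (stProj F (q, τ)) := by
      unfold lop
      have e : ∀ i j, dir (ec i) (dir (ec j) fun y => u (y, τ)) (F q τ).1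
          = dir (eb i) (dir (eb j) u) (stProj F (q, τ)) := fun i j =>
        (iter_slice (u := u) (x := (F q τ).1) (t := τ) hz4.1 [i, j]).self_of_nhds
      simp only [e, hgrad]
    rw [hgrad] at hN hH
    rw [hlop] at hH
    rw [hN, hH] at hev
    set g := grad eb u (stProj F (q, τ)) with hg
    set L := lop eb u u (stProj F (q, τ)) with hL
    have hw : wgt g * wgt g * (1 - ‖g‖ ^ 2) = 1 := wgt_sq_mul hz4.2
    -- differentiate `F₂ = u(F₁, t)` in time
    have htq : Tendsto (fun s : ℝ => (q, s)) (𝓝 τ) (𝓝 (q, τ)) := by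
      have : Continuous fun s : ℝ => (q, s) := by fun_prop
      exact this.continuousAt
    have hcurve : HasDerivAt (fun s => stProj F (q, s))
        (((wgt g * L) • wgt g • g, 1) : ST n) τ := by
      have h1 : HasDerivAt (fun s => (F q s).1) ((wgt g * L) • wgt g • g) τ :=
        hev.hasFDerivAt.fst.hasDerivAt.congr_deriv (by simp)
      exact h1.prodMk (hasDerivAt_id τ)
    have hd0 : HasFDerivAt u (fderiv ℝ u (stProj F (q, τ))) (stProj F (q, τ)) :=
      hz4.1.differentiableAt.hasFDerivAt
    have hd1 := HasFDerivAt.comp_hasDerivAt (f := fun s => stProj F (q, s)) τ hd0 hcurve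
    have hd2 : HasDerivAt (fun s => (F q s).2) ((wgt g * L) * wgt g) τ :=
      hev.hasFDerivAt.snd.hasDerivAt.congr_deriv (by simp)
    have heq : (fun s => (F q s).2) =ᶠ[𝓝 τ] u ∘ fun s => stProj F (q, s) :=
      htq.eventually hz3
    have key := (hd2.congr_of_eventuallyEq heq.symm).unique hd1
    have e2 : fderiv ℝ u (stProj F (q, τ)) (((wgt g * L) • wgt g • g, 1) : ST n)
        = wgt g * L * wgt g * ‖g‖ ^ 2 + dir et u (stProj F (q, τ)) := by
      have : (((wgt g * L) • wgt g • g, 1) : ST n)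
          = (wgt g * L * wgt g) • ((g, 0) : ST n) + et := by
        simp [et, smul_smul]
      rw [this, map_add, map_smul]
      congr 1
      have hgs : ((g, 0) : ST n) = ∑ i, g i • (eb i : ST n) := by
        refine Prod.ext ?_ ?_
        · rw [Prod.fst_sum]; simp only [eb, Prod.smul_fst]; exact euc_eq_sum g
        · rw [Prod.snd_sum]; simp [eb]
      rw [hgs, map_sum, norm_sq_eq_sum, smul_eq_mul]
      congr 1
      exact Finset.sum_congr rfl fun i _ => by rw [map_smul]; rfl
    rw [e2] at key
    linear_combination L * hw - key
  exact hopen (by rw [mem_map]; exact hev)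

end IsNeumannMCF

end FlowAt


/-! ### The unit normal: characterisation, independence of the chart, continuity -/

section UnitNormal

variable {n : ℕ} {s : Set (Euc n)} {X : Euc n → Mink n} {x : Euc n}

theorem posDef_det_ne_zero (h : (metric s X x).PosDef) : (metric s X x).det ≠ 0 :=
  (Matrix.isUnit_iff_isUnit_det _).1 h.isUnit |>.ne_zero

theorem ip_pd_normalPart' (hdet : (metric s X x).det ≠ 0) (c : Fin n) :
    ip (pd s X c x) (normalPart s X x) = 0 := by
  unfold normalPart
  simp only [ip_sub_right, ip_sum_right, ip_smul_right]
  have u : IsUnit (metric s X x).det := isUnit_iff_ne_zero.2 hdet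
  have h1 := Matrix.mul_nonsing_inv _ u
  have h2 : ∀ j, ∑ i, (metric s X x) c i * (metric s X x)⁻¹ i j
      = (1 : Matrix (Fin n) (Fin n) ℝ) c j := fun j => by rw [← h1, Matrix.mul_apply]
  have h3 : ∀ i, ip (pd s X c x) (pd s X i x) = metric s X x c i := fun i => by simp [metric]
  simp only [h3]
  rw [Finset.sum_comm]
  have : ∀ j, ∑ i, (metric s X x)⁻¹ i j * ip ((0, 1) : Mink n) (pd s X j x)
      * metric s X x c i = (1 : Matrix (Fin n) (Fin n) ℝ) c j
        * ip ((0, 1) : Mink n) (pd s X j x) := fun j => by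
    rw [← h2, Finset.sum_mul]; exact Finset.sum_congr rfl fun i _ => by ring
  simp only [this, Matrix.one_apply]
  simp [ip_comm]

theorem ip_normalPart_self (h : (metric s X x).PosDef) :
    ip (normalPart s X x) (normalPart s X x) = -(normalPart s X x).2 ∧ 1 ≤ (normalPart s X x).2 := by
  set N := normalPart s X x with hN
  have e0 : ∀ a : Mink n, ip ((0, 1) : Mink n) a = -a.2 := fun a => by simp [ip]
  have hNe : N = (0, 1) - ∑ i, ∑ j, ((metric s X x)⁻¹ i j * ip ((0, 1) : Mink n) (pd s X j x))
      • pd s X i x := rfl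
  have h1 : ip N N = ip ((0, 1) : Mink n) N := by
    nth_rewrite 1 [hNe]
    rw [ip_sub_left, ip_sum_left]
    have : ∀ i, ip (∑ j, ((metric s X x)⁻¹ i j * ip ((0, 1) : Mink n) (pd s X j x)) • pd s X i x) N
        = 0 := fun i => by
      rw [← Finset.sum_smul, ip_smul_left, hN, ip_pd_normalPart' (posDef_det_ne_zero h), mul_zero]
    simp [this]
  refine ⟨by rw [h1, e0], ?_⟩
  set a : Fin n → ℝ := fun j => ip ((0, 1) : Mink n) (pd s X j x) with ha
  have h2 : N.2 = 1 + ∑ i, ∑ j, a i * ((metric s X x)⁻¹ i j * a j) := by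
    rw [hNe, Prod.snd_sub, Prod.snd_sum]
    have : ∀ i, (∑ j, ((metric s X x)⁻¹ i j * a j) • pd s X i x).2
        = -∑ j, a i * ((metric s X x)⁻¹ i j * a j) := fun i => by
      rw [← Finset.sum_smul, Prod.smul_snd, smul_eq_mul, Finset.sum_mul, ← Finset.sum_neg_distrib]
      refine Finset.sum_congr rfl fun j _ => ?_
      have : (pd s X i x).2 = -a i := by rw [ha]; simp only [e0]; ring
      rw [this]; ring
    rw [Finset.sum_congr rfl fun i _ => this i, Finset.sum_neg_distrib]
    ring
  have h3 := h.inv.posSemidef.dotProduct_mulVec_nonneg a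
  simp only [dotProduct, Matrix.mulVec, Finset.mul_sum, star_trivial] at h3
  linarith

/-- `N` is the future directed unit normal of the hyperplane `range D`. -/
structure IsUnitNormal (D : Euc n →L[ℝ] Mink n) (N : Mink n) : Prop where
  orthogonal : ∀ w, ip (D w) N = 0
  unit : ip N N = -1
  future : 0 < N.2

theorem isUnitNormal_unitNormal (h : (metric s X x).PosDef) :
    IsUnitNormal (fderivWithin ℝ X s x) (unitNormal s X x) := by
  obtain ⟨h1, h2⟩ := ip_normalPart_self h
  set N := normalPart s X x with hN
  have h3 : 0 < √(-ip N N) := Real.sqrt_pos.2 (by rw [h1]; linarith)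
  refine ⟨fun w => ?_, ?_, ?_⟩
  · rw [fderivWithin_eq_sum_pd, ip_sum_left]
    refine Finset.sum_eq_zero fun i _ => ?_
    rw [unitNormal, ip_smul_left, ip_smul_right, ip_pd_normalPart' (posDef_det_ne_zero h)]
    ring
  · rw [unitNormal, ip_smul_left, ip_smul_right, ← hN, ← mul_assoc, ← mul_inv,
      Real.mul_self_sqrt (by rw [h1]; linarith)]
    have : ip N N ≠ 0 := by rw [h1]; linarith
    field_simp
  · rw [unitNormal, ← hN, Prod.smul_snd, smul_eq_mul]
    exact mul_pos (inv_pos.2 h3) (by linarith)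

/-- The future directed unit normal is determined by the tangent space. -/
theorem IsUnitNormal.eq {D D' : Euc n →L[ℝ] Mink n} {N N' : Mink n} (h : IsUnitNormal D N)
    (h' : IsUnitNormal D' N') (hD : ∀ w, (D w).1 = 0 → w = 0) (hr : ∀ w, ∃ w', D w = D' w') :
    N = N' := by
  have hsurj : ∀ y : Euc n, ∃ w, (D w).1 = y := by
    have : Function.Injective ((ContinuousLinearMap.fst ℝ (Euc n) ℝ).comp D).toLinearMap :=
      (injective_iff_map_eq_zero _).2 hD
    exact LinearMap.injective_iff_surjective.1 this
  -- both normals have the same slope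
  have key : ∀ y : Euc n, ⟪y, N.1⟫_ℝ * N'.2 = ⟪y, N'.1⟫_ℝ * N.2 := by
    intro y
    obtain ⟨w, hw⟩ := hsurj y
    obtain ⟨w', hw'⟩ := hr w
    have h1 := h.orthogonal w
    have h2 := h'.orthogonal w'
    rw [← hw'] at h2
    simp only [ip, hw] at h1 h2
    linear_combination N'.2 * h1 - N.2 * h2
  have hN : N'.2 • N.1 = N.2 • N'.1 := by
    refine ext_inner_left ℝ fun y => ?_
    rw [real_inner_smul_right, real_inner_smul_right]; linarith [key y]
  have e1 : N.1 = (N.2 / N'.2) • N'.1 := by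
    have h0 := h'.future.ne'
    rw [div_eq_inv_mul, mul_smul, ← hN, smul_smul, inv_mul_cancel₀ h0, one_smul]
  set c := N.2 / N'.2 with hc
  have hc0 : 0 < c := div_pos h.future h'.future
  have e2 : N.2 = c * N'.2 := by rw [hc]; field_simp [h'.future.ne']
  have e3 : N = c • N' := Prod.ext e1 e2
  have h1 := h.unit
  rw [e3, ip_smul_left, ip_smul_right, h'.unit] at h1
  have h2 : c = 1 := by nlinarith
  rw [e3, h2, one_smul]

/-- The unit normal depends continuously on the first derivatives. -/
theorem tendsto_unitNormal {ι : Type*} {l : Filter ι} {Y : ι → Euc n → Mink n} {y : ι → Euc n}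
    (h : (metric s X x).PosDef) (hd : ∀ i, Tendsto (fun k => pd s (Y k) i (y k)) l (𝓝 (pd s X i x))) :
    Tendsto (fun k => unitNormal s (Y k) (y k)) l (𝓝 (unitNormal s X x)) := by
  have hip : ∀ {a b : ι → Mink n} {a' b' : Mink n}, Tendsto a l (𝓝 a') → Tendsto b l (𝓝 b') →
      Tendsto (fun k => ip (a k) (b k)) l (𝓝 (ip a' b')) := fun ha hb => by
    unfold ip
    exact (ha.fst_nhds.inner hb.fst_nhds).sub (ha.snd_nhds.mul hb.snd_nhds)
  have hm : Tendsto (fun k => metric s (Y k) (y k)) l (𝓝 (metric s X x)) :=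
    tendsto_pi_nhds.2 fun i => tendsto_pi_nhds.2 fun j => hip (hd i) (hd j)
  have hdet : Tendsto (fun k => (metric s (Y k) (y k)).det) l (𝓝 (metric s X x).det) :=
    (Continuous.matrix_det continuous_id).continuousAt.tendsto.comp hm
  have hadj : Tendsto (fun k => (metric s (Y k) (y k)).adjugate) l (𝓝 (metric s X x).adjugate) :=
    (Continuous.matrix_adjugate continuous_id).continuousAt.tendsto.comp hm
  have hinv : ∀ i j, Tendsto (fun k => (metric s (Y k) (y k))⁻¹ i j) l
      (𝓝 ((metric s X x)⁻¹ i j)) := by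
    intro i j
    simp only [Matrix.inv_def, Ring.inverse_eq_inv', Matrix.smul_apply, smul_eq_mul]
    exact (hdet.inv₀ (posDef_det_ne_zero h)).mul
      (tendsto_pi_nhds.1 (tendsto_pi_nhds.1 hadj i) j)
  have hN : Tendsto (fun k => normalPart s (Y k) (y k)) l (𝓝 (normalPart s X x)) := by
    unfold normalPart
    exact tendsto_const_nhds.sub <| tendsto_finsetSum _ fun i _ => tendsto_finsetSum _ fun j _ =>
      ((hinv i j).mul (hip tendsto_const_nhds (hd j))).smul (hd i)
  obtain ⟨h1, h2⟩ := ip_normalPart_self h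
  have h3 : √(-ip (normalPart s X x) (normalPart s X x)) ≠ 0 :=
    (Real.sqrt_pos.2 (by rw [h1]; linarith)).ne'
  unfold unitNormal
  exact ((Real.continuous_sqrt.continuousAt.tendsto.comp (hip hN hN).neg).inv₀ h3).smul hN

end UnitNormal

section Charts

variable {n : ℕ} [NeZero n] {M : Type*} [TopologicalSpace M]
  [ChartedSpace (EuclideanHalfSpace n) M] [IsManifold (𝓡∂ n) ∞ M] {f : M → Mink n} {p q : M}

theorem contDiffOn_localRep (hf : ContMDiff (𝓡∂ n) 𝓘(ℝ, Mink n) ∞ f) (p : M) :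
    ContDiffOn ℝ ∞ (localRep f p) (extChartAt (𝓡∂ n) p).target := by
  rw [← contMDiffOn_iff_contDiffOn]
  exact hf.comp_contMDiffOn (contMDiffOn_extChartAt_symm p)

theorem differentiableWithinAt_localRep (hf : ContMDiff (𝓡∂ n) 𝓘(ℝ, Mink n) ∞ f)
    (hq : q ∈ (extChartAt (𝓡∂ n) p).source) :
    DifferentiableWithinAt ℝ (localRep f p) (Set.range (𝓡∂ n)) (extChartAt (𝓡∂ n) p q) := by
  have h1 := ((contDiffOn_localRep hf p) _ ((extChartAt (𝓡∂ n) p).map_source hq)).differentiableWithinAt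
    (by simp)
  exact h1.mono_of_mem_nhdsWithin (extChartAt_target_mem_nhdsWithin' hq)

/-- The differentials of `f` in two charts. -/
theorem fderivWithin_localRep (hf : ContMDiff (𝓡∂ n) 𝓘(ℝ, Mink n) ∞ f) {p' : M}
    (hq : q ∈ (extChartAt (𝓡∂ n) p).source) (hq' : q ∈ (extChartAt (𝓡∂ n) p').source) (w : Euc n) :
    fderivWithin ℝ (localRep f p) (Set.range (𝓡∂ n)) (extChartAt (𝓡∂ n) p q) w
      = fderivWithin ℝ (localRep f p') (Set.range (𝓡∂ n)) (extChartAt (𝓡∂ n) p' q)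
        (tangentCoordChange (𝓡∂ n) p p' q w) := by
  have h1 := hasFDerivWithinAt_tangentCoordChange (I := 𝓡∂ n) ⟨hq, hq'⟩
  have h2 := (differentiableWithinAt_localRep hf hq').hasFDerivWithinAt
  have hpt : (extChartAt (𝓡∂ n) p' ∘ (extChartAt (𝓡∂ n) p).symm) (extChartAt (𝓡∂ n) p q)
      = extChartAt (𝓡∂ n) p' q := by
    simp only [Function.comp_apply, (extChartAt (𝓡∂ n) p).left_inv hq]
  rw [← hpt] at h2
  have h3 := h2.comp (extChartAt (𝓡∂ n) p q) h1 fun y _ => Set.mem_range_self _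
  have hcont : Tendsto (extChartAt (𝓡∂ n) p).symm
      (𝓝[Set.range (𝓡∂ n)] (extChartAt (𝓡∂ n) p q)) (𝓝 q) := by
    have := (continuousAt_extChartAt_symm' (I := 𝓡∂ n) hq).tendsto
    rw [(extChartAt (𝓡∂ n) p).left_inv hq] at this
    exact this.mono_left nhdsWithin_le_nhds
  have h4 : localRep f p =ᶠ[𝓝[Set.range (𝓡∂ n)] (extChartAt (𝓡∂ n) p q)]
      localRep f p' ∘ (extChartAt (𝓡∂ n) p' ∘ (extChartAt (𝓡∂ n) p).symm) := by
    filter_upwards [hcont.eventually (extChartAt_source_mem_nhds' (I := 𝓡∂ n) hq')] with y hy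
    simp only [localRep, Function.comp_apply, (extChartAt (𝓡∂ n) p').left_inv hy]
  have h5 := h3.congr_of_eventuallyEq h4 (by
    simp only [localRep, Function.comp_apply, (extChartAt (𝓡∂ n) p).left_inv hq,
      (extChartAt (𝓡∂ n) p').left_inv hq'])
  rw [h5.fderivWithin ((𝓡∂ n).uniqueDiffOn _ (Set.mem_range_self _)), hpt]
  rfl

theorem tangentCoordChange_inv {p' : M} (hq : q ∈ (extChartAt (𝓡∂ n) p).source)
    (hq' : q ∈ (extChartAt (𝓡∂ n) p').source) (w : Euc n) :
    tangentCoordChange (𝓡∂ n) p' p q (tangentCoordChange (𝓡∂ n) p p' q w) = w := by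
  rw [tangentCoordChange_comp ⟨⟨hq, hq'⟩, hq⟩, tangentCoordChange_self hq]

theorem posDef_localRep (hf : ContMDiff (𝓡∂ n) 𝓘(ℝ, Mink n) ∞ f) (hs : IsSpacelike f)
    (hq : q ∈ (extChartAt (𝓡∂ n) p).source) :
    (metric (Set.range (𝓡∂ n)) (localRep f p) (extChartAt (𝓡∂ n) p q)).PosDef := by
  rw [posDef_iff]
  intro w hw
  rw [fderivWithin_localRep hf hq (mem_extChartAt_source q)]
  refine posDef_iff.1 (hs q) _ fun h0 => hw ?_
  rw [← tangentCoordChange_inv hq (mem_extChartAt_source q) w, h0, map_zero]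

theorem normalAt_eq_localRep (hf : ContMDiff (𝓡∂ n) 𝓘(ℝ, Mink n) ∞ f) (hs : IsSpacelike f)
    (hq : q ∈ (extChartAt (𝓡∂ n) p).source) : normalAt f q
    = unitNormal (Set.range (𝓡∂ n)) (localRep f p) (extChartAt (𝓡∂ n) p q) := by
  refine (isUnitNormal_unitNormal (hs q)).eq (isUnitNormal_unitNormal (posDef_localRep hf hs hq))
    (fst_fderivWithin_injective (hs q)) fun w => ⟨tangentCoordChange (𝓡∂ n) q p q w, ?_⟩
  exact fderivWithin_localRep hf (mem_extChartAt_source q) hq w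

variable {S : Euc n → Euc n} {F₀ : M → Mink n} {T : ℝ} {F : M → ℝ → Mink n}

theorem IsNeumannMCF.contMDiff_slice (hF : IsNeumannMCF S F₀ T F)
    (hF₀ : ContMDiff (𝓡∂ n) 𝓘(ℝ, Mink n) ∞ F₀) {t : ℝ} (ht : t ∈ Set.Icc 0 T) :
    ContMDiff (𝓡∂ n) 𝓘(ℝ, Mink n) ∞ fun q => F q t := by
  rcases eq_or_ne t 0 with rfl | h0
  · have : (fun q => F q 0) = F₀ := funext hF.initial
    rw [this]; exact hF₀
  · rw [← contMDiffOn_univ]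
    refine hF.smooth.comp ((contMDiff_id (I := 𝓡∂ n)).prodMk contMDiff_const).contMDiffOn
      fun q _ => ⟨⟨Set.mem_univ _, ht⟩, fun hb => h0 hb.2⟩

/-- The unit normal is continuous on space-time, up to the boundary. -/
theorem IsNeumannMCF.continuousOn_normalAt (hF : IsNeumannMCF S F₀ T F)
    (hF₀ : ContMDiff (𝓡∂ n) 𝓘(ℝ, Mink n) ∞ F₀) :
    ContinuousOn (fun z : M × ℝ => normalAt (fun q => F q z.2) z.1) (Set.univ ×ˢ Set.Icc 0 T) := by
  rintro ⟨p, t⟩ hz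
  have ht : t ∈ Set.Icc 0 T := hz.2
  have hsrc : ∀ᶠ z in 𝓝[Set.univ ×ˢ Set.Icc 0 T] (p, t), z.1 ∈ (extChartAt (𝓡∂ n) p).source :=
    nhdsWithin_le_nhds ((continuousAt_fst (p := (p, t))).preimage_mem_nhds
      (extChartAt_source_mem_nhds (I := 𝓡∂ n) p))
  have hmem : ∀ᶠ z in 𝓝[Set.univ ×ˢ Set.Icc 0 T] (p, t), z ∈ Set.univ ×ˢ Set.Icc 0 T :=
    eventually_mem_nhdsWithin
  have heq : (fun z : M × ℝ => normalAt (fun q => F q z.2) z.1)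
      =ᶠ[𝓝[Set.univ ×ˢ Set.Icc 0 T] (p, t)] fun z => unitNormal (Set.range (𝓡∂ n))
        (localRep (fun q => F q z.2) p) (extChartAt (𝓡∂ n) p z.1) := by
    filter_upwards [hsrc, hmem] with z h1 h2
    exact normalAt_eq_localRep (hF.contMDiff_slice hF₀ h2.2) (hF.spacelike _ h2.2) h1
  have hχ : Tendsto (fun z : M × ℝ => (extChartAt (𝓡∂ n) p z.1, z.2))
      (𝓝[Set.univ ×ˢ Set.Icc 0 T] (p, t))
      (𝓝[(extChartAt (𝓡∂ n) p).target ×ˢ Set.Icc 0 T] (extChartAt (𝓡∂ n) p p, t)) := by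
    refine tendsto_nhdsWithin_iff.2 ⟨?_, ?_⟩
    · have : ContinuousAt (fun z : M × ℝ => (extChartAt (𝓡∂ n) p z.1, z.2)) (p, t) :=
        ((continuousAt_extChartAt (I := 𝓡∂ n) p).comp continuousAt_fst).prodMk continuousAt_snd
      exact this.tendsto.mono_left nhdsWithin_le_nhds
    · filter_upwards [hsrc, hmem] with z h1 h2
      exact ⟨(extChartAt (𝓡∂ n) p).map_source h1, h2.2⟩
  refine Tendsto.congr' heq.symm ?_
  refine tendsto_unitNormal (hF.spacelike t ht p) fun i => ?_
  have := hF.continuousOn_fst p i (extChartAt (𝓡∂ n) p p, t) ⟨mem_extChartAt_target p, ht⟩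
  exact this.tendsto.comp hχ

end Charts


/-! ### Continuity of the derivatives of the graph functions, up to the initial time -/

section Jets

variable {n : ℕ} [NeZero n] {M : Type*} [TopologicalSpace M]
  [ChartedSpace (EuclideanHalfSpace n) M]

open Classical in
/-- The derivative `∂_I v`, at the point `f q`, of a function `v` whose graph is `f` near `q`; it does not
depend on the choice of `v`. Where there is no such function the value is zero. -/
def jetAt (f : M → Mink n) (I : List (Fin n)) (q : M) : ℝ :=
  if h : ∃ v, GraphAt f q v then iter ec I h.choose (f q).1 else 0

theorem GraphAt.jetAt_eq {f : M → Mink n} {q : M} {v : Euc n → ℝ} (h : GraphAt f q v)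
    (I : List (Fin n)) : MinkMCF.jetAt f I q = iter ec I v (f q).1 := by
  have hex : ∃ v, GraphAt f q v := ⟨v, h⟩
  rw [MinkMCF.jetAt, dif_pos hex]
  exact (iter_congr (hex.choose_spec.eventuallyEq h.graph) I).self_of_nhds

variable {F : M → ℝ → Mink n} {p : M} {t T : ℝ}

/-- The part of the space-time chart at `p` that avoids the boundary. -/
def stDom (M : Type*) [TopologicalSpace M] [ChartedSpace (EuclideanHalfSpace n) M] (p : M) (T : ℝ) :
    Set (ST n) :=
  interior (extChartAt (𝓡∂ n) p).target ×ˢ Set.Icc 0 T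

/-- The spatial differential of the vertical projection of the flow, in a chart. -/
def projDer (F : M → ℝ → Mink n) (p : M) (T : ℝ) (z : ST n) : Euc n →L[ℝ] Euc n :=
  (ContinuousLinearMap.fst ℝ (Euc n) ℝ).comp
    ((fderivWithin ℝ (stRep F p) (stDom M p T) z).comp (ContinuousLinearMap.inl ℝ (Euc n) ℝ))

/-- The derivatives of the graph function as functions in a chart. They are defined through the
differential of the projection, so that they make sense on all of the closed time interval. -/
def chartJet (F : M → ℝ → Mink n) (p : M) (T : ℝ) : List (Fin n) → ST n → ℝ
  | [] => fun z => (stRep F p z).2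
  | i :: I => fun z => fderivWithin ℝ (chartJet F p T I) (stDom M p T) z
      ((projDer F p T z).inverse (ec i), 0)

variable [IsManifold (𝓡∂ n) ∞ M] {S : Euc n → Euc n} {F₀ : M → Mink n}

theorem uniqueDiffOn_stDom (p : M) (hT : 0 < T) : UniqueDiffOn ℝ (stDom M p T : Set (ST n)) :=
  isOpen_interior.uniqueDiffOn.prod (uniqueDiffOn_Icc hT)

theorem hasFDerivAt_slice {W : Type*} [NormedAddCommGroup W] [NormedSpace ℝ W] {g : ST n → W}
    {x : Euc n} (hg : DifferentiableWithinAt ℝ g (stDom M p T) (x, t)) (hz : (x, t) ∈ stDom M p T) :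
    HasFDerivAt (fun y => g (y, t)) ((fderivWithin ℝ g (stDom M p T) (x, t)).comp
      (ContinuousLinearMap.inl ℝ (Euc n) ℝ)) x := by
  have hsl : HasFDerivAt (𝕜 := ℝ) (fun x : Euc n => ((x, t) : ST n))
      (ContinuousLinearMap.inl ℝ (Euc n) ℝ) x :=
    (hasFDerivAt_id x).prodMk (hasFDerivAt_const t x)
  have h1 := hg.hasFDerivWithinAt.comp x (hsl.hasFDerivWithinAt
    (s := interior (extChartAt (𝓡∂ n) p).target)) fun y hy => Set.mk_mem_prod hy hz.2
  exact h1.hasFDerivAt (isOpen_interior.mem_nhds hz.1)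

namespace IsNeumannMCF

theorem differentiableWithinAt_stRep (hF : IsNeumannMCF S F₀ T F) {z : ST n}
    (hz : z ∈ stDom M p T) : DifferentiableWithinAt ℝ (stRep F p) (stDom M p T) z :=
  ((hF.contDiffOn_stRep p) z hz).differentiableWithinAt (by simp)

theorem hasFDerivAt_proj (hF : IsNeumannMCF S F₀ T F) {x : Euc n} (hz : (x, t) ∈ stDom M p T) :
    HasFDerivAt (fun y => (stRep F p (y, t)).1) (projDer F p T (x, t)) x :=
  (hasFDerivAt_slice (hF.differentiableWithinAt_stRep hz) hz).fst

theorem projDer_invertible (hF : IsNeumannMCF S F₀ T F)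
    (hF₀ : ContMDiff (𝓡∂ n) 𝓘(ℝ, Mink n) ∞ F₀) {z : ST n} (hz : z ∈ stDom M p T) :
    (projDer F p T z).IsInvertible := by
  obtain ⟨x, t⟩ := z
  have hx : x ∈ interior (extChartAt (𝓡∂ n) p).target := hz.1
  have hxt := interior_subset hx
  have hq := (extChartAt (𝓡∂ n) p).map_target hxt
  have h1 := posDef_localRep (hF.contMDiff_slice hF₀ hz.2) (hF.spacelike t hz.2) hq
  rw [(extChartAt (𝓡∂ n) p).right_inv hxt] at h1
  have hrange : Set.range (𝓡∂ n) ∈ 𝓝 x :=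
    mem_of_superset (isOpen_interior.mem_nhds hx)
      (interior_subset.trans (extChartAt_target_subset_range p))
  have h2 : HasFDerivAt (localRep (fun q => F q t) p) _ x :=
    hasFDerivAt_slice (hF.differentiableWithinAt_stRep hz) hz
  have hinj : Function.Injective (projDer F p T (x, t)).toLinearMap := by
    refine (injective_iff_map_eq_zero _).2 fun w hw => ?_
    refine fst_fderivWithin_injective h1 w ?_
    rw [fderivWithin_of_mem_nhds hrange, h2.fderiv]
    exact hw
  refine ⟨(LinearEquiv.ofInjectiveEndo _ hinj).toContinuousLinearEquiv, ?_⟩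
  ext w; rfl

theorem contDiffOn_projDer (hF : IsNeumannMCF S F₀ T F) (hT : 0 < T) (p : M) :
    ContDiffOn ℝ ∞ (projDer F p T) (stDom M p T) := by
  have h1 := (hF.contDiffOn_stRep p).fderivWithin (m := ∞) (uniqueDiffOn_stDom p hT) (by simp)
  exact contDiffOn_const.clm_comp (h1.clm_comp contDiffOn_const)

theorem contDiffOn_chartJet (hF : IsNeumannMCF S F₀ T F)
    (hF₀ : ContMDiff (𝓡∂ n) 𝓘(ℝ, Mink n) ∞ F₀) (hT : 0 < T) (p : M) (I : List (Fin n)) :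
    ContDiffOn ℝ ∞ (chartJet F p T I) (stDom M p T) := by
  induction I with
  | nil => exact (hF.contDiffOn_stRep p).snd
  | cons i I ih =>
    have h1 := ih.fderivWithin (m := ∞) (uniqueDiffOn_stDom p hT) (by simp)
    have h2 : ContDiffOn ℝ ∞ (fun z => (projDer F p T z).inverse) (stDom M p T) := fun z hz =>
      ((hF.projDer_invertible hF₀ hz).contDiffAt_map_inverse).comp_contDiffWithinAt z
        (hF.contDiffOn_projDer hT p z hz)
    exact h1.clm_apply ((h2.clm_apply contDiffOn_const).prodMk contDiffOn_const)

/-- The derivatives of the graph function in terms of the chart. This expression is continuous up to the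
initial time, where no space-time graph function is available. -/
theorem iter_eq_chartJet (hF : IsNeumannMCF S F₀ T F)
    (hF₀ : ContMDiff (𝓡∂ n) 𝓘(ℝ, Mink n) ∞ F₀) (hT : 0 < T) {x : Euc n}
    (hz : (x, t) ∈ stDom M p T) {v : Euc n → ℝ} (hv : SmoothNear v (stRep F p (x, t)).1)
    (hg : ∀ᶠ y in 𝓝 x, (stRep F p (y, t)).2 = v (stRep F p (y, t)).1) (I : List (Fin n)) :
    ∀ᶠ y in 𝓝 x, iter ec I v (stRep F p (y, t)).1 = chartJet F p T I (y, t) := by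
  have hdom : ∀ᶠ y in 𝓝 x, (y, t) ∈ stDom M p T := by
    filter_upwards [isOpen_interior.mem_nhds hz.1] with y hy using ⟨hy, hz.2⟩
  have hv' : ∀ᶠ y in 𝓝 x, SmoothNear v (stRep F p (y, t)).1 :=
    (hF.hasFDerivAt_proj hz).continuousAt.eventually hv.eventually
  induction I with
  | nil => filter_upwards [hg] with y hy using hy.symm
  | cons i I ih =>
    filter_upwards [ih.eventually_nhds, hdom, hv'] with y h1 h2 h3
    have hA := hF.hasFDerivAt_proj h2
    have hc : HasFDerivAt (fun y => iter ec I v (stRep F p (y, t)).1) _ y :=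
      (h3.iter (b := ec) I).differentiableAt.hasFDerivAt.comp y hA
    have hj := hasFDerivAt_slice (((hF.contDiffOn_chartJet hF₀ hT p I) _ h2).differentiableWithinAt
      (by simp)) h2
    have heq := (hc.congr_of_eventuallyEq (h1.mono fun _ h => h.symm)).unique hj
    have := congr_arg (fun L : Euc n →L[ℝ] ℝ => L ((projDer F p T (y, t)).inverse (ec i))) heq
    have hinv : projDer F p T (y, t) ((projDer F p T (y, t)).inverse (ec i)) = ec i := by
      have := hF.projDer_invertible hF₀ h2
      rw [← ContinuousLinearMap.comp_apply, this.self_comp_inverse]; rfl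
    simp only [ContinuousLinearMap.comp_apply, hinv] at this
    exact this

/-- On the interior of `M` the derivatives of the graph functions are continuous in space-time, up to
the initial and the final time. -/
theorem continuousWithinAt_jetAt (hF : IsNeumannMCF S F₀ T F)
    (hF₀ : ContMDiff (𝓡∂ n) 𝓘(ℝ, Mink n) ∞ F₀) (hT : 0 < T) (hp : (𝓡∂ n).IsInteriorPoint p)
    (ht : t ∈ Set.Icc 0 T) (I : List (Fin n)) :
    ContinuousWithinAt (fun z : M × ℝ => jetAt (fun q => F q z.2) I z.1) (Set.univ ×ˢ Set.Icc 0 T)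
      (p, t) := by
  have hx : extChartAt (𝓡∂ n) p p ∈ interior (extChartAt (𝓡∂ n) p).target :=
    mem_interior_of_isInteriorPoint hp (mem_extChartAt_source p)
  have key : ∀ z : M × ℝ, z.1 ∈ (extChartAt (𝓡∂ n) p).source → (𝓡∂ n).IsInteriorPoint z.1 →
      z.2 ∈ Set.Icc 0 T → jetAt (fun q => F q z.2) I z.1
        = chartJet F p T I (extChartAt (𝓡∂ n) p z.1, z.2) := by
    rintro ⟨q, τ⟩ hq hqi hτ
    obtain ⟨v, hv⟩ := (hF.smoothAt hqi hτ).exists_graphAt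
    have hq' := mem_interior_of_isInteriorPoint (p := p) hqi hq
    have e : stRep F p (extChartAt (𝓡∂ n) p q, τ) = F q τ := by
      simp only [stRep, (extChartAt (𝓡∂ n) p).left_inv hq]
    have hc : Tendsto (extChartAt (𝓡∂ n) p).symm (𝓝 (extChartAt (𝓡∂ n) p q)) (𝓝 q) := by
      have := (continuousAt_extChartAt_symm' (I := 𝓡∂ n) hq).tendsto
      rwa [(extChartAt (𝓡∂ n) p).left_inv hq] at this
    have := (hF.iter_eq_chartJet hF₀ hT (p := p) (x := extChartAt (𝓡∂ n) p q) (t := τ) ⟨hq', hτ⟩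
      (v := v) (by rw [e]; exact hv.adm.1) (hc.eventually hv.graph) I).self_of_nhds
    rw [hv.jetAt_eq, ← this, e]
  have hsrc : ∀ᶠ z in 𝓝[Set.univ ×ˢ Set.Icc 0 T] (p, t), z.1 ∈ (extChartAt (𝓡∂ n) p).source :=
    nhdsWithin_le_nhds ((continuousAt_fst (p := (p, t))).preimage_mem_nhds
      (extChartAt_source_mem_nhds (I := 𝓡∂ n) p))
  have hint : ∀ᶠ z in 𝓝[Set.univ ×ˢ Set.Icc 0 T] (p, t), (𝓡∂ n).IsInteriorPoint z.1 :=
    nhdsWithin_le_nhds ((continuousAt_fst (p := (p, t))).eventually (eventually_isInteriorPoint hp))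
  have hmem : ∀ᶠ z in 𝓝[Set.univ ×ˢ Set.Icc 0 T] (p, t), z ∈ Set.univ ×ˢ Set.Icc 0 T :=
    eventually_mem_nhdsWithin
  have hχ : Tendsto (fun z : M × ℝ => (extChartAt (𝓡∂ n) p z.1, z.2))
      (𝓝[Set.univ ×ˢ Set.Icc 0 T] (p, t)) (𝓝[stDom M p T] (extChartAt (𝓡∂ n) p p, t)) := by
    refine tendsto_nhdsWithin_iff.2 ⟨?_, ?_⟩
    · have : ContinuousAt (fun z : M × ℝ => (extChartAt (𝓡∂ n) p z.1, z.2)) (p, t) :=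
        ((continuousAt_extChartAt (I := 𝓡∂ n) p).comp continuousAt_fst).prodMk continuousAt_snd
      exact this.tendsto.mono_left nhdsWithin_le_nhds
    · filter_upwards [hsrc, hint, hmem] with z h1 h2 h3
      exact ⟨mem_interior_of_isInteriorPoint h2 h1, h3.2⟩
  have hlim := ((hF.contDiffOn_chartJet hF₀ hT p I).continuousOn (extChartAt (𝓡∂ n) p p, t)
    ⟨hx, ht⟩).tendsto.comp hχ
  rw [ContinuousWithinAt]
  have e0 : jetAt (fun q => F q t) I p = chartJet F p T I (extChartAt (𝓡∂ n) p p, t) :=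
    key (p, t) (mem_extChartAt_source p) hp ht
  rw [e0]
  refine Tendsto.congr' ?_ hlim
  filter_upwards [hsrc, hint, hmem] with z h1 h2 h3
  exact (key z h1 h2 h3.2).symm

end IsNeumannMCF

end Jets


/-! ### The boundary cone and its normals -/

section Cone

variable {n : ℕ} {S : Euc n → Euc n}

/-- The parametrisation `z ↦ |z| (S(z / |z|), 1)` of the cone by the punctured space. -/
def coneMap (S : Euc n → Euc n) (z : Euc n) : Mink n := (‖z‖ • S (‖z‖⁻¹ • z), ‖z‖)

theorem mem_cone_iff {q : Mink n} : q ∈ cone S ↔ ∃ z, z ≠ 0 ∧ coneMap S z = q := by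
  constructor
  · rintro ⟨l, hl, x, hx, rfl⟩
    have hx1 : ‖x‖ = 1 := by simpa using hx
    have hn : ‖l • x‖ = l := by rw [norm_smul, hx1, Real.norm_of_nonneg hl.le, mul_one]
    refine ⟨l • x, fun h => ?_, ?_⟩
    · rw [h, norm_zero] at hn; exact hl.ne hn
    · rw [coneMap, hn, smul_smul, inv_mul_cancel₀ hl.ne', one_smul]
      simp
  · rintro ⟨z, hz, rfl⟩
    have hz' := norm_pos_iff.2 hz
    refine ⟨‖z‖, hz', ‖z‖⁻¹ • z, ?_, ?_⟩
    · rw [mem_sphere_zero_iff_norm, norm_smul, norm_inv, norm_norm, inv_mul_cancel₀ hz'.ne']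
    · simp [coneMap]

theorem IsSphereEmbedding.contDiffAt_coneMap (hS : IsSphereEmbedding S) {z : Euc n} (hz : z ≠ 0) :
    ContDiffAt ℝ ∞ (coneMap S) z := by
  have h1 : ContDiffAt ℝ ∞ (fun z : Euc n => ‖z‖) z := contDiffAt_norm ℝ hz
  have h2 : ContDiffAt ℝ ∞ (fun z : Euc n => ‖z‖⁻¹ • z) z :=
    (h1.inv (norm_ne_zero_iff.2 hz)).smul contDiffAt_id
  exact (h1.smul (hS.smooth.contDiffAt.comp z h2)).prodMk h1

theorem IsSphereEmbedding.fderiv_coneMap (hS : IsSphereEmbedding S) {z : Euc n} (hz : z ≠ 0)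
    (v : Euc n) : (fderiv ℝ (coneMap S) z v).2 = ⟪z, v⟫_ℝ / ‖z‖ ∧
      (⟪z, v⟫_ℝ = 0 → (fderiv ℝ (coneMap S) z v).1 = fderiv ℝ S (‖z‖⁻¹ • z) v) := by
  have hz' := norm_ne_zero_iff.2 hz
  have h1 : HasFDerivAt (fun z : Euc n => ‖z‖) (fderiv ℝ (fun z : Euc n => ‖z‖) z) z :=
    ((contDiffAt_norm ℝ hz (n := 1)).differentiableAt (by simp)).hasFDerivAt
  set ρ := fderiv ℝ (fun z : Euc n => ‖z‖) z with hρ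
  have hρv : ρ v = ⟪z, v⟫_ℝ / ‖z‖ := by
    have h2 := (hasStrictFDerivAt_norm_sq z).hasFDerivAt.unique (h1.pow 2)
    have := congr_arg (fun L : Euc n →L[ℝ] ℝ => L v) h2
    simp at this
    rw [eq_div_iff hz']; linarith
  have h3 : HasFDerivAt (fun z : Euc n => ‖z‖⁻¹ • z) _ z :=
    ((hasDerivAt_inv hz').comp_hasFDerivAt z h1).smul (hasFDerivAt_id z)
  have h4 : HasFDerivAt (fun z : Euc n => S (‖z‖⁻¹ • z)) _ z :=
    HasFDerivAt.comp (g := S) (f := fun z : Euc n => ‖z‖⁻¹ • z) z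
      (hS.smooth.differentiable (by simp) (‖z‖⁻¹ • z)).hasFDerivAt h3
  have h5 : HasFDerivAt (coneMap S) _ z := (h1.smul h4).prodMk h1
  rw [h5.fderiv]
  refine ⟨hρv, fun h0 => ?_⟩
  rw [h0, zero_div] at hρv
  simp [hρv, smul_smul, hz']

theorem IsSphereEmbedding.fderiv_coneMap_injective (hS : IsSphereEmbedding S) {z : Euc n}
    (hz : z ≠ 0) {v : Euc n} (hv : fderiv ℝ (coneMap S) z v = 0) : v = 0 := by
  have hz' := norm_ne_zero_iff.2 hz
  obtain ⟨h1, h2⟩ := hS.fderiv_coneMap hz v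
  rw [hv] at h1 h2
  have h0 : ⟪z, v⟫_ℝ = 0 := by
    have : ⟪z, v⟫_ℝ / ‖z‖ = 0 := h1.symm
    rw [div_eq_zero_iff] at this; exact this.resolve_right hz'
  refine hS.immersion (‖z‖⁻¹ • z) ?_ v ?_ (h2 h0).symm
  · rw [mem_sphere_zero_iff_norm, norm_smul, norm_inv, norm_norm, inv_mul_cancel₀ hz']
  · rw [real_inner_smul_left, h0, mul_zero]

theorem IsSphereEmbedding.coneMap_injOn (hS : IsSphereEmbedding S) {z z' : Euc n} (hz : z ≠ 0)
    (h : coneMap S z = coneMap S z') : z = z' := by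
  have h2 : ‖z‖ = ‖z'‖ := congr_arg Prod.snd h
  have h1 : ‖z‖ • S (‖z‖⁻¹ • z) = ‖z'‖ • S (‖z'‖⁻¹ • z') := congr_arg Prod.fst h
  have n1 := norm_ne_zero_iff.2 hz
  rw [← h2] at h1
  have h3 := smul_right_injective _ n1 h1
  have hm : ∀ y : Euc n, ‖y‖ = ‖z‖ → ‖z‖⁻¹ • y ∈ Metric.sphere (0 : Euc n) 1 := fun y hy => by
    rw [mem_sphere_zero_iff_norm, norm_smul, norm_inv, norm_norm, hy, inv_mul_cancel₀ n1]
  exact smul_right_injective _ (inv_ne_zero n1) (hS.injOn (hm z rfl) (hm z' h2.symm) h3)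

/-- Points of the cone near `coneMap S z` have their parameters near `z`. -/
theorem IsSphereEmbedding.eventually_coneMap (hS : IsSphereEmbedding S) {z : Euc n} (hz : z ≠ 0)
    {P : Euc n → Prop} (hP : ∀ᶠ z' in 𝓝 z, P z') :
    ∀ᶠ y in 𝓝 (coneMap S z), ∀ z', z' ≠ 0 → coneMap S z' = y → P z' := by
  have n0 := norm_pos_iff.2 hz
  obtain ⟨U, hU, hUo, hzU⟩ := eventually_nhds_iff.1 hP
  set K : Set (Euc n) := (Metric.closedBall 0 (2 * ‖z‖) \ Metric.ball 0 (‖z‖ / 2)) \ U with hK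
  have hKc : IsCompact K :=
    ((isCompact_closedBall _ _).diff Metric.isOpen_ball).diff hUo
  have hK0 : ∀ y ∈ K, y ≠ 0 := by
    rintro y ⟨⟨-, h⟩, -⟩ rfl
    exact h (Metric.mem_ball_self (by linarith))
  have hcont : ContinuousOn (coneMap S) K := fun y hy =>
    (hS.contDiffAt_coneMap (hK0 y hy)).continuousAt.continuousWithinAt
  have hnot : coneMap S z ∉ coneMap S '' K := by
    rintro ⟨y, hy, h⟩
    have := hS.coneMap_injOn (hK0 y hy) h
    exact hy.2 (this ▸ hzU)
  have h1 := (hKc.image_of_continuousOn hcont).isClosed.isOpen_compl.mem_nhds hnot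
  have h2 : ∀ᶠ y in 𝓝 (coneMap S z), ‖z‖ / 2 < y.2 ∧ y.2 < 2 * ‖z‖ :=
    continuousAt_snd.eventually (isOpen_Ioo.mem_nhds
      (⟨(by linarith : ‖z‖ / 2 < ‖z‖), (by linarith : ‖z‖ < 2 * ‖z‖)⟩ :
        (coneMap S z).2 ∈ Set.Ioo (‖z‖ / 2) (2 * ‖z‖)))
  filter_upwards [h1, h2] with y hy1 hy2 z' hz' h
  by_contra hP'
  refine hy1 ⟨z', ⟨⟨?_, ?_⟩, fun hu => hP' (hU z' hu)⟩, h⟩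
  · have : ‖z'‖ = y.2 := congr_arg Prod.snd h
    rw [mem_closedBall_zero_iff, this]; exact hy2.2.le
  · have : ‖z'‖ = y.2 := congr_arg Prod.snd h
    rw [mem_ball_zero_iff, this]; exact not_lt.2 hy2.1.le

theorem cone_timelike (hS : IsSphereEmbedding S) {q : Mink n} (hq : q ∈ cone S) :
    ip q q < 0 ∧ 0 < q.2 := by
  obtain ⟨l, hl, x, hx, rfl⟩ := hq
  have h1 : ‖S x‖ < 1 := by simpa using hS.mem_ball x hx
  have h2 : ‖S x‖ ^ 2 < 1 := by nlinarith [norm_nonneg (S x)]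
  refine ⟨?_, by simpa using hl⟩
  rw [ip_smul_left, ip_smul_right]
  simp only [ip, real_inner_self_eq_norm_sq]
  have : 0 < l * l := mul_pos hl hl
  nlinarith

theorem solidCone_timelike (hS : IsSphereEmbedding S) {q : Mink n} (hq : q ∈ solidCone S) :
    ip q q < 0 ∧ 0 < q.2 := by
  obtain ⟨l, hl, y, hy, rfl⟩ := hq
  have hsub : convexHull ℝ (S '' Metric.sphere (0 : Euc n) 1) ⊆ Metric.ball 0 1 :=
    convexHull_min (by rintro _ ⟨x, hx, rfl⟩; exact hS.mem_ball x hx) (convex_ball 0 1)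
  have h1 : ‖y‖ < 1 := by simpa using hsub hy
  have h2 : ‖y‖ ^ 2 < 1 := by nlinarith [norm_nonneg y]
  refine ⟨?_, by simpa using hl⟩
  rw [ip_smul_left, ip_smul_right]
  simp only [ip, real_inner_self_eq_norm_sq]
  have : 0 < l * l := mul_pos hl hl
  nlinarith

/-- The cone lies on the negative side of its tangent hyperplanes. -/
theorem IsOutwardUnitNormal.support {q μ : Mink n} (h : IsOutwardUnitNormal S q μ) :
    ip μ μ = 1 ∧ ip μ q = 0 ∧ ∀ y ∈ cone S, ip μ y ≤ 0 := by
  obtain ⟨l, hl, x, hx, rfl, h1, h2, h3, h4⟩ := h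
  refine ⟨h3, by rw [ip_smul_right, h1, mul_zero], ?_⟩
  rintro _ ⟨k, hk, y, hy, rfl⟩
  rw [ip_smul_right]
  have h5 := h4 y hy
  have : ((S y - S x, 0) : Mink n) = (S y, 1) - (S x, 1) := by simp
  rw [this, ip_sub_right, h1] at h5
  exact mul_nonpos_of_nonneg_of_nonpos hk.le (by linarith)

/-- `ip μ` as a continuous linear map. -/
def ipL (μ : Mink n) : Mink n →L[ℝ] ℝ :=
  (innerSL ℝ μ.1).comp (ContinuousLinearMap.fst ℝ (Euc n) ℝ)
    - μ.2 • ContinuousLinearMap.snd ℝ (Euc n) ℝ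

theorem ipL_apply (μ y : Mink n) : ipL μ y = ip μ y := by
  simp [ipL, ip]

theorem IsSphereEmbedding.ip_fderiv_coneMap_eq_zero (hS : IsSphereEmbedding S) {z : Euc n}
    (hz : z ≠ 0) {μ : Mink n} (h0 : ip μ (coneMap S z) = 0) (h : ∀ y ∈ cone S, ip μ y ≤ 0)
    (v : Euc n) : ip μ (fderiv ℝ (coneMap S) z v) = 0 := by
  have hmax : IsLocalMax (fun y => ipL μ (coneMap S y)) z := by
    filter_upwards [isOpen_ne.mem_nhds hz] with y hy
    rw [ipL_apply, ipL_apply, h0]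
    exact h _ (mem_cone_iff.2 ⟨y, hy, rfl⟩)
  have hd := (ipL μ).hasFDerivAt.comp z
    ((hS.contDiffAt_coneMap hz).differentiableAt (by simp)).hasFDerivAt
  have := hmax.hasFDerivAt_eq_zero hd
  have := congr_arg (fun L : Euc n →L[ℝ] ℝ => L v) this
  simpa [ipL_apply] using this

/-- Convexity of the sphere provides a supporting hyperplane at each of its points. -/
theorem exists_supporting_normal (hS : IsSphereEmbedding S) (hconv : IsConvexSphere S) {x : Euc n}
    (hx : x ∈ Metric.sphere (0 : Euc n) 1) :
    ∃ N : Euc n, N ≠ 0 ∧ ∀ y ∈ Metric.sphere (0 : Euc n) 1, ⟪N, S y - S x⟫_ℝ ≤ 0 := by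
  set K := convexHull ℝ (S '' Metric.sphere (0 : Euc n) 1) with hK
  have hKx : S x ∈ frontier K := by rw [hK, hconv]; exact ⟨x, hx, rfl⟩
  have hin : ∀ y ∈ Metric.sphere (0 : Euc n) 1, S y ∈ K := fun y hy =>
    subset_convexHull ℝ _ ⟨y, hy, rfl⟩
  have hcK : Convex ℝ K := convex_convexHull ℝ _
  by_cases hne : (interior K).Nonempty
  · obtain ⟨f, hf⟩ := geometric_hahn_banach_open_point hcK.interior isOpen_interior hKx.2
    have hle : ∀ y ∈ K, f y ≤ f (S x) := by
      intro y hy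
      have hcl : y ∈ closure (interior K) := by
        rw [hcK.closure_interior_eq_closure_of_nonempty_interior hne]; exact subset_closure hy
      exact closure_minimal (fun a ha => (hf a ha).le)
        (isClosed_le f.continuous continuous_const) hcl
    refine ⟨(InnerProductSpace.toDual ℝ (Euc n)).symm f, fun h0 => ?_, fun y hy => ?_⟩
    · obtain ⟨a, ha⟩ := hne
      have h1 := hf a ha
      have : f = 0 := by simpa using h0
      rw [this] at h1; simp at h1
    · rw [InnerProductSpace.toDual_symm_apply, map_sub]
      linarith [hle _ (hin y hy)]
  · rw [hcK.interior_nonempty_iff_affineSpan_eq_top] at hne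
    have hdir : (affineSpan ℝ K).direction ≠ ⊤ := fun h =>
      hne ((AffineSubspace.direction_eq_top_iff_of_nonempty
        ⟨S x, subset_affineSpan ℝ _ (hin x hx)⟩).1 h)
    obtain ⟨N, hN, hN0⟩ := Submodule.exists_mem_ne_zero_of_ne_bot
      (fun h => hdir (Submodule.orthogonal_eq_bot_iff.1 h))
    refine ⟨N, hN0, fun y hy => le_of_eq ?_⟩
    have := AffineSubspace.vsub_mem_direction (subset_affineSpan ℝ _ (hin y hy))
      (subset_affineSpan ℝ _ (hin x hx))
    rw [real_inner_comm]
    exact Submodule.mem_orthogonal _ _ |>.1 hN _ this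

theorem exists_isOutwardUnitNormal (hS : IsSphereEmbedding S) (hconv : IsConvexSphere S)
    {q : Mink n} (hq : q ∈ cone S) : ∃ μ, IsOutwardUnitNormal S q μ := by
  obtain ⟨l, hl, x, hx, rfl⟩ := hq
  obtain ⟨N, hN0, hN⟩ := exists_supporting_normal hS hconv hx
  set ν : Mink n := (N, ⟪N, S x⟫_ℝ) with hν
  have hx1 : ‖x‖ = 1 := by simpa using hx
  have hSx : ‖S x‖ < 1 := by simpa using hS.mem_ball x hx
  have h0 : ip ν (S x, 1) = 0 := by simp [ip, hν]
  have hpos : 0 < ip ν ν := by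
    have h1 := abs_real_inner_le_norm N (S x)
    have h2 : 0 < ‖N‖ := norm_pos_iff.2 hN0
    have h3 : |⟪N, S x⟫_ℝ| < ‖N‖ := h1.trans_lt (by nlinarith)
    have h4 : ⟪N, S x⟫_ℝ ^ 2 < ‖N‖ ^ 2 := by
      rw [← sq_abs]; nlinarith [abs_nonneg ⟪N, S x⟫_ℝ]
    simp only [ip, hν, real_inner_self_eq_norm_sq]; nlinarith
  have hsup : ∀ y ∈ cone S, ip ν y ≤ 0 := by
    rintro _ ⟨k, hk, y, hy, rfl⟩
    have := hN y hy
    rw [inner_sub_right] at this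
    rw [ip_smul_right]
    refine mul_nonpos_of_nonneg_of_nonpos hk.le ?_
    simp only [ip, hν]; linarith
  have hx0 : x ≠ 0 := by rintro rfl; simp at hx1
  have hE : coneMap S x = (S x, 1) := by simp [coneMap, hx1]
  have htan : ∀ v : Euc n, ⟪x, v⟫_ℝ = 0 → ip ν (fderiv ℝ S x v, 0) = 0 := by
    intro v hv
    have h1 := hS.ip_fderiv_coneMap_eq_zero hx0 (by rw [hE]; exact h0) hsup v
    obtain ⟨h2, h3⟩ := hS.fderiv_coneMap hx0 v
    rw [hv, zero_div] at h2
    have h4 := h3 hv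
    rw [hx1, inv_one, one_smul] at h4
    rwa [show fderiv ℝ (coneMap S) x v = (fderiv ℝ S x v, 0) from Prod.ext h4 h2] at h1
  have hs := Real.sqrt_pos.2 hpos
  refine ⟨(√(ip ν ν))⁻¹ • ν, l, hl, x, hx, rfl, ?_, fun v hv => ?_, ?_, fun y hy => ?_⟩
  · rw [ip_smul_left, h0, mul_zero]
  · rw [ip_smul_left, htan v hv, mul_zero]
  · rw [ip_smul_left, ip_smul_right, ← mul_assoc, ← mul_inv, Real.mul_self_sqrt hpos.le,
      inv_mul_cancel₀ hpos.ne']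
  · rw [ip_smul_left]
    refine mul_nonpos_of_nonneg_of_nonpos (inv_nonneg.2 hs.le) ?_
    have := hN y hy
    simpa [ip, hν] using this

/-- A conormal field of the cone that is differentiable as a function on Minkowski space. It is only
determined up to positive factors, which are normalised by a vector `e` inside the cone. -/
theorem exists_conormal_field (hS : IsSphereEmbedding S) {q e μ : Mink n}
    (he : ∀ q μ, IsOutwardUnitNormal S q μ → ip μ e < 0) (hμ : IsOutwardUnitNormal S q μ) :
    ∃ a : Mink n → Mink n →L[ℝ] ℝ, DifferentiableAt ℝ a q ∧
      ∀ᶠ y in 𝓝 q, ∀ ν, IsOutwardUnitNormal S y ν → ∃ c : ℝ, 0 < c ∧ ∀ x, ip ν x = c * a y x := by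
  have hcone : ∀ {y ν : Mink n}, IsOutwardUnitNormal S y ν → y ∈ cone S := by
    rintro y ν ⟨l, hl, x, hx, rfl, -⟩; exact ⟨l, hl, x, hx, rfl⟩
  obtain ⟨z, hz, rfl⟩ := mem_cone_iff.1 (hcone hμ)
  set G : Mink n → Mink n := fun y => coneMap S y.1 + y.2 • e with hG
  have hGz : G (z, 0) = coneMap S z := by simp [hG]
  have hGs : SmoothNear G (z, 0) := by
    have h1 : ∀ᶠ y in 𝓝 ((z, 0) : Mink n), y.1 ≠ 0 :=
      (continuousAt_fst (p := ((z, 0) : Mink n))).eventually (isOpen_ne.mem_nhds hz)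
    filter_upwards [h1] with y hy
    exact ((hS.contDiffAt_coneMap hy).comp y contDiffAt_fst).add
      (contDiffAt_snd.smul contDiffAt_const)
  have hGd : ∀ z' : Euc n, z' ≠ 0 → ∀ r : ℝ, ∀ v : Mink n,
      fderiv ℝ G (z', r) v = fderiv ℝ (coneMap S) z' v.1 + v.2 • e := by
    intro z' hz' r v
    have h1 : HasFDerivAt (fun y : Mink n => coneMap S y.1) _ (z', r) :=
      HasFDerivAt.comp (g := coneMap S) (f := Prod.fst) (z', r)
      ((hS.contDiffAt_coneMap hz').differentiableAt (by simp)).hasFDerivAt hasFDerivAt_fst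
    have h2 : HasFDerivAt (fun y : Mink n => y.2 • e) _ (z', r) :=
      HasFDerivAt.smul_const (𝕜 := ℝ) (hasFDerivAt_snd (p := (z', r))) e
    have h3 : HasFDerivAt G _ (z', r) := h1.add h2
    rw [h3.fderiv]; simp
  have hinj : ∀ w, fderiv ℝ G (z, 0) w = 0 → w = 0 := by
    intro w hw
    rw [hGd z hz] at hw
    obtain ⟨-, h1, h2⟩ := hμ.support
    have h3 := hS.ip_fderiv_coneMap_eq_zero hz h1 h2 w.1
    have h4 : ip μ (fderiv ℝ (coneMap S) z w.1 + w.2 • e) = 0 := by rw [hw, ip_zero_right]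
    rw [ip_add_right, h3, ip_smul_right, zero_add] at h4
    have h5 : w.2 = 0 := (mul_eq_zero.1 h4).resolve_right (he _ _ hμ).ne
    rw [h5, zero_smul, add_zero] at hw
    exact Prod.ext (hS.fderiv_coneMap_injective hz hw) h5
  obtain ⟨ψ, h1, h2, h3, h4⟩ := exists_smooth_inverse hGs hinj rfl
  rw [hGz] at h1 h2 h3
  set a : Mink n → Mink n →L[ℝ] ℝ := fun y =>
    -(ContinuousLinearMap.snd ℝ (Euc n) ℝ).comp (fderiv ℝ ψ y) with ha
  have had : DifferentiableAt ℝ a (coneMap S z) := by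
    have h5 : DifferentiableAt ℝ (fderiv ℝ ψ) (coneMap S z) :=
      (h1.contDiffAt.fderiv_right (m := ∞) (by simp)).differentiableAt (by simp)
    exact ((differentiableAt_const _).clm_comp h5).neg
  refine ⟨a, had, ?_⟩
  have h4' : ∀ᶠ z' in 𝓝 z, (∀ᶠ x in 𝓝 ((z', 0) : Mink n), ψ (G x) = x) ∧
      DifferentiableAt ℝ ψ (coneMap S z') ∧ ∀ᶠ y in 𝓝 (coneMap S z'), G (ψ y) = y := by
    have hc : Tendsto (fun z' : Euc n => ((z', 0) : Mink n)) (𝓝 z) (𝓝 (z, 0)) := by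
      exact (Continuous.prodMk continuous_id continuous_const).continuousAt
    have hc' : Tendsto (coneMap S) (𝓝 z) (𝓝 (coneMap S z)) :=
      (hS.contDiffAt_coneMap hz).continuousAt
    filter_upwards [hc.eventually h4.eventually_nhds, hc'.eventually h1,
      hc'.eventually h3.eventually_nhds] with z' a1 a2 a3
    exact ⟨a1, a2.differentiableAt (by simp), a3⟩
  filter_upwards [hS.eventually_coneMap hz h4'] with y hy ν hν
  obtain ⟨z', hz', rfl⟩ := mem_cone_iff.1 (hcone hν)
  obtain ⟨b1, b2, b3⟩ := hy z' hz' rfl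
  refine ⟨-ip ν e, neg_pos.2 (he _ _ hν), fun x => ?_⟩
  obtain ⟨-, c1, c2⟩ := hν.support
  have h6 := hS.ip_fderiv_coneMap_eq_zero hz' c1 c2
  have hψz : ψ (coneMap S z') = (z', 0) := by
    have := b1.self_of_nhds; simpa [hG] using this
  -- `x` is decomposed along the image of the differential of `G`
  have h7 : fderiv ℝ G (z', 0) (fderiv ℝ ψ (coneMap S z') x) = x := by
    have d1 : HasFDerivAt G (fderiv ℝ G (z', 0)) (ψ (coneMap S z')) := by
      rw [hψz]
      have : DifferentiableAt ℝ G (z', 0) := by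
        have e1 : DifferentiableAt ℝ (coneMap S) z' :=
          (hS.contDiffAt_coneMap hz').differentiableAt (by simp)
        exact (DifferentiableAt.comp (g := coneMap S) (f := Prod.fst) ((z', 0) : Mink n) e1
          differentiableAt_fst).add (differentiableAt_snd.smul_const e)
      exact this.hasFDerivAt
    have d2 := d1.comp (coneMap S z') b2.hasFDerivAt
    have d3 := (hasFDerivAt_id (𝕜 := ℝ) (coneMap S z')).congr_of_eventuallyEq
      (f₁ := G ∘ ψ) (by filter_upwards [b3] with y hy using hy)
    exact congr_arg (fun L : Mink n →L[ℝ] Mink n => L x) (d2.unique d3)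
  rw [hGd z' hz'] at h7
  have h8 := congr_arg (ip ν) h7
  rw [ip_add_right, h6, ip_smul_right, zero_add] at h8
  rw [← h8, ha]
  simp only [_root_.neg_apply, ContinuousLinearMap.comp_apply,
    ContinuousLinearMap.coe_snd']
  ring

end Cone


/-! ### The geometry of a hypersurface along its free boundary -/

section Support

variable {n : ℕ} {s : Set (Euc n)} {X : Euc n → Mink n} {x : Euc n}

theorem exists_hasFDerivWithinAt_ip {V : Type*} [NormedAddCommGroup V] [NormedSpace ℝ V]
    {s : Set V} {z : V} {f g : V → Mink n} {f' g' : V →L[ℝ] Mink n}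
    (hf : HasFDerivWithinAt f f' s z) (hg : HasFDerivWithinAt g g' s z) :
    ∃ L : V →L[ℝ] ℝ, HasFDerivWithinAt (fun y => ip (f y) (g y)) L s z ∧
      ∀ v, L v = ip (f' v) (g z) + ip (f z) (g' v) := by
  have h1 := (hf.fst.inner ℝ hg.fst).sub (hf.snd.mul hg.snd)
  refine ⟨_, h1, fun v => ?_⟩
  simp [MinkMCF.ip, fderivInnerCLM_apply]
  ring

/-- Minkowski space is the sum of a spacelike hyperplane and its normal line. -/
theorem IsUnitNormal.exists_decomposition {D : Euc n →L[ℝ] Mink n} {N : Mink n}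
    (h : IsUnitNormal D N) (hD : ∀ w, w ≠ 0 → 0 < ip (D w) (D w)) (b : Mink n) :
    ∃ w, b = D w - ip b N • N := by
  set A : Mink n →L[ℝ] Mink n :=
    D.coprod (ContinuousLinearMap.toSpanSingleton ℝ N) with hA
  have hAv : ∀ v : Mink n, A v = D v.1 + v.2 • N := fun v => by simp [hA]
  have hinj : Function.Injective A.toLinearMap := by
    refine (injective_iff_map_eq_zero _).2 fun v hv => ?_
    have hv' : D v.1 + v.2 • N = 0 := by rw [← hAv]; exact hv
    have h1 := congr_arg (fun y => ip y N) hv'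
    simp only [ip_add_left, h.orthogonal, ip_smul_left, h.unit, ip_zero_left] at h1
    have h2 : v.2 = 0 := by linarith
    rw [h2, zero_smul, add_zero] at hv'
    refine Prod.ext (by_contra fun h3 => ?_) h2
    have := hD v.1 h3
    rw [hv', ip_zero_left] at this
    exact lt_irrefl _ this
  obtain ⟨v, hv⟩ := LinearMap.injective_iff_surjective.1 hinj b
  have hv' : b = D v.1 + v.2 • N := by rw [← hAv]; exact hv.symm
  have h1 := congr_arg (fun y => ip y N) hv'
  simp only [ip_add_left, h.orthogonal, ip_smul_left, h.unit] at h1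
  refine ⟨v.1, ?_⟩
  rw [show ip b N = -v.2 by linarith, neg_smul, sub_neg_eq_add]
  exact hv'

/-- Future directed timelike vectors have negative product. -/
theorem ip_neg_of_future {a b : Mink n} (ha : ip a a < 0) (ha' : 0 < a.2) (hb : ip b b < 0)
    (hb' : 0 < b.2) : ip a b < 0 := by
  simp only [ip, real_inner_self_eq_norm_sq] at *
  have h1 := real_inner_le_norm a.1 b.1
  have h2 : ‖a.1‖ < a.2 := by nlinarith [norm_nonneg a.1]
  have h3 : ‖b.1‖ < b.2 := by nlinarith [norm_nonneg b.1]
  nlinarith [norm_nonneg a.1, norm_nonneg b.1]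

theorem differentiableWithinAt_unitNormal (h : (metric s X x).PosDef)
    (hd : ∀ i, DifferentiableWithinAt ℝ (pd s X i) s x) :
    DifferentiableWithinAt ℝ (unitNormal s X) s x := by
  have hip : ∀ {a b : Euc n → Mink n}, DifferentiableWithinAt ℝ a s x →
      DifferentiableWithinAt ℝ b s x → DifferentiableWithinAt ℝ (fun y => ip (a y) (b y)) s x := by
    intro a b ha hb
    obtain ⟨L, hL, -⟩ := exists_hasFDerivWithinAt_ip ha.hasFDerivWithinAt hb.hasFDerivWithinAt
    exact hL.differentiableWithinAt
  have hm : ∀ i j, DifferentiableWithinAt ℝ (fun y => metric s X y i j) s x :=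
    fun i j => hip (hd i) (hd j)
  have hdetA : ∀ A : Euc n → Matrix (Fin n) (Fin n) ℝ,
      (∀ i j, DifferentiableWithinAt ℝ (fun y => A y i j) s x) →
      DifferentiableWithinAt ℝ (fun y => (A y).det) s x := by
    intro A hA
    simp only [Matrix.det_apply']
    refine DifferentiableWithinAt.fun_sum fun σ _ => (differentiableWithinAt_const _).mul ?_
    exact (HasFDerivWithinAt.finsetProd (g := fun i y => A y (σ i) i)
      fun i _ => (hA (σ i) i).hasFDerivWithinAt).differentiableWithinAt
  have hadj : ∀ i j, DifferentiableWithinAt ℝ (fun y => (metric s X y).adjugate i j) s x := by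
    intro i j
    simp only [Matrix.adjugate_apply]
    refine hdetA _ fun k l => ?_
    by_cases hk : k = j
    · subst hk
      simp only [Matrix.updateRow_self]
      exact differentiableWithinAt_const _
    · simp only [Matrix.updateRow_ne hk]
      exact hm k l
  have hinv : ∀ i j, DifferentiableWithinAt ℝ (fun y => (metric s X y)⁻¹ i j) s x := by
    intro i j
    simp only [Matrix.inv_def, Ring.inverse_eq_inv', Matrix.smul_apply, smul_eq_mul]
    exact ((hdetA _ hm).inv (posDef_det_ne_zero h)).mul (hadj i j)
  have hN : DifferentiableWithinAt ℝ (normalPart s X) s x := by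
    unfold normalPart
    refine (differentiableWithinAt_const _).sub ?_
    exact DifferentiableWithinAt.fun_sum fun i _ => DifferentiableWithinAt.fun_sum fun j _ =>
      ((hinv i j).mul (hip (differentiableWithinAt_const _) (hd j))).smul (hd i)
  obtain ⟨h1, h2⟩ := ip_normalPart_self h
  have h3 : 0 < -ip (normalPart s X x) (normalPart s X x) := by rw [h1]; linarith
  unfold unitNormal
  exact (((hip hN hN).neg.sqrt h3.ne').inv (Real.sqrt_pos.2 h3).ne').smul hN

/-- The derivative version of `⟨α(τ) - α(0), y(τ) - y(0)⟩ ≥ 0`. -/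
theorem nonneg_of_monotone_pairing {α : ℝ → Mink n →L[ℝ] ℝ} {y : ℝ → Mink n}
    {α' : Mink n →L[ℝ] ℝ} {y' : Mink n} (hα : HasDerivAt α α' 0) (hy : HasDerivAt y y' 0)
    (h : ∀ᶠ τ in 𝓝 (0 : ℝ), 0 ≤ (α τ - α 0) (y τ - y 0)) : 0 ≤ α' y' := by
  have h1 := (isBoundedBilinearMap_apply (𝕜 := ℝ) (E := Mink n) (F := ℝ)).continuous.tendsto
      (α', y') |>.comp ((hasDerivAt_iff_tendsto_slope.1 hα).prodMk_nhds
        (hasDerivAt_iff_tendsto_slope.1 hy))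
  refine ge_of_tendsto h1 ?_
  filter_upwards [nhdsWithin_le_nhds h] with τ hτ
  change 0 ≤ slope α 0 τ (slope y 0 τ)
  rw [slope_def_module, slope_def_module, ContinuousLinearMap.smul_apply, map_smul, smul_eq_mul,
    smul_eq_mul, ← mul_assoc]
  exact mul_nonneg (mul_self_nonneg _) hτ

end Support

section Boundary

variable {n : ℕ} [NeZero n] {M : Type*} [TopologicalSpace M]
  [ChartedSpace (EuclideanHalfSpace n) M] [IsManifold (𝓡∂ n) ∞ M] {f : M → Mink n} {p : M}
  {S : Euc n → Euc n}

/-- Linear functions with spacelike gradient have no interior maxima on a spacelike hypersurface. -/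
theorem not_isLocalMax_ip (hf : ContMDiff (𝓡∂ n) 𝓘(ℝ, Mink n) ∞ f) (hs : IsSpacelike f)
    (hp : (𝓡∂ n).IsInteriorPoint p) {a : Mink n} (ha : 0 < ip a a) :
    ¬ IsLocalMax (fun q => ip a (f q)) p := by
  intro hmax
  set x := extChartAt (𝓡∂ n) p p with hx
  have hxi : x ∈ interior (extChartAt (𝓡∂ n) p).target :=
    mem_interior_of_isInteriorPoint hp (mem_extChartAt_source p)
  have hr : Set.range (𝓡∂ n) ∈ 𝓝 x :=
    mem_of_superset (isOpen_interior.mem_nhds hxi)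
      (interior_subset.trans (extChartAt_target_subset_range p))
  have hD := (differentiableWithinAt_localRep hf (mem_extChartAt_source p)).hasFDerivWithinAt
  set D := fderivWithin ℝ (localRep f p) (Set.range (𝓡∂ n)) x with hDdef
  have hmax' : IsLocalMax (fun y => ipL a (localRep f p y)) x := by
    filter_upwards [(tendsto_extChartAt_symm p).eventually hmax] with y hy
    simp only [ipL_apply]
    rw [hx, localRep_self]; exact hy
  have h0 := hmax'.hasFDerivAt_eq_zero ((ipL a).hasFDerivAt.comp x (hD.hasFDerivAt hr))
  have h0' : ∀ w, ip a (D w) = 0 := fun w => by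
    have := congr_arg (fun L : Euc n →L[ℝ] ℝ => L w) h0
    simpa [ipL_apply] using this
  have hpos := posDef_iff.1 (hs p)
  obtain ⟨w, hw⟩ := (isUnitNormal_unitNormal (hs p)).exists_decomposition hpos a
  have hN := (isUnitNormal_unitNormal (hs p)).unit
  set N := unitNormal (Set.range (𝓡∂ n)) (localRep f p) (extChartAt (𝓡∂ n) p p)
  have h1 : ip a a = -ip a N * ip a N := by
    nth_rewrite 2 [hw]
    rw [ip_sub_right, ip_smul_right]
    have := h0' w
    rw [hDdef] at this
    rw [this]; ring
  nlinarith [mul_self_nonneg (ip a N)]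

theorem isBoundaryPoint_symm {x : Euc n} (hx : x ∈ (extChartAt (𝓡∂ n) p).target) (h0 : x 0 = 0) :
    (extChartAt (𝓡∂ n) p).symm x ∈ (𝓡∂ n).boundary M := by
  by_contra h
  have hi : (𝓡∂ n).IsInteriorPoint ((extChartAt (𝓡∂ n) p).symm x) :=
    ((𝓡∂ n).isInteriorPoint_iff_not_isBoundaryPoint _).2 h
  have h1 := mem_interior_of_isInteriorPoint hi ((extChartAt (𝓡∂ n) p).map_target hx)
  rw [(extChartAt (𝓡∂ n) p).right_inv hx] at h1
  have h2 := interior_mono (extChartAt_target_subset_range p) h1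
  rw [interior_range_modelWithCornersEuclideanHalfSpace] at h2
  have h3 : 0 < x 0 := h2
  linarith

theorem extChartAt_zero_of_boundary (hp : p ∈ (𝓡∂ n).boundary M) :
    extChartAt (𝓡∂ n) p p 0 = 0 := by
  have h : extChartAt (𝓡∂ n) p p ∈ frontier (Set.range (𝓡∂ n)) := hp
  rw [frontier_range_modelWithCornersEuclideanHalfSpace] at h
  exact h.symm

variable [CompactSpace M]

/-- Half spaces with timelike boundary that contain the cone contain the hypersurface, with its
interior in their interior. -/
theorem ip_nonpos_of_support (hf : ContMDiff (𝓡∂ n) 𝓘(ℝ, Mink n) ∞ f) (hs : IsSpacelike f)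
    (hb : MeetsConePerp S f) {a : Mink n} (ha : 0 < ip a a) (hc : ∀ y ∈ cone S, ip a y ≤ 0) :
    (∀ q, ip a (f q) ≤ 0) ∧ ∀ q, (𝓡∂ n).IsInteriorPoint q → ip a (f q) < 0 := by
  have hcont : Continuous fun q => ip a (f q) := by
    simp only [← ipL_apply]; exact (ipL a).continuous.comp hf.continuous
  have h1 : ∀ q, ip a (f q) ≤ 0 := by
    intro q
    have : Nonempty M := ⟨q⟩
    obtain ⟨p, -, hp⟩ := isCompact_univ.exists_isMaxOn Set.univ_nonempty hcont.continuousOn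
    refine (hp (Set.mem_univ q)).trans ?_
    rcases (𝓡∂ n).isInteriorPoint_or_isBoundaryPoint p with hi | hbd
    · exact absurd (Filter.Eventually.of_forall fun q => hp (Set.mem_univ q))
        (not_isLocalMax_ip hf hs hi ha)
    · exact hc _ (hb p hbd).1
  refine ⟨h1, fun q hq => lt_of_le_of_ne (h1 q) fun h0 => ?_⟩
  refine not_isLocalMax_ip hf hs hq ha (Filter.Eventually.of_forall fun q' => ?_)
  exact (h1 q').trans h0.ge

/-- A spacelike hypersurface with boundary on `Σ` stays inside `Σ`. -/
theorem MeetsConePerp.ip_nonpos (hf : ContMDiff (𝓡∂ n) 𝓘(ℝ, Mink n) ∞ f) (hs : IsSpacelike f)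
    (hb : MeetsConePerp S f) {y μ : Mink n} (hμ : IsOutwardUnitNormal S y μ) :
    (∀ q, ip μ (f q) ≤ 0) ∧ ∀ q, (𝓡∂ n).IsInteriorPoint q → ip μ (f q) < 0 := by
  obtain ⟨h1, -, h2⟩ := hμ.support
  exact ip_nonpos_of_support hf hs hb (by rw [h1]; exact one_pos) h2

theorem mem_posTangentConeAt_halfSpace {x v : Euc n} (hx : x ∈ Set.range (𝓡∂ n)) (hv : 0 ≤ v 0) :
    v ∈ posTangentConeAt (Set.range (𝓡∂ n)) x := by
  refine mem_posTangentConeAt_of_segment_subset ?_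
  rw [range_modelWithCornersEuclideanHalfSpace] at hx ⊢
  rw [segment_eq_image']
  rintro _ ⟨θ, hθ, rfl⟩
  have h1 : 0 ≤ x 0 := hx
  simp only [Set.mem_ofPred_eq, add_sub_cancel_left, PiLp.add_apply, PiLp.smul_apply, smul_eq_mul]
  exact add_nonneg h1 (mul_nonneg hθ.1 hv)

theorem MeetsConePerp.ip_fderivWithin_nonpos (hf : ContMDiff (𝓡∂ n) 𝓘(ℝ, Mink n) ∞ f)
    (hs : IsSpacelike f) (hb : MeetsConePerp S f) {μ : Mink n}
    (hμ : IsOutwardUnitNormal S (f p) μ) {v : Euc n} (hv : 0 ≤ v 0) :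
    ip μ (fderivWithin ℝ (localRep f p) (Set.range (𝓡∂ n)) (extChartAt (𝓡∂ n) p p) v) ≤ 0 := by
  have hD := (differentiableWithinAt_localRep hf (mem_extChartAt_source p)).hasFDerivWithinAt
  have hmax : IsLocalMaxOn (fun y => ipL μ (localRep f p y)) (Set.range (𝓡∂ n))
      (extChartAt (𝓡∂ n) p p) := by
    refine Filter.Eventually.of_forall fun y => ?_
    simp only [ipL_apply]
    rw [localRep_self, hμ.support.2.1]
    exact (hb.ip_nonpos hf hs hμ).1 _
  have := hmax.hasFDerivWithinAt_nonpos ((ipL μ).hasFDerivAt.comp_hasFDerivWithinAt _ hD)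
    (mem_posTangentConeAt_halfSpace (Set.mem_range_self _) hv)
  simpa [ipL_apply] using this

theorem MeetsConePerp.ip_fderivWithin_eq_zero (hf : ContMDiff (𝓡∂ n) 𝓘(ℝ, Mink n) ∞ f)
    (hs : IsSpacelike f) (hb : MeetsConePerp S f) {μ : Mink n}
    (hμ : IsOutwardUnitNormal S (f p) μ) {v : Euc n} (hv : v 0 = 0) :
    ip μ (fderivWithin ℝ (localRep f p) (Set.range (𝓡∂ n)) (extChartAt (𝓡∂ n) p p) v) = 0 := by
  refine le_antisymm (hb.ip_fderivWithin_nonpos hf hs hμ hv.ge) ?_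
  have := hb.ip_fderivWithin_nonpos hf hs hμ (v := -v) (by simp [hv])
  rw [map_neg, ip_neg_right] at this
  linarith

/-- The inward conormal of the hypersurface is the inward normal of the cone. -/
theorem MeetsConePerp.exists_inward (hf : ContMDiff (𝓡∂ n) 𝓘(ℝ, Mink n) ∞ f)
    (hs : IsSpacelike f) (hb : MeetsConePerp S f) (hp : p ∈ (𝓡∂ n).boundary M) {μ : Mink n}
    (hμ : IsOutwardUnitNormal S (f p) μ) :
    ∃ w : Euc n, fderivWithin ℝ (localRep f p) (Set.range (𝓡∂ n)) (extChartAt (𝓡∂ n) p p) w = -μ ∧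
      0 < w 0 := by
  have hN := (hb p hp).2 μ hμ
  obtain ⟨w, hw⟩ := (isUnitNormal_unitNormal (hs p)).exists_decomposition (posDef_iff.1 (hs p)) (-μ)
  rw [ip_neg_left, ip_comm, show ip (unitNormal _ _ _) μ = 0 from hN, neg_zero, zero_smul,
    sub_zero] at hw
  refine ⟨w, hw.symm, by_contra fun h0 => ?_⟩
  have := hb.ip_fderivWithin_nonpos hf hs hμ (v := -w) (by simpa using h0)
  rw [map_neg, ← hw, neg_neg, hμ.support.1] at this
  linarith

/-- The support function `-⟨F, ν⟩` of a hypersurface in a chart. -/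
def supportRep (f : M → Mink n) (p : M) (y : Euc n) : ℝ :=
  -ip (localRep f p y) (unitNormal (Set.range (𝓡∂ n)) (localRep f p) y)

/-- At a perpendicular boundary along a convex cone the support function `-⟨F, ν⟩` does not decrease
in the inward direction. -/
theorem MeetsConePerp.supportRep_inward (hS : IsSphereEmbedding S) (hconv : IsConvexSphere S)
    (hf : ContMDiff (𝓡∂ n) 𝓘(ℝ, Mink n) ∞ f) (hs : IsSpacelike f) (hb : MeetsConePerp S f)
    {e : Mink n} (he : ∀ q μ, IsOutwardUnitNormal S q μ → ip μ e < 0)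
    (hp : p ∈ (𝓡∂ n).boundary M) {μ : Mink n} (hμ : IsOutwardUnitNormal S (f p) μ) {w : Euc n}
    (hw : fderivWithin ℝ (localRep f p) (Set.range (𝓡∂ n)) (extChartAt (𝓡∂ n) p p) w = -μ)
    (hw0 : 0 < w 0) :
    ∃ L : Euc n →L[ℝ] ℝ, HasFDerivWithinAt (supportRep f p) L (Set.range (𝓡∂ n))
      (extChartAt (𝓡∂ n) p p) ∧ 0 ≤ L w := by
  set s := Set.range (𝓡∂ n) with hsdef
  set x := extChartAt (𝓡∂ n) p p with hx
  set X := localRep f p with hX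
  have hxs : x ∈ s := Set.mem_range_self _
  have hsU : UniqueDiffOn ℝ s := (𝓡∂ n).uniqueDiffOn
  have hXx : X x = f p := localRep_self f p
  have hXc : ContDiffWithinAt ℝ ∞ X s x :=
    (contDiffOn_localRep hf p x (mem_extChartAt_target p)).mono_of_mem_nhdsWithin
      (extChartAt_target_mem_nhdsWithin p)
  have hD2c : DifferentiableWithinAt ℝ (fderivWithin ℝ X s) s x :=
    (hXc.fderivWithin_right (m := ∞) hsU (by simp) hxs).differentiableWithinAt (by simp)
  have hXd : HasFDerivWithinAt X (fderivWithin ℝ X s x) s x :=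
    (differentiableWithinAt_localRep hf (mem_extChartAt_source p)).hasFDerivWithinAt
  set D := fderivWithin ℝ X s x with hD
  set D2 := fderivWithin ℝ (fderivWithin ℝ X s) s x with hD2
  have hsymm : ∀ v v', D2 v v' = D2 v' v := by
    refine hXc.isSymmSndFDerivWithinAt (by simpa using WithTop.coe_le_coe.2 (le_top (a := (2 : ℕ∞)))) hsU ?_ hxs
    exact (𝓡∂ n).range_subset_closure_interior hxs
  have hNd : HasFDerivWithinAt (unitNormal s X) _ s x :=
    (differentiableWithinAt_unitNormal (hs p) fun i => hD2c.clm_apply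
      (differentiableWithinAt_const _)).hasFDerivWithinAt
  set N := unitNormal s X with hN
  set DN := fderivWithin ℝ N s x with hDN
  have hnormal := isUnitNormal_unitNormal (hs p)
  have hnear : ∀ᶠ y in 𝓝[s] x, IsUnitNormal (fderivWithin ℝ X s y) (N y) := by
    filter_upwards [extChartAt_target_mem_nhdsWithin (I := 𝓡∂ n) p] with y hy
    have := posDef_localRep hf hs ((extChartAt (𝓡∂ n) p).map_target hy)
    rw [(extChartAt (𝓡∂ n) p).right_inv hy] at this
    exact isUnitNormal_unitNormal this
  have hNN : ∀ v, ip (N x) (DN v) = 0 := by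
    intro v
    obtain ⟨L, h1, h2⟩ := exists_hasFDerivWithinAt_ip hNd hNd
    have h3 := (hasFDerivWithinAt_const (𝕜 := ℝ) (-1 : ℝ) x s).congr_of_eventuallyEq
      (f₁ := fun y => ip (N y) (N y)) (by filter_upwards [hnear] with y hy using hy.unit)
      hnormal.unit
    have h4 := congr_arg (fun L : Euc n →L[ℝ] ℝ => L v) ((hsU x hxs).eq h1 h3)
    simp only [h2, ContinuousLinearMap.zero_apply] at h4
    rw [ip_comm (DN v)] at h4; linarith
  have hDN2 : ∀ v v', ip (D v) (DN v') = -ip (D2 v' v) (N x) := by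
    intro v v'
    have h0 : HasFDerivWithinAt (fun y => fderivWithin ℝ X s y v) (D2.flip v) s x := by
      have := hD2c.hasFDerivWithinAt.clm_apply (hasFDerivWithinAt_const v x s)
      refine this.congr_fderiv ?_
      ext1 v; simp [hD2]
    obtain ⟨L, h1, h2⟩ := exists_hasFDerivWithinAt_ip h0 hNd
    have h3 := (hasFDerivWithinAt_const (𝕜 := ℝ) (0 : ℝ) x s).congr_of_eventuallyEq
      (f₁ := fun y => ip (fderivWithin ℝ X s y v) (N y))
      (by filter_upwards [hnear] with y hy using hy.orthogonal v) (hnormal.orthogonal v)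
    have h4 := congr_arg (fun L : Euc n →L[ℝ] ℝ => L v') ((hsU x hxs).eq h1 h3)
    simp only [h2, ContinuousLinearMap.zero_apply, ContinuousLinearMap.flip_apply] at h4
    linarith
  obtain ⟨L, hL, hLv⟩ := exists_hasFDerivWithinAt_ip hXd hNd
  refine ⟨-L, hL.neg, ?_⟩
  -- the tangential part of the position vector
  obtain ⟨z, hz⟩ := hnormal.exists_decomposition (posDef_iff.1 (hs p)) (f p)
  have hNμ : ip (N x) μ = 0 := (hb p hp).2 μ hμ
  obtain ⟨hμ1, hμ2, -⟩ := hμ.support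
  have hDzμ : ip μ (D z) = 0 := by
    have h1 : D z = f p + ip (f p) (N x) • N x := by
      nth_rewrite 1 [hz]; exact (sub_add_cancel _ _).symm
    rw [h1, ip_add_right, ip_smul_right, hμ2, ip_comm μ, hNμ]; ring
  have hz0 : z 0 = 0 := by
    have h1 := hb.ip_fderivWithin_eq_zero hf hs hμ (v := z - (z 0 / w 0) • w) (by
      simp only [PiLp.sub_apply, PiLp.smul_apply, smul_eq_mul]
      field_simp; ring)
    rw [map_sub, map_smul, hw, ip_sub_right, ip_smul_right, ip_neg_right, hμ1] at h1
    change ip μ (D z) - _ = 0 at h1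
    rw [hDzμ] at h1
    have : z 0 / w 0 = 0 := by linarith
    exact (div_eq_zero_iff.1 this).resolve_right hw0.ne'
  have hLw : (-L) w = ip μ (DN z) := by
    change -(L w) = _
    rw [hLv]
    change -(ip (D w) (N x) + ip (X x) (DN w)) = _
    rw [hnormal.orthogonal w, hXx]
    have h1 : ip (f p) (DN w) = ip (D z) (DN w) := by
      nth_rewrite 1 [hz]
      rw [ip_sub_left, ip_smul_left]
      change ip (D z) (DN w) - ip (f p) (N x) * ip (N x) (DN w) = _
      rw [hNN]; ring
    rw [h1, hDN2, hsymm, ← hDN2, show D w = -μ from hw, ip_neg_left]; ring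
  rw [hLw]
  -- curves along the boundary in the direction of `z`
  obtain ⟨a, had, ha⟩ := exists_conormal_field hS he hμ
  set c : ℝ → Euc n := fun τ => x + τ • z with hc
  have hc0 : c 0 = x := by simp [hc]
  have hcd : HasDerivAt c z 0 := by
    have := ((hasDerivAt_id (0 : ℝ)).smul_const z).const_add x
    rw [one_smul] at this
    exact this
  have hx0 : x 0 = 0 := extChartAt_zero_of_boundary hp
  have hc00 : ∀ τ, c τ 0 = 0 := fun τ => by simp [hc, hx0, hz0]
  have hcs : ∀ τ, c τ ∈ s := fun τ => by
    rw [hsdef, range_modelWithCornersEuclideanHalfSpace]; exact (hc00 τ).ge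
  have hcT : Tendsto c (𝓝 0) (𝓝[s] x) :=
    tendsto_nhdsWithin_iff.2 ⟨hc0 ▸ hcd.continuousAt, Filter.Eventually.of_forall hcs⟩
  have hyd : HasDerivAt (fun τ => X (c τ)) (D z) 0 := by
    rw [← hasDerivWithinAt_univ]
    exact HasFDerivWithinAt.comp_hasDerivWithinAt (t := s) 0 (by rw [hc0]; exact hXd)
      hcd.hasDerivWithinAt fun τ _ => hcs τ
  have hnd : HasDerivAt (fun τ => N (c τ)) (DN z) 0 := by
    rw [← hasDerivWithinAt_univ]
    exact HasFDerivWithinAt.comp_hasDerivWithinAt (t := s) 0 (by rw [hc0]; exact hNd)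
      hcd.hasDerivWithinAt fun τ _ => hcs τ
  have hαd : HasDerivAt (fun τ => a (X (c τ))) (fderiv ℝ a (f p) (D z)) 0 :=
    HasFDerivAt.comp_hasDerivAt (f := fun τ => X (c τ)) 0
      (by rw [hc0, hXx]; exact had.hasFDerivAt) hyd
  set α : ℝ → Mink n →L[ℝ] ℝ := fun τ => a (X (c τ)) with hα
  set α' := fderiv ℝ a (f p) (D z) with hα'
  have hα0 : α 0 = a (f p) := by simp only [hα]; rw [hc0, hXx]
  obtain ⟨c0, hc0pos, hc0μ⟩ := ha.self_of_nhds μ hμ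
  have hyT : Tendsto (fun τ => X (c τ)) (𝓝 0) (𝓝 (f p)) := by
    have := hyd.continuousAt
    rwa [ContinuousAt, hc0, hXx] at this
  have hS' : ∀ y ∈ cone S, a (f p) y ≤ 0 := fun y hy => by
    have h1 := hμ.support.2.2 y hy
    rw [hc0μ] at h1
    exact nonpos_of_mul_nonpos_right h1 hc0pos
  have hf0 : a (f p) (f p) = 0 := by
    have := hμ2; rw [hc0μ] at this
    exact (mul_eq_zero.1 this).resolve_left hc0pos.ne'
  have key : ∀ᶠ τ in 𝓝 (0 : ℝ), X (c τ) ∈ cone S ∧ α τ (N (c τ)) = 0 ∧ α τ (X (c τ)) = 0 ∧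
      α τ (f p) ≤ 0 := by
    filter_upwards [hyT.eventually ha,
      hcT.eventually (extChartAt_target_mem_nhdsWithin (I := 𝓡∂ n) p)] with τ h1 h2
    have hbd := isBoundaryPoint_symm h2 (hc00 τ)
    obtain ⟨hcn, hperp⟩ := hb _ hbd
    change X (c τ) ∈ cone S at hcn
    refine ⟨hcn, ?_⟩
    obtain ⟨ν, hν⟩ : ∃ ν, IsOutwardUnitNormal S (X (c τ)) ν := exists_isOutwardUnitNormal hS hconv hcn
    obtain ⟨k, hk, hkν⟩ := h1 ν hν
    have hNq := hperp ν hν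
    rw [normalAt_eq_localRep hf hs ((extChartAt (𝓡∂ n) p).map_target h2),
      (extChartAt (𝓡∂ n) p).right_inv h2] at hNq
    change ip (N (c τ)) ν = 0 at hNq
    obtain ⟨-, b1, b2⟩ := hν.support
    rw [ip_comm, hkν] at hNq
    rw [hkν] at b1
    have b3 := b2 (f p) (hb p hp).1
    rw [hkν] at b3
    exact ⟨(mul_eq_zero.1 hNq).resolve_left hk.ne', (mul_eq_zero.1 b1).resolve_left hk.ne',
      nonpos_of_mul_nonpos_right b3 hk⟩
  -- first derivative of `⟨ν, μ⟩ = 0`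
  have r1 : α' (N x) + a (f p) (DN z) = 0 := by
    have h1 := hαd.clm_apply hnd
    have h2 := (hasDerivAt_const (0 : ℝ) (0 : ℝ)).congr_of_eventuallyEq
      (f₁ := fun τ => α τ (N (c τ))) (by filter_upwards [key] with τ h using h.2.1)
    have h3 := h1.unique h2
    rw [hc0] at h3
    rw [← hα0]; exact h3
  -- the conormal along the curve has its maximum at `f p`
  have r2 : α' (f p) = 0 := by
    have h1 := hαd.clm_apply (hasDerivAt_const (0 : ℝ) (f p))
    have hmax : IsLocalMax (fun τ => α τ (f p)) 0 := by
      filter_upwards [key] with τ h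
      rw [hα0, hf0]; exact h.2.2.2
    have := hmax.hasDerivAt_eq_zero h1
    simpa using this
  -- convexity: the conormal is monotone
  have r3 : 0 ≤ α' (D z) := by
    refine nonneg_of_monotone_pairing hαd hyd ?_
    filter_upwards [key] with τ ⟨k1, _, k2, k3⟩
    have e0 : X (c 0) = f p := by rw [hc0, hXx]
    rw [e0, hα0]
    simp only [ContinuousLinearMap.sub_apply, map_sub, k2, hf0]
    linarith [hS' _ k1]
  rw [hc0μ]
  refine mul_nonneg hc0pos.le ?_
  have hfp := cone_timelike hS (hb p hp).1
  have hsup : ip (f p) (N x) < 0 :=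
    ip_neg_of_future hfp.1 hfp.2 (by rw [hnormal.unit]; norm_num) hnormal.future
  have r4 : α' (D z) = ip (f p) (N x) * α' (N x) := by
    have h1 : D z = f p + ip (f p) (N x) • N x := by
      nth_rewrite 1 [hz]; exact (sub_add_cancel _ _).symm
    rw [h1, map_add, map_smul, r2, zero_add, smul_eq_mul]
  rw [r4] at r3
  have : α' (N x) ≤ 0 := nonpos_of_mul_nonneg_right r3 hsup
  linarith

end Boundary


/-! ### The maximum principle with free boundary and the global bounds -/

section GlobalBounds

variable {n : ℕ} [NeZero n] {M : Type*} [TopologicalSpace M]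
  [ChartedSpace (EuclideanHalfSpace n) M] {F : M → ℝ → Mink n} {p : M} {t T : ℝ} {u : ST n → ℝ}
  {S : Euc n → Euc n} {F₀ : M → Mink n}

theorem ip_eq_sum (a b : Mink n) : ip a b = ∑ i, a.1 i * b.1 i - a.2 * b.2 := by
  simp only [ip, PiLp.inner_apply, RCLike.inner_apply, conj_trivial]
  congr 1
  exact Finset.sum_congr rfl fun i _ => mul_comm _ _

theorem gF_stProj {z : M × ℝ} (h : (F z.1 z.2).2 = u (stProj F z)) :
    gF u (stProj F z) = -ip (F z.1 z.2) (F z.1 z.2) := by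
  rw [ip_eq_sum, gF, h]; simp [xc, stProj]

theorem gE_stProj (e : Mink n) {z : M × ℝ} (h : (F z.1 z.2).2 = u (stProj F z)) :
    gE e u (stProj F z) = -ip (F z.1 z.2) e := by
  rw [ip_comm, ip_eq_sum, gE, h]; simp [xc, stProj]

theorem tendsto_prodMk_left (z : M × ℝ) : Tendsto (fun q : M => (q, z.2)) (𝓝 z.1) (𝓝 z) := by
  have : Continuous fun q : M => (q, z.2) := by fun_prop
  exact this.continuousAt

namespace IsNeumannMCF

theorem continuousOn_ip (hF : IsNeumannMCF S F₀ T F) (e : Mink n) :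
    ContinuousOn (fun z : M × ℝ => ip (F z.1 z.2) e) (Set.univ ×ˢ Set.Icc 0 T) := by
  have : (fun z : M × ℝ => ip (F z.1 z.2) e) = fun z => ipL e (F z.1 z.2) := by
    funext z; rw [ipL_apply, ip_comm]
  rw [this]
  exact (ipL e).continuous.comp_continuousOn hF.continuousOn

theorem continuousOn_ip_self (hF : IsNeumannMCF S F₀ T F) :
    ContinuousOn (fun z : M × ℝ => ip (F z.1 z.2) (F z.1 z.2)) (Set.univ ×ˢ Set.Icc 0 T) := by
  unfold ip
  exact (hF.continuousOn.fst.inner hF.continuousOn.fst).sub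
    (hF.continuousOn.snd.mul hF.continuousOn.snd)

/-- The solution stays in the future cone: it is timelike by the bound for `F²`, and continuous in time. -/
theorem future (hF : IsNeumannMCF S F₀ T F) (h : ∀ p, ∀ t ∈ Set.Icc 0 T, ip (F p t) (F p t) < 0)
    (h0 : ∀ p, 0 < (F₀ p).2) (p : M) {t : ℝ} (ht : t ∈ Set.Icc 0 T) : 0 < (F p t).2 := by
  by_contra! hle
  have hcont : ContinuousOn (fun τ => (F p τ).2) (Set.Icc 0 t) := by
    have : ContinuousOn (fun τ => F p τ) (Set.Icc 0 t) :=
      hF.continuousOn.comp (Continuous.prodMk continuous_const continuous_id).continuousOn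
        fun τ hτ => ⟨Set.mem_univ _, hτ.1, hτ.2.trans ht.2⟩
    exact this.snd
  have h1 : (0 : ℝ) ∈ Set.Icc (F p t).2 (F p 0).2 := ⟨hle, by rw [hF.initial]; exact (h0 p).le⟩
  obtain ⟨τ, hτ, hτ0⟩ := intermediate_value_Icc' ht.1 hcont h1
  have h2 := h p τ ⟨hτ.1, hτ.2.trans ht.2⟩
  simp only [ip] at h2
  have h3 : (F p τ).2 = 0 := hτ0
  rw [h3, mul_zero, sub_zero] at h2
  exact absurd h2 (not_lt.2 real_inner_self_nonneg)

end IsNeumannMCF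

variable [IsManifold (𝓡∂ n) ∞ M]

/-- Dictionary between the solution and its local graph representation. -/
theorem FlowAt.eventually_normalAt (h : FlowAt F p t u) (hF : IsNeumannMCF S F₀ T F)
    (hp : (𝓡∂ n).IsInteriorPoint p) (ht : t ∈ Set.Ioo 0 T) : ∀ᶠ z in 𝓝 (p, t),
      Adm eb u (stProj F z) ∧ normalAt (fun q => F q z.2) z.1
        = wgt (grad eb u (stProj F z)) • ((grad eb u (stProj F z), 1) : Mink n) ∧
      ∀ I, jetAt (fun q => F q z.2) I z.1 = iter eb I u (stProj F z) := by
  have hint : ∀ᶠ z in 𝓝 (p, t), (𝓡∂ n).IsInteriorPoint z.1 :=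
    (continuousAt_fst (p := (p, t))).eventually (IsNeumannMCF.eventually_isInteriorPoint hp)
  have htime : ∀ᶠ z in 𝓝 (p, t), z.2 ∈ Set.Ioo 0 T :=
    (continuousAt_snd (p := (p, t))).eventually (isOpen_Ioo.mem_nhds ht)
  filter_upwards [hint, htime, h.graph.eventually_nhds,
    (hF.continuousAt_stProj p ht).eventually h.flow.1.eventually] with z hz1 hz2 hz3 hz4
  obtain ⟨q, τ⟩ := z
  have hSq := hF.smoothAt hz1 (Set.Ioo_subset_Icc_self hz2)
  have ha : Adm ec (fun y => u (y, τ)) (F q τ).1 := hz4.slice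
  have hgq : ∀ᶠ q' in 𝓝 q, (F q' τ).2 = u ((F q' τ).1, τ) :=
    (tendsto_prodMk_left (q, τ)).eventually hz3
  have hgrad : grad ec (fun y => u (y, τ)) (F q τ).1 = grad eb u (stProj F (q, τ)) :=
    grad_slice hz4.1
  refine ⟨hz4, ?_, fun I => ?_⟩
  · have hN := hSq.normalAt_eq ha hgq
    rw [hgrad] at hN; exact hN
  · obtain ⟨v, hv⟩ := hSq.exists_graphAt
    have e := (iter_congr (b := ec) (hv.eventuallyEq (v' := fun y => u (y, τ)) hgq) I).self_of_nhds
    change jetAt (fun q => F q τ) I q = _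
    rw [hv.jetAt_eq, e]
    exact (iter_slice (u := u) (x := (F q τ).1) (t := τ) hz4.1 I).self_of_nhds

theorem FlowAt.eventually_gS (h : FlowAt F p t u) (hF : IsNeumannMCF S F₀ T F)
    (hp : (𝓡∂ n).IsInteriorPoint p) (ht : t ∈ Set.Ioo 0 T) : ∀ᶠ z in 𝓝 (p, t),
      gS u (stProj F z) = -ip (F z.1 z.2) (normalAt (fun q => F q z.2) z.1) := by
  filter_upwards [h.eventually_normalAt hF hp ht, h.graph] with z ⟨_, h2, _⟩ h3
  rw [h2, ip_eq_sum, gS, h3]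
  simp [xc, stProj, gn, gw, nrm]

theorem nonempty_interior (p : M) : ∃ q : M, (𝓡∂ n).IsInteriorPoint q := by
  have h1 : extChartAt (𝓡∂ n) p p ∈ closure (interior (Set.range (𝓡∂ n))) :=
    (𝓡∂ n).range_subset_closure_interior (Set.mem_range_self _)
  have h2 := extChartAt_target_mem_nhdsWithin (I := 𝓡∂ n) p
  obtain ⟨U, hU, hxU, hUs⟩ := mem_nhdsWithin.1 h2
  obtain ⟨x, hx1, hx2⟩ := mem_closure_iff.1 h1 U hU hxU
  refine ⟨(extChartAt (𝓡∂ n) p).symm x, isInteriorPoint_of_mem ?_⟩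
  rw [mem_interior]
  exact ⟨U ∩ interior (Set.range (𝓡∂ n)), fun y hy => hUs ⟨hy.1, interior_subset hy.2⟩,
    hU.inter isOpen_interior, hx1, hx2⟩

namespace IsNeumannMCF

variable [CompactSpace M]

/-- The parabolic maximum principle for functions that do not decrease in the inward direction along
the free boundary. The vector `e` inside the cone makes the boundary inequality strict after a small
perturbation. -/
theorem max_principle (hF : IsNeumannMCF S F₀ T F) (hS : IsSphereEmbedding S)
    (hconv : IsConvexSphere S) (hF₀ : ContMDiff (𝓡∂ n) 𝓘(ℝ, Mink n) ∞ F₀) (hT : 0 < T)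
    {e : Mink n} (he : ∀ q μ, IsOutwardUnitNormal S q μ → ip μ e < 0) {Ψ : M × ℝ → ℝ} {C : ℝ}
    (hc : ContinuousOn Ψ (Set.univ ×ˢ Set.Icc 0 T))
    (hint : ∀ p, (𝓡∂ n).IsInteriorPoint p → ∀ t ∈ Set.Ioo 0 T, ∀ u, FlowAt F p t u →
      ∃ ψ : ST n → ℝ, SmoothNear ψ (stProj F (p, t)) ∧
        (∀ᶠ z in 𝓝 (p, t), Ψ z = ψ (stProj F z)) ∧
        box (fun i => gn u i (stProj F (p, t))) ψ (stProj F (p, t)) ≤ 0)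
    (hbd : ∀ p ∈ (𝓡∂ n).boundary M, ∀ t ∈ Set.Ioo 0 T, ∀ μ w, IsOutwardUnitNormal S (F p t) μ →
      fderivWithin ℝ (localRep (fun q => F q t) p) (Set.range (𝓡∂ n)) (extChartAt (𝓡∂ n) p p) w
        = -μ → 0 < w 0 → ∃ L : Euc n →L[ℝ] ℝ,
        HasFDerivWithinAt (fun y => Ψ ((extChartAt (𝓡∂ n) p).symm y, t)) L (Set.range (𝓡∂ n))
          (extChartAt (𝓡∂ n) p p) ∧ 0 ≤ L w)
    (h0 : ∀ p, Ψ (p, 0) ≤ C) (p : M) {t : ℝ} (ht : t ∈ Set.Icc 0 T) : Ψ (p, t) ≤ C := by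
  have hn : (0 : ℝ) < n := by exact_mod_cast Nat.pos_of_ne_zero (NeZero.ne n)
  -- it suffices to argue before the final time
  suffices key : ∀ T', 0 < T' → T' < T → ∀ p, ∀ t ∈ Set.Icc 0 T', Ψ (p, t) ≤ C by
    have h1 : ∀ τ ∈ Set.Ico 0 T, Ψ (p, τ) ≤ C := fun τ hτ =>
      key ((τ + T) / 2) (by linarith [hτ.1]) (by linarith [hτ.2]) p τ ⟨hτ.1, by linarith [hτ.2]⟩
    have h2 : ContinuousWithinAt (fun τ => Ψ (p, τ)) (Set.Ico 0 T) t :=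
      ContinuousWithinAt.comp (t := Set.univ ×ˢ Set.Icc 0 T) (hc (p, t) ⟨Set.mem_univ _, ht⟩)
        (Continuous.prodMk continuous_const continuous_id).continuousWithinAt
        fun τ hτ => ⟨Set.mem_univ _, Set.Ico_subset_Icc_self hτ⟩
    have h3 := h2.mem_closure (by rw [closure_Ico hT.ne]; exact ht)
      (t := Set.Iic C) fun τ hτ => h1 τ hτ
    rwa [isClosed_Iic.closure_eq] at h3
  clear ht p t
  intro T' hT'0 hT' p t ht
  have hsub : (Set.univ : Set M) ×ˢ Set.Icc 0 T' ⊆ Set.univ ×ˢ Set.Icc 0 T :=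
    Set.prod_mono le_rfl (Set.Icc_subset_Icc_right hT'.le)
  have hcomp : IsCompact ((Set.univ : Set M) ×ˢ Set.Icc 0 T') := isCompact_univ.prod isCompact_Icc
  obtain ⟨B, hB⟩ := hcomp.exists_bound_of_continuousOn ((hF.continuousOn_ip e).mono hsub)
  have hB0 : 0 ≤ B := (norm_nonneg _).trans (hB (p, 0) ⟨Set.mem_univ _, by constructor <;> linarith⟩)
  suffices key : ∀ ε, 0 < ε → Ψ (p, t) ≤ C + ε * (2 * B + 2 * n * T') by
    by_contra! hlt
    have hK : 0 < 2 * B + 2 * n * T' := by positivity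
    have := key ((Ψ (p, t) - C) / (2 * (2 * B + 2 * n * T')))
      (div_pos (by linarith) (by linarith))
    have h5 : (Ψ (p, t) - C) / (2 * (2 * B + 2 * n * T')) * (2 * B + 2 * n * T')
        = (Ψ (p, t) - C) / 2 := by field_simp
    linarith
  intro ε hε
  set Φ : M × ℝ → ℝ := fun z => Ψ z + ε * (ip (F z.1 z.2) e - 2 * n * z.2) with hΦ
  have hΦc : ContinuousOn Φ (Set.univ ×ˢ Set.Icc 0 T') :=
    (hc.mono hsub).add (((hF.continuousOn_ip e).mono hsub |>.sub
      (by fun_prop)).const_smul ε)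
  obtain ⟨⟨p', t'⟩, hz, hmax⟩ := hcomp.exists_isMaxOn
    ⟨(p, t), ⟨Set.mem_univ _, ht⟩⟩ hΦc
  have ht' : t' ∈ Set.Icc 0 T' := hz.2
  have hpt := hmax (⟨Set.mem_univ _, ht⟩ : (p, t) ∈ Set.univ ×ˢ Set.Icc 0 T')
  have b1 := abs_le.1 (hB (p, t) ⟨Set.mem_univ _, ht⟩)
  have b2 := abs_le.1 (hB (p', t') hz)
  have b3 : n * t ≤ n * T' := mul_le_mul_of_nonneg_left ht.2 hn.le
  rcases eq_or_lt_of_le ht'.1 with h00 | hpos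
  · subst h00
    have h1 : Ψ (p, t) + ε * (ip (F p t) e - 2 * n * t)
      ≤ Ψ (p', 0) + ε * (ip (F p' 0) e - 2 * n * 0) := hpt
    have h2 := h0 p'
    have h3 : ε * (ip (F p' 0) e - 2 * n * 0 - (ip (F p t) e - 2 * n * t))
        ≤ ε * (2 * B + 2 * n * T') :=
      mul_le_mul_of_nonneg_left (by simp only at b1 b2; linarith [b1.1, b2.2]) hε.le
    linarith
  exfalso
  have htT : t' ∈ Set.Ioo 0 T := ⟨hpos, ht'.2.trans_lt hT'⟩
  have htI := Set.Ioo_subset_Icc_self htT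
  rcases (𝓡∂ n).isInteriorPoint_or_isBoundaryPoint p' with hi | hb
  · obtain ⟨u, hu⟩ := hF.exists_flowAt hi htT
    obtain ⟨ψ, h1, h2, h3⟩ := hint p' hi t' htT u hu
    have hA := hu.flow.1
    set f : ST n → ℝ := fun y => ψ y + ε * ((-1) * gE e u y - th 0 y ^ 1) with hf
    have hg1 : SmoothNear (fun y => (-1) * gE e u y) (stProj F (p', t')) :=
      (smoothNear_gE e hA.1).const_mul _
    have hg2 : SmoothNear (fun y => th 0 y ^ 1) (stProj F (p', t')) := (smoothNear_th 0 _).pow 1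
    have hg3 := hg1.sub hg2
    have hfs : SmoothNear f (stProj F (p', t')) := h1.add (hg3.const_mul ε)
    have hΦf : ∀ᶠ z in 𝓝 (p', t'), Φ z = f (stProj F z) := by
      filter_upwards [h2, hu.graph] with z a1 a2
      simp only [hΦ, hf, a1, gE_stProj e a2, th]
      simp only [stProj]
      ring
    have hloc : ∀ᶠ z in 𝓝 (p', t'), z.2 ≤ t' → Φ z ≤ Φ (p', t') := by
      filter_upwards [(continuousAt_snd (p := (p', t'))).eventually (lt_mem_nhds hpos)] with z a1 a2
      exact hmax ⟨Set.mem_univ _, a1.le, a2.trans ht'.2⟩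
    have hbox := (box_nonneg_of_max (N := fun i => gn u i (stProj F (p', t'))) hfs
      (hu.eventually_le hΦf hloc)).2
    rw [hf, box_add h1 (hg3.const_mul ε), box_const_mul _ hg3, box_sub hg1 hg2,
      box_const_mul _ (smoothNear_gE e hA.1), hu.flow.box_gE, box_th_pow] at hbox
    simp only [Nat.cast_one, tsub_self, pow_zero] at hbox
    nlinarith [mul_pos hε hn]
  · have hfs := hF.contMDiff_slice hF₀ htI
    have hsp := hF.spacelike t' htI
    have hperp := hF.perp t' htI
    obtain ⟨μ, hμ⟩ := exists_isOutwardUnitNormal hS hconv (hperp p' hb).1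
    obtain ⟨w, hw, hw0⟩ := hperp.exists_inward hfs hsp hb hμ
    obtain ⟨L, hL, hLw⟩ := hbd p' hb t' htT μ w hμ hw hw0
    have hD := (differentiableWithinAt_localRep hfs (mem_extChartAt_source p')).hasFDerivWithinAt
    have h1 := (ipL e).hasFDerivAt.comp_hasFDerivWithinAt _ hD
    have h2 := hL.add ((h1.sub_const (2 * n * t')).const_smul ε)
    have hmaxOn : IsLocalMaxOn (fun y => Ψ ((extChartAt (𝓡∂ n) p').symm y, t')
        + ε • ((ipL e) (localRep (fun q => F q t') p' y) - 2 * n * t'))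
        (Set.range (𝓡∂ n)) (extChartAt (𝓡∂ n) p' p') := by
      refine Filter.Eventually.of_forall fun y => ?_
      have := hmax (⟨Set.mem_univ _, ht'⟩ :
        ((extChartAt (𝓡∂ n) p').symm y, t') ∈ Set.univ ×ˢ Set.Icc 0 T')
      simp only [hΦ, Set.mem_ofPred_eq] at this
      simp only [extChartAt_to_inv, localRep, Function.comp_apply, ipL_apply, smul_eq_mul]
      rw [ip_comm e, ip_comm e]
      exact this
    have h3 := hmaxOn.hasFDerivWithinAt_nonpos h2
      (mem_posTangentConeAt_halfSpace (Set.mem_range_self _) hw0.le)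
    have h4 : (ipL e) (fderivWithin ℝ (localRep (fun q => F q t') p') (Set.range (𝓡∂ n))
        (extChartAt (𝓡∂ n) p' p') w) = -ip μ e := by
      rw [hw, ipL_apply, ip_neg_right, ip_comm]
    simp only [_root_.add_apply, _root_.smul_apply,
      ContinuousLinearMap.comp_apply, smul_eq_mul, h4] at h3
    nlinarith [he _ _ hμ]

/-- The two cases `σ = 1` and `σ = -1` bound `F²` from below and from above. -/
theorem sq_bounds (hF : IsNeumannMCF S F₀ T F) (hS : IsSphereEmbedding S)
    (hconv : IsConvexSphere S) (hF₀ : ContMDiff (𝓡∂ n) 𝓘(ℝ, Mink n) ∞ F₀) (hT : 0 < T)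
    {e : Mink n} (he : ∀ q μ, IsOutwardUnitNormal S q μ → ip μ e < 0) {σ C : ℝ}
    (h0 : ∀ p, σ * ip (F₀ p) (F₀ p) ≤ C) (p : M) {t : ℝ} (ht : t ∈ Set.Icc 0 T) :
    σ * (ip (F p t) (F p t) + 2 * n * t) ≤ C := by
  refine hF.max_principle (Ψ := fun z => σ * (ip (F z.1 z.2) (F z.1 z.2) + 2 * n * z.2)) hS hconv
    hF₀ hT he ?_ ?_ ?_ ?_ p ht
  · exact continuousOn_const.mul (hF.continuousOn_ip_self.add (by fun_prop))
  · intro p hp t ht u hu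
    have hA := hu.flow.1
    have h1 : SmoothNear (fun y => th 0 y ^ 1) (stProj F (p, t)) := (smoothNear_th 0 _).pow 1
    have h2 := smoothNear_gF hA.1
    refine ⟨fun y => σ * (th 0 y ^ 1 - gF u y), (h1.sub h2).const_mul σ, ?_, ?_⟩
    · filter_upwards [hu.graph] with z hz
      rw [gF_stProj hz]; simp only [th, stProj]; ring
    · rw [box_const_mul _ (h1.sub h2), box_sub h1 h2, box_th_pow, hu.flow.box_gF]
      simp
  · intro p hp t ht μ w hμ hw hw0
    have hfs := hF.contMDiff_slice hF₀ (Set.Ioo_subset_Icc_self ht)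
    have hD := (differentiableWithinAt_localRep hfs (mem_extChartAt_source p)).hasFDerivWithinAt
    obtain ⟨L, hL, hLv⟩ := exists_hasFDerivWithinAt_ip hD hD
    refine ⟨σ • L, (hL.add_const (2 * n * t)).const_smul σ, ?_⟩
    rw [ContinuousLinearMap.smul_apply, hLv, hw, localRep_self, ip_neg_left, ip_neg_right,
      ip_comm (F p t), hμ.support.2.1]
    simp
  · intro p
    simpa [hF.initial] using h0 p

theorem support_bound (hF : IsNeumannMCF S F₀ T F) (hS : IsSphereEmbedding S)
    (hconv : IsConvexSphere S) (hF₀ : ContMDiff (𝓡∂ n) 𝓘(ℝ, Mink n) ∞ F₀) (hT : 0 < T)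
    {e : Mink n} (he : ∀ q μ, IsOutwardUnitNormal S q μ → ip μ e < 0) {C : ℝ}
    (h0 : ∀ p, ip (F₀ p) (normalAt F₀ p) ^ 2 ≤ C) (p : M) {t : ℝ} (ht : t ∈ Set.Icc 0 T) :
    ip (F p t) (normalAt (fun q => F q t) p) ^ 2 ≤ C + (4 * n + 4) * t := by
  have hn : (0 : ℝ) < n := by exact_mod_cast Nat.pos_of_ne_zero (NeZero.ne n)
  set c : ℝ := (4 * n + 4) / (2 * n) with hc
  have hc' : c * (2 * n) = 4 * n + 4 := by rw [hc]; field_simp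
  suffices h : ip (F p t) (normalAt (fun q => F q t) p) ^ 2 - c * (2 * n * t) ≤ C by
    have : c * (2 * n * t) = (4 * n + 4) * t := by rw [← hc']; ring
    linarith
  refine hF.max_principle (Ψ := fun z => ip (F z.1 z.2) (normalAt (fun q => F q z.2) z.1) ^ 2
    - c * (2 * n * z.2)) hS hconv hF₀ hT he ?_ ?_ ?_ ?_ p ht
  · have hN := hF.continuousOn_normalAt hF₀
    refine ContinuousOn.sub (ContinuousOn.pow ?_ 2) (by fun_prop)
    unfold ip
    exact (hF.continuousOn.fst.inner hN.fst).sub (hF.continuousOn.snd.mul hN.snd)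
  · intro p hp t ht u hu
    have hA := hu.flow.1
    have h1 : SmoothNear (fun y => th 0 y ^ 1) (stProj F (p, t)) := (smoothNear_th 0 _).pow 1
    have h2 := hA.gS.mul hA.gS
    refine ⟨fun y => gS u y * gS u y - c * th 0 y ^ 1, h2.sub (h1.const_mul c), ?_, ?_⟩
    · filter_upwards [hu.eventually_gS hF hp ht] with z hz
      rw [hz]; simp only [th, stProj]; ring
    · rw [box_sub h2 (h1.const_mul c), box_const_mul _ h1, box_th_pow]
      have := hu.flow.box_gS_sq_le
      simp only [Nat.cast_one, tsub_self, pow_zero, mul_one]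
      linarith
  · intro p hp t ht μ w hμ hw hw0
    have htI := Set.Ioo_subset_Icc_self ht
    have hfs := hF.contMDiff_slice hF₀ htI
    have hsp := hF.spacelike t htI
    have hperp := hF.perp t htI
    obtain ⟨L, hL, hLw⟩ := hperp.supportRep_inward hS hconv hfs hsp he hp hμ hw hw0
    have heq : (fun y => ip (F ((extChartAt (𝓡∂ n) p).symm y) t)
        (normalAt (fun q => F q t) ((extChartAt (𝓡∂ n) p).symm y)) ^ 2 - c * (2 * n * t))
        =ᶠ[𝓝[Set.range (𝓡∂ n)] extChartAt (𝓡∂ n) p p]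
        fun y => supportRep (fun q => F q t) p y * supportRep (fun q => F q t) p y
          - c * (2 * n * t) := by
      filter_upwards [extChartAt_target_mem_nhdsWithin (I := 𝓡∂ n) p] with y hy
      rw [normalAt_eq_localRep hfs hsp ((extChartAt (𝓡∂ n) p).map_target hy),
        (extChartAt (𝓡∂ n) p).right_inv hy]
      simp only [supportRep, localRep, Function.comp_apply]
      ring
    refine ⟨_, ((hL.mul hL).sub_const (c * (2 * n * t))).congr_of_eventuallyEq heq
      (heq.self_of_nhdsWithin (Set.mem_range_self _)), ?_⟩
    have hν := isUnitNormal_unitNormal (hsp p)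
    have hfp := cone_timelike hS (hperp p hp).1
    have hpos : 0 ≤ supportRep (fun q => F q t) p (extChartAt (𝓡∂ n) p p) := by
      rw [supportRep, localRep_self]
      have := ip_neg_of_future hfp.1 hfp.2 (by rw [hν.unit]; norm_num) hν.future
      linarith
    simp only [_root_.add_apply, _root_.smul_apply, smul_eq_mul]
    positivity
  · intro p
    have : (fun q => F q 0) = F₀ := funext hF.initial
    simpa [hF.initial, this] using h0 p

end IsNeumannMCF

variable [CompactSpace M]

/-- All solutions starting from `F₀` expand like `F² ∼ R + 2nt`, and the support function `-⟨F, ν⟩`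
grows at most like `|F|`. -/
theorem exists_global_bounds (hS : IsSphereEmbedding S) (hconv : IsConvexSphere S)
    (hF₀ : IsInitialHypersurface S F₀) : ∃ R D : ℝ, 0 < R ∧ 0 ≤ D ∧
      ∀ (T : ℝ) (F : M → ℝ → Mink n), 0 < T → IsNeumannMCF S F₀ T F → ∀ p, ∀ t ∈ Set.Icc 0 T,
        R + 2 * n * t ≤ -ip (F p t) (F p t) ∧ -ip (F p t) (F p t) ≤ D * (R + 2 * n * t) ∧
        0 < (F p t).2 ∧ ip (F p t) (normalAt (fun q => F q t) p) ^ 2 ≤ D * (R + 2 * n * t) := by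
  by_cases hex : ∃ (T : ℝ) (F : M → ℝ → Mink n), 0 < T ∧ IsNeumannMCF S F₀ T F
  swap
  · exact ⟨1, 0, one_pos, le_rfl, fun T F hT hF => absurd ⟨T, F, hT, hF⟩ hex⟩
  by_cases hM : Nonempty M
  swap
  · exact ⟨1, 0, one_pos, le_rfl, fun T F hT hF p => absurd ⟨p⟩ hM⟩
  obtain ⟨p₀⟩ := hM
  obtain ⟨p₁, hp₁⟩ := nonempty_interior (n := n) p₀
  have he : ∀ q μ, IsOutwardUnitNormal S q μ → ip μ (F₀ p₁) < 0 := fun q μ hμ =>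
    (hF₀.perp.ip_nonpos hF₀.smooth hF₀.spacelike hμ).2 p₁ hp₁
  have hn : (0 : ℝ) < n := by exact_mod_cast Nat.pos_of_ne_zero (NeZero.ne n)
  have hc : Continuous fun p => ip (F₀ p) (F₀ p) := by
    have := hF₀.smooth.continuous
    unfold ip; fun_prop
  obtain ⟨a, -, ha⟩ := isCompact_univ.exists_isMaxOn ⟨p₀, Set.mem_univ _⟩ hc.continuousOn
  obtain ⟨b, -, hb⟩ := isCompact_univ.exists_isMinOn ⟨p₀, Set.mem_univ _⟩ hc.continuousOn
  have htl := fun p => solidCone_timelike hS (hF₀.inside p)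
  obtain ⟨S0, hS0⟩ : ∃ S0 : ℝ, ∀ p, ip (F₀ p) (normalAt F₀ p) ^ 2 ≤ S0 := by
    obtain ⟨T, F, hT, hF⟩ := hex
    have h1 : ContinuousOn (fun z : M × ℝ => ip (F z.1 z.2) (normalAt (fun q => F q z.2) z.1) ^ 2)
        (Set.univ ×ˢ Set.Icc 0 T) := by
      have hN := hF.continuousOn_normalAt hF₀.smooth
      refine ContinuousOn.pow ?_ 2
      unfold ip
      exact (hF.continuousOn.fst.inner hN.fst).sub (hF.continuousOn.snd.mul hN.snd)
    obtain ⟨B, hB⟩ := (isCompact_univ.prod isCompact_Icc).exists_bound_of_continuousOn h1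
    refine ⟨B, fun p => ?_⟩
    have := hB (p, 0) ⟨Set.mem_univ _, le_rfl, hT.le⟩
    simp only [hF.initial] at this
    exact (le_abs_self _).trans this
  set R := -ip (F₀ a) (F₀ a) with hR
  set R2 := -ip (F₀ b) (F₀ b) with hR2
  have hR0 : 0 < R := by linarith [(htl a).1]
  have hS00 : 0 ≤ S0 := (sq_nonneg _).trans (hS0 p₀)
  have hRR : R ≤ R2 := by
    have : ip (F₀ b) (F₀ b) ≤ ip (F₀ a) (F₀ a) := ha (Set.mem_univ b)
    linarith
  have hD : 0 ≤ R2 / R + S0 / R + (4 * n + 4) / (2 * n) := by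
    have : 0 ≤ R2 := by linarith
    positivity
  refine ⟨R, R2 / R + S0 / R + (4 * n + 4) / (2 * n), hR0, hD, fun T F hT hF p t ht => ?_⟩
  have h1 := fun p t ht => hF.sq_bounds hS hconv hF₀.smooth hT he (σ := 1) (C := -R)
    (fun q => by have : ip (F₀ q) (F₀ q) ≤ ip (F₀ a) (F₀ a) := ha (Set.mem_univ q)
                 linarith) p (t := t) ht
  have h2 := hF.sq_bounds hS hconv hF₀.smooth hT he (σ := -1) (C := R2)
    (fun q => by have : ip (F₀ b) (F₀ b) ≤ ip (F₀ q) (F₀ q) := hb (Set.mem_univ q)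
                 linarith) p ht
  have h3 := hF.support_bound hS hconv hF₀.smooth hT he hS0 p ht
  have hnt : ∀ t ∈ Set.Icc 0 T, 0 ≤ 2 * n * t := fun t ht => by
    have := ht.1; positivity
  have h4 := hF.future (fun p t ht => by linarith [h1 p t ht, hnt t ht]) (fun p => (htl p).2) p ht
  have hx := hnt t ht
  have e1 : R2 ≤ R2 / R * (R + 2 * n * t) := by
    rw [mul_add, div_mul_cancel₀ _ hR0.ne']
    have : 0 ≤ R2 / R * (2 * n * t) := mul_nonneg (div_nonneg (by linarith) hR0.le) hx
    linarith
  have e2 : S0 ≤ S0 / R * (R + 2 * n * t) := by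
    rw [mul_add, div_mul_cancel₀ _ hR0.ne']
    have : 0 ≤ S0 / R * (2 * n * t) := mul_nonneg (div_nonneg hS00 hR0.le) hx
    linarith
  have e3 : (4 * n + 4) * t ≤ (4 * n + 4) / (2 * n) * (R + 2 * n * t) := by
    have : (4 * n + 4) / (2 * n) * (2 * n * t) = (4 * n + 4) * t := by field_simp
    rw [mul_add, this]
    have : 0 ≤ (4 * n + 4) / (2 * (n : ℝ)) * R := by positivity
    linarith
  have e4 : 2 * n * t ≤ (4 * n + 4) * t := by nlinarith [ht.1]
  have hθ : 0 ≤ R + 2 * n * t := by linarith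
  have e5 : 0 ≤ S0 / R * (R + 2 * n * t) := by positivity
  have e6 : 0 ≤ R2 / R * (R + 2 * n * t) :=
    mul_nonneg (div_nonneg (by linarith) hR0.le) hθ
  refine ⟨by linarith [h1 p t ht], ?_, h4, ?_⟩
  · rw [add_mul, add_mul]; linarith
  · rw [add_mul, add_mul]; linarith

end GlobalBounds


/-! ### Localised estimates away from the boundary -/

section Localisation

variable {n : ℕ}

/-- The cutoff function `c² F² - ⟨F, e⟩²`. On the hyperboloids `F² = const` it is positive at hyperbolic
distance less than `arcosh c` from `e`. -/
def phiF (c : ℝ) (e x : Mink n) : ℝ := c ^ 2 * (-ip x x) - ip x e * ip x e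

/-- The height of a future directed causal vector is controlled by its product with any future directed
unit vector. -/
theorem snd_le_of_future {a b : Mink n} (ha : ip a a ≤ 0) (ha' : 0 < a.2) (hb : ip b b = -1)
    (hb' : 0 < b.2) : a.2 ≤ 2 * b.2 * -ip a b := by
  simp only [ip, real_inner_self_eq_norm_sq] at *
  have h1 := real_inner_le_norm a.1 b.1
  have h2 : ‖a.1‖ ≤ a.2 := by nlinarith [norm_nonneg a.1]
  have h3 : ‖b.1‖ < b.2 := by nlinarith [norm_nonneg b.1]
  have h4 : ‖a.1‖ * ‖b.1‖ ≤ a.2 * ‖b.1‖ := mul_le_mul_of_nonneg_right h2 (norm_nonneg _)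
  have h5 : (b.2 - ‖b.1‖) * (b.2 + ‖b.1‖) = 1 := by nlinarith
  have h6 : 1 ≤ (b.2 - ‖b.1‖) * (2 * b.2) := by
    rw [← h5]; exact mul_le_mul_of_nonneg_left (by linarith) (by linarith)
  have h7 : a.2 * (b.2 - ‖b.1‖) ≤ -(inner ℝ a.1 b.1 - a.2 * b.2) := by linarith
  calc a.2 = a.2 * 1 := (mul_one _).symm
    _ ≤ a.2 * ((b.2 - ‖b.1‖) * (2 * b.2)) := mul_le_mul_of_nonneg_left h6 ha'.le
    _ = 2 * b.2 * (a.2 * (b.2 - ‖b.1‖)) := by ring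
    _ ≤ _ := mul_le_mul_of_nonneg_left h7 (by linarith)

/-- The region where the cutoff function is nonnegative: there the position vector is comparable to
its Minkowski length, and the normal is uniformly timelike. -/
theorem region_bounds {x N e : Mink n} {θ D b c : ℝ} (hθ : 0 < θ) (hx1 : θ ≤ -ip x x)
    (hx2 : -ip x x ≤ D * θ) (hx : 0 < x.2) (hs : ip x N ^ 2 ≤ D * θ) (hN : ip N N = -1)
    (hN' : 0 < N.2) (he : ip e e = -1) (he' : 0 < e.2) (heb : e.2 ≤ b) (hφ : 0 ≤ phiF c e x) :
    x.2 ^ 2 ≤ 4 * b ^ 2 * c ^ 2 * D * θ ∧ N.2 ^ 2 ≤ 16 * b ^ 2 * c ^ 2 * D ^ 2 := by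
  have hD : 0 ≤ D := by
    by_contra! h; nlinarith
  have h1 := snd_le_of_future (by linarith) hx he he'
  have h2 : x.2 ^ 2 ≤ 4 * b ^ 2 * c ^ 2 * D * θ := by
    have h3 : x.2 ^ 2 ≤ (2 * e.2 * -ip x e) ^ 2 := pow_le_pow_left₀ hx.le h1 2
    have h4 : ip x e ^ 2 ≤ c ^ 2 * (D * θ) := by
      have := mul_le_mul_of_nonneg_left hx2 (sq_nonneg c)
      unfold phiF at hφ; nlinarith
    have h5 : e.2 ^ 2 ≤ b ^ 2 := pow_le_pow_left₀ he'.le heb 2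
    calc x.2 ^ 2 ≤ 4 * e.2 ^ 2 * ip x e ^ 2 := by rw [← sub_nonneg]; linarith [h3, mul_self_nonneg (e.2 * ip x e), (by ring : (2 * e.2 * -ip x e) ^ 2 = 4 * e.2 ^ 2 * ip x e ^ 2)]
      _ ≤ 4 * b ^ 2 * (c ^ 2 * (D * θ)) := by gcongr
      _ = _ := by ring
  refine ⟨h2, ?_⟩
  -- `x / |x|` is a future unit vector
  set r := -ip x x with hr
  have hr0 : 0 < r := by linarith
  have hsr := Real.sqrt_pos.2 hr0
  have h3 := snd_le_of_future (a := N) (b := (√r)⁻¹ • x) (by linarith) hN' (by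
    rw [ip_smul_left, ip_smul_right, ← mul_assoc, ← mul_inv, Real.mul_self_sqrt hr0.le,
      show ip x x = -r by linarith]
    field_simp) (by simpa using mul_pos (inv_pos.2 hsr) hx)
  have h4 : N.2 ≤ r⁻¹ * (2 * x.2 * -ip x N) := by
    refine h3.trans (le_of_eq ?_)
    rw [ip_smul_right, ip_comm N x, Prod.smul_snd, smul_eq_mul]
    have : (√r)⁻¹ * (√r)⁻¹ = r⁻¹ := by rw [← mul_inv, Real.mul_self_sqrt hr0.le]
    linear_combination (2 * x.2 * -ip x N) * this
  have h5 : N.2 ^ 2 ≤ (r⁻¹ * (2 * x.2 * -ip x N)) ^ 2 := pow_le_pow_left₀ hN'.le h4 2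
  have h6 : r⁻¹ ≤ θ⁻¹ := inv_anti₀ hθ hx1
  calc N.2 ^ 2 ≤ r⁻¹ ^ 2 * (4 * x.2 ^ 2 * ip x N ^ 2) := h5.trans_eq (by ring)
    _ ≤ θ⁻¹ ^ 2 * (4 * (4 * b ^ 2 * c ^ 2 * D * θ) * (D * θ)) := by
        have := inv_pos.2 hr0
        gcongr
    _ = _ := by field_simp; ring

variable [NeZero n] {M : Type*} [TopologicalSpace M] [ChartedSpace (EuclideanHalfSpace n) M]

/-- Uniform control of all solutions starting from `F₀`, on the cones around the points of `Y`. -/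
structure SolutionBounds (S : Euc n → Euc n) (F₀ : M → Mink n) (Y : Set (Mink n))
    (c₁ R D b W : ℝ) : Prop where
  pos : 0 < R
  nonneg : 0 ≤ D
  nonneg_b : 0 ≤ b
  nonneg_W : 0 ≤ W
  compact : IsCompact Y
  mem : ∀ e ∈ Y, |e.2| ≤ b ∧ ∀ i, |e.1 i| ≤ b
  cone : ∀ y ∈ cone S, ∀ e ∈ Y, ∀ c, 0 ≤ c → c < c₁ → phiF c e y < 0
  size : ∀ (T : ℝ) (F : M → ℝ → Mink n), 0 < T → IsNeumannMCF S F₀ T F → ∀ p, ∀ t ∈ Set.Icc 0 T,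
    R + 2 * n * t ≤ -ip (F p t) (F p t) ∧ -ip (F p t) (F p t) ≤ D * (R + 2 * n * t)
  region : ∀ (T : ℝ) (F : M → ℝ → Mink n), 0 < T → IsNeumannMCF S F₀ T F → ∀ p, ∀ t ∈ Set.Icc 0 T,
    ∀ e ∈ Y, ∀ c, 0 ≤ c → c < c₁ → 0 ≤ phiF c e (F p t) → (F p t).2 ^ 2 ≤ D * (R + 2 * n * t) ∧
      (∀ i, (F p t).1 i ^ 2 ≤ D * (R + 2 * n * t)) ∧ (normalAt (fun q => F q t) p).2 ≤ W

variable {F : M → ℝ → Mink n} {p : M} {t T : ℝ} {u : ST n → ℝ}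
  {S : Euc n → Euc n} {F₀ : M → Mink n} {Y : Set (Mink n)} {c₁ R D b W : ℝ}

theorem gP_stProj (c : ℝ) (e : Mink n) {z : M × ℝ} (h : (F z.1 z.2).2 = u (stProj F z)) :
    gP c e u (stProj F z) = phiF c e (F z.1 z.2) := by
  rw [gP, gF_stProj h, gE_stProj e h, phiF]; ring

theorem continuous_phiF (c : ℝ) : Continuous fun z : Mink n × Mink n => phiF c z.1 z.2 := by
  unfold phiF ip; fun_prop

variable [IsManifold (𝓡∂ n) ∞ M]

/-- The cutoff function is negative on `Σ`, so its positivity set contains interior points only. -/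
theorem SolutionBounds.isInteriorPoint (hB : SolutionBounds S F₀ Y c₁ R D b W)
    (hF : IsNeumannMCF S F₀ T F) (ht : t ∈ Set.Icc 0 T) {e : Mink n} (he : e ∈ Y) {c : ℝ}
    (hc0 : 0 ≤ c) (hc : c < c₁) (h : 0 ≤ phiF c e (F p t)) : (𝓡∂ n).IsInteriorPoint p := by
  rcases (𝓡∂ n).isInteriorPoint_or_isBoundaryPoint p with hi | hb
  · exact hi
  · exact absurd h (not_le.2 (hB.cone _ (hF.perp t ht p hb).1 e he c hc0 hc))

theorem IsNeumannMCF.norm_jetAt_lt (hF : IsNeumannMCF S F₀ T F) (hp : (𝓡∂ n).IsInteriorPoint p)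
    (ht : t ∈ Set.Icc 0 T) :
    ‖(WithLp.toLp 2 fun i => jetAt (fun q => F q t) [i] p : Euc n)‖ < 1 := by
  obtain ⟨v, hv⟩ := (hF.smoothAt hp ht).exists_graphAt
  have : (WithLp.toLp 2 fun i => jetAt (fun q => F q t) [i] p : Euc n) = grad ec v (F p t).1 := by
    ext i
    simp only [hv.jetAt_eq, grad_apply]; rfl
  rw [this]; exact hv.adm.2

theorem IsNeumannMCF.continuousWithinAt_jet_functional (hF : IsNeumannMCF S F₀ T F)
    (hF₀ : ContMDiff (𝓡∂ n) 𝓘(ℝ, Mink n) ∞ F₀) (hT : 0 < T) (hp : (𝓡∂ n).IsInteriorPoint p)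
    (ht : t ∈ Set.Icc 0 T) {q : ℝ → (List (Fin n) → ℝ) → ℝ}
    (hqc : ∀ θ J, ‖(WithLp.toLp 2 fun i => J [i] : Euc n)‖ < 1 →
      ContinuousAt (fun x : ℝ × (List (Fin n) → ℝ) => q x.1 x.2) (θ, J)) (R : ℝ) :
    ContinuousWithinAt (fun z : M × ℝ => q (R + 2 * n * z.2)
      fun I => jetAt (fun q => F q z.2) I z.1) (Set.univ ×ˢ Set.Icc 0 T) (p, t) := by
  have h1 : ContinuousWithinAt (fun z : M × ℝ => (R + 2 * n * z.2,
      fun I => jetAt (fun q => F q z.2) I z.1)) (Set.univ ×ˢ Set.Icc 0 T) (p, t) := by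
    refine ContinuousWithinAt.prodMk (by fun_prop) (continuousWithinAt_pi.2 fun I => ?_)
    exact hF.continuousWithinAt_jetAt hF₀ hT hp ht I
  exact ContinuousAt.comp_continuousWithinAt (f := fun z : M × ℝ => (R + 2 * n * z.2,
      fun I => jetAt (fun q => F q z.2) I z.1)) (x := (p, t))
      (hqc _ _ (hF.norm_jetAt_lt hp ht)) h1

/-- An estimate that holds before the final time holds at the final time. -/
theorem SolutionBounds.le_of_forall_lt (hB : SolutionBounds S F₀ Y c₁ R D b W)
    (hF₀ : ContMDiff (𝓡∂ n) 𝓘(ℝ, Mink n) ∞ F₀) {c : ℝ} (hc0 : 0 ≤ c) (hc : c < c₁)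
    {q : ℝ → (List (Fin n) → ℝ) → ℝ}
    (hqc : ∀ θ J, ‖(WithLp.toLp 2 fun i => J [i] : Euc n)‖ < 1 →
      ContinuousAt (fun x : ℝ × (List (Fin n) → ℝ) => q x.1 x.2) (θ, J)) {C : ℝ} (hC : 0 ≤ C)
    (hT : 0 < T) (hF : IsNeumannMCF S F₀ T F) {e : Mink n} (he : e ∈ Y)
    (key : ∀ p, ∀ t ∈ Set.Ico 0 T, 0 ≤ phiF c e (F p t) → phiF c e (F p t) ^ 2
      * q (R + 2 * n * t) (fun I => jetAt (fun q => F q t) I p) ≤ C * (R + 2 * n * t) ^ 2)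
    (p : M) (t : ℝ) (ht : t ∈ Set.Icc 0 T) (hφ : 0 ≤ phiF c e (F p t)) : phiF c e (F p t) ^ 2
      * q (R + 2 * n * t) (fun I => jetAt (fun q => F q t) I p) ≤ C * (R + 2 * n * t) ^ 2 := by
  have hφc : ContinuousOn (fun z : M × ℝ => phiF c e (F z.1 z.2))
      (Set.univ ×ˢ Set.Icc 0 T) :=
    (continuous_phiF c).comp_continuousOn (f := fun z : M × ℝ => (e, F z.1 z.2))
      (continuousOn_const.prodMk hF.continuousOn)
  rcases eq_or_lt_of_le hφ with h0 | hpos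
  · rw [← h0]
    have : 0 ≤ C * (R + 2 * n * t) ^ 2 := by positivity
    simpa using this
  have hp := hB.isInteriorPoint hF ht he hc0 hc hφ
  have hsub : Set.MapsTo (fun τ : ℝ => (p, τ)) (Set.Ico 0 T) (Set.univ ×ˢ Set.Icc 0 T) :=
    fun τ hτ => ⟨Set.mem_univ _, Set.Ico_subset_Icc_self hτ⟩
  have hcl : (𝓝[Set.Ico 0 T] t).NeBot := by
    rw [← mem_closure_iff_nhdsWithin_neBot, closure_Ico hT.ne]; exact ht
  have hcm : ContinuousWithinAt (fun τ : ℝ => (p, τ)) (Set.Ico 0 T) t := by fun_prop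
  have h1 : ContinuousWithinAt (fun τ => phiF c e (F p τ)) (Set.Ico 0 T) t :=
    ContinuousWithinAt.comp (f := fun τ : ℝ => (p, τ)) (x := t)
      (hφc (p, t) ⟨Set.mem_univ _, ht⟩) hcm hsub
  have h2 : ContinuousWithinAt (fun τ => q (R + 2 * n * τ) (fun I => jetAt (fun q => F q τ) I p)) (Set.Ico 0 T) t :=
    ContinuousWithinAt.comp (f := fun τ : ℝ => (p, τ)) (x := t)
      (hF.continuousWithinAt_jet_functional hF₀ hT hp ht hqc R) hcm hsub
  refine le_of_tendsto_of_tendsto ((h1.pow 2).mul h2) (b := 𝓝[Set.Ico 0 T] t)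
    (g := fun τ => C * (R + 2 * n * τ) ^ 2) ?_ ?_
  · have : Continuous fun τ => C * (R + 2 * n * τ) ^ 2 := by fun_prop
    exact this.continuousWithinAt
  · filter_upwards [h1.eventually (lt_mem_nhds hpos), eventually_mem_nhdsWithin] with τ h3 h4
    exact key p τ h4 h3.le

/-- The estimate at an interior maximum point of `φ² q / θ²`. -/
theorem SolutionBounds.exists_bound_of_isMax (hB : SolutionBounds S F₀ Y c₁ R D b W)
    {c : ℝ} (hc0 : 0 ≤ c) (hc : c < c₁) {k : ℕ}
    {K K' δ : ℝ} (hK' : 0 ≤ K') (hδ : 0 < δ) {q : ℝ → (List (Fin n) → ℝ) → ℝ}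
    (hq0 : ∀ θ J, 0 < θ → 0 ≤ q θ J)
    (hqs : ∀ u z, FlowGraph u z → SmoothNear (fun y => q (th R y) fun I => iter eb I u y) z)
    (hqb : ∀ (u : ST n → ℝ) (z : ST n) (ρ : ℝ), 0 < th R z → 0 < ρ → ρ ^ 2 * th R z = 1 →
      FlowGraph u z → gw u z ≤ W → (∀ I : List (Fin n), 2 ≤ I.length → I.length ≤ k →
        |iter eb I u z| ≤ K * ρ ^ (I.length - 1)) →
      th R z * box (fun i => gn u i z) (fun y => q (th R y) fun I => iter eb I u y) z
        ≤ K' - δ * q (th R z) (fun I => iter eb I u z) ^ 2)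
    (hJ : ∀ (T : ℝ) (F : M → ℝ → Mink n), 0 < T → IsNeumannMCF S F₀ T F → ∀ p, ∀ t ∈ Set.Icc 0 T,
      ∀ e ∈ Y, 0 ≤ phiF c e (F p t) → ∀ I : List (Fin n), 2 ≤ I.length → I.length ≤ k →
      |jetAt (fun q => F q t) I p| ≤ K * (√(R + 2 * n * t))⁻¹ ^ (I.length - 1)) :
    ∃ C₁ : ℝ, 0 ≤ C₁ ∧ ∀ (T : ℝ) (F : M → ℝ → Mink n), 0 < T → IsNeumannMCF S F₀ T F →
      ∀ p, ∀ t ∈ Set.Ioo 0 T, ∀ e ∈ Y, 0 < phiF c e (F p t) →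
      (∀ᶠ z in 𝓝 (p, t), z.2 ≤ t → phiF c e (F z.1 z.2) ^ 2
        * q (R + 2 * n * z.2) (fun I => jetAt (fun q => F q z.2) I z.1) * (R + 2 * n * t) ^ 2
        - phiF c e (F p t) ^ 2 * q (R + 2 * n * t) (fun I => jetAt (fun q => F q t) I p)
          * (R + 2 * n * z.2) ^ 2 ≤ 0) →
      phiF c e (F p t) ^ 2
        * q (R + 2 * n * t) (fun I => jetAt (fun q => F q t) I p) ≤ C₁ * (R + 2 * n * t) ^ 2 := by
  obtain ⟨B, hB0, hBP⟩ := exists_gP_bounds (n := n) (c := c) hB.nonneg_b hB.nonneg hB.nonneg_W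
  obtain ⟨C₁, hC₁, hcut⟩ := exists_cutoff_bound (n := n) hK' hδ hB0
  refine ⟨C₁, hC₁, fun T F hT hF p t htI e he hpos hmax => ?_⟩
  have ht := Set.Ioo_subset_Icc_self htI
  have hp := hB.isInteriorPoint hF ht he hc0 hc hpos.le
  have hn : (0 : ℝ) < n := by exact_mod_cast Nat.pos_of_ne_zero (NeZero.ne n)
  obtain ⟨θ, hθ⟩ : ∃ θ, θ = R + 2 * n * t := ⟨_, rfl⟩
  have hθt : 0 < θ := by
    have := hB.pos; have := mul_nonneg (mul_nonneg zero_le_two hn.le) ht.1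
    linarith
  obtain ⟨u, hu⟩ := hF.exists_flowAt hp htI
  have hfl := hu.flow
  have hev := hu.eventually_normalAt hF hp htI
  have hQψ : ∀ᶠ z in 𝓝 (p, t), q (R + 2 * n * z.2) (fun I => jetAt (fun q => F q z.2) I z.1)
      = q (th R (stProj F z)) fun I => iter eb I u (stProj F z) := by
    filter_upwards [hev] with z hz
    simp only [hz.2.2]; rfl
  have hQ0 := hQψ.self_of_nhds
  have hφP : ∀ᶠ z in 𝓝 (p, t), phiF c e (F z.1 z.2) = gP c e u (stProj F z) := by
    filter_upwards [hu.graph] with z hz using (gP_stProj c e hz).symm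
  have hφ0 := hφP.self_of_nhds
  have eth : th R (stProj F (p, t)) = θ := hθ.symm
  obtain ⟨r1, r2, r3⟩ := hB.region T F hT hF p t ht e he c hc0 hc hpos.le
  rw [← hθ] at r1
  replace r2 : ∀ i, (F p t).1 i ^ 2 ≤ D * θ := fun i => hθ ▸ r2 i
  have hgw : gw u (stProj F (p, t)) ≤ W := by
    have h1 := hev.self_of_nhds.2.1
    have h2 : (normalAt (fun q => F q t) p).2 = gw u (stProj F (p, t)) := by
      rw [h1]; simp [gw]
    rwa [← h2]
  have hu2 : u (stProj F (p, t)) = (F p t).2 := hu.graph.self_of_nhds.symm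
  obtain ⟨g1, g2, g3⟩ := hBP u (stProj F (p, t)) e θ hθt.le hfl hgw (hB.mem e he).1
    (hB.mem e he).2 (by rw [hu2]; exact r1) r2
  have hρ : (√θ)⁻¹ ^ 2 * θ = 1 := by
    rw [inv_pow, Real.sq_sqrt hθt.le, inv_mul_cancel₀ hθt.ne']
  have hbox := hqb u (stProj F (p, t)) (√θ)⁻¹ (eth ▸ hθt) (inv_pos.2 (Real.sqrt_pos.2 hθt))
    (eth ▸ hρ) hfl hgw fun I hI1 hI2 => by
      have := hJ T F hT hF p t ht e he hpos.le I hI1 hI2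
      rw [hev.self_of_nhds.2.2 I, ← hθ] at this
      exact this
  dsimp only at hQ0 hφ0 hmax
  have hθq : ∀ J, q (R + 2 * n * t) J = q θ J := fun J => by rw [hθ]
  simp only [hθq] at hQ0 hmax ⊢
  have hfinal := hcut (fun i => gn u i (stProj F (p, t))) R (gP c e u)
    (fun y => q (th R y) fun I => iter eb I u y) (stProj F (p, t)) (eth ▸ hθt)
    (smoothNear_gP c e hfl.1.1) (hqs u _ hfl) (by rw [← hφ0]; exact hpos)
    (hq0 _ _ (eth ▸ hθt)) (by rw [eth]; exact g1) g2 (by rw [eth]; exact g3) hbox ?_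
  · beta_reduce at hfinal
    rw [← hφ0, ← hQ0, eth] at hfinal
    rw [← hθ]; exact hfinal
  -- the maximum over the past, in the graph coordinates
  have h1 : ∀ᶠ z in 𝓝 (p, t), phiF c e (F z.1 z.2) ^ 2
        * q (R + 2 * n * z.2) (fun I => jetAt (fun q => F q z.2) I z.1) * θ ^ 2
        - phiF c e (F p t) ^ 2 * q θ (fun I => jetAt (fun q => F q t) I p)
          * (R + 2 * n * z.2) ^ 2
      = gP c e u (stProj F z) ^ 2 * (q (th R (stProj F z)) fun I => iter eb I u (stProj F z))
          * θ ^ 2 - phiF c e (F p t) ^ 2 * q θ (fun I => jetAt (fun q => F q t) I p)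
        * th R (stProj F z) ^ 2 := by
    filter_upwards [hφP, hQψ] with z a1 a2
    rw [a1, a2]; rfl
  have h2 := hu.eventually_le (Ψ := fun z => phiF c e (F z.1 z.2) ^ 2
        * q (R + 2 * n * z.2) (fun I => jetAt (fun q => F q z.2) I z.1) * θ ^ 2
        - phiF c e (F p t) ^ 2 * q θ (fun I => jetAt (fun q => F q t) I p)
          * (R + 2 * n * z.2) ^ 2)
    (f := fun y => gP c e u y ^ 2 * (q (th R y) fun I => iter eb I u y) * θ ^ 2
      - phiF c e (F p t) ^ 2 * q θ (fun I => jetAt (fun q => F q t) I p) * th R y ^ 2) h1 (by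
    filter_upwards [hmax] with z a1 a2
    have a3 := a1 a2
    rw [hθq, ← hθ, sub_self]; rw [← hθ] at a3; exact a3)
  filter_upwards [h2] with y a1 a2
  have a3 := a1 a2
  rw [← hφ0, ← hQ0, eth] at a3 ⊢
  linarith

variable [CompactSpace M]

/-- All solutions agree at the initial time, so the quantity is bounded there. -/
theorem SolutionBounds.exists_initial_bound (hB : SolutionBounds S F₀ Y c₁ R D b W)
    (hF₀ : ContMDiff (𝓡∂ n) 𝓘(ℝ, Mink n) ∞ F₀) {c : ℝ} (hc0 : 0 ≤ c) (hc : c < c₁)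
    {q : ℝ → (List (Fin n) → ℝ) → ℝ}
    (hqc : ∀ θ J, ‖(WithLp.toLp 2 fun i => J [i] : Euc n)‖ < 1 →
      ContinuousAt (fun x : ℝ × (List (Fin n) → ℝ) => q x.1 x.2) (θ, J)) :
    ∃ B₀ : ℝ, 0 ≤ B₀ ∧ ∀ (T : ℝ) (F : M → ℝ → Mink n), 0 < T →
      IsNeumannMCF S F₀ T F → ∀ p, ∀ e ∈ Y, 0 ≤ phiF c e (F p 0) →
        q R (fun I => jetAt (fun q => F q 0) I p) ≤ B₀ := by
  by_cases hex : ∃ (T : ℝ) (F : M → ℝ → Mink n), 0 < T ∧ IsNeumannMCF S F₀ T F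
  swap
  · exact ⟨0, le_rfl, fun T F hT hF => absurd ⟨T, F, hT, hF⟩ hex⟩
  obtain ⟨T, F, hT, hF⟩ := hex
  have hT0 : (0 : ℝ) ∈ Set.Icc 0 T := ⟨le_rfl, hT.le⟩
  set A : Set (M × Mink n) := (Set.univ ×ˢ Y) ∩ {z | 0 ≤ phiF c z.2 (F z.1 0)} with hA
  have hcF : Continuous fun q => F q 0 := (hF.contMDiff_slice hF₀ hT0).continuous
  have hAc : IsCompact A := (isCompact_univ.prod hB.compact).inter_right
    (isClosed_le continuous_const ((continuous_phiF c).comp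
      (continuous_snd.prodMk (hcF.comp continuous_fst))))
  have hcq : ContinuousOn (fun p => q R (fun I => jetAt (fun q => F q 0) I p)) (Prod.fst '' A) := by
    rintro _ ⟨⟨p, e⟩, hz, rfl⟩
    have hp := hB.isInteriorPoint hF hT0 hz.1.2 hc0 hc hz.2
    have h1 := hF.continuousWithinAt_jet_functional hF₀ hT hp hT0 hqc R
    have h2 := ContinuousWithinAt.comp (f := fun p : M => (p, (0 : ℝ))) (s := Prod.fst '' A)
      (x := p) h1 (by fun_prop) fun p _ => ⟨Set.mem_univ _, hT0⟩
    refine h2.congr (fun p _ => ?_) ?_ <;> simp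
  obtain ⟨B₀, h0⟩ := (hAc.image continuous_fst).exists_bound_of_continuousOn hcq
  refine ⟨max B₀ 0, le_max_right _ _, fun T' F' hT' hF' p e he hφ => ?_⟩
  have e1 : (fun q => F' q 0) = fun q => F q 0 := by
    funext q; rw [hF.initial, hF'.initial]
  rw [e1]
  have e2 : F' p 0 = F p 0 := by rw [hF.initial, hF'.initial]
  rw [e2] at hφ
  exact ((le_abs_self _).trans (h0 p ⟨(p, e), ⟨⟨Set.mem_univ _, he⟩, hφ⟩, rfl⟩)).trans
    (le_max_left _ _)

/-- The cutoff argument: a functional `q` of the derivatives whose evolution has the good term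
`-δ q² / θ` on the region `φ ≥ 0` is bounded there by a multiple of `(θ / φ)²`. -/
theorem SolutionBounds.exists_bound (hB : SolutionBounds S F₀ Y c₁ R D b W)
    (hF₀ : ContMDiff (𝓡∂ n) 𝓘(ℝ, Mink n) ∞ F₀) {c : ℝ} (hc0 : 0 ≤ c) (hc : c < c₁) {k : ℕ}
    {K K' δ : ℝ} (hK' : 0 ≤ K') (hδ : 0 < δ) {q : ℝ → (List (Fin n) → ℝ) → ℝ}
    (hq0 : ∀ θ J, 0 < θ → 0 ≤ q θ J)
    (hqc : ∀ θ J, ‖(WithLp.toLp 2 fun i => J [i] : Euc n)‖ < 1 →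
      ContinuousAt (fun x : ℝ × (List (Fin n) → ℝ) => q x.1 x.2) (θ, J))
    (hqs : ∀ u z, FlowGraph u z → SmoothNear (fun y => q (th R y) fun I => iter eb I u y) z)
    (hqb : ∀ (u : ST n → ℝ) (z : ST n) (ρ : ℝ), 0 < th R z → 0 < ρ → ρ ^ 2 * th R z = 1 →
      FlowGraph u z → gw u z ≤ W → (∀ I : List (Fin n), 2 ≤ I.length → I.length ≤ k →
        |iter eb I u z| ≤ K * ρ ^ (I.length - 1)) →
      th R z * box (fun i => gn u i z) (fun y => q (th R y) fun I => iter eb I u y) z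
        ≤ K' - δ * q (th R z) (fun I => iter eb I u z) ^ 2)
    (hJ : ∀ (T : ℝ) (F : M → ℝ → Mink n), 0 < T → IsNeumannMCF S F₀ T F → ∀ p, ∀ t ∈ Set.Icc 0 T,
      ∀ e ∈ Y, 0 ≤ phiF c e (F p t) → ∀ I : List (Fin n), 2 ≤ I.length → I.length ≤ k →
      |jetAt (fun q => F q t) I p| ≤ K * (√(R + 2 * n * t))⁻¹ ^ (I.length - 1)) :
    ∃ C : ℝ, 0 ≤ C ∧ ∀ (T : ℝ) (F : M → ℝ → Mink n), 0 < T → IsNeumannMCF S F₀ T F →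
      ∀ p, ∀ t ∈ Set.Icc 0 T, ∀ e ∈ Y, 0 ≤ phiF c e (F p t) → phiF c e (F p t) ^ 2
        * q (R + 2 * n * t) (fun I => jetAt (fun q => F q t) I p) ≤ C * (R + 2 * n * t) ^ 2 := by
  have hn : (0 : ℝ) < n := by exact_mod_cast Nat.pos_of_ne_zero (NeZero.ne n)
  obtain ⟨C₁, hC₁, hmaxb⟩ := hB.exists_bound_of_isMax hc0 hc hK' hδ hq0 hqs hqb hJ
  obtain ⟨B₀, hB₀0, hB₀⟩ := hB.exists_initial_bound hF₀ hc0 hc hqc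
  have hD := hB.nonneg
  refine ⟨C₁ + (c ^ 2 * D) ^ 2 * B₀, by positivity, fun T F hT hF p t ht e he =>
    hB.le_of_forall_lt hF₀ hc0 hc hqc (by positivity) hT hF he ?_ p t ht⟩
  clear p t ht
  have hθ0 : ∀ t ∈ Set.Icc 0 T, 0 < R + 2 * n * t := fun t ht => by
    have := hB.pos; have := mul_nonneg (mul_nonneg zero_le_two hn.le) ht.1
    linarith
  have hφc : ContinuousOn (fun z : M × ℝ => phiF c e (F z.1 z.2)) (Set.univ ×ˢ Set.Icc 0 T) :=
    (continuous_phiF c).comp_continuousOn (f := fun z : M × ℝ => (e, F z.1 z.2))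
      (continuousOn_const.prodMk hF.continuousOn)
  intro p₁ t₁ ht₁ hφ₁
  have hsub : (Set.univ : Set M) ×ˢ Set.Icc 0 t₁ ⊆ Set.univ ×ˢ Set.Icc 0 T :=
    Set.prod_mono le_rfl (Set.Icc_subset_Icc_right ht₁.2.le)
  obtain ⟨A, hA⟩ : ∃ A : Set (M × ℝ), A = {z ∈ Set.univ ×ˢ Set.Icc 0 t₁ |
    0 ≤ phiF c e (F z.1 z.2)} := ⟨_, rfl⟩
  have hAmem : ∀ z, z ∈ A ↔ z ∈ Set.univ ×ˢ Set.Icc 0 t₁ ∧ 0 ≤ phiF c e (F z.1 z.2) := by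
    intro z; rw [hA]; rfl
  have hAc : IsCompact A := by
    have h1 : IsClosed A := hA ▸ (hφc.mono hsub).preimage_isClosed_of_isClosed
      (isClosed_univ.prod isClosed_Icc) isClosed_Ici
    exact (isCompact_univ.prod isCompact_Icc).of_isClosed_subset h1 fun z hz => ((hAmem z).1 hz).1
  have hAint : ∀ z ∈ A, (𝓡∂ n).IsInteriorPoint z.1 := fun z hz =>
    hB.isInteriorPoint hF (hsub ((hAmem z).1 hz).1).2 he hc0 hc ((hAmem z).1 hz).2
  obtain ⟨Ψ, hΨ⟩ : ∃ Ψ : M × ℝ → ℝ, ∀ z, Ψ z = phiF c e (F z.1 z.2) ^ 2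
      * q (R + 2 * n * z.2) (fun I => jetAt (fun q => F q z.2) I z.1) / (R + 2 * n * z.2) ^ 2 :=
    ⟨_, fun _ => rfl⟩
  have hΨc : ContinuousOn Ψ A := by
    intro z hz
    rw [show Ψ = _ from funext hΨ]
    have hz0 := ((hAmem z).1 hz).1
    have hz1 := hsub hz0
    have h1 := ((hφc) z hz1).mono fun y hy => hsub ((hAmem y).1 hy).1
    have h2 := (hF.continuousWithinAt_jet_functional hF₀ hT (hAint z hz) hz1.2 hqc R).mono
        fun y hy => hsub ((hAmem y).1 hy).1
    have h3 : ContinuousWithinAt (fun z : M × ℝ => (R + 2 * n * z.2) ^ 2) A z := by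
      fun_prop
    exact ((h1.pow 2).mul h2).div h3 (pow_pos (hθ0 _ hz1.2) 2).ne'
  have hmem : (p₁, t₁) ∈ A := (hAmem _).2 ⟨⟨Set.mem_univ _, ht₁.1, le_rfl⟩, hφ₁⟩
  obtain ⟨⟨p, t⟩, hz, hmax⟩ := hAc.exists_isMaxOn ⟨_, hmem⟩ hΨc
  rw [isMaxOn_iff] at hmax
  obtain ⟨hz1, hφ0⟩ := (hAmem _).1 hz
  have ht : t ∈ Set.Icc 0 T := (hsub hz1).2
  replace hφ0 : 0 ≤ phiF c e (F p t) := hφ0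
  have hθt := hθ0 t ht
  have hθt₁ := hθ0 t₁ ⟨ht₁.1, ht₁.2.le⟩
  have hm' := hmax _ hmem
  rw [hΨ, hΨ] at hm'
  suffices h : phiF c e (F p t) ^ 2 * q (R + 2 * n * t) (fun I => jetAt (fun q => F q t) I p)
      ≤ (C₁ + (c ^ 2 * D) ^ 2 * B₀) * (R + 2 * n * t) ^ 2 by
    have h2 := hm'.trans ((div_le_iff₀ (pow_pos hθt 2)).2 h)
    exact (div_le_iff₀ (pow_pos hθt₁ 2)).1 h2
  rcases eq_or_lt_of_le hφ0 with h00 | hpos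
  · rw [← h00]
    have : 0 ≤ (C₁ + (c ^ 2 * D) ^ 2 * B₀) * (R + 2 * n * t) ^ 2 := by positivity
    simpa using this
  rcases eq_or_lt_of_le ht.1 with h0t | h0t
  · -- the maximum is attained at the initial time
    subst h0t
    have h1 := hB₀ T F hT hF p e he hφ0
    have e1 : R + 2 * (n : ℝ) * 0 = R := by ring
    have hQ0 := hq0 R (fun I => jetAt (fun q => F q 0) I p) hB.pos
    have h2 : phiF c e (F p 0) ≤ c ^ 2 * D * R := by
      have h3 := (hB.size T F hT hF p 0 ht).2
      have h4 := mul_le_mul_of_nonneg_left h3 (sq_nonneg c)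
      rw [e1] at h4
      unfold phiF
      nlinarith [mul_self_nonneg (ip (F p 0) e)]
    rw [e1]
    calc phiF c e (F p 0) ^ 2 * q R (fun I => jetAt (fun q => F q 0) I p)
        ≤ (c ^ 2 * D * R) ^ 2 * B₀ :=
          mul_le_mul (pow_le_pow_left₀ hφ0 h2 2) h1 hQ0 (by positivity)
      _ = (c ^ 2 * D) ^ 2 * B₀ * R ^ 2 := by ring
      _ ≤ _ := by
          have : 0 ≤ C₁ * R ^ 2 := by positivity
          linarith
  have htI : t ∈ Set.Ioo 0 T := ⟨h0t, lt_of_le_of_lt hz1.2.2 ht₁.2⟩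
  refine (hmaxb T F hT hF p t htI e he hpos ?_).trans ?_
  swap
  · have : 0 ≤ (c ^ 2 * D) ^ 2 * B₀ * (R + 2 * n * t) ^ 2 := by positivity
    linarith
  have hcφ : ContinuousAt (fun z : M × ℝ => phiF c e (F z.1 z.2)) (p, t) := hφc.continuousAt
    (prod_mem_nhds univ_mem (Icc_mem_nhds htI.1 htI.2))
  filter_upwards [hcφ.eventually (lt_mem_nhds hpos),
    (continuousAt_snd (p := (p, t))).eventually (lt_mem_nhds h0t)] with z a1 a2 a3
  have hzA : z ∈ A := (hAmem _).2 ⟨⟨Set.mem_univ _, a2.le, a3.trans hz1.2.2⟩, a1.le⟩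
  have a4 := hmax z hzA
  rw [hΨ, hΨ] at a4
  have a5 := hθ0 z.2 (hsub ((hAmem _).1 hzA).1).2
  rw [div_le_div_iff₀ (pow_pos a5 2) (pow_pos hθt 2)] at a4
  linarith

end Localisation


/-! ### Estimates of all derivatives in the cone over a compact set -/

section Jets

variable {n : ℕ}

/-- `∑_{|I| = k} J_I²` for a family `J` of derivatives. -/
def jD (k : ℕ) (J : List (Fin n) → ℝ) : ℝ :=
  ∑ I : Fin k → Fin n, J (List.ofFn I) * J (List.ofFn I)

/-- The squared norm `|A|²` of a graph in terms of the family `J` of its derivatives. -/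
def jA (J : List (Fin n) → ℝ) : ℝ :=
  wgt (WithLp.toLp 2 fun i => J [i]) ^ 2 * (∑ i, ∑ k, J [i, k] * J [i, k])
    + 2 * wgt (WithLp.toLp 2 fun i => J [i]) ^ 4
      * (∑ k, (∑ i, J [i] * J [k, i]) * (∑ i, J [i] * J [k, i]))
    + wgt (WithLp.toLp 2 fun i => J [i]) ^ 6 * (∑ k, J [k] * ∑ i, J [i] * J [k, i]) ^ 2

theorem jD_nonneg (k : ℕ) (J : List (Fin n) → ℝ) : 0 ≤ jD k J :=
  Finset.sum_nonneg fun _ _ => mul_self_nonneg _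

theorem sq_le_jD (I : List (Fin n)) (J : List (Fin n) → ℝ) : J I ^ 2 ≤ jD I.length J := by
  have := Finset.single_le_sum (f := fun K : Fin I.length → Fin n =>
    J (List.ofFn K) * J (List.ofFn K)) (fun _ _ => mul_self_nonneg _) (Finset.mem_univ I.get)
  simp only [List.ofFn_get] at this
  rw [sq]; exact this

theorem jD_two (J : List (Fin n) → ℝ) : jD 2 J = ∑ i, ∑ k, J [i, k] * J [i, k] := by
  rw [jD, ← (finTwoArrowEquiv (Fin n)).symm.sum_comp, Fintype.sum_prod_type]
  refine Finset.sum_congr rfl fun i _ => Finset.sum_congr rfl fun j _ => ?_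
  simp [finTwoArrowEquiv, List.ofFn_succ]

theorem continuous_jD (k : ℕ) : Continuous (jD k : (List (Fin n) → ℝ) → ℝ) := by
  unfold jD; fun_prop

theorem jA_nonneg (J : List (Fin n) → ℝ) : 0 ≤ jA J := by
  have h1 : 0 ≤ ∑ i, ∑ k, J [i, k] * J [i, k] :=
    Finset.sum_nonneg fun _ _ => Finset.sum_nonneg fun _ _ => mul_self_nonneg _
  have h2 : 0 ≤ ∑ k, (∑ i, J [i] * J [k, i]) * (∑ i, J [i] * J [k, i]) :=
    Finset.sum_nonneg fun _ _ => mul_self_nonneg _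
  unfold jA; positivity

theorem one_le_wgt {p : Euc n} (hp : ‖p‖ < 1) : 1 ≤ wgt p := by
  have h1 := one_sub_norm_sq_pos hp
  rw [wgt]
  refine one_le_inv_iff₀.2 ⟨Real.sqrt_pos.2 h1, Real.sqrt_le_one.2 ?_⟩
  linarith [sq_nonneg ‖p‖]

theorem jD_le_jA (J : List (Fin n) → ℝ) (hJ : ‖(WithLp.toLp 2 fun i => J [i] : Euc n)‖ < 1) :
    jD 2 J ≤ jA J := by
  have h0 := jD_nonneg 2 J
  have h1 := one_le_pow₀ (one_le_wgt hJ) (n := 2)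
  have h2 : 0 ≤ ∑ k, (∑ i, J [i] * J [k, i]) * (∑ i, J [i] * J [k, i]) :=
    Finset.sum_nonneg fun _ _ => mul_self_nonneg _
  rw [jA, ← jD_two]
  have h3 := mul_le_mul_of_nonneg_right h1 h0
  have h4 : 0 ≤ 2 * wgt (WithLp.toLp 2 fun i => J [i]) ^ 4
    * (∑ k, (∑ i, J [i] * J [k, i]) * (∑ i, J [i] * J [k, i])) := by positivity
  have h5 : 0 ≤ wgt (WithLp.toLp 2 fun i => J [i]) ^ 6
    * (∑ k, J [k] * ∑ i, J [i] * J [k, i]) ^ 2 := by positivity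
  linarith

theorem continuousAt_jA {J : List (Fin n) → ℝ}
    (hJ : ‖(WithLp.toLp 2 fun i => J [i] : Euc n)‖ < 1) : ContinuousAt jA J := by
  have h1 : ContinuousAt (wgt (n := n)) (WithLp.toLp 2 fun i => J [i]) :=
    (contDiffOn_wgt.continuousOn).continuousAt
      (Metric.isOpen_ball.mem_nhds (mem_ball_zero_iff.2 hJ))
  have h2 : ContinuousAt (fun J : List (Fin n) → ℝ => wgt (WithLp.toLp 2 fun i => J [i] : Euc n)) J :=
    ContinuousAt.comp (f := fun J : List (Fin n) → ℝ => (WithLp.toLp 2 fun i => J [i] : Euc n)) h1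
      ((PiLp.continuous_toLp 2 _).comp (continuous_pi fun i => continuous_apply [i])).continuousAt
  unfold jA
  refine ContinuousAt.add (ContinuousAt.add ?_ ?_) ?_
  · exact (h2.pow 2).mul (by fun_prop)
  · exact ((h2.pow 4).const_mul 2).mul (by fun_prop)
  · exact (h2.pow 6).mul (by fun_prop)

theorem Adm.gA_eq_jA {u : ST n → ℝ} {z : ST n} (h : Adm eb u z) :
    MinkMCF.gA u z = jA fun I => iter eb I u z := by
  rw [h.gA_eq]; rfl

variable [NeZero n] {M : Type*} [TopologicalSpace M] [ChartedSpace (EuclideanHalfSpace n) M]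
  [CompactSpace M] [IsManifold (𝓡∂ n) ∞ M]
  {S : Euc n → Euc n} {F₀ : M → Mink n} {Y : Set (Mink n)} {c₁ R D b W : ℝ}

/-- The derivatives of order between `2` and `k` of all solutions have the natural scaling in the
region `φ ≥ 0`. -/
def JetBound (S : Euc n → Euc n) (F₀ : M → Mink n) (Y : Set (Mink n)) (R c : ℝ) (k : ℕ) (K : ℝ) :
    Prop :=
  ∀ (T : ℝ) (F : M → ℝ → Mink n), 0 < T → IsNeumannMCF S F₀ T F → ∀ p, ∀ t ∈ Set.Icc 0 T,
    ∀ e ∈ Y, 0 ≤ phiF c e (F p t) → ∀ I : List (Fin n), 2 ≤ I.length → I.length ≤ k →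
    |jetAt (fun q => F q t) I p| ≤ K * (√(R + 2 * n * t))⁻¹ ^ (I.length - 1)

theorem abs_le_of_pow_mul_sq_le {θ x C : ℝ} {k : ℕ} (hθ : 0 < θ) (h : θ ^ k * x ^ 2 ≤ C) :
    |x| ≤ √C * (√θ)⁻¹ ^ k := by
  have h0 := Real.sqrt_pos.2 hθ
  have h1 : |√θ ^ k * x| ≤ √C := Real.abs_le_sqrt (by
    rw [mul_pow, ← pow_mul, mul_comm k 2, pow_mul, Real.sq_sqrt hθ.le]; exact h)
  rw [abs_mul, abs_of_pos (pow_pos h0 k)] at h1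
  rw [inv_pow, ← div_eq_mul_inv, le_div_iff₀ (pow_pos h0 k), mul_comm]
  exact h1

/-- One more derivative: a quantity that satisfies the hypotheses of the cutoff argument and controls
the derivatives of order `k + 1` gives their bound on a smaller region. -/
theorem SolutionBounds.jetBound_succ (hB : SolutionBounds S F₀ Y c₁ R D b W)
    (hF₀ : ContMDiff (𝓡∂ n) 𝓘(ℝ, Mink n) ∞ F₀) {c c' : ℝ} (hc0 : 0 ≤ c) (hcc : c < c')
    (hc : c' < c₁) {k : ℕ} {K K' δ : ℝ} (hK : 1 ≤ K) (hK' : 0 ≤ K') (hδ : 0 < δ)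
    {q : ℝ → (List (Fin n) → ℝ) → ℝ} (hq0 : ∀ θ J, 0 < θ → 0 ≤ q θ J)
    (hqc : ∀ θ J, ‖(WithLp.toLp 2 fun i => J [i] : Euc n)‖ < 1 →
      ContinuousAt (fun x : ℝ × (List (Fin n) → ℝ) => q x.1 x.2) (θ, J))
    (hqs : ∀ u z, FlowGraph u z → SmoothNear (fun y => q (th R y) fun I => iter eb I u y) z)
    (hqb : ∀ (u : ST n → ℝ) (z : ST n) (ρ : ℝ), 0 < th R z → 0 < ρ → ρ ^ 2 * th R z = 1 →
      FlowGraph u z → gw u z ≤ W → (∀ I : List (Fin n), 2 ≤ I.length → I.length ≤ k →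
        |iter eb I u z| ≤ K * ρ ^ (I.length - 1)) →
      th R z * box (fun i => gn u i z) (fun y => q (th R y) fun I => iter eb I u y) z
        ≤ K' - δ * q (th R z) (fun I => iter eb I u z) ^ 2)
    (hql : ∀ θ J, 0 < θ → ‖(WithLp.toLp 2 fun i => J [i] : Euc n)‖ < 1 →
      ∀ I : List (Fin n), I.length = k + 1 → θ ^ k * J I ^ 2 ≤ q θ J)
    (hJ : JetBound S F₀ Y R c' k K) :
    ∃ K₂ : ℝ, 1 ≤ K₂ ∧ JetBound S F₀ Y R c (k + 1) K₂ := by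
  obtain ⟨C, hC, h⟩ := hB.exists_bound hF₀ (hc0.trans hcc.le) hc hK' hδ hq0 hqc hqs hqb hJ
  set η := c' ^ 2 - c ^ 2 with hη
  have hη0 : 0 < η := by nlinarith
  refine ⟨max K (√(C / η ^ 2)), le_max_of_le_left hK, fun T F hT hF p t ht e he hφ I h2 hk => ?_⟩
  have hsz := (hB.size T F hT hF p t ht).1
  have hθ : 0 < R + 2 * n * t := by
    have := hB.pos; have := mul_nonneg (mul_nonneg zero_le_two (Nat.cast_nonneg (α := ℝ) n)) ht.1
    linarith
  have hφ' : η * (R + 2 * n * t) ≤ phiF c' e (F p t) := by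
    have h3 : phiF c' e (F p t) = phiF c e (F p t) + η * -ip (F p t) (F p t) := by
      simp only [phiF, hη]; ring
    have := mul_le_mul_of_nonneg_left hsz hη0.le
    linarith
  have hφ0 : 0 ≤ phiF c' e (F p t) := le_trans (by positivity) hφ'
  have hρ : 0 ≤ (√(R + 2 * n * t))⁻¹ ^ (I.length - 1) := by positivity
  rcases Nat.lt_or_ge I.length (k + 1) with hlt | hge
  · refine (hJ T F hT hF p t ht e he hφ0 I h2 (by omega)).trans ?_
    exact mul_le_mul_of_nonneg_right (le_max_left _ _) hρ
  have hlen : I.length = k + 1 := le_antisymm hk hge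
  refine le_trans ?_ (mul_le_mul_of_nonneg_right (le_max_right _ _) hρ)
  rw [hlen, Nat.add_sub_cancel]
  refine abs_le_of_pow_mul_sq_le hθ ?_
  have hp := hB.isInteriorPoint hF ht he (hc0.trans hcc.le) hc hφ0
  refine (hql _ (fun I => jetAt (fun q => F q t) I p) hθ (hF.norm_jetAt_lt hp ht) I hlen).trans ?_
  have h3 := h T F hT hF p t ht e he hφ0
  have h4 := hq0 _ (fun I => jetAt (fun q => F q t) I p) hθ
  have h5 : (η * (R + 2 * n * t)) ^ 2 ≤ phiF c' e (F p t) ^ 2 :=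
    pow_le_pow_left₀ (by positivity) hφ' 2
  have h6 := (mul_le_mul_of_nonneg_right h5 h4).trans h3
  rw [le_div_iff₀ (by positivity)]
  refine le_of_mul_le_mul_right (a := (R + 2 * n * t) ^ 2) ?_ (by positivity)
  linarith

/-- Induction on the order of the derivatives, with the regions shrinking in each step. -/
theorem SolutionBounds.exists_jetBound (hB : SolutionBounds S F₀ Y c₁ R D b W)
    (hF₀ : ContMDiff (𝓡∂ n) 𝓘(ℝ, Mink n) ∞ F₀) (k : ℕ) : ∀ c, 0 ≤ c → c < c₁ →
    ∃ K : ℝ, 1 ≤ K ∧ JetBound S F₀ Y R c (k + 1) K := by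
  induction k with
  | zero => exact fun c _ _ => ⟨1, le_rfl, fun _ _ _ _ _ _ _ _ _ _ I h1 h2 => by omega⟩
  | succ k ih =>
    intro c hc0 hc
    obtain ⟨c', hcc, hc'⟩ := exists_between hc
    obtain ⟨K, hK, hJ⟩ := ih c' (hc0.trans hcc.le) hc'
    rcases Nat.eq_zero_or_pos k with rfl | hk
    · refine hB.jetBound_succ hF₀ hc0 hcc hc' hK (sq_nonneg (n : ℝ)) one_pos
        (q := fun θ J => θ ^ 1 * jA J) (fun θ J hθ => mul_nonneg (pow_nonneg hθ.le 1) (jA_nonneg J))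
        (fun θ J hJ => ?_) (fun u z h => ?_) (fun u z ρ hθ _ _ h _ _ => ?_)
        (fun θ J hθ hn I hI => ?_) hJ
      · exact (continuousAt_fst.pow 1).mul (ContinuousAt.comp (f := Prod.snd) (x := (θ, J))
          (continuousAt_jA hJ) continuousAt_snd)
      · refine (((smoothNear_th R z).pow 1).mul h.1.gA).congr ?_
        filter_upwards [h.1.eventually] with y hy
        rw [hy.gA_eq_jA]
      · have e : (fun y => th R y ^ 1 * jA fun I => iter eb I u y) =ᶠ[𝓝 z]
            fun y => th R y ^ 1 * gA u y := by
          filter_upwards [h.1.eventually] with y hy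
          rw [hy.gA_eq_jA]
        rw [box_congr e, ← h.1.gA_eq_jA]
        exact h.th_box_gA_le R hθ
      · refine mul_le_mul_of_nonneg_left (le_trans ?_ (jD_le_jA J hn)) (pow_nonneg hθ.le 1)
        have := sq_le_jD I J
        rwa [hI] at this
    · obtain ⟨Λ, K', δ, hΛ, hK', hδ, hev⟩ := exists_gQ_evolution (n := n) k hk K W hK
      have hpos : ∀ (θ : ℝ) (J : List (Fin n) → ℝ), 0 < θ → 0 ≤ θ ^ k * jD (k + 1) J :=
        fun θ J hθ => mul_nonneg (pow_nonneg hθ.le k) (jD_nonneg _ J)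
      refine hB.jetBound_succ hF₀ hc0 hcc hc' hK hK' hδ
        (q := fun θ J => θ ^ (k + 1) * jD (k + 2) J * (Λ + θ ^ k * jD (k + 1) J))
        (fun θ J hθ => ?_) (fun θ J _ => ?_) (fun u z h => smoothNear_gQ k Λ R h.1.1)
        (fun u z ρ hθ hρ hρθ h hw hI => hev u z R ρ hθ hρ hρθ h hw hI)
        (fun θ J hθ hn I hI => ?_) hJ
      · have := hpos θ J hθ
        have := jD_nonneg (k + 2) J
        positivity
      · have h1 := continuous_jD (n := n) (k + 1)
        have h2 := continuous_jD (n := n) (k + 2)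
        fun_prop
      · have h1 := sq_le_jD I J
        rw [hI] at h1
        have h2 := hpos θ J hθ
        have h3 : θ ^ (k + 1) * J I ^ 2 ≤ θ ^ (k + 1) * jD (k + 2) J :=
          mul_le_mul_of_nonneg_left h1 (pow_nonneg hθ.le _)
        refine h3.trans (le_mul_of_one_le_right ?_ (by linarith))
        exact mul_nonneg (pow_nonneg hθ.le _) (jD_nonneg _ J)

end Jets


/-! ### The cone over a compact part of the hyperbolic plane -/

section Cone

variable {n : ℕ}

/-- The reversed Cauchy-Schwarz inequality; the hyperbolic distance is thus not a junk value. -/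
theorem one_le_neg_ip {x y : Mink n} (hx : x ∈ hypPlane n) (hy : y ∈ hypPlane n) :
    1 ≤ -ip x y := by
  obtain ⟨hx1, hx2⟩ := hx
  obtain ⟨hy1, hy2⟩ := hy
  simp only [ip, real_inner_self_eq_norm_sq] at *
  have h1 := real_inner_le_norm x.1 y.1
  have h2 : ‖x.1‖ * ‖y.1‖ + 1 ≤ x.2 * y.2 := by
    refine abs_le_of_sq_le_sq' ?_ (mul_pos hx2 hy2).le |>.2
    nlinarith [sq_nonneg (‖x.1‖ - ‖y.1‖)]
  linarith

theorem inv_sqrt_smul_mem_hypPlane {x : Mink n} (hx : ip x x < 0) (hx2 : 0 < x.2) :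
    (√(-ip x x))⁻¹ • x ∈ hypPlane n := by
  have h1 : 0 < -ip x x := by linarith
  refine ⟨?_, by simpa using mul_pos (inv_pos.2 (Real.sqrt_pos.2 h1)) hx2⟩
  rw [ip_smul_left, ip_smul_right, ← mul_assoc, ← mul_inv, Real.mul_self_sqrt h1.le, inv_neg,
    neg_mul, inv_mul_cancel₀ hx.ne]

theorem inv_smul_mem_cone {S : Euc n → Euc n} {x : Mink n} (hx : x ∈ cone S) {r : ℝ} (hr : 0 < r) :
    r⁻¹ • x ∈ cone S := by
  obtain ⟨l, hl, y, hy, rfl⟩ := hx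
  exact ⟨r⁻¹ * l, mul_pos (inv_pos.2 hr) hl, y, hy, by rw [smul_smul]⟩

/-- On the boundary cone the cutoff functions around points at hyperbolic distance at least `d` are
negative. -/
theorem phiF_neg_of_mem_cone {S : Euc n → Euc n} (hS : IsSphereEmbedding S) {e : Mink n}
    (he : e ∈ hypPlane n) {d : ℝ} (hd : 0 < d)
    (hdist : ∀ y ∈ hypPlane n ∩ cone S, d ≤ hypDist e y) {y : Mink n} (hy : y ∈ cone S) {c : ℝ}
    (hc0 : 0 ≤ c) (hc : c < Real.cosh d) : phiF c e y < 0 := by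
  obtain ⟨h1, h2⟩ := cone_timelike hS hy
  have h3 : 0 < -ip y y := by linarith
  have h4 := inv_sqrt_smul_mem_hypPlane h1 h2
  have h5 := Real.sqrt_pos.2 h3
  have h6 : d ≤ Real.arcosh _ := hdist _ ⟨h4, inv_smul_mem_cone hy h5⟩
  have h7 : Real.cosh d ≤ -ip e ((√(-ip y y))⁻¹ • y) := by
    rw [← Real.cosh_arcosh (one_le_neg_ip he h4)]
    exact Real.cosh_le_cosh.2 (by
      rw [abs_of_pos hd, abs_of_nonneg (hd.le.trans h6)]; exact h6)
  have h8 : c ^ 2 < (-ip e ((√(-ip y y))⁻¹ • y)) ^ 2 := pow_lt_pow_left₀ (hc.trans_le h7) hc0 two_ne_zero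
  rw [ip_smul_right, ip_comm e y, neg_sq, mul_pow, inv_pow, Real.sq_sqrt h3.le,
    inv_mul_eq_div, lt_div_iff₀ h3] at h8
  rw [phiF]; linarith

variable [NeZero n] {M : Type*} [TopologicalSpace M] [CompactSpace M]
  [ChartedSpace (EuclideanHalfSpace n) M] [IsManifold (𝓡∂ n) ∞ M] {S : Euc n → Euc n}
  {F₀ : M → Mink n}

theorem exists_solutionBounds (hS : IsSphereEmbedding S) (hconv : IsConvexSphere S)
    (hF₀ : IsInitialHypersurface S F₀) {Y : Set (Mink n)} (hY : IsCompact Y) (hYp : Y ⊆ hypPlane n)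
    {d : ℝ} (hd : 0 < d) (hYd : ∀ x ∈ Y, ∀ y ∈ hypPlane n ∩ cone S, d ≤ hypDist x y) :
    ∃ R D b W : ℝ, SolutionBounds S F₀ Y (Real.cosh d) R D b W ∧
      ∀ (T : ℝ) (F : M → ℝ → Mink n), 0 < T → IsNeumannMCF S F₀ T F →
        ∀ p, ∀ t ∈ Set.Icc 0 T, 0 < (F p t).2 := by
  obtain ⟨R, D, hR, hD, h⟩ := exists_global_bounds hS hconv hF₀
  obtain ⟨b₀, hb₀⟩ := hY.isBounded.exists_norm_le
  obtain ⟨b, hb0, hb⟩ : ∃ b : ℝ, 0 ≤ b ∧ ∀ e ∈ Y, ‖e‖ ≤ b :=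
    ⟨max b₀ 0, le_max_right _ _, fun e he => (hb₀ e he).trans (le_max_left _ _)⟩
  have hsnd : ∀ e ∈ Y, |e.2| ≤ b := fun e he => (norm_snd_le e).trans (hb e he)
  set k := Real.cosh d with hk
  have hk0 : 0 < k := Real.cosh_pos d
  refine ⟨R, max D (4 * b ^ 2 * k ^ 2 * D), b, 4 * b * k * D, ?_,
    fun T F hT hF p t ht => (h T F hT hF p t ht).2.2.1⟩
  have hθ : ∀ t : ℝ, 0 ≤ t → 0 < R + 2 * n * t := fun t ht => by
    have := mul_nonneg (mul_nonneg zero_le_two (Nat.cast_nonneg (α := ℝ) n)) ht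
    linarith
  constructor
  · exact hR
  · exact le_max_of_le_left hD
  · exact hb0
  · positivity
  · exact hY
  · exact fun e he => ⟨hsnd e he, fun i => ((PiLp.norm_apply_le e.1 i).trans (norm_fst_le e)).trans
      (hb e he)⟩
  · exact fun y hy e he c hc0 hc => phiF_neg_of_mem_cone hS (hYp he) hd (hYd e he) hy hc0 hc
  · exact fun T F hT hF p t ht => ⟨(h T F hT hF p t ht).1, (h T F hT hF p t ht).2.1.trans
      (mul_le_mul_of_nonneg_right (le_max_left _ _) (hθ t ht.1).le)⟩
  · intro T F hT hF p t ht e he c hc0 hc hφ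
    obtain ⟨h1, h2, h3, h4⟩ := h T F hT hF p t ht
    have hθt := hθ t ht.1
    have hN : IsUnitNormal _ (normalAt (fun q => F q t) p) :=
      isUnitNormal_unitNormal (hF.spacelike t ht p)
    obtain ⟨r1, r2⟩ := region_bounds hθt h1 h2 h3 h4 hN.unit hN.future (hYp he).1 (hYp he).2
      ((le_abs_self _).trans (hsnd e he)) hφ
    have hcc : c ^ 2 ≤ k ^ 2 := pow_le_pow_left₀ hc0 hc.le 2
    have r3 : (F p t).2 ^ 2 ≤ max D (4 * b ^ 2 * k ^ 2 * D) * (R + 2 * n * t) :=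
      calc (F p t).2 ^ 2 ≤ 4 * b ^ 2 * c ^ 2 * D * (R + 2 * n * t) := r1
        _ ≤ 4 * b ^ 2 * k ^ 2 * D * (R + 2 * n * t) := by gcongr
        _ ≤ _ := mul_le_mul_of_nonneg_right (le_max_right _ _) hθt.le
    refine ⟨r3, fun i => le_trans ?_ r3, ?_⟩
    · have h5 : ‖(F p t).1‖ ^ 2 ≤ (F p t).2 ^ 2 := by
        have : ip (F p t) (F p t) = ‖(F p t).1‖ ^ 2 - (F p t).2 * (F p t).2 := by
          rw [ip, real_inner_self_eq_norm_sq]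
        nlinarith
      refine le_trans ?_ h5
      have := PiLp.norm_apply_le (F p t).1 i
      exact sq_le_sq' (by linarith [neg_abs_le ((F p t).1 i), Real.norm_eq_abs ((F p t).1 i)])
        ((le_abs_self _).trans this)
    · refine abs_le_of_sq_le_sq' ?_ (by positivity) |>.2
      calc _ ≤ 16 * b ^ 2 * c ^ 2 * D ^ 2 := r2
        _ ≤ 16 * b ^ 2 * k ^ 2 * D ^ 2 := by gcongr
        _ = _ := by ring

/-- The derivative estimates at the points of the cone over `Y`, in terms of `θ = R + 2nt`. -/
theorem SolutionBounds.exists_nablaASq_le {Y : Set (Mink n)} {c₁ R D b W : ℝ}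
    (hB : SolutionBounds S F₀ Y c₁ R D b W) (hc₁ : 1 < c₁)
    (hF₀ : ContMDiff (𝓡∂ n) 𝓘(ℝ, Mink n) ∞ F₀) (m : ℕ) :
    ∃ C : ℝ, 0 ≤ C ∧ ∀ (T : ℝ) (F : M → ℝ → Mink n), 0 < T → IsNeumannMCF S F₀ T F →
      ∀ p, ∀ t ∈ Set.Icc 0 T, ∀ e ∈ Y, 0 ≤ phiF 1 e (F p t) →
        nablaASq (fun q => F q t) m p ≤ C * ((R + 2 * n * t)⁻¹) ^ (m + 1) := by
  obtain ⟨K, hK, hJ⟩ := hB.exists_jetBound hF₀ (m + 1) 1 zero_le_one hc₁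
  obtain ⟨κ, hκ, hgr⟩ := exists_norm_le_of_wgt_le n W
  obtain ⟨C, hC, h⟩ := exists_nablaA_bound n m K κ hκ
  refine ⟨C, hC, fun T F hT hF p t ht e he hφ => ?_⟩
  have hp := hB.isInteriorPoint hF ht he zero_le_one hc₁ hφ
  have hs := hF.smoothAt hp ht
  obtain ⟨v, hv⟩ := hs.exists_graphAt
  have hθ : 0 ≤ R + 2 * n * t := by
    have := hB.pos; have := mul_nonneg (mul_nonneg zero_le_two (Nat.cast_nonneg (α := ℝ) n)) ht.1
    linarith
  have hw : wgt (grad ec v (F p t).1) ≤ W := by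
    have h1 := (hB.region T F hT hF p t ht e he 1 zero_le_one hc₁ hφ).2.2
    rw [hs.normalAt_eq hv.adm hv.graph] at h1
    simpa using h1
  rw [hs.nablaASq_eq hv.adm hv.graph]
  refine (h v (F p t).1 (√(R + 2 * n * t))⁻¹ (by positivity) hv.adm (hgr _ hv.adm.2 hw)
    fun I h1 h2 => ?_).trans_eq ?_
  · have := hJ T F hT hF p t ht e he hφ I h1 h2
    rwa [hv.jetAt_eq] at this
  · rw [pow_mul, inv_pow, Real.sq_sqrt hθ]

end Cone

end MinkMCF

end

theorem lemma8p4 {n : ℕ} [NeZero n] (hn : 2 ≤ n)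
    -- the convex timelike boundary cone
    (S : MinkMCF.Euc n → MinkMCF.Euc n) (hS : MinkMCF.IsSphereEmbedding S)
    (hconv : MinkMCF.IsConvexSphere S)
    -- the compact manifold with boundary and the initial hypersurface
    {M : Type*} [TopologicalSpace M] [T2Space M] [CompactSpace M]
    [ChartedSpace (EuclideanHalfSpace n) M] [IsManifold (𝓡∂ n) ∞ M]
    (F₀ : M → MinkMCF.Mink n) (hF₀ : MinkMCF.IsInitialHypersurface S F₀)
    -- the cone over a compact set of the hyperbolic plane, at distance at least `d` from the boundary
    (L : Set (MinkMCF.Mink n)) (hL : ∀ x ∈ L, ∀ c : ℝ, c • x ∈ L)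
    (hLc : IsCompact (MinkMCF.hypPlane n ∩ L)) (d : ℝ) (hd : 0 < d)
    (hLd : ∀ x ∈ MinkMCF.hypPlane n ∩ L, ∀ y ∈ MinkMCF.hypPlane n ∩ MinkMCF.cone S,
      d ≤ MinkMCF.hypDist x y)
    (m : ℕ) (hm : 1 ≤ m) :
    ∃ C : ℝ, ∀ (T : ℝ) (F : M → ℝ → MinkMCF.Mink n), 0 < T → MinkMCF.IsNeumannMCF S F₀ T F →
      ∀ t ∈ Set.Icc 0 T, ∀ p : M, F p t ∈ L →
        MinkMCF.nablaASq (fun q => F q t) m p ≤ C / (-MinkMCF.ip (F p t) (F p t)) := by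
  obtain ⟨R, D, b, W, hB, hpos⟩ := MinkMCF.exists_solutionBounds hS hconv hF₀ hLc
    Set.inter_subset_left hd hLd
  have hcosh : 1 < Real.cosh d := Real.one_lt_cosh.2 hd.ne'
  obtain ⟨C, hC, h⟩ := hB.exists_nablaASq_le hcosh hF₀.smooth m
  refine ⟨C * (R⁻¹ ^ m * D), fun T F hT hF t ht p hp => ?_⟩
  obtain ⟨h1, h2⟩ := hB.size T F hT hF p t ht
  have hR := hB.pos
  have hθR : R ≤ R + 2 * n * t := by
    have := mul_nonneg (mul_nonneg zero_le_two (Nat.cast_nonneg (α := ℝ) n)) ht.1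
    linarith
  have hθ := hR.trans_le hθR
  have hF2 : 0 < -MinkMCF.ip (F p t) (F p t) := hθ.trans_le h1
  -- the point of the hyperbolic plane on the ray through `F p t`
  have he := MinkMCF.inv_sqrt_smul_mem_hypPlane (by linarith) (hpos T F hT hF p t ht)
  refine (h T F hT hF p t ht _ ⟨he, hL _ hp _⟩ (le_of_eq ?_)).trans ?_
  · have := Real.sq_sqrt hF2.le
    have h0 := (Real.sqrt_pos.2 hF2).ne'
    rw [MinkMCF.phiF, MinkMCF.ip_smul_right]
    field_simp
    rw [this]; ring
  · rw [mul_div_assoc, pow_succ]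
    refine mul_le_mul_of_nonneg_left ?_ hC
    rw [mul_div_assoc]
    refine mul_le_mul (pow_le_pow_left₀ (inv_nonneg.2 hθ.le) (inv_anti₀ hR hθR) m) ?_
      (inv_nonneg.2 hθ.le) (pow_nonneg (inv_nonneg.2 hR.le) m)
    rw [le_div_iff₀ hF2, inv_mul_le_iff₀ hθ]
    linarith
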